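/- Conventions. A theory is an RE set of sentences of classical predicate logic in a finite signature. A translation of a language $L$ into a language $L'$ may be more-dimensional, may relativise quantifiers to a definable domain, may translate identity to a formula other than identity, may use parameters ranging over a definable parameter domain $\alpha$, and sends function symbols to formulas for their graphs; one may moreover allow or forbid domains built up from finitely many pieces of different dimensions (the theorem holds under both conventions). $V\rhd U$ ($V$ interprets $U$) means that there is a translation $\tau$ with $V\vdash\exists\vec x\,\alpha(\vec x)$ and $V\vdash\forall\vec x\,(\alpha(\vec x)\to\varphi^{\tau,\vec x})$ for every theorem $\varphi$ of $U$. $V\rhd_{\sf mod}U$ ($V$ model-interprets $U$) means that for every model $\mathcal M$ of $V$ there is a translation $\tau$ whose parameter domain is non-empty in $\mathcal M$ and which, for all parameters in that domain, defines an internal model of $U$ in $\mathcal M$. $V$ laxly interprets $U$ (or: $V$ essentially tolerates $U$) if every consistent RE extension $V'$ of $V$ in the same language has a consistent RE extension $V''$ in the same language with $V''\rhd U$. The theory ${\sf R}$, in the language $0,{\sf S},+,\times,<$, has the axioms $\underline m+\underline n=\underline{m+n}$; $\underline m\times\underline n=\underline{m\times n}$; $\underline m\neq\underline n$ for $m\ne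 n$; $x<\underline n\to\bigvee_{i<n}x=\underline i$; $x<\underline n\vee x=\underline n\vee\underline n<x$. The theory ${\sf R}_{\sf succ}$, in the language $0,{\sf S}$, has the axioms $\underline n\neq\underline m$ for $n\neq m$. We write $x\le y$ for $x<y\vee x=y$. The theory ${\sf TN}$ has the axioms $x\not<0$; $(x<y\wedge y<z)\to x<z$; $x<y\vee x=y\vee y<x$; $x=0\vee\exists y\,x={\sf S}y$; ${\sf S}x\not<x$; $x<y\to(x<{\sf S}x\wedge y\not<{\sf S}x)$; $x+0=x$; $x+{\sf S}y={\sf S}(x+y)$; $x\times0=0$; $x\times{\sf S}y=x\times y+x$. The formula $z\models{\sf TN}$ says that the elements $\le z$, with the operations cut off at $z$ (a value that is not $\le z$ is replaced by $z$), satisfy ${\sf TN}$. Pure $\Delta_0$-formulas are built from $\bot$, $\top$, $u<v$, $0=u$, ${\sf S}u=v$, $u+v=w$, $u\times v=w$ by $\neg,\wedge,\vee,\to$ and the bounded quantifiers $\forall u<v$, $\exists u<v$, $\forall u\le v$, $\exists u\le v$. A pure 1-$\Sigma^0_1$-sentence is a sentence $\sigma=\exists x\,\delta$ with $\delta$ pure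 $\Delta_0$; put $\sigma^{\mathfrak q}:=\exists z\,(\exists x<z\;\delta\wedge z\models{\sf TN})$. A theory $U$ is $\Sigma^0_1$-friendly if it is consistent and RE and there is a recursive function $\Phi$ from pure 1-$\Sigma^0_1$-sentences to $U$-sentences such that, for every $\sigma$, $U\vdash\Phi(\sigma)$ if $\sigma$ is true, and $(U+\Phi(\sigma))\rhd\sigma^{\mathfrak q}$. The theory ${\sf PA}^-_{\sf scat}$ is formulated in the relational signature with $<$ and with relation symbols for the graphs of ${\sf S},+,\times$, without zero. It has the axioms $\exists a\,\widetilde n(a)$ for $n\in\omega$. Here $\widetilde n(a)$ says, relativised to the $y$ with $a\le y$ and with $a$ in the role of $0$: there is a $z$ with $z\models{\sf TN}$ (where the cut-off operations are total functions) such that the numeral $\underline n$ has a value strictly below $z$; and there are at least $n$ elements. The structure $\mathbb N_{\sf scat}$ has as domain the pairs $\langle n,m\rangle$ with $m<n$; its relations hold only between elements with the same first component $n$, and there they are those of the number $n$: the usual order on second components, and successor, addition and multiplication cut off at $n-1$. Theorem. (a) ${\sf PA}^-_{\sf scat}$ is contained in ${\sf R}$: every theorem of ${\sf PA}^-_{\sf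 scat}$, with the relation symbols read as the graphs of the operations, is a theorem of ${\sf R}$. (b) ${\sf PA}^-_{\sf scat}$ is $\Sigma^0_1$-friendly, and ${\sf PA}^-_{\sf scat}$ laxly interprets ${\sf R}$. (c) $\mathbb N_{\sf scat}$ is a model of ${\sf PA}^-_{\sf scat}$, and there is no inner model of ${\sf R}_{\sf succ}$ in $\mathbb N_{\sf scat}$: no translation, with any choice of parameters and even if piecewise domains are allowed, defines one. Hence ${\sf PA}^-_{\sf scat}$ does not model-interpret ${\sf R}_{\sf succ}$, and it does not model-interpret ${\sf R}$. (d) Model interpretability is strictly stronger than lax interpretability: for all RE theories $U,V$ in finite signatures, if $V\rhd_{\sf mod}U$ then $V$ laxly interprets $U$; and the RE theories ${\sf PA}^-_{\sf scat}$ and ${\sf R}$ show that the converse fails. -/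

import Mathlib

open FirstOrder FirstOrder.Language

namespace LaxInt

/-! ### Formula helpers -/

section Helpers
variable {L : FirstOrder.Language.{0, 0}} {α : Type}

/-- Conjunction of a list of formulas. -/
def bigAnd {n : ℕ} (l : List (L.BoundedFormula α n)) : L.BoundedFormula α n :=
  l.foldr (· ⊓ ·) ⊤

/-- Disjunction of a list of formulas. -/
def bigOr {n : ℕ} (l : List (L.BoundedFormula α n)) : L.BoundedFormula α n :=
  l.foldr (· ⊔ ·) ⊥

/-- A block of `k` existential quantifiers, binding the last `k` variables. -/
def exBlock {m : ℕ} : (k : ℕ) → L.BoundedFormula α (m + k) → L.BoundedFormula α m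
  | 0, φ => φ
  | k + 1, φ => exBlock k φ.ex

/-- A free variable, as a term. -/
def fv {n : ℕ} (v : α) : L.Term (α ⊕ Fin n) := Term.var (Sum.inl v)

end Helpers

/-! ### Gödel numbers, recursively enumerable theories -/

section Coding
variable {L : FirstOrder.Language.{0, 0}} [Encodable (Σ n, L.Functions n)] [Encodable (Σ n, L.Relations n)]

/-- Gödel number of a term. -/
def termCode {n : ℕ} : L.Term (Empty ⊕ Fin n) → ℕ
  | .var (.inl e) => e.elim
  | .var (.inr i) => Nat.pair 0 i
  | .func (l := l) f ts =>
      Nat.pair 1 (Nat.pair (Encodable.encode (⟨l, f⟩ : Σ n, L.Functions n))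
        (Encodable.encode (List.ofFn fun i => termCode (ts i))))

/-- Gödel number of a formula. -/
def formulaCode : {n : ℕ} → L.BoundedFormula Empty n → ℕ
  | _, .falsum => Nat.pair 0 0
  | _, .equal t u => Nat.pair 1 (Nat.pair (termCode t) (termCode u))
  | _, .rel (l := l) R ts =>
      Nat.pair 2 (Nat.pair (Encodable.encode (⟨l, R⟩ : Σ n, L.Relations n))
        (Encodable.encode (List.ofFn fun i => termCode (ts i))))
  | _, .imp φ ψ => Nat.pair 3 (Nat.pair (formulaCode φ) (formulaCode ψ))
  | _, .all φ => Nat.pair 4 (formulaCode φ)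

/-- A theory is RE when the set of Gödel numbers of its axioms is recursively enumerable. -/
def IsRE (T : L.Theory) : Prop :=
  REPred fun k : ℕ => ∃ φ : L.Sentence, φ ∈ T ∧ formulaCode φ = k

end Coding

/-- Containment of theories in the same language: every theorem of `U` is a theorem of `V`. -/
def SubTheory {L : FirstOrder.Language.{0, 0}} (U V : L.Theory) : Prop :=
  ∀ φ : L.Sentence, U ⊨ᵇ φ → V ⊨ᵇ φ

/-! ### Translations -/

/-- A translation of the language `L` into the language `L'`: piecewise, more-dimensional, with
parameters and a parameter domain, with domain relativisation, and with identity translated to a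
formula. A function symbol is translated to a formula for its graph. -/
structure Translation (L L' : FirstOrder.Language.{0, 0}) where
  /-- number of pieces of the domain -/
  pieces : ℕ
  /-- dimension of each piece -/
  dim : Fin pieces → ℕ
  /-- number of parameters -/
  params : ℕ
  /-- the parameter domain -/
  paramDom : L'.Formula (Fin params)
  /-- the domain formula of a piece -/
  dom : ∀ k, L'.Formula (Fin params ⊕ Fin (dim k))
  /-- translation of the identity between elements of two pieces -/
  eqv : ∀ k l, L'.Formula (Fin params ⊕ (Fin (dim k) ⊕ Fin (dim l)))
  /-- translation of a relation symbol, for arguments in the pieces listed by `c` -/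
  rel : ∀ {n : ℕ}, L.Relations n → ∀ c : Fin n → Fin pieces,
    L'.Formula (Fin params ⊕ (Σ i, Fin (dim (c i))))
  /-- translation of the graph of a function symbol, for arguments in the pieces listed by `c` and
  value in the piece `k` -/
  func : ∀ {n : ℕ}, L.Functions n → ∀ (c : Fin n → Fin pieces) (k : Fin pieces),
    L'.Formula (Fin params ⊕ ((Σ i, Fin (dim (c i))) ⊕ Fin (dim k)))

namespace Translation
variable {L L' : FirstOrder.Language.{0, 0}} (τ : Translation L L')

/-- The variables of the target language that stand for variables `x₀, …, xₙ₋₁` of the source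
language, when `xᵢ` ranges over the piece `c i`. -/
abbrev Vars {n : ℕ} (c : Fin n → Fin τ.pieces) : Type := Σ i, Fin (τ.dim (c i))

/-- Splits the variables that stand for `x₀, …, xₙ` into those for `x₀, …, xₙ₋₁` and those
for `xₙ`. -/
def splitLast {n : ℕ} (c : Fin n → Fin τ.pieces) (k : Fin τ.pieces) :
    τ.Vars (Fin.snoc c k : Fin (n + 1) → Fin τ.pieces) → τ.Vars c ⊕ Fin (τ.dim k)
  | ⟨i, j⟩ =>
    if h : i.val < n then
      Sum.inl ⟨⟨i.val, h⟩, Fin.cast (by simp [Fin.snoc, h, Fin.castLT]) j⟩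
    else
      Sum.inr (Fin.cast (by simp [Fin.snoc, h]) j)

/-- The formula that says that the (unnested) term `t` has as value the element of piece `k` given
by the second group of variables. A variable has itself as value; the intermediate values of
subterms are quantified over the translated domain. -/
noncomputable def termGraph {n : ℕ} (c : Fin n → Fin τ.pieces) :
    L.Term (Empty ⊕ Fin n) → ∀ k : Fin τ.pieces,
      L'.Formula (Fin τ.params ⊕ (τ.Vars c ⊕ Fin (τ.dim k)))
  | .var (.inl e), _ => e.elim
  | .var (.inr i), k =>
      if h : c i = k then
        Formula.iInf fun j : Fin (τ.dim k) =>
          Term.equal (.var (.inr (.inl ⟨i, Fin.cast (by rw [h]) j⟩))) (.var (.inr (.inr j)))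
      else ⊥
  | .func (l := m) f ts, k =>
      Formula.iSup fun d : Fin m → Fin τ.pieces =>
        Formula.iExs (τ.Vars d)
          ((Formula.iInf fun i : Fin m =>
              ((τ.dom (d i)).relabel (Sum.map Sum.inl fun j => ⟨i, j⟩) :
                L'.Formula ((Fin τ.params ⊕ (τ.Vars c ⊕ Fin (τ.dim k))) ⊕ τ.Vars d)) ⊓
              (termGraph c (ts i) (d i)).relabel
                (Sum.elim (fun p => Sum.inl (Sum.inl p))
                  (Sum.elim (fun x => Sum.inl (Sum.inr (Sum.inl x)))
                    fun j => Sum.inr ⟨i, j⟩))) ⊓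
            (τ.func f d k).relabel
              (Sum.elim (fun p => Sum.inl (Sum.inl p))
                (Sum.elim Sum.inr fun j => Sum.inl (Sum.inr (Sum.inr j)))))

/-- The translation of a formula, where the variable `xᵢ` ranges over the piece `c i`. Atomic
formulas are first unnested; quantifiers become conjunctions over the pieces of quantifiers
relativised to the domain. -/
noncomputable def trans : {n : ℕ} → L.BoundedFormula Empty n → ∀ c : Fin n → Fin τ.pieces,
    L'.Formula (Fin τ.params ⊕ τ.Vars c)
  | _, .falsum, _ => ⊥
  | _, .equal t u, c =>
      Formula.iSup fun d : Fin τ.pieces × Fin τ.pieces =>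
        Formula.iExs (Fin (τ.dim d.1) ⊕ Fin (τ.dim d.2))
          (((τ.dom d.1).relabel (Sum.map Sum.inl Sum.inl) :
              L'.Formula ((Fin τ.params ⊕ τ.Vars c) ⊕ (Fin (τ.dim d.1) ⊕ Fin (τ.dim d.2)))) ⊓
            (τ.dom d.2).relabel (Sum.map Sum.inl Sum.inr) ⊓
            (τ.termGraph c t d.1).relabel
              (Sum.elim (fun p => Sum.inl (Sum.inl p))
                (Sum.elim (fun x => Sum.inl (Sum.inr x)) fun j => Sum.inr (Sum.inl j))) ⊓
            (τ.termGraph c u d.2).relabel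
              (Sum.elim (fun p => Sum.inl (Sum.inl p))
                (Sum.elim (fun x => Sum.inl (Sum.inr x)) fun j => Sum.inr (Sum.inr j))) ⊓
            (τ.eqv d.1 d.2).relabel (Sum.map Sum.inl id))
  | _, .rel (l := m) R ts, c =>
      Formula.iSup fun d : Fin m → Fin τ.pieces =>
        Formula.iExs (τ.Vars d)
          ((Formula.iInf fun i : Fin m =>
              ((τ.dom (d i)).relabel (Sum.map Sum.inl fun j => ⟨i, j⟩) :
                L'.Formula ((Fin τ.params ⊕ τ.Vars c) ⊕ τ.Vars d)) ⊓
              (τ.termGraph c (ts i) (d i)).relabel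
                (Sum.elim (fun p => Sum.inl (Sum.inl p))
                  (Sum.elim (fun x => Sum.inl (Sum.inr x)) fun j => Sum.inr ⟨i, j⟩))) ⊓
            (τ.rel R d).relabel (Sum.map Sum.inl id))
  | _, .imp φ ψ, c => (trans φ c).imp (trans ψ c)
  | _, .all φ, c =>
      Formula.iInf fun k : Fin τ.pieces =>
        Formula.iAlls (Fin (τ.dim k))
          (((τ.dom k).relabel (Sum.map Sum.inl id) :
              L'.Formula ((Fin τ.params ⊕ τ.Vars c) ⊕ Fin (τ.dim k))).imp
            ((trans φ (Fin.snoc c k)).relabel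
              (Sum.elim (fun p => Sum.inl (Sum.inl p))
                fun x => Sum.map Sum.inr id (τ.splitLast c k x))))

/-- The translation of a sentence; the free variables are the parameters. -/
noncomputable def sentence (φ : L.Sentence) : L'.Formula (Fin τ.params) :=
  (τ.trans φ Fin.elim0).relabel (Sum.elim id fun x => x.1.elim0)

/-- `τ`, with parameters `p`, defines an internal model of the theory `U` in the structure `M`. -/
def DefinesModel (U : L.Theory) (M : Type) [L'.Structure M] (p : Fin τ.params → M) : Prop :=
  ∀ φ : L.Sentence, U ⊨ᵇ φ → (τ.sentence φ).Realize p

/-- The sentence that says that the parameter domain is not empty. -/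
noncomputable def paramDomNonempty : L'.Sentence :=
  Formula.iExs (Fin τ.params) (τ.paramDom.relabel Sum.inr)

/-- A translation with a single one-dimensional piece and with identity translated to identity. -/
def simple (p : ℕ) (α : L'.Formula (Fin p)) (δ : L'.Formula (Fin p ⊕ Fin 1))
    (rel : ∀ {n : ℕ}, L.Relations n → L'.Formula (Fin p ⊕ Fin n))
    (func : ∀ {n : ℕ}, L.Functions n → L'.Formula (Fin p ⊕ Fin (n + 1))) : Translation L L' where
  pieces := 1
  dim _ := 1
  params := p
  paramDom := α
  dom _ := δ
  eqv _ _ := Term.equal (.var (.inr (.inl 0))) (.var (.inr (.inr 0)))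
  rel R _ := (rel R).relabel (Sum.map id fun i => ⟨i, 0⟩)
  func f _ _ := (func f).relabel
    (Sum.map id (Fin.lastCases (Sum.inr 0) fun i => Sum.inl ⟨i, 0⟩))

end Translation

/-! ### Interpretability relations

The proposition `pw` fixes the convention on translations: if it holds, piecewise translations are
allowed, otherwise only translations with a single piece. -/

/-- `V` interprets `U`. -/
def Interprets (pw : Prop) {L L' : FirstOrder.Language.{0, 0}} (V : L'.Theory) (U : L.Theory) : Prop :=
  ∃ τ : Translation L L', (pw ∨ τ.pieces = 1) ∧ V ⊨ᵇ τ.paramDomNonempty ∧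
    ∀ φ : L.Sentence, U ⊨ᵇ φ → V ⊨ᵇ τ.paramDom.imp (τ.sentence φ)

/-- `V` model-interprets `U`: for every model `M` of `V` there is a translation that defines an
internal model of `U` in `M`. -/
def ModelInterprets (pw : Prop) {L L' : FirstOrder.Language.{0, 0}} (V : L'.Theory) (U : L.Theory) : Prop :=
  ∀ (M : Type) [L'.Structure M] [Nonempty M], M ⊨ V →
    ∃ τ : Translation L L', (pw ∨ τ.pieces = 1) ∧
      (∃ p : Fin τ.params → M, τ.paramDom.Realize p) ∧
      ∀ p : Fin τ.params → M, τ.paramDom.Realize p → τ.DefinesModel U M p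

/-- `V` essentially tolerates (laxly interprets) `U`: every consistent RE extension of `V` in the
same language has a consistent RE extension in the same language that interprets `U`. -/
def LaxInterprets (pw : Prop) {L L' : FirstOrder.Language.{0, 0}}
    [Encodable (Σ n, L'.Functions n)] [Encodable (Σ n, L'.Relations n)]
    (V : L'.Theory) (U : L.Theory) : Prop :=
  ∀ V' : L'.Theory, IsRE V' → V'.IsSatisfiable → SubTheory V V' →
    ∃ V'' : L'.Theory, IsRE V'' ∧ V''.IsSatisfiable ∧ SubTheory V' V'' ∧ Interprets pw V'' U

/-! ### The arithmetical language and the theory `R` -/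

/-- Function symbols of arithmetic. -/
inductive ArithFunc : ℕ → Type
  | zero : ArithFunc 0
  | succ : ArithFunc 1
  | add : ArithFunc 2
  | mul : ArithFunc 2

/-- Relation symbols of arithmetic. -/
inductive ArithRel : ℕ → Type
  | lt : ArithRel 2

/-- The language of arithmetic with `0`, `S`, `+`, `×`, `<`. -/
def arith : FirstOrder.Language.{0, 0} := ⟨ArithFunc, ArithRel⟩

noncomputable instance : Encodable (Σ n, arith.Functions n) :=
  Encodable.ofInj
    (fun x : Σ n, ArithFunc n =>
      match x with
      | ⟨_, .zero⟩ => 0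
      | ⟨_, .succ⟩ => 1
      | ⟨_, .add⟩ => 2
      | ⟨_, .mul⟩ => 3)
    (by rintro ⟨_, _ | _⟩ ⟨_, _ | _⟩ h <;> first | rfl | exact absurd h (by decide))

noncomputable instance : Encodable (Σ n, arith.Relations n) :=
  Encodable.ofInj (fun _ : Σ n, ArithRel n => 0)
    (by rintro ⟨_, _ | _⟩ ⟨_, _ | _⟩ _; rfl)

section ArithSyntax
variable {α : Type}

/-- The term `0`. -/
def aZero : arith.Term α := Term.func (L := arith) ArithFunc.zero ![]
/-- The term `S t`. -/
def aSucc (t : arith.Term α) : arith.Term α := Term.func (L := arith) ArithFunc.succ ![t]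
/-- The term `t + u`. -/
def aAdd (t u : arith.Term α) : arith.Term α := Term.func (L := arith) ArithFunc.add ![t, u]
/-- The term `t × u`. -/
def aMul (t u : arith.Term α) : arith.Term α := Term.func (L := arith) ArithFunc.mul ![t, u]
/-- The numeral of `n`. -/
def aNum : ℕ → arith.Term α
  | 0 => aZero
  | n + 1 => aSucc (aNum n)

/-- The formula `t < u`. -/
def aLt {n : ℕ} (t u : arith.Term (α ⊕ Fin n)) : arith.BoundedFormula α n :=
  BoundedFormula.rel (L := arith) ArithRel.lt ![t, u]
/-- The formula `t ≤ u`, that is, `t < u ∨ t = u`. -/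
def aLe {n : ℕ} (t u : arith.Term (α ⊕ Fin n)) : arith.BoundedFormula α n :=
  aLt t u ⊔ (t =' u)

end ArithSyntax

/-- The theory `R`. -/
inductive R : arith.Theory
  | add (m n : ℕ) : R (aAdd (aNum m) (aNum n) =' aNum (m + n))
  | mul (m n : ℕ) : R (aMul (aNum m) (aNum n) =' aNum (m * n))
  | ne (m n : ℕ) (h : m ≠ n) : R (∼(aNum m =' aNum n))
  | lt (n : ℕ) : R (∀' (aLt (&0) (aNum n) ⟹ bigOr ((List.range n).map fun i => (&0) =' aNum i)))
  | tri (n : ℕ) : R (∀' ((aLt (&0) (aNum n) ⊔ ((&0) =' aNum n)) ⊔ aLt (aNum n) (&0)))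

/-- The standard model of arithmetic. -/
instance natStructure : arith.Structure ℕ where
  funMap f := match f with
    | ArithFunc.zero => fun _ => 0
    | ArithFunc.succ => fun x => x 0 + 1
    | ArithFunc.add => fun x => x 0 + x 1
    | ArithFunc.mul => fun x => x 0 * x 1
  RelMap r := match r with
    | ArithRel.lt => fun x => x 0 < x 1

/-! ### The theory of a number -/

/-- The conjunction of the ten axioms of the theory `TN` of a number. -/
def TN : arith.Sentence :=
  bigAnd
    [ ∀' ∼(aLt (&0) aZero),
      ∀' ∀' ∀' ((aLt (&0) (&1) ⊓ aLt (&1) (&2)) ⟹ aLt (&0) (&2)),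
      ∀' ∀' ((aLt (&0) (&1) ⊔ ((&0) =' (&1))) ⊔ aLt (&1) (&0)),
      ∀' (((&0) =' aZero) ⊔ ∃' ((&0) =' aSucc (&1))),
      ∀' ∼(aLt (aSucc (&0)) (&0)),
      ∀' ∀' (aLt (&0) (&1) ⟹ (aLt (&0) (aSucc (&0)) ⊓ ∼(aLt (&1) (aSucc (&0))))),
      ∀' (aAdd (&0) aZero =' (&0)),
      ∀' ∀' (aAdd (&0) (aSucc (&1)) =' aSucc (aAdd (&0) (&1))),
      ∀' (aMul (&0) aZero =' aZero),
      ∀' ∀' (aMul (&0) (aSucc (&1)) =' aAdd (aMul (&0) (&1)) (&0)) ]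

/-- The part of the theory of identity for the arithmetical language that says that the function
symbols stand for total functions. It is logically valid, but its translation expresses that the
translations of the function symbols are total and functional. -/
def idArith : arith.Sentence :=
  bigAnd
    [ ∃' (aZero =' (&0)),
      ∀' ∀' ((aZero =' (&0)) ⟹ (aZero =' (&1)) ⟹ ((&0) =' (&1))),
      ∀' ∃' (aSucc (&0) =' (&1)),
      ∀' ∀' ∀' ((aSucc (&0) =' (&1)) ⟹ (aSucc (&0) =' (&2)) ⟹ ((&1) =' (&2))),
      ∀' ∀' ∃' (aAdd (&0) (&1) =' (&2)),
      ∀' ∀' ∀' ∀' ((aAdd (&0) (&1) =' (&2)) ⟹ (aAdd (&0) (&1) =' (&3)) ⟹ ((&2) =' (&3))),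
      ∀' ∀' ∃' (aMul (&0) (&1) =' (&2)),
      ∀' ∀' ∀' ∀' ((aMul (&0) (&1) =' (&2)) ⟹ (aMul (&0) (&1) =' (&3)) ⟹ ((&2) =' (&3))) ]

/-- `w` is the value of the term `t`, cut off at `z`. -/
def aCut {α : Type} {n : ℕ} (t z w : arith.Term (α ⊕ Fin n)) : arith.BoundedFormula α n :=
  (aLe t z ⊓ (w =' t)) ⊔ (∼(aLe t z) ⊓ (w =' z))

/-- The translation, with parameter `z`, of the arithmetical language in itself that restricts the
domain to the `x ≤ z` and cuts off the operations at `z`. -/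
def cutTrans : Translation arith arith :=
  .simple 1 ⊤ (aLe (fv (.inr 0)) (fv (.inl 0)))
    (fun r => match r with
      | ArithRel.lt => aLt (fv (.inr 0)) (fv (.inr 1)))
    (fun f => match f with
      | ArithFunc.zero => fv (.inr 0) =' aZero
      | ArithFunc.succ => aCut (aSucc (fv (.inr 0))) (fv (.inl 0)) (fv (.inr 1))
      | ArithFunc.add => aCut (aAdd (fv (.inr 0)) (fv (.inr 1))) (fv (.inl 0)) (fv (.inr 2))
      | ArithFunc.mul => aCut (aMul (fv (.inr 0)) (fv (.inr 1))) (fv (.inl 0)) (fv (.inr 2)))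

/-- The formula `z ⊨ TN`, where the free variable is `z`. -/
noncomputable def modelsTN : arith.Formula (Fin 1) := cutTrans.sentence (idArith ⊓ TN)

/-! ### Pure `Δ₀`-formulas and pure 1-`Σ⁰₁`-sentences -/

/-- Pure `Δ₀`-formulas with free variables among `x₀, …, xₙ₋₁`. A bounded quantifier binds the
variable `xₙ`. -/
inductive PureDelta : ℕ → Type
  | bot {n} : PureDelta n
  | top {n} : PureDelta n
  /-- `u < v` -/
  | lt {n} (u v : Fin n) : PureDelta n
  /-- `0 = u` -/
  | zero {n} (u : Fin n) : PureDelta n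
  /-- `S u = v` -/
  | succ {n} (u v : Fin n) : PureDelta n
  /-- `u + v = w` -/
  | add {n} (u v w : Fin n) : PureDelta n
  /-- `u × v = w` -/
  | mul {n} (u v w : Fin n) : PureDelta n
  | neg {n} (φ : PureDelta n) : PureDelta n
  | and {n} (φ ψ : PureDelta n) : PureDelta n
  | or {n} (φ ψ : PureDelta n) : PureDelta n
  | imp {n} (φ ψ : PureDelta n) : PureDelta n
  | allLt {n} (v : Fin n) (φ : PureDelta (n + 1)) : PureDelta n
  | exLt {n} (v : Fin n) (φ : PureDelta (n + 1)) : PureDelta n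
  | allLe {n} (v : Fin n) (φ : PureDelta (n + 1)) : PureDelta n
  | exLe {n} (v : Fin n) (φ : PureDelta (n + 1)) : PureDelta n

/-- Gödel number of a pure `Δ₀`-formula. -/
def PureDelta.code : {n : ℕ} → PureDelta n → ℕ
  | _, .bot => Nat.pair 0 0
  | _, .top => Nat.pair 1 0
  | _, .lt u v => Nat.pair 2 (Nat.pair u v)
  | _, .zero u => Nat.pair 3 u
  | _, .succ u v => Nat.pair 4 (Nat.pair u v)
  | _, .add u v w => Nat.pair 5 (Nat.pair u (Nat.pair v w))
  | _, .mul u v w => Nat.pair 6 (Nat.pair u (Nat.pair v w))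
  | _, .neg φ => Nat.pair 7 φ.code
  | _, .and φ ψ => Nat.pair 8 (Nat.pair φ.code ψ.code)
  | _, .or φ ψ => Nat.pair 9 (Nat.pair φ.code ψ.code)
  | _, .imp φ ψ => Nat.pair 10 (Nat.pair φ.code ψ.code)
  | _, .allLt v φ => Nat.pair 11 (Nat.pair v φ.code)
  | _, .exLt v φ => Nat.pair 12 (Nat.pair v φ.code)
  | _, .allLe v φ => Nat.pair 13 (Nat.pair v φ.code)
  | _, .exLe v φ => Nat.pair 14 (Nat.pair v φ.code)

/-- The arithmetical formula of a pure `Δ₀`-formula, with `xᵢ` renamed to the variable `ρ i`. -/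
def PureDelta.toFormula : {n m : ℕ} → (Fin n → Fin m) → PureDelta n → arith.BoundedFormula Empty m
  | _, _, _, .bot => ⊥
  | _, _, _, .top => ⊤
  | _, _, ρ, .lt u v => aLt (&(ρ u)) (&(ρ v))
  | _, _, ρ, .zero u => aZero =' (&(ρ u))
  | _, _, ρ, .succ u v => aSucc (&(ρ u)) =' (&(ρ v))
  | _, _, ρ, .add u v w => aAdd (&(ρ u)) (&(ρ v)) =' (&(ρ w))
  | _, _, ρ, .mul u v w => aMul (&(ρ u)) (&(ρ v)) =' (&(ρ w))
  | _, _, ρ, .neg φ => ∼(φ.toFormula ρ)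
  | _, _, ρ, .and φ ψ => φ.toFormula ρ ⊓ ψ.toFormula ρ
  | _, _, ρ, .or φ ψ => φ.toFormula ρ ⊔ ψ.toFormula ρ
  | _, _, ρ, .imp φ ψ => φ.toFormula ρ ⟹ ψ.toFormula ρ
  | _, m, ρ, .allLt v φ =>
      ∀' (aLt (&(Fin.last m)) (&((ρ v).castSucc)) ⟹
        φ.toFormula (Fin.snoc (fun i => (ρ i).castSucc) (Fin.last m)))
  | _, m, ρ, .exLt v φ =>
      ∃' (aLt (&(Fin.last m)) (&((ρ v).castSucc)) ⊓
        φ.toFormula (Fin.snoc (fun i => (ρ i).castSucc) (Fin.last m)))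
  | _, m, ρ, .allLe v φ =>
      ∀' (aLe (&(Fin.last m)) (&((ρ v).castSucc)) ⟹
        φ.toFormula (Fin.snoc (fun i => (ρ i).castSucc) (Fin.last m)))
  | _, m, ρ, .exLe v φ =>
      ∃' (aLe (&(Fin.last m)) (&((ρ v).castSucc)) ⊓
        φ.toFormula (Fin.snoc (fun i => (ρ i).castSucc) (Fin.last m)))

/-- The pure 1-`Σ⁰₁`-sentence `∃ x₀ δ(x₀)`. -/
def sigmaSentence (δ : PureDelta 1) : arith.Sentence := ∃' (δ.toFormula id)

/-- For `σ := ∃ x δ(x)`, the sentence `σ^q := ∃ z (∃ x < z δ(x) ∧ z ⊨ TN)`. -/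
noncomputable def sigmaQ (δ : PureDelta 1) : arith.Sentence :=
  ∃' ((∃' (aLt (&1) (&0) ⊓ δ.toFormula fun _ => (1 : Fin 2))) ⊓
    (BoundedFormula.relabel Sum.inr modelsTN : arith.BoundedFormula Empty 1))

/-- `U` is `Σ⁰₁`-friendly: `U` is a consistent RE theory and there is a recursive function `Φ` from
pure 1-`Σ⁰₁`-sentences `σ` to sentences of `U` such that `U ⊢ Φ(σ)` whenever `σ` is true, and
`U + Φ(σ)` always interprets `σ^q`. -/
structure SigmaFriendly (pw : Prop) {L : FirstOrder.Language.{0, 0}}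
    [Encodable (Σ n, L.Functions n)] [Encodable (Σ n, L.Relations n)] (U : L.Theory) : Prop where
  re : IsRE U
  consistent : U.IsSatisfiable
  friendly : ∃ Φ : PureDelta 1 → L.Sentence,
    (∃ f : ℕ → ℕ, Computable f ∧ ∀ δ, f δ.code = formulaCode (Φ δ)) ∧
    (∀ δ, ℕ ⊨ sigmaSentence δ → U ⊨ᵇ Φ δ) ∧
    ∀ δ, Interprets pw (U ∪ {Φ δ}) ({sigmaQ δ} : arith.Theory)

/-! ### The theory of scattered numbers -/

/-- Relation symbols of the relational signature of arithmetic without zero. -/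
inductive ScatRel : ℕ → Type
  | lt : ScatRel 2
  | succ : ScatRel 2
  | add : ScatRel 3
  | mul : ScatRel 3

/-- The relational language of arithmetic with `<` and without zero. -/
def scatLang : FirstOrder.Language.{0, 0} := ⟨fun _ => Empty, ScatRel⟩

noncomputable instance : Encodable (Σ n, scatLang.Functions n) :=
  Encodable.ofInj (fun _ : Σ _ : ℕ, Empty => 0) (by rintro ⟨_, ⟨⟩⟩)

noncomputable instance : Encodable (Σ n, scatLang.Relations n) :=
  Encodable.ofInj
    (fun x : Σ n, ScatRel n =>
      match x with
      | ⟨_, .lt⟩ => 0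
      | ⟨_, .succ⟩ => 1
      | ⟨_, .add⟩ => 2
      | ⟨_, .mul⟩ => 3)
    (by rintro ⟨_, _ | _⟩ ⟨_, _ | _⟩ h <;> first | rfl | exact absurd h (by decide))

section ScatSyntax
variable {α : Type} {n : ℕ}

/-- The formula `t < u`. -/
def sLt (t u : scatLang.Term (α ⊕ Fin n)) : scatLang.BoundedFormula α n :=
  BoundedFormula.rel (L := scatLang) ScatRel.lt ![t, u]
/-- The formula `t ≤ u`, that is, `t < u ∨ t = u`. -/
def sLe (t u : scatLang.Term (α ⊕ Fin n)) : scatLang.BoundedFormula α n := sLt t u ⊔ (t =' u)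
/-- The formula `S(t, u)`. -/
def sSucc (t u : scatLang.Term (α ⊕ Fin n)) : scatLang.BoundedFormula α n :=
  BoundedFormula.rel (L := scatLang) ScatRel.succ ![t, u]

end ScatSyntax

/-- The graph of an arithmetical operation, cut off at `z`, on the domain of the `y` with `a ≤ y`:
either the operation has a value `v ≤ z` in the domain and `w` is such a value, or it has no such
value and `w = z`. The parameters are `a` and `z`; the last argument is `w`. -/
def sCut {n : ℕ} (r : ScatRel (n + 1)) : scatLang.Formula (Fin 2 ⊕ Fin (n + 1)) :=
  ((∃' (sLe (fv (.inl 0)) (&0) ⊓ sLe (&0) (fv (.inl 1)) ⊓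
        BoundedFormula.rel (L := scatLang) r
          (Fin.snoc (fun i : Fin n => fv (.inr i.castSucc)) (&0)))) ⊓
      BoundedFormula.rel (L := scatLang) r (fun i => fv (.inr i))) ⊔
    (∼(∃' (sLe (fv (.inl 0)) (&0) ⊓ sLe (&0) (fv (.inl 1)) ⊓
        BoundedFormula.rel (L := scatLang) r
          (Fin.snoc (fun i : Fin n => fv (.inr i.castSucc)) (&0)))) ⊓
      (fv (.inr (Fin.last n)) =' fv (.inl 1)))

/-- The cut-off translation of the arithmetical language in the language of scattered numbers, with
parameters `a`, `z`: zero becomes `a`, the domain consists of the `y` with `a ≤ y` and `y ≤ z`, and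
the operations are cut off at `z`. -/
def scatTrans : Translation arith scatLang :=
  .simple 2 ⊤ (sLe (fv (.inl 0)) (fv (.inr 0)) ⊓ sLe (fv (.inr 0)) (fv (.inl 1)))
    (fun r => match r with
      | ArithRel.lt => sLt (fv (.inr 0)) (fv (.inr 1)))
    (fun f => match f with
      | ArithFunc.zero => fv (.inr 0) =' fv (.inl 0)
      | ArithFunc.succ => sCut ScatRel.succ
      | ArithFunc.add => sCut ScatRel.add
      | ArithFunc.mul => sCut ScatRel.mul)

/-- The formula `z ⊨ TN` with zero replaced by `a`; the free variables are `a`, `z`. -/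
noncomputable def scatModelsTN : scatLang.Formula (Fin 2) := scatTrans.sentence (idArith ⊓ TN)

/-- For the variables `a = x₀` and `z = x₁`: there are `y₀, …, yₙ` in the domain, all below `z`,
with `y₀ = a` and `S(yᵢ, yᵢ₊₁)` for `i < n`. This is the statement that the numeral of `n` has a
value below `z`, with zero replaced by `a`. -/
def numeralBelow (n : ℕ) : scatLang.BoundedFormula Empty 2 :=
  exBlock (n + 1)
    (((&(Fin.natAdd 2 (0 : Fin (n + 1)))) =' (&(Fin.castAdd (n + 1) (0 : Fin 2)))) ⊓
      bigAnd ((List.finRange (n + 1)).map fun i =>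
        sLe (&(Fin.castAdd (n + 1) (0 : Fin 2))) (&(Fin.natAdd 2 i)) ⊓
          sLt (&(Fin.natAdd 2 i)) (&(Fin.castAdd (n + 1) (1 : Fin 2)))) ⊓
      bigAnd ((List.finRange n).map fun i =>
        sSucc (&(Fin.natAdd 2 i.castSucc)) (&(Fin.natAdd 2 i.succ))))

/-- For the variable `a = x₀`: there are at least `n` elements `y` with `a ≤ y`. -/
def atLeast (n : ℕ) : scatLang.BoundedFormula Empty 1 :=
  exBlock n
    (bigAnd ((List.finRange n).map fun i =>
        sLe (&(Fin.castAdd n (0 : Fin 1))) (&(Fin.natAdd 1 i))) ⊓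
      bigAnd ((List.finRange n).map fun j =>
        bigAnd (((List.finRange n).filter (· < j)).map fun i =>
          ∼((&(Fin.natAdd 1 i)) =' (&(Fin.natAdd 1 j))))))

/-- The formula `ñ(a)`, where `a = x₀`. -/
noncomputable def tildeNum (n : ℕ) : scatLang.BoundedFormula Empty 1 :=
  (∃' (sLe (&0) (&1) ⊓ numeralBelow n ⊓
    (BoundedFormula.relabel Sum.inr scatModelsTN : scatLang.BoundedFormula Empty 2))) ⊓ atLeast n

/-- The theory `PA⁻_scat`, axiomatised by `∃ a ñ(a)` for all natural numbers `n`. -/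
def PAscat : scatLang.Theory := Set.range fun n : ℕ => ∃' (tildeNum n)

/-- Atomic formulas of the relational language, read in the language of arithmetic with function
symbols. -/
def atomToArith {α : Type} {n l : ℕ} (r : ScatRel l) (ts : Fin l → arith.Term (α ⊕ Fin n)) :
    arith.BoundedFormula α n :=
  match r with
  | .lt => aLt (ts 0) (ts 1)
  | .succ => aSucc (ts 0) =' ts 1
  | .add => aAdd (ts 0) (ts 1) =' ts 2
  | .mul => aMul (ts 0) (ts 1) =' ts 2

/-- Terms of the relational language are variables. -/
def termToArith {α : Type} : scatLang.Term α → arith.Term α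
  | .var x => .var x
  | .func f _ => Empty.elim f

/-- The reading of formulas of the relational language without zero as formulas of the language of
arithmetic: the relation symbols denote the graphs of the operations. -/
def toArith {α : Type} : {n : ℕ} → scatLang.BoundedFormula α n → arith.BoundedFormula α n
  | _, .falsum => .falsum
  | _, .equal t u => .equal (termToArith t) (termToArith u)
  | _, .rel r ts => atomToArith r fun i => termToArith (ts i)
  | _, .imp φ ψ => .imp (toArith φ) (toArith ψ)
  | _, .all φ => .all (toArith φ)

/-- The domain of the model of scattered numbers: pairs `⟨n, m⟩` with `m < n`. -/
def Nscat : Type := Σ n : ℕ, Fin n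

/-- The model of scattered numbers: the disjoint sum of all finite numbers, where on the number `n`
the operations are cut off at `n - 1`. -/
instance : scatLang.Structure Nscat where
  funMap f := Empty.elim f
  RelMap r := match r with
    | ScatRel.lt => fun x => (x 0).1 = (x 1).1 ∧ (x 0).2.val < (x 1).2.val
    | ScatRel.succ => fun x =>
        (x 0).1 = (x 1).1 ∧ (x 1).2.val = min ((x 0).2.val + 1) ((x 0).1 - 1)
    | ScatRel.add => fun x =>
        (x 0).1 = (x 1).1 ∧ (x 1).1 = (x 2).1 ∧
          (x 2).2.val = min ((x 0).2.val + (x 1).2.val) ((x 0).1 - 1)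
    | ScatRel.mul => fun x =>
        (x 0).1 = (x 1).1 ∧ (x 1).1 = (x 2).1 ∧
          (x 2).2.val = min ((x 0).2.val * (x 1).2.val) ((x 0).1 - 1)

/-! ### The theory `R_succ` -/

/-- Function symbols `0` and `S`. -/
inductive SuccFunc : ℕ → Type
  | zero : SuccFunc 0
  | succ : SuccFunc 1

/-- The language with `0` and `S`. -/
def succLang : FirstOrder.Language.{0, 0} := ⟨SuccFunc, fun _ => Empty⟩

/-- The numeral of `n`. -/
def succNum {α : Type} : ℕ → succLang.Term α
  | 0 => Term.func (L := succLang) SuccFunc.zero ![]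
  | n + 1 => Term.func (L := succLang) SuccFunc.succ ![succNum n]

/-- The theory `R_succ`: different numerals have different values. -/
def Rsucc : succLang.Theory :=
  {φ | ∃ m n : ℕ, n ≠ m ∧ φ = ∼(succNum n =' succNum m)}

end LaxInt

/-!
# Scattered numbers: lax interpretability without model interpretability

A translation `τ` with parameters `p` determines a *raw structure* `τ.raw p`, and the translation of
a sentence says that the sentence is satisfied in it (`Translation.realize_sentence`). If the finitely
many axioms of identity hold in the raw structure, then its quotient is a structure in the usual sense
(`RawStr.exists_presents`, `RawStr.Presents.sat_sentence`). All statements about interpretations are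
reduced in this way to statements about structures. In particular `z ⊨ TN` holds, with zero replaced by
`a`, exactly when the segment from `a` to `z` is a number (`realize_scatModelsTN_iff`).

**Containment in `R`, and the model of scattered numbers.** In a model of `R` the numerals up to `K` form
a segment that is a copy of the standard number `K + 1`, and so do the elements of a component of `Nscat`.
Such segments, for all `K`, make a structure a model of `PAscat` (`models_PAscat_of_segments`).

**Friendliness and lax interpretation of `R`.** The sentence `witnessSentence δ` says that some segment is
a number with a witness of `δ` below its largest element. It follows from `PAscat` if `∃ x δ(x)` is true,
and it yields an interpretation with the end points of such segments as parameters
(`interprets_of_witness`). If `∃ x δ(x)` is false, then every number with a witness of `δ` is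
nonstandard, since `Δ₀`-formulas are absolute below a standard number; so its numerals increase forever
and it is a model of `R` (`IsTN.num_increasing`, `IsTN.models_R`). For a consistent recursively enumerable extension `V` of
`PAscat`, some false `∃ x δ(x)` has a `witnessSentence δ` that is consistent with `V`; otherwise
falsehood of `Σ₁`-sentences would be inconsistency with `V`, hence recursively enumerable. This uses
that recursively enumerable predicates are `Σ₁` (`Sig.of_partrec`), and that inconsistency with `V` is
recursively enumerable (`rePred_not_isSatisfiable`). The latter is proved without a proof calculus: the
Henkin conditions are clauses for a propositional valuation, and unsatisfiability of clauses is derived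
along a semantic tree.

**No internal model of `R_succ`.** For each quantifier depth there are finitely many types of tuples, relative
to a component of `Nscat`, and two components of the same type can be interchanged. Hence a formula that
holds of some tuple holds of a tuple from the components below a bound that depends only on the formula,
where elements below the bound need not be changed (`Scat.eventually_small`). So in an internal
structure all iterates of the successor at zero are represented by tuples below a fixed bound, of which
there are finitely many (`Scat.not_injective_iterate`).

**Model interpretability implies lax interpretability.** A model of a consistent extension `V'` of `V` provides a
translation, and `V'` is extended by the statement that it is an interpretation of `U`. To see that the
extension is recursively enumerable, the translation is carried out on Gödel numbers by a recursively
enumerable set of rules (`TransRule`), with sentences that are equivalent to the translated ones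
(`exists_isRE_translation`).
-/


namespace LaxInt

/-! ### Raw internal structures -/

/-- The data that a translation determines in a structure, before any identification of elements:
a domain, a relation that stands for identity, and relations for the relation symbols and for the
graphs of the function symbols. Nothing is assumed about them. -/
structure RawStr (L : FirstOrder.Language.{0, 0}) (X : Type) where
  dom : X → Prop
  eqv : X → X → Prop
  rel : ∀ {n : ℕ}, L.Relations n → (Fin n → X) → Prop
  func : ∀ {n : ℕ}, L.Functions n → (Fin n → X) → X → Prop

namespace RawStr
variable {L : FirstOrder.Language.{0, 0}} {X : Type} (S : RawStr L X)

/-- `y` is a value of the unnested term `t`. -/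
def Val {n : ℕ} (e : Fin n → X) : L.Term (Empty ⊕ Fin n) → X → Prop
  | .var (.inl v), _ => v.elim
  | .var (.inr i), y => e i = y
  | .func f ts, y => ∃ d, (∀ i, S.dom (d i) ∧ Val e (ts i) (d i)) ∧ S.func f d y

/-- Satisfaction in a raw structure: quantifiers are relativised to the domain, atomic formulas are
unnested. -/
def Sat : {n : ℕ} → L.BoundedFormula Empty n → (Fin n → X) → Prop
  | _, .falsum, _ => False
  | _, .equal t u, e => ∃ y z, S.dom y ∧ S.dom z ∧ S.Val e t y ∧ S.Val e u z ∧ S.eqv y z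
  | _, .rel R ts, e => ∃ d, (∀ i, S.dom (d i) ∧ S.Val e (ts i) (d i)) ∧ S.rel R d
  | _, .imp φ ψ, e => Sat φ e → Sat ψ e
  | _, .all φ, e => ∀ y, S.dom y → Sat φ (Fin.snoc e y)

variable {n : ℕ} (e : Fin n → X)

@[simp] theorem sat_imp (φ ψ : L.BoundedFormula Empty n) :
    S.Sat (φ.imp ψ) e ↔ (S.Sat φ e → S.Sat ψ e) := Iff.rfl
@[simp] theorem sat_top : S.Sat (⊤ : L.BoundedFormula Empty n) e ↔ True := by
  change (False → False) ↔ True; simp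
@[simp] theorem sat_inf (φ ψ : L.BoundedFormula Empty n) :
    S.Sat (φ ⊓ ψ) e ↔ S.Sat φ e ∧ S.Sat ψ e := by
  change ((_ → (_ → False)) → False) ↔ _; tauto
@[simp] theorem sat_all (φ : L.BoundedFormula Empty (n + 1)) :
    S.Sat φ.all e ↔ ∀ y, S.dom y → S.Sat φ (Fin.snoc e y) := Iff.rfl
@[simp] theorem sat_ex (φ : L.BoundedFormula Empty (n + 1)) :
    S.Sat φ.ex e ↔ ∃ y, S.dom y ∧ S.Sat φ (Fin.snoc e y) := by
  change ((∀ y, S.dom y → (_ → False)) → False) ↔ _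
  constructor
  · intro h
    by_contra h'
    exact h fun y hy hs => h' ⟨y, hy, hs⟩
  · rintro ⟨y, hy, hs⟩ h
    exact h y hy hs
theorem sat_equal (t u : L.Term (Empty ⊕ Fin n)) :
    S.Sat (t =' u) e ↔ ∃ y z, S.dom y ∧ S.dom z ∧ S.Val e t y ∧ S.Val e u z ∧ S.eqv y z := Iff.rfl
theorem sat_bigAnd (l : List (L.BoundedFormula Empty n)) :
    S.Sat (bigAnd l) e ↔ ∀ φ ∈ l, S.Sat φ e := by
  induction l with
  | nil => simp [bigAnd]
  | cons φ l ih => simpa [bigAnd] using fun _ => ih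
theorem sat_alls (φ : L.BoundedFormula Empty n) :
    S.Sat φ.alls Fin.elim0 ↔ ∀ e : Fin n → X, (∀ i, S.dom (e i)) → S.Sat φ e := by
  induction n with
  | zero =>
    refine ⟨fun h e _ => ?_, fun h => h _ fun i => i.elim0⟩
    rwa [Subsingleton.elim e Fin.elim0]
  | succ n ih =>
    have := ih (φ := φ.all)
    rw [show φ.alls = φ.all.alls from rfl, this]
    constructor
    · intro h e he
      have := h (Fin.init e) (fun i => he _) (e (Fin.last n)) (he _)
      rwa [Fin.snoc_init_self] at this
    · intro h e he y hy
      refine h _ fun i => ?_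
      refine Fin.lastCases ?_ (fun i => ?_) i
      · simpa using hy
      · simpa using he i

/-- The map `cls` from the domain of a raw structure onto a structure `N` turns the raw identity,
relations and graphs into those of `N`. -/
structure Presents (N : Type) [L.Structure N] (cls : {x // S.dom x} → N) : Prop where
  surj : Function.Surjective cls
  eqv_iff : ∀ x y, S.eqv x.1 y.1 ↔ cls x = cls y
  rel_iff : ∀ {n : ℕ} (R : L.Relations n) (d : Fin n → {x // S.dom x}),
    S.rel R (fun i => (d i).1) ↔ Structure.RelMap R fun i => cls (d i)
  func_total : ∀ {n : ℕ} (f : L.Functions n) (d : Fin n → {x // S.dom x}),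
    ∃ y : {x // S.dom x}, S.func f (fun i => (d i).1) y.1
  func_val : ∀ {n : ℕ} (f : L.Functions n) (d : Fin n → {x // S.dom x}) (y : {x // S.dom x}),
    S.func f (fun i => (d i).1) y.1 → cls y = Structure.funMap f fun i => cls (d i)

variable {S} {N : Type} [L.Structure N] {cls : {x // S.dom x} → N}

theorem Presents.val_total (h : S.Presents N cls) (e : Fin n → {x // S.dom x})
    (t : L.Term (Empty ⊕ Fin n)) : ∃ y : {x // S.dom x}, S.Val (fun i => (e i).1) t y.1 := by
  induction t with
  | var x =>
    rcases x with v | i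
    · exact v.elim
    · exact ⟨e i, rfl⟩
  | func f ts ih =>
    choose d hd using ih
    obtain ⟨y, hy⟩ := h.func_total f d
    exact ⟨y, fun i => (d i).1, fun i => ⟨(d i).2, hd i⟩, hy⟩

theorem Presents.val_eq (h : S.Presents N cls) (e : Fin n → {x // S.dom x})
    (t : L.Term (Empty ⊕ Fin n)) (y : {x // S.dom x}) (hy : S.Val (fun i => (e i).1) t y.1) :
    cls y = t.realize (Sum.elim default fun i => cls (e i)) := by
  induction t generalizing y with
  | var x =>
    rcases x with v | i
    · exact v.elim
    · exact congrArg cls (Subtype.ext (Eq.symm hy))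
  | func f ts ih =>
    obtain ⟨d, hd, hf⟩ := hy
    rw [h.func_val f (fun i => ⟨d i, (hd i).1⟩) y hf]
    exact congrArg _ (funext fun i => ih i ⟨d i, (hd i).1⟩ (hd i).2)

/-- Satisfaction in a raw structure agrees with satisfaction in the structure it presents. -/
theorem Presents.sat_iff (h : S.Presents N cls) :
    ∀ {n : ℕ} (φ : L.BoundedFormula Empty n) (e : Fin n → {x // S.dom x}),
      S.Sat φ (fun i => (e i).1) ↔ φ.Realize default fun i => cls (e i)
  | _, .falsum, _ => Iff.rfl
  | _, .equal t u, e => by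
    change (∃ _, _) ↔ t.realize _ = u.realize _
    constructor
    · rintro ⟨y, z, hy, hz, ht, hu, hE⟩
      rw [← h.val_eq e t ⟨y, hy⟩ ht, ← h.val_eq e u ⟨z, hz⟩ hu]
      exact (h.eqv_iff ⟨y, hy⟩ ⟨z, hz⟩).1 hE
    · intro he
      obtain ⟨y, hy⟩ := h.val_total e t
      obtain ⟨z, hz⟩ := h.val_total e u
      refine ⟨y, z, y.2, z.2, hy, hz, (h.eqv_iff y z).2 ?_⟩
      rw [h.val_eq e t y hy, h.val_eq e u z hz, he]
  | _, .rel R ts, e => by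
    change (∃ _, _) ↔ Structure.RelMap R fun i => (ts i).realize _
    constructor
    · rintro ⟨d, hd, hR⟩
      have := (h.rel_iff R fun i => ⟨d i, (hd i).1⟩).1 hR
      rwa [funext fun i => h.val_eq e (ts i) ⟨d i, (hd i).1⟩ (hd i).2] at this
    · intro hR
      choose d hd using fun i => h.val_total e (ts i)
      refine ⟨fun i => (d i).1, fun i => ⟨(d i).2, hd i⟩, (h.rel_iff R d).2 ?_⟩
      rwa [funext fun i => h.val_eq e (ts i) (d i) (hd i)]
  | _, .imp φ ψ, e => imp_congr (h.sat_iff φ e) (h.sat_iff ψ e)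
  | _, .all φ, e => by
    change (∀ y, _ → _) ↔ ∀ a, _
    constructor
    · intro H a
      obtain ⟨y, rfl⟩ := h.surj a
      have := (h.sat_iff φ (Fin.snoc e y)).1 (by
        convert H y.1 y.2 using 1
        exact Fin.comp_snoc Subtype.val e y)
      convert this using 1
      exact (Fin.comp_snoc cls e y).symm
    · intro H y hy
      have := (h.sat_iff φ (Fin.snoc e ⟨y, hy⟩)).2 (by
        convert H (cls ⟨y, hy⟩) using 1
        exact Fin.comp_snoc cls e _)
      convert this using 1
      exact (Fin.comp_snoc Subtype.val e (⟨y, hy⟩ : {x // S.dom x})).symm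

theorem Presents.sat_sentence (h : S.Presents N cls) (φ : L.Sentence) :
    S.Sat φ Fin.elim0 ↔ N ⊨ φ := by
  have := h.sat_iff φ Fin.elim0
  rw [Subsingleton.elim (fun i : Fin 0 => ((Fin.elim0 i : {x // S.dom x}) : X)) Fin.elim0,
    Subsingleton.elim (fun i : Fin 0 => cls (Fin.elim0 i)) default] at this
  exact this

end RawStr

theorem realize_of_eq {L : FirstOrder.Language.{0, 0}} {M α : Type} [L.Structure M]
    {φ : L.Formula α} {v w : α → M} (h : φ.Realize v) (e : v = w) : φ.Realize w := e ▸ h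

namespace Translation
variable {L L' : FirstOrder.Language.{0, 0}} (τ : Translation L L') {M : Type} [L'.Structure M]
  (p : Fin τ.params → M)

/-- The raw structure that a translation defines, with the parameters `p`. Its elements are tuples
together with the number of their piece. -/
def raw : RawStr L (Σ k, Fin (τ.dim k) → M) where
  dom x := (τ.dom x.1).Realize (Sum.elim p x.2)
  eqv x y := (τ.eqv x.1 y.1).Realize (Sum.elim p (Sum.elim x.2 y.2))
  rel R d := (τ.rel R fun i => (d i).1).Realize (Sum.elim p fun x => (d x.1).2 x.2)
  func f d y := (τ.func f (fun i => (d i).1) y.1).Realize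
    (Sum.elim p (Sum.elim (fun x => (d x.1).2 x.2) y.2))

theorem realize_termGraph {n : ℕ} (c : Fin n → Fin τ.pieces) (x : τ.Vars c → M)
    (t : L.Term (Empty ⊕ Fin n)) (k : Fin τ.pieces) (y : Fin (τ.dim k) → M) :
    (τ.termGraph c t k).Realize (Sum.elim p (Sum.elim x y)) ↔
      (τ.raw p).Val (fun i => ⟨c i, fun j => x ⟨i, j⟩⟩) t ⟨k, y⟩ := by
  induction t generalizing k with
  | var v =>
    rcases v with v | i
    · exact v.elim
    · by_cases h : c i = k
      · subst h
        simp only [termGraph, RawStr.Val]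
        simp [Formula.realize_iInf, Formula.realize_equal, Sigma.mk.injEq, funext_iff]
      · simp [termGraph, RawStr.Val, h]
  | func f ts ih =>
    simp only [termGraph, RawStr.Val, Formula.realize_iSup, Formula.realize_iExs,
      Formula.realize_inf, Formula.realize_iInf, Formula.realize_relabel]
    constructor
    · rintro ⟨d, v, hd, hf⟩
      refine ⟨fun i => ⟨d i, fun j => v ⟨i, j⟩⟩, fun i => ⟨?_, ?_⟩, ?_⟩
      · exact realize_of_eq (hd i).1 (funext <| by rintro (z | z) <;> rfl)
      · rw [← ih]
        exact realize_of_eq (hd i).2 (funext <| by rintro (z | z | z) <;> rfl)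
      · exact realize_of_eq hf (funext <| by rintro (z | z | z) <;> rfl)
    · rintro ⟨d, hd, hf⟩
      refine ⟨fun i => (d i).1, fun x => (d x.1).2 x.2, fun i => ⟨?_, ?_⟩, ?_⟩
      · exact realize_of_eq (hd i).1 (funext <| by rintro (z | z) <;> rfl)
      · exact realize_of_eq ((ih i (d i).1 (d i).2).2 (hd i).2) (funext <| by rintro (z | z | z) <;> rfl)
      · exact realize_of_eq hf (funext <| by rintro (z | z | z) <;> rfl)

theorem realize_trans : ∀ {n : ℕ} (φ : L.BoundedFormula Empty n) (c : Fin n → Fin τ.pieces)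
    (x : τ.Vars c → M), (τ.trans φ c).Realize (Sum.elim p x) ↔
      (τ.raw p).Sat φ fun i => ⟨c i, fun j => x ⟨i, j⟩⟩
  | _, .falsum, c, x => Iff.rfl
  | _, .equal t u, c, x => by
    simp only [trans, RawStr.Sat, Formula.realize_iSup, Formula.realize_iExs,
      Formula.realize_inf, Formula.realize_relabel]
    constructor
    · rintro ⟨d, v, ⟨⟨⟨h1, h2⟩, h3⟩, h4⟩, h5⟩
      refine ⟨⟨d.1, fun j => v (.inl j)⟩, ⟨d.2, fun j => v (.inr j)⟩, ?_, ?_, ?_, ?_, ?_⟩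
      · exact realize_of_eq h1 (funext <| by rintro (z | z) <;> rfl)
      · exact realize_of_eq h2 (funext <| by rintro (z | z) <;> rfl)
      · rw [← realize_termGraph]
        exact realize_of_eq h3 (funext <| by rintro (z | z | z) <;> rfl)
      · rw [← realize_termGraph]
        exact realize_of_eq h4 (funext <| by rintro (z | z | z) <;> rfl)
      · exact realize_of_eq h5 (funext <| by rintro (z | z | z) <;> rfl)
    · rintro ⟨y, z, h1, h2, h3, h4, h5⟩
      refine ⟨(y.1, z.1), Sum.elim y.2 z.2, ⟨⟨⟨?_, ?_⟩, ?_⟩, ?_⟩, ?_⟩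
      · exact realize_of_eq h1 (funext <| by rintro (z | z) <;> rfl)
      · exact realize_of_eq h2 (funext <| by rintro (z | z) <;> rfl)
      · exact realize_of_eq ((τ.realize_termGraph p c x t y.1 y.2).2 h3) (funext <| by rintro (z | z | z) <;> rfl)
      · exact realize_of_eq ((τ.realize_termGraph p c x u z.1 z.2).2 h4) (funext <| by rintro (z | z | z) <;> rfl)
      · exact realize_of_eq h5 (funext <| by rintro (z | z | z) <;> rfl)
  | _, .rel R ts, c, x => by
    simp only [trans, RawStr.Sat, Formula.realize_iSup, Formula.realize_iExs,
      Formula.realize_inf, Formula.realize_iInf, Formula.realize_relabel]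
    constructor
    · rintro ⟨d, v, hd, hf⟩
      refine ⟨fun i => ⟨d i, fun j => v ⟨i, j⟩⟩, fun i => ⟨?_, ?_⟩, ?_⟩
      · exact realize_of_eq (hd i).1 (funext <| by rintro (z | z) <;> rfl)
      · rw [← realize_termGraph]
        exact realize_of_eq (hd i).2 (funext <| by rintro (z | z | z) <;> rfl)
      · exact realize_of_eq hf (funext <| by rintro (z | z) <;> rfl)
    · rintro ⟨d, hd, hf⟩
      refine ⟨fun i => (d i).1, fun x => (d x.1).2 x.2, fun i => ⟨?_, ?_⟩, ?_⟩
      · exact realize_of_eq (hd i).1 (funext <| by rintro (z | z) <;> rfl)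
      · exact realize_of_eq ((τ.realize_termGraph p c x (ts i) (d i).1 (d i).2).2 (hd i).2) (funext <| by rintro (z | z | z) <;> rfl)
      · exact realize_of_eq hf (funext <| by rintro (z | z) <;> rfl)
  | _, .imp φ ψ, c, x => by
    simp only [trans, RawStr.Sat, Formula.realize_imp]
    rw [realize_trans φ c x, realize_trans ψ c x]
  | n, .all φ, c, x => by
    simp only [trans, RawStr.Sat, Formula.realize_iInf, Formula.realize_iAlls,
      Formula.realize_imp, Formula.realize_relabel]
    have key : ∀ (k : Fin τ.pieces) (y : Fin (τ.dim k) → M),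
        ((τ.dom k).Realize ((fun a => Sum.elim (Sum.elim p x) y a) ∘ Sum.map Sum.inl id) →
          (τ.trans φ (Fin.snoc c k)).Realize ((fun a => Sum.elim (Sum.elim p x) y a) ∘
            Sum.elim (fun p => Sum.inl (Sum.inl p))
              fun x => Sum.map Sum.inr id (τ.splitLast c k x))) ↔
        ((τ.raw p).dom ⟨k, y⟩ → (τ.raw p).Sat φ
          (Fin.snoc (fun i => ⟨c i, fun j => x ⟨i, j⟩⟩) (⟨k, y⟩ : Σ k, Fin (τ.dim k) → M))) := by
      intro k y
      refine imp_congr ?_ ?_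
      · refine iff_of_eq (congrArg _ ?_)
        funext z; rcases z with z | z <;> rfl
      · have := realize_trans φ (Fin.snoc c k) (fun z => Sum.elim x y (τ.splitLast c k z))
        refine Iff.trans (iff_of_eq (congrArg _ ?_)) (this.trans (iff_of_eq (congrArg _ ?_)))
        · funext z
          rcases z with z | z
          · rfl
          · simp only [Function.comp, Sum.elim_inr]
            rcases τ.splitLast c k z with w | w <;> rfl
        · funext i
          refine Fin.lastCases ?_ (fun i => ?_) i
          · refine Eq.trans ?_ (Fin.snoc_last (α := fun _ => Σ k, Fin (τ.dim k) → M) _ _).symm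
            refine Sigma.ext (by simp) ?_
            refine Function.hfunext (by simp) fun a b hab => heq_of_eq ?_
            simp only [splitLast, Fin.val_last, lt_irrefl, ↓reduceDIte, Sum.elim_inr]
            congr 1
            apply Fin.ext
            have h2 : τ.dim ((Fin.snoc c k : Fin (n + 1) → Fin τ.pieces) (Fin.last n)) = τ.dim k := by simp
            simpa using (Fin.heq_ext_iff h2).1 hab
          · refine Eq.trans ?_ (Fin.snoc_castSucc (α := fun _ => Σ k, Fin (τ.dim k) → M) _ _ _).symm
            refine Sigma.ext (by simp) ?_
            refine Function.hfunext (by simp) fun a b hab => heq_of_eq ?_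
            have hi : (Fin.castSucc i).val < n := i.2
            simp only [splitLast, hi, ↓reduceDIte, Sum.elim_inl]
            congr 2
            apply Fin.ext
            have h2 : τ.dim ((Fin.snoc c k : Fin (n + 1) → Fin τ.pieces) (Fin.castSucc i)) = τ.dim (c i) := by simp
            simpa using (Fin.heq_ext_iff h2).1 hab
    constructor
    · rintro h ⟨k, y⟩
      exact (key k y).1 (h k y)
    · intro h k y
      exact (key k y).2 (h ⟨k, y⟩)

theorem realize_sentence (φ : L.Sentence) :
    (τ.sentence φ).Realize p ↔ (τ.raw p).Sat φ Fin.elim0 := by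
  have := τ.realize_trans p φ Fin.elim0 (fun x => x.1.elim0)
  rw [sentence, Formula.realize_relabel]
  convert this using 2
  · funext z
    rcases z with z | z
    · rfl
    · exact z.1.elim0

end Translation
end LaxInt

namespace LaxInt

/-! ### Identity axioms and the quotient of a raw structure -/

section Identity
variable {L : FirstOrder.Language.{0, 0}}

/-- The variable with name `s`, when the variables are named by the elements of a finite type. -/
noncomputable def namedVar {ι : Type} [Fintype ι] (s : ι) : L.Term (Empty ⊕ Fin (Fintype.card ι)) :=
  &(Fintype.equivFin ι s)

/-- Names of the variables in a congruence axiom: two tuples of arguments and two values. -/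
abbrev CongVar (m : ℕ) : Type := Fin m ⊕ Fin m ⊕ Fin 2

/-- The two tuples of arguments are pairwise equal. -/
noncomputable def argsEq (m : ℕ) : L.BoundedFormula Empty (Fintype.card (CongVar m)) :=
  bigAnd (List.ofFn fun i : Fin m =>
    namedVar (.inl i : CongVar m) =' namedVar (.inr (.inl i) : CongVar m))

/-- A function symbol stands for a total function. -/
def totalAx {m : ℕ} (f : L.Functions m) : L.Sentence :=
  (Term.func f (fun i => &i.castSucc) =' &(Fin.last m)).ex.alls

/-- Values of a function symbol at equal arguments are equal. -/
noncomputable def congAx {m : ℕ} (f : L.Functions m) : L.Sentence :=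
  (argsEq m ⟹ (Term.func f (fun i => namedVar (.inl i : CongVar m)) =' namedVar (.inr (.inr 0))) ⟹
    (Term.func f (fun i => namedVar (.inr (.inl i) : CongVar m)) =' namedVar (.inr (.inr 1))) ⟹
    (namedVar (.inr (.inr 0)) =' namedVar (.inr (.inr 1)))).alls

/-- A relation symbol respects equality. -/
noncomputable def relCongAx {m : ℕ} (R : L.Relations m) : L.Sentence :=
  (argsEq m ⟹ BoundedFormula.rel R (fun i => namedVar (.inl i : CongVar m)) ⟹
    BoundedFormula.rel R (fun i => namedVar (.inr (.inl i) : CongVar m))).alls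

/-- The theory of identity of a language. All its axioms are logically valid; their translations
say that the raw structure has a quotient that is a structure. -/
noncomputable def idTheory (L : FirstOrder.Language.{0, 0}) : L.Theory :=
  {∃' ⊤, ∀' ((&0) =' (&0)), ∀' ∀' (((&0) =' (&1)) ⟹ ((&1) =' (&0))),
    ∀' ∀' ∀' (((&0) =' (&1)) ⟹ ((&1) =' (&2)) ⟹ ((&0) =' (&2)))} ∪
  (Set.range fun f : Σ n, L.Functions n => totalAx f.2) ∪
  (Set.range fun f : Σ n, L.Functions n => congAx f.2) ∪
  (Set.range fun R : Σ n, L.Relations n => relCongAx R.2)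

theorem idTheory_finite [Finite (Σ n, L.Functions n)] [Finite (Σ n, L.Relations n)] :
    (idTheory L).Finite := by
  refine Set.Finite.union (Set.Finite.union (Set.Finite.union ?_ ?_) ?_) ?_
  · simp
  all_goals exact Set.finite_range _

theorem realize_bigAnd {α M : Type} [L.Structure M] {n : ℕ} (l : List (L.BoundedFormula α n))
    (v : α → M) (xs : Fin n → M) :
    (bigAnd l).Realize v xs ↔ ∀ φ ∈ l, BoundedFormula.Realize φ v xs :=
  BoundedFormula.realize_foldr_inf l v xs

theorem models_idTheory (M : Type) [L.Structure M] [Nonempty M] : M ⊨ idTheory L := by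
  have hargs : ∀ {m : ℕ} (xs : Fin (Fintype.card (CongVar m)) → M),
      (argsEq (L := L) m).Realize default xs → ∀ i : Fin m,
        xs (Fintype.equivFin (CongVar m) (.inl i)) =
          xs (Fintype.equivFin (CongVar m) (.inr (.inl i))) := by
    intro m xs h i
    rw [argsEq, realize_bigAnd] at h
    simpa [namedVar] using h _ (List.mem_ofFn.2 ⟨i, rfl⟩)
  refine ⟨fun φ hφ => ?_⟩
  rcases hφ with ((hφ | ⟨f, rfl⟩) | ⟨f, rfl⟩) | ⟨R, rfl⟩
  · rcases hφ with rfl | rfl | rfl | rfl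
    · simp [Sentence.Realize, Formula.Realize]
    · simp [Sentence.Realize, Formula.Realize]
    · simp [Sentence.Realize, Formula.Realize, Fin.snoc]
    · simp [Sentence.Realize, Formula.Realize, Fin.snoc]
  · simp only [totalAx, Sentence.Realize]
    rw [BoundedFormula.realize_alls]
    intro xs
    simp
  · simp only [congAx, Sentence.Realize]
    rw [BoundedFormula.realize_alls]
    intro xs h h1 h2
    exact h1.symm.trans ((congrArg (Structure.funMap f.2) (funext (hargs xs h))).trans h2)
  · simp only [relCongAx, Sentence.Realize]
    rw [BoundedFormula.realize_alls]
    intro xs h h1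
    exact (congrArg (Structure.RelMap R.2) (funext (hargs xs h))).mp h1

end Identity

namespace RawStr
variable {L : FirstOrder.Language.{0, 0}} {X : Type} (S : RawStr L X)

theorem val_var {n : ℕ} (e : Fin n → X) (i : Fin n) (y : X) :
    S.Val e (&i) y ↔ e i = y := Iff.rfl

theorem val_func_vars {n m : ℕ} (e : Fin n → X) (f : L.Functions m) (v : Fin m → Fin n) (y : X) :
    S.Val e (Term.func f fun i => &(v i)) y ↔
      (∀ i, S.dom (e (v i))) ∧ S.func f (fun i => e (v i)) y := by
  change (∃ d : Fin m → X, (∀ i, S.dom (d i) ∧ e (v i) = d i) ∧ S.func f d y) ↔ _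
  constructor
  · rintro ⟨d, hd, hf⟩
    obtain rfl : (fun i => e (v i)) = d := funext fun i => (hd i).2
    exact ⟨fun i => (hd i).1, hf⟩
  · rintro ⟨hd, hf⟩
    exact ⟨_, fun i => ⟨hd i, rfl⟩, hf⟩

theorem sat_var_eq {n : ℕ} (e : Fin n → X) (i j : Fin n) :
    S.Sat ((&i) =' (&j)) e ↔ S.dom (e i) ∧ S.dom (e j) ∧ S.eqv (e i) (e j) := by
  rw [sat_equal]
  simp only [val_var]
  constructor
  · rintro ⟨_, _, h1, h2, rfl, rfl, h3⟩
    exact ⟨h1, h2, h3⟩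
  · rintro ⟨h1, h2, h3⟩
    exact ⟨_, _, h1, h2, rfl, rfl, h3⟩

theorem sat_func_eq {n m : ℕ} (e : Fin n → X) (f : L.Functions m) (v : Fin m → Fin n) (j : Fin n) :
    S.Sat ((Term.func f fun i => &(v i)) =' (&j)) e ↔
      ∃ y, S.dom y ∧ S.dom (e j) ∧ ((∀ i, S.dom (e (v i))) ∧ S.func f (fun i => e (v i)) y) ∧
        S.eqv y (e j) := by
  rw [sat_equal]
  simp only [val_var, val_func_vars]
  constructor
  · rintro ⟨y, _, h1, h2, h3, rfl, h4⟩
    exact ⟨y, h1, h2, h3, h4⟩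
  · rintro ⟨y, h1, h2, h3, h4⟩
    exact ⟨y, _, h1, h2, h3, rfl, h4⟩

theorem sat_rel_vars {n m : ℕ} (e : Fin n → X) (R : L.Relations m) (v : Fin m → Fin n) :
    S.Sat (BoundedFormula.rel R fun i => &(v i)) e ↔
      (∀ i, S.dom (e (v i))) ∧ S.rel R (fun i => e (v i)) := by
  change (∃ d : Fin m → X, (∀ i, S.dom (d i) ∧ e (v i) = d i) ∧ S.rel R d) ↔ _
  constructor
  · rintro ⟨d, hd, hf⟩
    obtain rfl : (fun i => e (v i)) = d := funext fun i => (hd i).2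
    exact ⟨fun i => (hd i).1, hf⟩
  · rintro ⟨hd, hf⟩
    exact ⟨_, fun i => ⟨hd i, rfl⟩, hf⟩

/-- A raw structure that satisfies the theory of identity presents a structure, namely its quotient
by the raw identity. -/
theorem exists_presents (h : ∀ φ ∈ idTheory L, S.Sat φ Fin.elim0) :
    ∃ (N : Type) (_ : Nonempty N) (_ : L.Structure N) (cls : {x // S.dom x} → N),
      S.Presents N cls := by
  have hne : ∃ x, S.dom x := by
    have := h (∃' ⊤) (by simp [idTheory])
    simpa using this
  have hrefl : ∀ x, S.dom x → S.eqv x x := by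
    have := h (∀' ((&0) =' (&0))) (by simp [idTheory])
    intro x hx
    exact ((S.sat_var_eq _ _ _).1 (this x hx)).2.2
  have hsymm : ∀ x y, S.dom x → S.dom y → S.eqv x y → S.eqv y x := by
    have := h (∀' ∀' (((&0) =' (&1)) ⟹ ((&1) =' (&0)))) (by simp [idTheory])
    intro x y hx hy hxy
    exact ((S.sat_var_eq _ _ _).1 (this x hx y hy ((S.sat_var_eq _ _ _).2 ⟨hx, hy, hxy⟩))).2.2
  have htrans : ∀ x y z, S.dom x → S.dom y → S.dom z → S.eqv x y → S.eqv y z → S.eqv x z := by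
    have := h (∀' ∀' ∀' (((&0) =' (&1)) ⟹ ((&1) =' (&2)) ⟹ ((&0) =' (&2)))) (by simp [idTheory])
    intro x y z hx hy hz hxy hyz
    exact ((S.sat_var_eq _ _ _).1 (this x hx y hy z hz ((S.sat_var_eq _ _ _).2 ⟨hx, hy, hxy⟩)
      ((S.sat_var_eq _ _ _).2 ⟨hy, hz, hyz⟩))).2.2
  have htot : ∀ {m : ℕ} (f : L.Functions m) (d : Fin m → {x // S.dom x}),
      ∃ y : {x // S.dom x}, S.func f (fun i => (d i).1) y.1 := by
    intro m f d
    have := h (totalAx f) (.inl (.inl (.inr ⟨⟨m, f⟩, rfl⟩)))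
    obtain ⟨y, hy, hs⟩ := (S.sat_ex _ _).1 ((S.sat_alls _).1 this _ fun i => (d i).2)
    obtain ⟨z, hz, -, ⟨-, hf⟩, -⟩ := (S.sat_func_eq _ f (fun i => i.castSucc) (Fin.last m)).1 hs
    refine ⟨⟨z, hz⟩, ?_⟩
    simpa using hf
  have hargs : ∀ {m : ℕ} (d d' : Fin m → {x // S.dom x}) (y : Fin 2 → {x // S.dom x}),
      (∀ i, S.eqv (d i).1 (d' i).1) →
      S.Sat (argsEq m) (fun i => (Sum.elim d (Sum.elim d' y)
        ((Fintype.equivFin (CongVar m)).symm i)).1) := by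
    intro m d d' y hd
    rw [argsEq, sat_bigAnd]
    intro φ hφ
    obtain ⟨i, rfl⟩ := List.mem_ofFn.1 hφ
    refine (S.sat_var_eq _ _ _).2 ⟨Subtype.prop _, Subtype.prop _, ?_⟩
    simpa using hd i
  have hcong : ∀ {m : ℕ} (f : L.Functions m) (d d' : Fin m → {x // S.dom x}) (y : Fin 2 → {x // S.dom x}),
      (∀ i, S.eqv (d i).1 (d' i).1) → S.func f (fun i => (d i).1) (y 0).1 →
      S.func f (fun i => (d' i).1) (y 1).1 → S.eqv (y 0).1 (y 1).1 := by
    intro m f d d' y hd h0 h1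
    have := h (congAx f) (.inl (.inr ⟨⟨m, f⟩, rfl⟩))
    have := (S.sat_alls _).1 this (fun i => (Sum.elim d (Sum.elim d' y)
        ((Fintype.equivFin (CongVar m)).symm i)).1) (fun i => Subtype.prop _)
    have := this (hargs d d' y hd)
      ((S.sat_func_eq _ f (fun i => _) _).2 ⟨(y 0).1, (y 0).2, Subtype.prop _,
        ⟨fun i => Subtype.prop _, by simpa using h0⟩, by simpa using hrefl _ (y 0).2⟩)
      ((S.sat_func_eq _ f (fun i => _) _).2 ⟨(y 1).1, (y 1).2, Subtype.prop _,
        ⟨fun i => Subtype.prop _, by simpa using h1⟩, by simpa using hrefl _ (y 1).2⟩)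
    simpa using ((S.sat_var_eq _ _ _).1 this).2.2
  have hrel : ∀ {m : ℕ} (R : L.Relations m) (d d' : Fin m → {x // S.dom x}),
      (∀ i, S.eqv (d i).1 (d' i).1) → S.rel R (fun i => (d i).1) →
      S.rel R (fun i => (d' i).1) := by
    intro m R d d' hd h0
    obtain ⟨z, hz⟩ := hne
    have := h (relCongAx R) (.inr ⟨⟨m, R⟩, rfl⟩)
    have := (S.sat_alls _).1 this (fun i => (Sum.elim d (Sum.elim d' fun _ => ⟨z, hz⟩)
        ((Fintype.equivFin (CongVar m)).symm i)).1) (fun i => Subtype.prop _)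
    have := this (hargs d d' _ hd)
      ((S.sat_rel_vars _ R (fun i => _)).2 ⟨fun i => Subtype.prop _, by simpa using h0⟩)
    simpa using ((S.sat_rel_vars _ R (fun i => _)).1 this).2
  let s : Setoid {x // S.dom x} := ⟨fun x y => S.eqv x.1 y.1, fun x => hrefl _ x.2,
    fun {x y} => hsymm _ _ x.2 y.2, fun {x y z} => htrans _ _ _ x.2 y.2 z.2⟩
  have hout : ∀ x : {x // S.dom x}, S.eqv (Quotient.out (Quotient.mk s x)).1 x.1 := fun x =>
    Quotient.mk_out (s := s) x
  let str : L.Structure (Quotient s) :=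
    { funMap := fun f q => Quotient.mk s (htot f fun i => (q i).out).choose
      RelMap := fun R q => S.rel R fun i => (q i).out.1 }
  refine ⟨Quotient s, hne.elim fun x hx => ⟨Quotient.mk s ⟨x, hx⟩⟩, str, Quotient.mk s,
    Quotient.mk_surjective, fun x y => (Quotient.eq (r := s)).symm, ?_, htot, ?_⟩
  · intro n R d
    exact ⟨hrel R _ _ fun i => hsymm _ _ (Subtype.prop _) (d i).2 (hout (d i)),
      hrel R _ _ fun i => hout (d i)⟩
  · intro n f d y hy
    refine (Quotient.eq (r := s)).2 ?_
    exact hcong f d _ ![y, (htot f fun i => (Quotient.mk s (d i)).out).choose]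
      (fun i => hsymm _ _ (Subtype.prop _) (d i).2 (hout (d i))) hy
      (htot f fun i => (Quotient.mk s (d i)).out).choose_spec

end RawStr
end LaxInt

namespace LaxInt

/-! ### Models of the theory of a number -/

section ArithOps
variable {N : Type} [arith.Structure N]

/-- The interpretation of `0`. -/
def zro (N : Type) [arith.Structure N] : N := Structure.funMap (L := arith) ArithFunc.zero ![]
/-- The interpretation of `S`. -/
def suc (x : N) : N := Structure.funMap (L := arith) ArithFunc.succ ![x]
/-- The interpretation of `+`. -/
def plus (x y : N) : N := Structure.funMap (L := arith) ArithFunc.add ![x, y]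
/-- The interpretation of `×`. -/
def times (x y : N) : N := Structure.funMap (L := arith) ArithFunc.mul ![x, y]
/-- The interpretation of `<`. -/
def less (x y : N) : Prop := Structure.RelMap (L := arith) ArithRel.lt ![x, y]
/-- The value of a numeral. -/
def num (N : Type) [arith.Structure N] : ℕ → N
  | 0 => zro N
  | n + 1 => suc (num N n)

variable {α : Type} {v : α → N}

@[simp] theorem realize_aZero : (aZero : arith.Term α).realize v = zro N :=
  congrArg (Structure.funMap (L := arith) (M := N) ArithFunc.zero) (Subsingleton.elim _ _)
@[simp] theorem realize_aSucc (t : arith.Term α) : (aSucc t).realize v = suc (t.realize v) :=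
  congrArg (Structure.funMap (L := arith) (M := N) ArithFunc.succ)
    (funext fun i => by fin_cases i; rfl)
@[simp] theorem realize_aAdd (t u : arith.Term α) :
    (aAdd t u).realize v = plus (t.realize v) (u.realize v) :=
  congrArg (Structure.funMap (L := arith) (M := N) ArithFunc.add)
    (funext fun i => by fin_cases i <;> rfl)
@[simp] theorem realize_aMul (t u : arith.Term α) :
    (aMul t u).realize v = times (t.realize v) (u.realize v) :=
  congrArg (Structure.funMap (L := arith) (M := N) ArithFunc.mul)
    (funext fun i => by fin_cases i <;> rfl)
@[simp] theorem realize_aNum (n : ℕ) : (aNum n : arith.Term α).realize v = num N n := by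
  induction n with
  | zero => simp [aNum, num]
  | succ n ih => simp [aNum, num, ih]
@[simp] theorem realize_aLt {n : ℕ} (t u : arith.Term (α ⊕ Fin n)) (xs : Fin n → N) :
    (aLt t u).Realize v xs ↔ less (t.realize (Sum.elim v xs)) (u.realize (Sum.elim v xs)) := by
  refine iff_of_eq (congrArg (Structure.RelMap (L := arith) (M := N) ArithRel.lt)
    (funext fun i => ?_))
  fin_cases i <;> rfl
@[simp] theorem realize_aLe {n : ℕ} (t u : arith.Term (α ⊕ Fin n)) (xs : Fin n → N) :
    (aLe t u).Realize v xs ↔ less (t.realize (Sum.elim v xs)) (u.realize (Sum.elim v xs)) ∨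
      t.realize (Sum.elim v xs) = u.realize (Sum.elim v xs) := by
  simp [aLe]

end ArithOps

/-- The axioms of the theory of a number, for a structure. -/
structure IsTN (N : Type) [arith.Structure N] : Prop where
  not_lt_zero : ∀ x : N, ¬ less x (zro N)
  trans : ∀ x y z : N, less x y → less y z → less x z
  tri : ∀ x y : N, (less x y ∨ x = y) ∨ less y x
  pred : ∀ x : N, x = zro N ∨ ∃ y, x = suc y
  suc_not_lt : ∀ x : N, ¬ less (suc x) x
  lt_suc : ∀ x y : N, less x y → less x (suc x) ∧ ¬ less y (suc x)
  add_zero : ∀ x : N, plus x (zro N) = x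
  add_suc : ∀ x y : N, plus x (suc y) = suc (plus x y)
  mul_zero : ∀ x : N, times x (zro N) = zro N
  mul_suc : ∀ x y : N, times x (suc y) = plus (times x y) x

theorem models_TN_iff (N : Type) [arith.Structure N] : N ⊨ TN ↔ IsTN N := by
  have h : N ⊨ TN ↔ (∀ x : N, ¬ less x (zro N)) ∧
      (∀ x y z : N, less x y → less y z → less x z) ∧
      (∀ x y : N, (less x y ∨ x = y) ∨ less y x) ∧
      (∀ x : N, x = zro N ∨ ∃ y, x = suc y) ∧
      (∀ x : N, ¬ less (suc x) x) ∧
      (∀ x y : N, less x y → less x (suc x) ∧ ¬ less y (suc x)) ∧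
      (∀ x : N, plus x (zro N) = x) ∧
      (∀ x y : N, plus x (suc y) = suc (plus x y)) ∧
      (∀ x : N, times x (zro N) = zro N) ∧
      (∀ x y : N, times x (suc y) = plus (times x y) x) := by
    simp [TN, bigAnd, Sentence.Realize, Formula.Realize, Fin.snoc]
  rw [h]
  constructor
  · rintro ⟨h1, h2, h3, h4, h5, h6, h7, h8, h9, h10⟩
    exact ⟨h1, h2, h3, h4, h5, h6, h7, h8, h9, h10⟩
  · rintro ⟨h1, h2, h3, h4, h5, h6, h7, h8, h9, h10⟩
    exact ⟨h1, h2, h3, h4, h5, h6, h7, h8, h9, h10⟩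

theorem models_idArith (N : Type) [arith.Structure N] : N ⊨ idArith := by
  simp [idArith, bigAnd, Sentence.Realize, Formula.Realize, Fin.snoc]

/-- Truth of a pure `Δ₀`-formula in a structure. -/
def PureDelta.Holds (N : Type) [arith.Structure N] : {n : ℕ} → PureDelta n → (Fin n → N) → Prop
  | _, .bot, _ => False
  | _, .top, _ => True
  | _, .lt a b, v => less (v a) (v b)
  | _, .zero a, v => zro N = v a
  | _, .succ a b, v => suc (v a) = v b
  | _, .add a b c, v => plus (v a) (v b) = v c
  | _, .mul a b c, v => times (v a) (v b) = v c
  | _, .neg φ, v => ¬ φ.Holds N v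
  | _, .and φ ψ, v => φ.Holds N v ∧ ψ.Holds N v
  | _, .or φ ψ, v => φ.Holds N v ∨ ψ.Holds N v
  | _, .imp φ ψ, v => φ.Holds N v → ψ.Holds N v
  | _, .allLt a φ, v => ∀ x, less x (v a) → φ.Holds N (Fin.snoc v x)
  | _, .exLt a φ, v => ∃ x, less x (v a) ∧ φ.Holds N (Fin.snoc v x)
  | _, .allLe a φ, v => ∀ x, less x (v a) ∨ x = v a → φ.Holds N (Fin.snoc v x)
  | _, .exLe a φ, v => ∃ x, (less x (v a) ∨ x = v a) ∧ φ.Holds N (Fin.snoc v x)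

theorem realize_toFormula {N : Type} [arith.Structure N] : ∀ {n m : ℕ} (δ : PureDelta n)
    (ρ : Fin n → Fin m) (v : Empty → N) (xs : Fin m → N),
    (δ.toFormula ρ).Realize v xs ↔ δ.Holds N (xs ∘ ρ)
  | _, _, .bot, ρ, v, xs => Iff.rfl
  | _, _, .top, ρ, v, xs => by simp [PureDelta.toFormula, PureDelta.Holds]
  | _, _, .lt a b, ρ, v, xs => by simp [PureDelta.toFormula, PureDelta.Holds]
  | _, _, .zero a, ρ, v, xs => by simp [PureDelta.toFormula, PureDelta.Holds]
  | _, _, .succ a b, ρ, v, xs => by simp [PureDelta.toFormula, PureDelta.Holds]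
  | _, _, .add a b c, ρ, v, xs => by simp [PureDelta.toFormula, PureDelta.Holds]
  | _, _, .mul a b c, ρ, v, xs => by simp [PureDelta.toFormula, PureDelta.Holds]
  | _, _, .neg φ, ρ, v, xs => by
    simp [PureDelta.toFormula, PureDelta.Holds, realize_toFormula φ]
  | _, _, .and φ ψ, ρ, v, xs => by
    simp [PureDelta.toFormula, PureDelta.Holds, realize_toFormula φ, realize_toFormula ψ]
  | _, _, .or φ ψ, ρ, v, xs => by
    simp [PureDelta.toFormula, PureDelta.Holds, realize_toFormula φ, realize_toFormula ψ]
  | _, _, .imp φ ψ, ρ, v, xs => by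
    simp [PureDelta.toFormula, PureDelta.Holds, realize_toFormula φ, realize_toFormula ψ]
  | n, m, .allLt a φ, ρ, v, xs => by
    have h (x : N) : Fin.snoc xs x ∘ (Fin.snoc (fun i => (ρ i).castSucc) (Fin.last m) :
        Fin (n + 1) → Fin (m + 1)) = (Fin.snoc (xs ∘ ρ) x : Fin (n + 1) → N) := by
      rw [Fin.comp_snoc]; congr 1 <;> simp [Function.comp_def]
    simp [PureDelta.toFormula, PureDelta.Holds, realize_toFormula φ, h]
  | n, m, .exLt a φ, ρ, v, xs => by
    have h (x : N) : Fin.snoc xs x ∘ (Fin.snoc (fun i => (ρ i).castSucc) (Fin.last m) :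
        Fin (n + 1) → Fin (m + 1)) = (Fin.snoc (xs ∘ ρ) x : Fin (n + 1) → N) := by
      rw [Fin.comp_snoc]; congr 1 <;> simp [Function.comp_def]
    simp [PureDelta.toFormula, PureDelta.Holds, realize_toFormula φ, h]
  | n, m, .allLe a φ, ρ, v, xs => by
    have h (x : N) : Fin.snoc xs x ∘ (Fin.snoc (fun i => (ρ i).castSucc) (Fin.last m) :
        Fin (n + 1) → Fin (m + 1)) = (Fin.snoc (xs ∘ ρ) x : Fin (n + 1) → N) := by
      rw [Fin.comp_snoc]; congr 1 <;> simp [Function.comp_def]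
    simp only [PureDelta.toFormula, PureDelta.Holds, BoundedFormula.realize_all,
      BoundedFormula.realize_imp, realize_toFormula φ, h, realize_aLe]
    simp
  | n, m, .exLe a φ, ρ, v, xs => by
    have h (x : N) : Fin.snoc xs x ∘ (Fin.snoc (fun i => (ρ i).castSucc) (Fin.last m) :
        Fin (n + 1) → Fin (m + 1)) = (Fin.snoc (xs ∘ ρ) x : Fin (n + 1) → N) := by
      rw [Fin.comp_snoc]; congr 1 <;> simp [Function.comp_def]
    simp only [PureDelta.toFormula, PureDelta.Holds, BoundedFormula.realize_ex,
      BoundedFormula.realize_inf, realize_toFormula φ, h, realize_aLe]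
    simp

theorem models_sigmaSentence (N : Type) [arith.Structure N] (δ : PureDelta 1) :
    N ⊨ sigmaSentence δ ↔ ∃ x, δ.Holds N fun _ => x := by
  simp only [sigmaSentence, Sentence.Realize, Formula.Realize, BoundedFormula.realize_ex,
    realize_toFormula]
  refine exists_congr fun x => iff_of_eq (congrArg _ (funext fun i => ?_))
  fin_cases i; rfl

namespace IsTN
variable {N : Type} [arith.Structure N] (h : IsTN N)
include h

theorem irrefl (x : N) : ¬ less x x := fun hx => (h.lt_suc x x hx).2 (h.lt_suc x x hx).1

theorem asymm {x y : N} (h1 : less x y) (h2 : less y x) : False := h.irrefl x (h.trans _ _ _ h1 h2)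

theorem le_suc (x : N) : less x (suc x) ∨ x = suc x := by
  rcases h.tri x (suc x) with h1 | h1
  · exact h1
  · exact (h.suc_not_lt x h1).elim

theorem plus_num (m n : ℕ) : plus (num N m) (num N n) = num N (m + n) := by
  induction n with
  | zero => exact h.add_zero _
  | succ n ih => exact (h.add_suc _ _).trans (congrArg suc ih)

theorem times_num (m n : ℕ) : times (num N m) (num N n) = num N (m * n) := by
  induction n with
  | zero => exact h.mul_zero _
  | succ n ih =>
    rw [num, h.mul_suc, ih, h.plus_num, Nat.mul_succ]

theorem num_le {m n : ℕ} (hmn : m ≤ n) : less (num N m) (num N n) ∨ num N m = num N n := by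
  induction n, hmn using Nat.le_induction with
  | base => exact .inr rfl
  | succ n hmn ih =>
    rcases ih with ih | ih
    · rcases h.le_suc (num N n) with h1 | h1
      · exact .inl (h.trans _ _ _ ih h1)
      · exact .inl (by rw [num, ← h1]; exact ih)
    · rw [ih]; exact h.le_suc _

theorem lt_num {j : ℕ} {x : N} (hx : less x (num N j)) : ∃ i < j, x = num N i := by
  induction j generalizing x with
  | zero => exact (h.not_lt_zero x hx).elim
  | succ j ih =>
    rcases h.tri x (num N j) with (h1 | h1) | h1
    · obtain ⟨i, hi, e⟩ := ih h1
      exact ⟨i, by omega, e⟩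
    · exact ⟨j, by omega, h1⟩
    · exact ((h.lt_suc _ _ h1).2 hx).elim

variable {k : ℕ} (hk : ∀ i < k, less (num N i) (num N (i + 1)))
include hk

theorem num_lt {i j : ℕ} (hij : i < j) (hi : i < k) : less (num N i) (num N j) := by
  rcases h.num_le (N := N) (Nat.succ_le_of_lt hij) with h1 | h1
  · exact h.trans _ _ _ (hk i hi) h1
  · rw [← h1]; exact hk i hi

theorem num_lt_iff {i j : ℕ} (hi : i < k) (hj : j < k) : less (num N i) (num N j) ↔ i < j := by
  refine ⟨fun h1 => ?_, fun h1 => h.num_lt hk h1 hi⟩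
  by_contra h2
  rcases (Nat.le_of_not_lt h2).lt_or_eq with h3 | rfl
  · exact h.asymm h1 (h.num_lt hk h3 hj)
  · exact h.irrefl _ h1

theorem num_eq_iff {m w : ℕ} (hw : w < k) : num N m = num N w ↔ m = w := by
  refine ⟨fun h1 => ?_, fun h1 => congrArg _ h1⟩
  by_contra h2
  rcases Nat.lt_or_gt_of_ne h2 with h3 | h3
  · exact h.irrefl _ (h1 ▸ h.num_lt hk h3 (h3.trans hw))
  · exact h.irrefl _ (h1 ▸ h.num_lt hk h3 hw)

/-- Below a number at which the numerals still increase, pure `Δ₀`-formulas are absolute: their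
bounded quantifiers never reach the cut-off. -/
theorem holds_iff : ∀ {n : ℕ} (δ : PureDelta n) (v : Fin n → ℕ), (∀ i, v i < k) →
    (δ.Holds N (fun i => num N (v i)) ↔ δ.Holds ℕ v)
  | _, .bot, v, hv => Iff.rfl
  | _, .top, v, hv => Iff.rfl
  | _, .lt a b, v, hv => h.num_lt_iff hk (hv a) (hv b)
  | _, .zero a, v, hv => h.num_eq_iff hk (m := 0) (hv a)
  | _, .succ a b, v, hv => h.num_eq_iff hk (m := v a + 1) (hv b)
  | _, .add a b c, v, hv => by
    simp only [PureDelta.Holds, h.plus_num]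
    exact h.num_eq_iff hk (hv c)
  | _, .mul a b c, v, hv => by
    simp only [PureDelta.Holds, h.times_num]
    exact h.num_eq_iff hk (hv c)
  | _, .neg φ, v, hv => not_congr (holds_iff φ v hv)
  | _, .and φ ψ, v, hv => and_congr (holds_iff φ v hv) (holds_iff ψ v hv)
  | _, .or φ ψ, v, hv => or_congr (holds_iff φ v hv) (holds_iff ψ v hv)
  | _, .imp φ ψ, v, hv => imp_congr (holds_iff φ v hv) (holds_iff ψ v hv)
  | n, .allLt a φ, v, hv => by
    have key (i : ℕ) (hi : i < k) : φ.Holds N (Fin.snoc (fun i => num N (v i)) (num N i)) ↔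
        φ.Holds ℕ (Fin.snoc v i) := by
      rw [← holds_iff φ (Fin.snoc v i) (Fin.lastCases (by simpa using hi) (by simpa using hv))]
      exact iff_of_eq (congrArg _ (Fin.comp_snoc (num N) v i).symm)
    constructor
    · intro H i (hi : i < v a)
      exact (key i (hi.trans (hv a))).1 (H _ (h.num_lt hk hi (hi.trans (hv a))))
    · intro H x hx
      obtain ⟨i, hi, rfl⟩ := h.lt_num hx
      exact (key i (hi.trans (hv a))).2 (H i hi)
  | n, .exLt a φ, v, hv => by
    have key (i : ℕ) (hi : i < k) : φ.Holds N (Fin.snoc (fun i => num N (v i)) (num N i)) ↔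
        φ.Holds ℕ (Fin.snoc v i) := by
      rw [← holds_iff φ (Fin.snoc v i) (Fin.lastCases (by simpa using hi) (by simpa using hv))]
      exact iff_of_eq (congrArg _ (Fin.comp_snoc (num N) v i).symm)
    constructor
    · rintro ⟨x, hx, H⟩
      obtain ⟨i, hi, rfl⟩ := h.lt_num hx
      exact ⟨i, hi, (key i (hi.trans (hv a))).1 H⟩
    · rintro ⟨i, hi, H⟩
      have hi : i < v a := hi
      exact ⟨_, h.num_lt hk hi (hi.trans (hv a)), (key i (hi.trans (hv a))).2 H⟩
  | n, .allLe a φ, v, hv => by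
    have key (i : ℕ) (hi : i < k) : φ.Holds N (Fin.snoc (fun i => num N (v i)) (num N i)) ↔
        φ.Holds ℕ (Fin.snoc v i) := by
      rw [← holds_iff φ (Fin.snoc v i) (Fin.lastCases (by simpa using hi) (by simpa using hv))]
      exact iff_of_eq (congrArg _ (Fin.comp_snoc (num N) v i).symm)
    constructor
    · rintro H i (hi : i < v a ∨ i = v a)
      refine (key i (by have := hv a; omega)).1 (H _ ?_)
      rcases hi with hi | rfl
      · exact .inl (h.num_lt hk hi (hi.trans (hv a)))
      · exact .inr rfl
    · rintro H x (hx | rfl)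
      · obtain ⟨i, hi, rfl⟩ := h.lt_num hx
        exact (key i (hi.trans (hv a))).2 (H i (.inl hi))
      · exact (key _ (hv a)).2 (H _ (.inr rfl))
  | n, .exLe a φ, v, hv => by
    have key (i : ℕ) (hi : i < k) : φ.Holds N (Fin.snoc (fun i => num N (v i)) (num N i)) ↔
        φ.Holds ℕ (Fin.snoc v i) := by
      rw [← holds_iff φ (Fin.snoc v i) (Fin.lastCases (by simpa using hi) (by simpa using hv))]
      exact iff_of_eq (congrArg _ (Fin.comp_snoc (num N) v i).symm)
    constructor
    · rintro ⟨x, hx | rfl, H⟩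
      · obtain ⟨i, hi, rfl⟩ := h.lt_num hx
        exact ⟨i, .inl hi, (key i (hi.trans (hv a))).1 H⟩
      · exact ⟨v a, .inr rfl, (key _ (hv a)).1 H⟩
    · rintro ⟨i, hi, H⟩
      have hi : i < v a ∨ i = v a := hi
      rcases hi with hi | rfl
      · exact ⟨_, .inl (h.num_lt hk hi (hi.trans (hv a))), (key i (hi.trans (hv a))).2 H⟩
      · exact ⟨_, .inr rfl, (key _ (hv a)).2 H⟩

end IsTN

/-- A number in which all numerals increase is a model of `R`. -/
theorem IsTN.models_R {N : Type} [arith.Structure N] (h : IsTN N)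
    (hN : ∀ i, less (num N i) (num N (i + 1))) : N ⊨ R := by
  refine ⟨fun φ hφ => ?_⟩
  cases hφ with
  | add m n => simp [Sentence.Realize, Formula.Realize, h.plus_num]
  | mul m n => simp [Sentence.Realize, Formula.Realize, h.times_num]
  | ne m n hmn =>
    simpa [Sentence.Realize, Formula.Realize] using
      (h.num_eq_iff (k := n + 1) (fun i _ => hN i) (m := m) (Nat.lt_succ_self n)).not.2 hmn
  | lt n =>
    simp only [Sentence.Realize, Formula.Realize, BoundedFormula.realize_all,
      BoundedFormula.realize_imp, realize_aLt, bigOr, BoundedFormula.realize_foldr_sup]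
    intro x hx
    obtain ⟨i, hi, rfl⟩ := h.lt_num (by simpa using hx)
    exact ⟨_, List.mem_map.2 ⟨i, List.mem_range.2 hi, rfl⟩, by simp [Fin.snoc]⟩
  | tri n =>
    simp only [Sentence.Realize, Formula.Realize, BoundedFormula.realize_all,
      BoundedFormula.realize_sup, realize_aLt]
    intro x
    simpa [Fin.snoc] using h.tri x (num N n)

/-- If the witness of a false `Σ⁰₁`-sentence lies below the largest element of a number, then that
element is non-standard. -/
theorem IsTN.num_increasing {N : Type} [arith.Structure N] (h : IsTN N) {z : N}
    (hz : ∀ x, ¬ less z x) (δ : PureDelta 1) {x : N} (hx : less x z) (hδ : δ.Holds N fun _ => x)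
    (hfalse : ¬ ∃ n, δ.Holds ℕ fun _ => n) (i : ℕ) : less (num N i) (num N (i + 1)) := by
  classical
  by_contra hi
  have hex : ∃ i, ¬ less (num N i) (num N (i + 1)) := ⟨i, hi⟩
  have hmin : ∀ i < Nat.find hex, less (num N i) (num N (i + 1)) := fun i hi =>
    not_not.1 (Nat.find_min hex hi)
  have hk := Nat.find_spec hex
  obtain rfl : z = num N (Nat.find hex) := by
    rcases h.tri z (num N (Nat.find hex)) with (h1 | h1) | h1
    · exact (hz _ h1).elim
    · exact h1
    · exact (hk (h.lt_suc _ _ h1).1).elim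
  obtain ⟨j, hj, rfl⟩ := h.lt_num hx
  exact hfalse ⟨j, (h.holds_iff hmin δ (fun _ => j) fun _ => hj).1 hδ⟩

end LaxInt

namespace LaxInt

/-! ### Cut-off translations -/

/-- A simple translation in a structure `M` presents every structure that is embedded in `M` with
the translated domain as range. -/
theorem simple_presents {L L' : FirstOrder.Language.{0, 0}} {P : ℕ} (α : L'.Formula (Fin P))
    (δ : L'.Formula (Fin P ⊕ Fin 1)) (rel : ∀ {n : ℕ}, L.Relations n → L'.Formula (Fin P ⊕ Fin n))
    (func : ∀ {n : ℕ}, L.Functions n → L'.Formula (Fin P ⊕ Fin (n + 1)))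
    {M N : Type} [L'.Structure M] [L.Structure N] (p : Fin P → M) (e : N → M)
    (he : Function.Injective e)
    (hdom : ∀ m, δ.Realize (Sum.elim p fun _ => m) ↔ ∃ x, e x = m)
    (hrel : ∀ {n : ℕ} (r : L.Relations n) (d : Fin n → N),
      (rel r).Realize (Sum.elim p fun i => e (d i)) ↔ Structure.RelMap r d)
    (hfunc : ∀ {n : ℕ} (f : L.Functions n) (d : Fin n → N) (y : N),
      (func f).Realize (Sum.elim p (Fin.snoc (fun i => e (d i)) (e y))) ↔
        y = Structure.funMap f d) (φ : L.Sentence) :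
    ((Translation.simple P α δ rel func).sentence φ).Realize p ↔ N ⊨ φ := by
  let τ : Translation L L' := Translation.simple P α δ rel func
  have hD : ∀ x : {x // (τ.raw p).dom x}, ∃ y, e y = x.1.2 (0 : Fin 1) := by
    rintro ⟨⟨k, x⟩, hx⟩
    refine (hdom _).1 ?_
    refine realize_of_eq hx (funext ?_)
    rintro (i | i)
    · rfl
    · exact congrArg x (Subsingleton.elim (α := Fin 1) _ _)
  choose cls hcls using hD
  have hrel' : ∀ {n : ℕ} (r : L.Relations n) (d : Fin n → {x // (τ.raw p).dom x}),
      (τ.raw p).rel r (fun i => (d i).1) ↔ (rel r).Realize (Sum.elim p fun i => e (cls (d i))) := by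
    intro n r d
    change Formula.Realize (Formula.relabel _ _) _ ↔ _
    refine Formula.realize_relabel.trans ?_
    refine iff_of_eq (congrArg _ (funext ?_))
    rintro (i | i)
    · rfl
    · exact (hcls (d i)).symm
  have hfunc' : ∀ {n : ℕ} (f : L.Functions n) (d : Fin n → {x // (τ.raw p).dom x})
      (y : {x // (τ.raw p).dom x}), (τ.raw p).func f (fun i => (d i).1) y.1 ↔
        (func f).Realize (Sum.elim p (Fin.snoc (fun i => e (cls (d i))) (e (cls y)))) := by
    intro n f d y
    change Formula.Realize (Formula.relabel _ _) _ ↔ _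
    refine Formula.realize_relabel.trans ?_
    refine iff_of_eq (congrArg _ (funext ?_))
    rintro (i | i)
    · rfl
    · let F : (Σ _ : Fin n, Fin 1) ⊕ Fin 1 → M := Sum.elim (fun x => (d x.1).1.2 x.2) y.1.2
      refine Fin.lastCases ?_ (fun i => ?_) i
      · exact Eq.trans (congrArg F (Fin.lastCases_last (motive := fun _ => (Σ _ : Fin n, Fin 1) ⊕ Fin 1)
          (last := .inr 0) (cast := fun i => .inl ⟨i, 0⟩)))
            ((hcls y).symm.trans
              (Fin.snoc_last (α := fun _ => M) (e (cls y)) fun i => e (cls (d i))).symm)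
      · exact Eq.trans (congrArg F (Fin.lastCases_castSucc
          (motive := fun _ => (Σ _ : Fin n, Fin 1) ⊕ Fin 1)
          (last := .inr 0) (cast := fun i => .inl ⟨i, 0⟩) i))
            ((hcls (d i)).symm.trans
              (Fin.snoc_castSucc (α := fun _ => M) (e (cls y)) (fun i => e (cls (d i))) i).symm)
  have hpt : ∀ x : N, (τ.raw p).dom ⟨(0 : Fin 1), fun _ => e x⟩ := by
    intro x
    refine realize_of_eq ((hdom (e x)).2 ⟨x, rfl⟩) (funext ?_)
    rintro (i | i) <;> rfl
  have hcls' : ∀ x : N, cls ⟨_, hpt x⟩ = x := fun x => he (hcls _)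
  have H : (τ.raw p).Presents N cls := by
    refine ⟨fun x => ⟨_, hcls' x⟩, ?_, ?_, ?_, ?_⟩
    · intro x y
      have : (τ.raw p).eqv x.1 y.1 ↔ x.1.2 (0 : Fin 1) = y.1.2 (0 : Fin 1) := by
        change Formula.Realize (Term.equal _ _) _ ↔ _
        exact Formula.realize_equal
      rw [this, ← hcls x, ← hcls y, he.eq_iff]
    · intro n r d
      exact (hrel' r d).trans (hrel r _)
    · intro n f d
      refine ⟨⟨_, hpt (Structure.funMap f fun i => cls (d i))⟩, (hfunc' f d _).2 ?_⟩
      exact (hfunc f _ _).2 (hcls' _)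
    · intro n f d y hy
      exact (hfunc f _ _).1 ((hfunc' f d y).1 hy)
  exact (τ.realize_sentence p φ).trans (H.sat_sentence φ)

/-- A largest element of a number satisfies `z ⊨ TN`: cutting off at it changes nothing. -/
theorem realize_modelsTN {N : Type} [arith.Structure N] (h : IsTN N) {z : N}
    (hz : ∀ x, ¬ less z x) : modelsTN.Realize fun _ => z := by
  have hle : ∀ x, less x z ∨ x = z := fun x => by
    rcases h.tri x z with h1 | h1
    · exact h1
    · exact (hz _ h1).elim
  rw [modelsTN]
  refine (simple_presents _ _ _ _ (N := N) (fun _ => z) id Function.injective_id ?_ ?_ ?_ _).2 ?_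
  · intro m
    simpa [Formula.Realize, fv] using hle m
  · intro n r d
    cases r
    simp only [Formula.Realize, realize_aLt]
    refine iff_of_eq (congrArg _ (funext fun i => ?_))
    fin_cases i <;> rfl
  · intro n f d y
    cases f
    · simp only [Formula.Realize, BoundedFormula.realize_bdEqual, realize_aZero, fv,
        Term.realize_var]
      rw [Subsingleton.elim d (![])]
      rfl
    · obtain ⟨x, rfl⟩ : ∃ x, d = ![x] := ⟨d 0, funext fun i => by fin_cases i; rfl⟩
      simp [Formula.Realize, aCut, fv, hle, Fin.snoc]
      rfl
    · obtain ⟨x, y', rfl⟩ : ∃ x y, d = ![x, y] := ⟨d 0, d 1, funext fun i => by fin_cases i <;> rfl⟩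
      simp [Formula.Realize, aCut, fv, hle]
      rfl
    · obtain ⟨x, y', rfl⟩ : ∃ x y, d = ![x, y] := ⟨d 0, d 1, funext fun i => by fin_cases i <;> rfl⟩
      simp [Formula.Realize, aCut, fv, hle]
      rfl
  · have h1 := models_idArith N
    have h2 := (models_TN_iff N).2 h
    rw [Sentence.Realize, Formula.realize_inf]
    exact ⟨h1, h2⟩

theorem models_sigmaQ {N : Type} [arith.Structure N] (h : IsTN N) {z : N}
    (hz : ∀ x, ¬ less z x) (δ : PureDelta 1) {x : N} (hx : less x z)
    (hδ : δ.Holds N fun _ => x) : N ⊨ sigmaQ δ := by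
  simp only [sigmaQ, Sentence.Realize, Formula.Realize, BoundedFormula.realize_ex,
    BoundedFormula.realize_inf, realize_toFormula, realize_aLt]
  refine ⟨z, ⟨x, by simpa [Fin.snoc] using hx, ?_⟩, ?_⟩
  · convert hδ using 1
    funext i
    simp [Fin.snoc]
  · rw [Formula.realize_relabel_sumInr]
    convert realize_modelsTN h hz using 1
    funext i
    fin_cases i
    simp [Fin.snoc]

section Scat
variable {M : Type} [scatLang.Structure M]

/-- The order relation of a structure of scattered numbers. -/
def slt (x y : M) : Prop := Structure.RelMap (L := scatLang) ScatRel.lt ![x, y]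
/-- The non-strict order relation of a structure of scattered numbers. -/
def sle (x y : M) : Prop := slt x y ∨ x = y

variable {α : Type} {v : α → M} {n : ℕ}

@[simp] theorem realize_sLt (t u : scatLang.Term (α ⊕ Fin n)) (xs : Fin n → M) :
    (sLt t u).Realize v xs ↔ slt (t.realize (Sum.elim v xs)) (u.realize (Sum.elim v xs)) := by
  refine iff_of_eq (congrArg (Structure.RelMap (L := scatLang) (M := M) ScatRel.lt)
    (funext fun i => ?_))
  fin_cases i <;> rfl
@[simp] theorem realize_sLe (t u : scatLang.Term (α ⊕ Fin n)) (xs : Fin n → M) :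
    (sLe t u).Realize v xs ↔ sle (t.realize (Sum.elim v xs)) (u.realize (Sum.elim v xs)) := by
  simp [sLe, sle]
@[simp] theorem realize_sSucc (t u : scatLang.Term (α ⊕ Fin n)) (xs : Fin n → M) :
    (sSucc t u).Realize v xs ↔ Structure.RelMap (L := scatLang) ScatRel.succ
      ![t.realize (Sum.elim v xs), u.realize (Sum.elim v xs)] := by
  refine iff_of_eq (congrArg (Structure.RelMap (L := scatLang) (M := M) ScatRel.succ)
    (funext fun i => ?_))
  fin_cases i <;> rfl

/-- The elements from `a` up to `z`. -/
def inSeg (a z x : M) : Prop := sle a x ∧ sle x z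

/-- The graph of an operation, cut off at `z`. -/
def CutGraph (a z : M) (r : ScatRel (n + 1)) (d : Fin n → M) (w : M) : Prop :=
  ((∃ u, inSeg a z u ∧ Structure.RelMap (L := scatLang) (M := M) r (Fin.snoc d u)) ∧
      Structure.RelMap (L := scatLang) (M := M) r (Fin.snoc d w)) ∨
    (¬ (∃ u, inSeg a z u ∧ Structure.RelMap (L := scatLang) (M := M) r (Fin.snoc d u)) ∧ w = z)

theorem realize_sCut (a z : M) (r : ScatRel (n + 1)) (d : Fin n → M) (w : M) :
    (sCut r).Realize (Sum.elim ![a, z] (Fin.snoc d w)) ↔ CutGraph a z r d w := by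
  have h1 : ∀ u : M, (fun i => Term.realize (Sum.elim
        (Sum.elim ![a, z] (Fin.snoc d w : Fin (n + 1) → M)) (Fin.snoc default u : Fin 1 → M))
        ((Fin.snoc (fun i : Fin n => fv (.inr i.castSucc)) (&0) :
          Fin (n + 1) → scatLang.Term ((Fin 2 ⊕ Fin (n + 1)) ⊕ Fin 1)) i)) =
      (Fin.snoc d u : Fin (n + 1) → M) := by
    intro u
    refine funext fun i => Fin.lastCases ?_ (fun i => ?_) i
    · simp [Fin.snoc]
    · simp [fv]
  have h2 : ∀ u : M, (BoundedFormula.rel (L := scatLang) r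
      (Fin.snoc (fun i : Fin n => fv (.inr i.castSucc)) (&0)) :
        scatLang.BoundedFormula (Fin 2 ⊕ Fin (n + 1)) 1).Realize
        (Sum.elim ![a, z] (Fin.snoc d w)) (Fin.snoc default u) ↔
      Structure.RelMap (L := scatLang) (M := M) r (Fin.snoc d u) := fun u =>
    iff_of_eq (congrArg (Structure.RelMap (L := scatLang) (M := M) r) (h1 u))
  have h3 : (BoundedFormula.rel (L := scatLang) r (fun i => fv (.inr i)) :
        scatLang.BoundedFormula (Fin 2 ⊕ Fin (n + 1)) 0).Realize
        (Sum.elim ![a, z] (Fin.snoc d w)) default ↔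
      Structure.RelMap (L := scatLang) (M := M) r (Fin.snoc d w) := Iff.rfl
  simp only [sCut, Formula.Realize, BoundedFormula.realize_sup, BoundedFormula.realize_inf,
    BoundedFormula.realize_ex, BoundedFormula.realize_not, realize_sLe, CutGraph, inSeg, h2, h3,
    BoundedFormula.realize_bdEqual]
  simp [fv, Fin.snoc]

/-- The operation of an arithmetical structure for a relation symbol other than `<`. -/
def relOfFunc : {n : ℕ} → ArithFunc (n + 1) → ScatRel (n + 2)
  | _, .succ => .succ
  | _, .add => .add
  | _, .mul => .mul

/-- The arithmetical structure `N` is the segment from `a` to `z` with the operations cut off. -/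
structure IsSegment (a z : M) (N : Type) [arith.Structure N] (e : N → M) : Prop where
  inj : Function.Injective e
  range : ∀ m, inSeg a z m ↔ ∃ x, e x = m
  zero : e (zro N) = a
  lt : ∀ x y, slt (e x) (e y) ↔ less x y
  op : ∀ {n : ℕ} (f : ArithFunc (n + 1)) (d : Fin (n + 1) → N) (y : N),
    CutGraph a z (relOfFunc f) (fun i => e (d i)) (e y) ↔
      y = Structure.funMap (L := arith) (M := N) f d

theorem IsSegment.realize_sentence {a z : M} {N : Type} [arith.Structure N] {e : N → M}
    (h : IsSegment a z N e) (φ : arith.Sentence) :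
    (scatTrans.sentence φ).Realize ![a, z] ↔ N ⊨ φ := by
  refine simple_presents _ _ _ _ (N := N) ![a, z] e h.inj ?_ ?_ ?_ _
  · intro m
    rw [← h.range]
    simp [Formula.Realize, fv, inSeg]
  · intro n r d
    cases r
    obtain ⟨x, y', rfl⟩ : ∃ x y, d = ![x, y] := ⟨d 0, d 1, funext fun i => by fin_cases i <;> rfl⟩
    have := h.lt x y'
    simpa [Formula.Realize, fv, less] using this
  · intro n f d y
    cases f
    · rw [Subsingleton.elim d (![])]
      have := h.zero
      simp only [Formula.Realize, BoundedFormula.realize_bdEqual, fv, Term.realize_var,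
        Sum.elim_inl, Sum.elim_inr]
      change _ = a ↔ y = zro N
      rw [← this, ← h.inj.eq_iff]
      rfl
    all_goals
      refine (realize_sCut _ _ _ _ _).trans ?_
    · exact h.op ArithFunc.succ d y
    · exact h.op ArithFunc.add d y
    · exact h.op ArithFunc.mul d y

end Scat
end LaxInt

namespace LaxInt

/-! ### Segments that are numbers -/

section Segment
variable {M : Type} [scatLang.Structure M] (a z : M)

/-- An element of `M`, as an element of the raw structure of the cut-off translation. -/
def segPt (m : M) : Σ k, Fin (scatTrans.dim k) → M := ⟨(0 : Fin 1), fun _ => m⟩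

theorem dom_segPt (m : M) : (scatTrans.raw ![a, z]).dom (segPt m) ↔ inSeg a z m := by
  refine Formula.realize_inf.trans (and_congr ?_ ?_) <;> exact realize_sLe _ _ _

theorem eqv_segPt (x y : M) : (scatTrans.raw ![a, z]).eqv (segPt x) (segPt y) ↔ x = y :=
  Formula.realize_equal

theorem func_segPt {n : ℕ} (f : ArithFunc (n + 1)) (d : Fin (n + 1) → M) (y : M) :
    (scatTrans.raw ![a, z]).func (f : arith.Functions (n + 1)) (fun i => segPt (d i)) (segPt y) ↔
      CutGraph a z (relOfFunc f) d y := by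
  have key : ∀ φ : scatLang.Formula (Fin 2 ⊕ Fin (n + 2)),
      (φ.relabel (Sum.map id (Fin.lastCases (motive := fun _ => (Σ _ : Fin (n + 1), Fin 1) ⊕ Fin 1)
        (.inr 0) fun i => .inl ⟨i, 0⟩)) : scatLang.Formula (Fin 2 ⊕ _)).Realize
          (Sum.elim ![a, z] (Sum.elim (fun x => d x.1) fun _ => y)) ↔
      φ.Realize (Sum.elim ![a, z] (Fin.snoc d y)) := by
    intro φ
    rw [Formula.realize_relabel]
    refine iff_of_eq (congrArg _ (funext ?_))
    rintro (i | i)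
    · rfl
    · refine Fin.lastCases ?_ (fun i => ?_) i <;> simp
  cases f <;> exact (key _).trans (realize_sCut _ _ _ _ _)

theorem func_zero_segPt (d : Fin 0 → Σ k, Fin (scatTrans.dim k) → M) (y : M) :
    (scatTrans.raw ![a, z]).func (ArithFunc.zero : arith.Functions 0) d (segPt y) ↔ y = a := by
  change Formula.Realize (Formula.relabel _ _) _ ↔ _
  refine Formula.realize_relabel.trans ?_
  exact Formula.realize_equal (t₁ := .var (Sum.inr 0)) (t₂ := .var (Sum.inl 0))

variable {a z}

/-- If the identity axioms hold in a segment, then the cut-off operations are functions on it and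
it is a structure for the language of arithmetic. -/
theorem exists_isSegment (h : (scatTrans.raw ![a, z]).Sat idArith Fin.elim0) :
    ∃ (N : Type) (_ : arith.Structure N) (e : N → M), IsSegment a z N e := by
  have hp : ∀ y : Σ k, Fin (scatTrans.dim k) → M, ∃ m, y = segPt m := by
    rintro ⟨k, y⟩
    obtain rfl : k = (0 : Fin 1) := Subsingleton.elim (α := Fin 1) _ _
    exact ⟨y (0 : Fin 1), congrArg (Sigma.mk _) (funext fun i =>
      congrArg y (Subsingleton.elim (α := Fin 1) _ _))⟩
  have hax := (RawStr.sat_bigAnd _ _ _).1 h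
  simp only [List.mem_cons, List.not_mem_nil, or_false, forall_eq_or_imp, forall_eq] at hax
  obtain ⟨h1, -, h3, h4, h5, h6, h7, h8⟩ := hax
  have e0 : ∀ {n : ℕ}, (aZero : arith.Term (Empty ⊕ Fin n)) =
      Term.func (ArithFunc.zero : arith.Functions 0) fun i => &(Fin.elim0 i) := fun {n} =>
    congrArg (Term.func (L := arith) ArithFunc.zero) (Subsingleton.elim _ _)
  have e1 : ∀ {n : ℕ} (i : Fin n), (aSucc (&i) : arith.Term (Empty ⊕ Fin n)) =
      Term.func (ArithFunc.succ : arith.Functions 1) fun j => &(![i] j) := fun {n} i =>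
    congrArg (Term.func (L := arith) ArithFunc.succ) (funext fun j => by fin_cases j; rfl)
  have e2 : ∀ {n : ℕ} (i i' : Fin n), (aAdd (&i) (&i') : arith.Term (Empty ⊕ Fin n)) =
      Term.func (ArithFunc.add : arith.Functions 2) fun j => &(![i, i'] j) := fun {n} i i' =>
    congrArg (Term.func (L := arith) ArithFunc.add) (funext fun j => by fin_cases j <;> rfl)
  have e3 : ∀ {n : ℕ} (i i' : Fin n), (aMul (&i) (&i') : arith.Term (Empty ⊕ Fin n)) =
      Term.func (ArithFunc.mul : arith.Functions 2) fun j => &(![i, i'] j) := fun {n} i i' =>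
    congrArg (Term.func (L := arith) ArithFunc.mul) (funext fun j => by fin_cases j <;> rfl)
  simp only [e0, e1, e2, e3] at h1 h3 h4 h5 h6 h7 h8
  set S := scatTrans.raw ![a, z] with hS
  have t0 : inSeg a z a := by
    obtain ⟨y, hy, hs⟩ := (S.sat_ex _ _).1 h1
    obtain ⟨m, rfl⟩ := hp y
    obtain ⟨y', hy', -, ⟨-, hf⟩, he⟩ := (S.sat_func_eq _ _ _ _).1 hs
    obtain ⟨m', rfl⟩ := hp y'
    obtain rfl := (func_zero_segPt a z _ _).1 hf
    exact (dom_segPt _ _ _).1 hy'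
  have key : ∀ (n m : ℕ) (f : ArithFunc (m + 1)) (x : Fin n → M) (v : Fin (m + 1) → Fin n)
      (j : Fin n), S.Sat ((Term.func (f : arith.Functions (m + 1)) fun i => &(v i)) =' (&j))
        (fun i => segPt (x i)) ↔ inSeg a z (x j) ∧ (∀ i, inSeg a z (x (v i))) ∧
          CutGraph a z (relOfFunc f) (fun i => x (v i)) (x j) := by
    intro n m f x v j
    refine (S.sat_func_eq (fun i => segPt (x i)) (f : arith.Functions (m + 1)) v j).trans ?_
    simp only [hS, dom_segPt]
    constructor
    · rintro ⟨y, hy, hj, ⟨hd, hf⟩, he⟩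
      obtain ⟨m, rfl⟩ := hp y
      obtain rfl := (eqv_segPt _ _ _ _).1 he
      exact ⟨hj, hd, (func_segPt a z f _ _).1 hf⟩
    · rintro ⟨hj, hd, hf⟩
      exact ⟨segPt (x j), (dom_segPt _ _ _).2 hj, hj, ⟨hd, (func_segPt a z f _ _).2 hf⟩,
        (eqv_segPt _ _ _ _).2 rfl⟩
  have hsnoc : ∀ {n : ℕ} (x : Fin n → M) (y : M),
      (Fin.snoc (fun i => segPt (x i)) (segPt y) : Fin (n + 1) → Σ k, Fin (scatTrans.dim k) → M) =
        fun i => segPt ((Fin.snoc x y : Fin (n + 1) → M) i) := fun x y =>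
    (Fin.comp_snoc segPt x y).symm
  have hnil : (Fin.elim0 : Fin 0 → Σ k, Fin (scatTrans.dim k) → M) =
      fun i => segPt ((Fin.elim0 : Fin 0 → M) i) := Subsingleton.elim _ _
  have hall : ∀ {n : ℕ} (φ : arith.BoundedFormula Empty (n + 1)) (x : Fin n → M),
      S.Sat φ.all (fun i => segPt (x i)) ↔ ∀ y, inSeg a z y →
        S.Sat φ (fun i => segPt ((Fin.snoc x y : Fin (n + 1) → M) i)) := by
    intro n φ x
    simp only [RawStr.sat_all, ← hsnoc]
    constructor
    · exact fun H y hy => H _ ((dom_segPt _ _ _).2 hy)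
    · intro H y hy
      obtain ⟨m, rfl⟩ := hp y
      exact H m ((dom_segPt _ _ _).1 hy)
  have hex : ∀ {n : ℕ} (φ : arith.BoundedFormula Empty (n + 1)) (x : Fin n → M),
      S.Sat φ.ex (fun i => segPt (x i)) ↔ ∃ y, inSeg a z y ∧
        S.Sat φ (fun i => segPt ((Fin.snoc x y : Fin (n + 1) → M) i)) := by
    intro n φ x
    simp only [RawStr.sat_ex, ← hsnoc]
    constructor
    · rintro ⟨y, hy, H⟩
      obtain ⟨m, rfl⟩ := hp y
      exact ⟨m, (dom_segPt _ _ _).1 hy, H⟩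
    · rintro ⟨y, hy, H⟩
      exact ⟨_, (dom_segPt _ _ _).2 hy, H⟩
  simp only [hnil, hall, hex, key, RawStr.sat_imp, RawStr.sat_var_eq] at h3 h4 h5 h6 h7 h8
  simp only [hS, dom_segPt, eqv_segPt] at h4 h6 h8
  have v1 : ∀ d : Fin 1 → M, ∃ x, d = ![x] := fun d =>
    ⟨d 0, funext fun i => by fin_cases i; rfl⟩
  have v2 : ∀ d : Fin 2 → M, ∃ x y, d = ![x, y] := fun d =>
    ⟨d 0, d 1, funext fun i => by fin_cases i <;> rfl⟩
  have w1 : ∀ (x y : M), (fun i => (Fin.snoc (Fin.snoc (Fin.elim0 : Fin 0 → M) x : Fin 1 → M) y :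
      Fin 2 → M) ((![0] : Fin 1 → Fin 2) i)) = ![x] := fun x y =>
    funext fun i => by fin_cases i; rfl
  have w1' : ∀ (x y y' : M), (fun i => (Fin.snoc (Fin.snoc (Fin.snoc (Fin.elim0 : Fin 0 → M) x :
      Fin 1 → M) y : Fin 2 → M) y' : Fin 3 → M) ((![0] : Fin 1 → Fin 3) i)) = ![x] :=
    fun x y y' => funext fun i => by fin_cases i; rfl
  have w2 : ∀ (x x' y : M), (fun i => (Fin.snoc (Fin.snoc (Fin.snoc (Fin.elim0 : Fin 0 → M) x :
      Fin 1 → M) x' : Fin 2 → M) y : Fin 3 → M) ((![0, 1] : Fin 2 → Fin 3) i)) = ![x, x'] :=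
    fun x x' y => funext fun i => by fin_cases i <;> rfl
  have w2' : ∀ (x x' y y' : M), (fun i => (Fin.snoc (Fin.snoc (Fin.snoc (Fin.snoc
      (Fin.elim0 : Fin 0 → M) x : Fin 1 → M) x' : Fin 2 → M) y : Fin 3 → M) y' : Fin 4 → M)
      ((![0, 1] : Fin 2 → Fin 4) i)) = ![x, x'] :=
    fun x x' y y' => funext fun i => by fin_cases i <;> rfl
  have T : ∀ {m : ℕ} (f : ArithFunc (m + 1)) (d : Fin (m + 1) → M), (∀ i, inSeg a z (d i)) →
      ∃ y, inSeg a z y ∧ CutGraph a z (relOfFunc f) d y := by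
    intro m f d hd
    cases f
    · obtain ⟨x, rfl⟩ := v1 d
      obtain ⟨y, hy, -, -, H⟩ := h3 x (hd 0)
      rw [w1] at H
      exact ⟨y, hy, H⟩
    · obtain ⟨x, x', rfl⟩ := v2 d
      obtain ⟨y, hy, -, -, H⟩ := h5 x (hd 0) x' (hd 1)
      rw [w2] at H
      exact ⟨y, hy, H⟩
    · obtain ⟨x, x', rfl⟩ := v2 d
      obtain ⟨y, hy, -, -, H⟩ := h7 x (hd 0) x' (hd 1)
      rw [w2] at H
      exact ⟨y, hy, H⟩
  have U : ∀ {m : ℕ} (f : ArithFunc (m + 1)) (d : Fin (m + 1) → M), (∀ i, inSeg a z (d i)) →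
      ∀ y y', inSeg a z y → inSeg a z y' → CutGraph a z (relOfFunc f) d y →
        CutGraph a z (relOfFunc f) d y' → y = y' := by
    intro m f d hd y y' hy hy' H H'
    cases f
    · obtain ⟨x, rfl⟩ := v1 d
      exact (h4 x (hd 0) y hy y' hy' ⟨hy, Fin.forall_fin_one.2 (hd 0), by rw [w1']; exact H⟩
        ⟨hy', Fin.forall_fin_one.2 (hd 0), by rw [w1']; exact H'⟩).2.2
    · obtain ⟨x, x', rfl⟩ := v2 d
      exact (h6 x (hd 0) x' (hd 1) y hy y' hy'
        ⟨hy, Fin.forall_fin_two.2 ⟨hd 0, hd 1⟩, by rw [w2']; exact H⟩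
        ⟨hy', Fin.forall_fin_two.2 ⟨hd 0, hd 1⟩, by rw [w2']; exact H'⟩).2.2
    · obtain ⟨x, x', rfl⟩ := v2 d
      exact (h8 x (hd 0) x' (hd 1) y hy y' hy'
        ⟨hy, Fin.forall_fin_two.2 ⟨hd 0, hd 1⟩, by rw [w2']; exact H⟩
        ⟨hy', Fin.forall_fin_two.2 ⟨hd 0, hd 1⟩, by rw [w2']; exact H'⟩).2.2
  choose F hF hF' using @T
  let str : arith.Structure {m // inSeg a z m} :=
    { funMap := fun f => match f with
        | ArithFunc.zero => fun _ => ⟨a, t0⟩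
        | ArithFunc.succ => fun d => ⟨F .succ (fun i => (d i).1) fun i => (d i).2, hF _ _ _⟩
        | ArithFunc.add => fun d => ⟨F .add (fun i => (d i).1) fun i => (d i).2, hF _ _ _⟩
        | ArithFunc.mul => fun d => ⟨F .mul (fun i => (d i).1) fun i => (d i).2, hF _ _ _⟩
      RelMap := fun r => match r with
        | ArithRel.lt => fun d => slt (d 0).1 (d 1).1 }
  have hop : ∀ {n : ℕ} (f : ArithFunc (n + 1)) (d : Fin (n + 1) → {m // inSeg a z m}),
      (Structure.funMap (L := arith) f d).1 = F f (fun i => (d i).1) fun i => (d i).2 := by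
    intro n f d
    cases f <;> rfl
  refine ⟨{m // inSeg a z m}, str, Subtype.val, Subtype.val_injective, fun m => ?_, rfl,
    fun x y => Iff.rfl, fun {n} f d y => ?_⟩
  · exact ⟨fun h => ⟨⟨m, h⟩, rfl⟩, by rintro ⟨x, rfl⟩; exact x.2⟩
  · rw [Subtype.ext_iff, hop]
    constructor
    · exact fun H => U f _ (fun i => (d i).2) _ _ y.2 (hF _ _ _) H (hF' _ _ _)
    · intro H
      rw [H]
      exact hF' _ _ _

/-- A segment satisfies `z ⊨ TN` exactly when it is a number. -/
theorem realize_scatModelsTN_iff : scatModelsTN.Realize ![a, z] ↔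
    ∃ (N : Type) (_ : arith.Structure N) (e : N → M), IsSegment a z N e ∧ IsTN N := by
  constructor
  · intro h
    have h' := (scatTrans.realize_sentence _ _).1 h
    rw [RawStr.sat_inf] at h'
    obtain ⟨N, _, e, hN⟩ := exists_isSegment h'.1
    refine ⟨N, _, e, hN, (models_TN_iff N).1 ?_⟩
    exact ((Sentence.realize_inf (M := N)).1 ((hN.realize_sentence _).1 h)).2
  · rintro ⟨N, _, e, hN, h⟩
    exact (hN.realize_sentence _).2
      ((Sentence.realize_inf (M := N)).2 ⟨models_idArith N, (models_TN_iff N).2 h⟩)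

end Segment
end LaxInt

namespace LaxInt

/-! ### Standard segments -/

/-- The number `K + 1 = {0, …, K}`, with the operations cut off at `K`. -/
abbrev CutNum (K : ℕ) : Type := Fin (K + 1)

/-- The arithmetical structure of a standard number. -/
@[reducible] def cutNumStructure (K : ℕ) : arith.Structure (CutNum K) where
  funMap f d := ⟨min (Structure.funMap (L := arith) (M := ℕ) f fun i => (d i).val) K, by omega⟩
  RelMap r := match r with
    | ArithRel.lt => fun x => x 0 < x 1

attribute [local instance] cutNumStructure

theorem isTN_cutNum (K : ℕ) : IsTN (CutNum K) where
  not_lt_zero x := by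
    change ¬ x < ⟨min 0 K, _⟩
    rw [Fin.lt_def]; simp
  trans x y z := fun (h1 : x < y) (h2 : y < z) => (h1.trans h2 : x < z)
  tri x y := by
    change (x < y ∨ x = y) ∨ y < x
    rw [or_assoc]
    exact lt_trichotomy x y
  pred x := by
    rcases Nat.eq_zero_or_pos x.val with h | h
    · left
      apply Fin.ext
      change x.val = min 0 K
      omega
    · right
      refine ⟨⟨x.val - 1, by omega⟩, Fin.ext ?_⟩
      change x.val = min (x.val - 1 + 1) K
      omega
  suc_not_lt x := by
    change ¬ (min (x.val + 1) K) < x.val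
    omega
  lt_suc x y := by
    change x.val < y.val → x.val < min (x.val + 1) K ∧ ¬ y.val < min (x.val + 1) K
    omega
  add_zero x := by
    apply Fin.ext
    change min (x.val + min 0 K) K = x.val
    omega
  add_suc x y := by
    apply Fin.ext
    change min (x.val + min (y.val + 1) K) K = min (min (x.val + y.val) K + 1) K
    omega
  mul_zero x := by
    apply Fin.ext
    change min (x.val * min 0 K) K = min 0 K
    simp
  mul_suc x y := by
    apply Fin.ext
    change min (x.val * min (y.val + 1) K) K = min (min (x.val * y.val) K + x.val) K
    rcases Nat.lt_or_ge K (y.val + 1) with h | h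
    · have hy : y.val = K := by omega
      rw [hy, min_eq_right (by omega : K ≤ K + 1)]
      rcases Nat.eq_zero_or_pos x.val with h0 | h0
      · simp [h0]
      · have := Nat.mul_le_mul_right K h0
        omega
    · rw [min_eq_left h, Nat.mul_succ]
      omega

section
variable {M : Type} [scatLang.Structure M]

/-- The elements `e 0, …, e K` form a segment that is a copy of the standard number `K + 1`; the
operations take the values of the operations on natural numbers, where `e i` for `i > K` either
lies outside the segment or equals `e K`. -/
structure StdSegment (K : ℕ) (e : ℕ → M) : Prop where
  inj : ∀ i j, i ≤ K → j ≤ K → e i = e j → i = j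
  range : ∀ m, inSeg (e 0) (e K) m ↔ ∃ i ≤ K, e i = m
  lt : ∀ i j, i ≤ K → j ≤ K → (slt (e i) (e j) ↔ i < j)
  beyond : ∀ g, K < g → e g = e K ∨ ¬ inSeg (e 0) (e K) (e g)
  rel : ∀ {n : ℕ} (f : ArithFunc (n + 1)) (d : Fin (n + 1) → ℕ) (u : M), (∀ i, d i ≤ K) →
    (Structure.RelMap (L := scatLang) (relOfFunc f) (Fin.snoc (fun i => e (d i)) u) ↔
      u = e (Structure.funMap (L := arith) (M := ℕ) f d))

theorem StdSegment.isSegment {K : ℕ} {e : ℕ → M} (h : StdSegment K e) :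
    IsSegment (e 0) (e K) (CutNum K) fun i => e i.val where
  inj i j hij := Fin.ext (h.inj _ _ (by omega) (by omega) hij)
  range m := by
    rw [h.range]
    constructor
    · rintro ⟨i, hi, rfl⟩
      exact ⟨⟨i, by omega⟩, rfl⟩
    · rintro ⟨i, rfl⟩
      exact ⟨i, by omega, rfl⟩
  zero := by
    change e (min 0 K) = _
    simp
  lt i j := h.lt _ _ (by omega) (by omega)
  op f d y := by
    have hr := fun u => h.rel f (fun i => (d i).val) u fun i => by omega
    simp only [CutGraph, hr, exists_eq_right]
    rw [Fin.ext_iff]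
    change _ ↔ y.val = min (Structure.funMap (L := arith) (M := ℕ) f fun i => (d i).val) K
    set g := Structure.funMap (L := arith) (M := ℕ) f fun i => (d i).val
    have hy : y.val ≤ K := by omega
    rcases Nat.lt_or_ge K g with hg | hg
    · have hK : e y.val = e K ↔ y.val = K := ⟨h.inj _ _ hy le_rfl, fun h => by rw [h]⟩
      rw [min_eq_right hg.le, ← hK]
      rcases h.beyond g hg with h1 | h1
      · have h2 : inSeg (e 0) (e K) (e K) := (h.range _).2 ⟨K, le_rfl, rfl⟩
        simp [h1, h2]
      · simp [h1]
    · have h1 : inSeg (e 0) (e K) (e g) := (h.range _).2 ⟨g, hg, rfl⟩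
      rw [min_eq_left hg]
      simp only [h1, true_and, not_true_eq_false, false_and, or_false]
      exact ⟨h.inj _ _ hy hg, fun h => by rw [h]⟩

theorem realize_exBlock {L : FirstOrder.Language.{0, 0}} {α M : Type} [L.Structure M] {m : ℕ} :
    ∀ (k : ℕ) (φ : L.BoundedFormula α (m + k)) (v : α → M) (xs : Fin m → M),
      (exBlock k φ).Realize v xs ↔ ∃ ys : Fin k → M, φ.Realize v (Fin.append xs ys)
  | 0, φ, v, xs => by
    have : ∀ ys : Fin 0 → M, Fin.append xs ys = xs := fun ys => by
      rw [Subsingleton.elim ys Fin.elim0, Fin.append_elim0]; rfl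
    simp [exBlock, this]
  | k + 1, φ, v, xs => by
    simp only [exBlock, realize_exBlock k, BoundedFormula.realize_ex]
    constructor
    · rintro ⟨ys, y, h⟩
      exact ⟨Fin.snoc ys y, by rwa [Fin.append_snoc]⟩
    · rintro ⟨ys, h⟩
      refine ⟨Fin.init ys, ys (Fin.last k), ?_⟩
      rw [← Fin.append_snoc, Fin.snoc_init_self]
      exact h

theorem realize_numeralBelow (n : ℕ) (v : Empty → M) (xs : Fin 2 → M) :
    (numeralBelow n).Realize v xs ↔ ∃ ys : Fin (n + 1) → M, ys 0 = xs 0 ∧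
      (∀ i, sle (xs 0) (ys i) ∧ slt (ys i) (xs 1)) ∧
      ∀ i : Fin n, Structure.RelMap (L := scatLang) ScatRel.succ ![ys i.castSucc, ys i.succ] := by
  simp [numeralBelow, realize_exBlock, realize_bigAnd, and_assoc]

theorem realize_atLeast_of_inj (n : ℕ) (v : Empty → M) (xs : Fin 1 → M) (ys : Fin n → M)
    (hinj : Function.Injective ys) (h : ∀ i, sle (xs 0) (ys i)) :
    (atLeast n).Realize v xs := by
  simp only [atLeast, realize_exBlock, BoundedFormula.realize_inf, realize_bigAnd,
    List.forall_mem_map, BoundedFormula.realize_not, BoundedFormula.realize_bdEqual]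
  refine ⟨ys, fun i _ => ?_, fun j _ i hi => ?_⟩
  · simpa using h i
  · have : i < j := by simpa using hi
    simpa using fun he => this.ne (hinj he)

theorem realize_tildeNum (n : ℕ) (v : Empty → M) (xs : Fin 1 → M) :
    (tildeNum n).Realize v xs ↔ (∃ z, sle (xs 0) z ∧
      (∃ ys : Fin (n + 1) → M, ys 0 = xs 0 ∧ (∀ i, sle (xs 0) (ys i) ∧ slt (ys i) z) ∧
        ∀ i : Fin n, Structure.RelMap (L := scatLang) ScatRel.succ ![ys i.castSucc, ys i.succ]) ∧
      scatModelsTN.Realize ![xs 0, z]) ∧ (atLeast n).Realize v xs := by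
  simp only [tildeNum, BoundedFormula.realize_inf, BoundedFormula.realize_ex, realize_sLe,
    realize_numeralBelow, Formula.realize_relabel_sumInr, and_assoc]
  refine and_congr_left fun _ => exists_congr fun z => ?_
  have h1 : (Fin.snoc xs z : Fin 2 → M) = ![xs 0, z] := funext fun i => by fin_cases i <;> rfl
  rw [h1]
  simp

theorem StdSegment.realize_tildeNum {K : ℕ} {e : ℕ → M} (h : StdSegment K e) {n : ℕ} (hn : n < K)
    (v : Empty → M) : (tildeNum n).Realize v fun _ => e 0 := by
  have hle : ∀ i, i ≤ K → sle (e 0) (e i) := fun i hi => ((h.range (e i)).2 ⟨i, hi, rfl⟩).1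
  refine (LaxInt.realize_tildeNum n v _).2 ⟨⟨e K, hle K le_rfl, ⟨fun i => e i.val, rfl,
    fun i => ⟨hle _ (by omega), (h.lt _ _ (by omega) le_rfl).2 (by omega)⟩, fun i => ?_⟩, ?_⟩, ?_⟩
  · have := (h.rel .succ (fun _ => i.val) (e (i.val + 1)) fun _ => by omega).2 rfl
    refine (congrArg (Structure.RelMap (L := scatLang) (M := M) ScatRel.succ)
      (funext fun j => ?_)).mp this
    fin_cases j <;> rfl
  · exact realize_scatModelsTN_iff.2 ⟨_, _, _, h.isSegment, isTN_cutNum K⟩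
  · refine realize_atLeast_of_inj n v _ (fun i => e i.val) (fun i j hij => ?_) fun i => ?_
    · exact Fin.ext (h.inj _ _ (by omega) (by omega) hij)
    · exact hle _ (by omega)

theorem models_PAscat_of_segments
    (h : ∀ n, ∃ K, n < K ∧ ∃ e : ℕ → M, StdSegment K e) : M ⊨ PAscat := by
  refine ⟨fun φ hφ => ?_⟩
  obtain ⟨n, rfl⟩ := hφ
  obtain ⟨K, hK, e, he⟩ := h n
  refine BoundedFormula.realize_ex.2 ⟨e 0, ?_⟩
  convert he.realize_tildeNum hK default using 1
  funext i
  simp [Fin.snoc]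

end

/-! ### The model of scattered numbers -/

/-- The element `m` of the number `n`. -/
def scatPt (n : ℕ) (m : Fin n) : Nscat := ⟨n, m⟩

theorem scatPt_fst (n : ℕ) (m : Fin n) : (scatPt n m).1 = n := rfl
theorem scatPt_snd (n : ℕ) (m : Fin n) : (scatPt n m).2.val = m.val := rfl

theorem Nscat_ext_iff (x y : Nscat) : x = y ↔ x.1 = y.1 ∧ x.2.val = y.2.val := by
  obtain ⟨n, x⟩ := x
  obtain ⟨m, y⟩ := y
  constructor
  · intro h
    cases h
    exact ⟨rfl, rfl⟩
  · rintro ⟨h1, h2⟩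
    obtain rfl : n = m := h1
    exact congrArg (Sigma.mk n) (Fin.ext h2)

theorem stdSegment_Nscat (K : ℕ) :
    StdSegment K fun i => scatPt (K + 1) ⟨min i K, by omega⟩ := by
  have hlt : ∀ x y : Nscat, slt x y ↔ x.1 = y.1 ∧ x.2.val < y.2.val := fun x y => Iff.rfl
  have hext := Nscat_ext_iff
  constructor
  · intro i j hi hj h
    have := ((hext _ _).1 h).2
    simp only [scatPt_snd] at this
    omega
  · intro m
    simp only [inSeg, sle, hlt, hext, scatPt_fst, scatPt_snd]
    constructor
    · rintro ⟨h1, h2⟩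
      have h3 : K + 1 = m.1 := by rcases h1 with h1 | h1 <;> exact h1.1
      refine ⟨m.2.val, ?_, h3, ?_⟩ <;> have := m.2.2 <;> omega
    · rintro ⟨i, hi, h1, h2⟩
      simp only [← h1, true_and]
      omega
  · intro i j hi hj
    simp only [hlt, true_and, scatPt_snd, scatPt_fst]
    omega
  · intro g hg
    left
    simp only [hext, true_and, scatPt_snd, scatPt_fst]
    omega
  · intro n f d u hd
    rw [hext]
    cases f
    · change (K + 1 = u.1 ∧ u.2.val = min (min (d 0) K + 1) (K + 1 - 1)) ↔
        u.1 = K + 1 ∧ u.2.val = min (d 0 + 1) K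
      have := hd 0
      omega
    · change (K + 1 = K + 1 ∧ K + 1 = u.1 ∧
          u.2.val = min (min (d 0) K + min (d 1) K) (K + 1 - 1)) ↔
        u.1 = K + 1 ∧ u.2.val = min (d 0 + d 1) K
      have := hd 0
      have := hd 1
      omega
    · change (K + 1 = K + 1 ∧ K + 1 = u.1 ∧
          u.2.val = min (min (d 0) K * min (d 1) K) (K + 1 - 1)) ↔
        u.1 = K + 1 ∧ u.2.val = min (d 0 * d 1) K
      rw [min_eq_left (hd 0), min_eq_left (hd 1)]
      omega

theorem Nscat_models_PAscat : Nscat ⊨ PAscat :=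
  models_PAscat_of_segments fun n => ⟨n + 1, by omega, _, stdSegment_Nscat (n + 1)⟩

instance : Nonempty Nscat := ⟨⟨1, 0⟩⟩

/-! ### Models of `R` -/

/-- The relational structure of an arithmetical structure: the relation symbols denote the graphs
of the operations. -/
@[reducible] def graphStructure (M : Type) [arith.Structure M] : scatLang.Structure M where
  funMap f := Empty.elim f
  RelMap r := match r with
    | ScatRel.lt => fun x => less (x 0) (x 1)
    | ScatRel.succ => fun x => suc (x 0) = x 1
    | ScatRel.add => fun x => plus (x 0) (x 1) = x 2
    | ScatRel.mul => fun x => times (x 0) (x 1) = x 2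

attribute [local instance] graphStructure

theorem realize_toArith {M α : Type} [arith.Structure M] : ∀ {n : ℕ}
    (φ : scatLang.BoundedFormula α n) (v : α → M) (xs : Fin n → M),
    (toArith φ).Realize v xs ↔ φ.Realize v xs
  | _, .falsum, v, xs => Iff.rfl
  | _, .equal t u, v, xs => by
    have ht : ∀ t : scatLang.Term (α ⊕ Fin _),
        (termToArith t).realize (Sum.elim v xs) = t.realize (Sum.elim v xs) := by
      rintro (x | f)
      · rfl
      · exact Empty.elim f
    change _ = _ ↔ _ = _
    rw [ht, ht]
  | _, .rel r ts, v, xs => by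
    have ht : ∀ t : scatLang.Term (α ⊕ Fin _),
        (termToArith t).realize (Sum.elim v xs) = t.realize (Sum.elim v xs) := by
      rintro (x | f)
      · rfl
      · exact Empty.elim f
    cases r <;> simp only [toArith, atomToArith, realize_aLt, BoundedFormula.realize_bdEqual,
      realize_aSucc, realize_aAdd, realize_aMul, ht] <;> rfl
  | _, .imp φ ψ, v, xs => imp_congr (realize_toArith φ v xs) (realize_toArith ψ v xs)
  | _, .all φ, v, xs => forall_congr' fun x => realize_toArith φ v (Fin.snoc xs x)

section
variable {M : Type} [arith.Structure M] (h : M ⊨ R)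
include h

theorem R_num_inj {i j : ℕ} (hij : num M i = num M j) : i = j := by
  by_contra hne
  have := h.realize_of_mem _ (R.ne i j hne)
  simp [Sentence.Realize, Formula.Realize, hij] at this

theorem R_lt_num {x : M} {n : ℕ} (hx : less x (num M n)) : ∃ i < n, x = num M i := by
  have := h.realize_of_mem _ (R.lt n)
  simp only [Sentence.Realize, Formula.Realize, BoundedFormula.realize_all,
      BoundedFormula.realize_imp, realize_aLt, bigOr, BoundedFormula.realize_foldr_sup] at this
  obtain ⟨φ, hφ, h1⟩ := this x (by simpa [Fin.snoc] using hx)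
  obtain ⟨i, hi, rfl⟩ := List.mem_map.1 hφ
  exact ⟨i, List.mem_range.1 hi, by simpa [Fin.snoc] using h1⟩

theorem R_tri (x : M) (n : ℕ) : (less x (num M n) ∨ x = num M n) ∨ less (num M n) x := by
  have := h.realize_of_mem _ (R.tri n)
  simp only [Sentence.Realize, Formula.Realize, BoundedFormula.realize_all,
      BoundedFormula.realize_sup, realize_aLt] at this
  simpa [Fin.snoc] using this x

theorem R_num_lt_iff (i j : ℕ) : less (num M i) (num M j) ↔ i < j := by
  constructor
  · intro h1
    obtain ⟨k, hk, e⟩ := R_lt_num h h1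
    rwa [R_num_inj h e]
  · intro h1
    rcases R_tri h (num M i) j with (h2 | h2) | h2
    · exact h2
    · exact (h1.ne (R_num_inj h h2)).elim
    · obtain ⟨k, hk, e⟩ := R_lt_num h h2
      have := R_num_inj h e
      omega

theorem stdSegment_of_models_R (K : ℕ) : StdSegment K (num M) where
  inj i j _ _ := R_num_inj h
  range m := by
    have hs : ∀ x y : M, slt x y ↔ less x y := fun x y => Iff.rfl
    simp only [inSeg, sle, hs]
    constructor
    · rintro ⟨-, h1 | rfl⟩
      · obtain ⟨i, hi, rfl⟩ := R_lt_num h h1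
        exact ⟨i, hi.le, rfl⟩
      · exact ⟨K, le_rfl, rfl⟩
    · rintro ⟨i, hi, rfl⟩
      rw [R_num_lt_iff h, R_num_lt_iff h]
      rcases Nat.eq_zero_or_pos i with rfl | h0
      · exact ⟨.inr rfl, by rcases hi.lt_or_eq with h1 | h1 <;> simp [h1]⟩
      · exact ⟨.inl h0, by rcases hi.lt_or_eq with h1 | h1 <;> simp [h1]⟩
  lt i j _ _ := R_num_lt_iff h i j
  beyond g hg := by
    right
    rintro ⟨-, h1 | h1⟩
    · have := (R_num_lt_iff h _ _).1 h1
      omega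
    · have := R_num_inj h h1
      omega
  rel f d u hd := by
    cases f
    · exact eq_comm
    · have : plus (num M (d 0)) (num M (d 1)) = num M (d 0 + d 1) := by
        simpa [Sentence.Realize, Formula.Realize] using h.realize_of_mem _ (R.add (d 0) (d 1))
      change plus (num M (d 0)) (num M (d 1)) = u ↔ u = num M (d 0 + d 1)
      rw [this, eq_comm]
    · have : times (num M (d 0)) (num M (d 1)) = num M (d 0 * d 1) := by
        simpa [Sentence.Realize, Formula.Realize] using h.realize_of_mem _ (R.mul (d 0) (d 1))
      change times (num M (d 0)) (num M (d 1)) = u ↔ u = num M (d 0 * d 1)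
      rw [this, eq_comm]

end

theorem R_proves_PAscat (φ : scatLang.Sentence) (hφ : PAscat ⊨ᵇ φ) :
    R ⊨ᵇ (toArith φ : arith.Sentence) := by
  rw [Theory.models_sentence_iff] at hφ ⊢
  intro M
  have hM : (M : Type) ⊨ PAscat := models_PAscat_of_segments fun n =>
    ⟨n + 1, by omega, _, stdSegment_of_models_R M.is_model (n + 1)⟩
  exact (realize_toArith φ default default).2 (hφ ⟨M⟩)

end LaxInt

namespace LaxInt

/-! ### Witnesses in scattered numbers -/

/-- The reading of a pure `Δ₀`-formula in the number between `a = x₀` and `z = x₁`; the variable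
`xᵢ` becomes `xᵢ₊₂`. -/
def PureDelta.toScat : {n : ℕ} → PureDelta n → scatLang.BoundedFormula Empty (n + 2)
  | _, .bot => ⊥
  | _, .top => ⊤
  | _, .lt u v => sLt (&u.succ.succ) (&v.succ.succ)
  | _, .zero u => (&0) =' (&u.succ.succ)
  | _, .succ u v => sSucc (&u.succ.succ) (&v.succ.succ)
  | _, .add u v w => BoundedFormula.rel (L := scatLang) ScatRel.add
      ![&u.succ.succ, &v.succ.succ, &w.succ.succ]
  | _, .mul u v w => BoundedFormula.rel (L := scatLang) ScatRel.mul
      ![&u.succ.succ, &v.succ.succ, &w.succ.succ]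
  | _, .neg φ => ∼φ.toScat
  | _, .and φ ψ => φ.toScat ⊓ ψ.toScat
  | _, .or φ ψ => φ.toScat ⊔ ψ.toScat
  | _, .imp φ ψ => φ.toScat ⟹ ψ.toScat
  | n, .allLt v φ => ∀' ((sLe (&0) (&(Fin.last (n + 2))) ⊓ sLe (&(Fin.last (n + 2))) (&1)) ⟹
      (sLt (&(Fin.last (n + 2))) (&v.succ.succ.castSucc) ⟹ φ.toScat))
  | n, .exLt v φ => ∃' ((sLe (&0) (&(Fin.last (n + 2))) ⊓ sLe (&(Fin.last (n + 2))) (&1)) ⊓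
      (sLt (&(Fin.last (n + 2))) (&v.succ.succ.castSucc) ⊓ φ.toScat))
  | n, .allLe v φ => ∀' ((sLe (&0) (&(Fin.last (n + 2))) ⊓ sLe (&(Fin.last (n + 2))) (&1)) ⟹
      (sLe (&(Fin.last (n + 2))) (&v.succ.succ.castSucc) ⟹ φ.toScat))
  | n, .exLe v φ => ∃' ((sLe (&0) (&(Fin.last (n + 2))) ⊓ sLe (&(Fin.last (n + 2))) (&1)) ⊓
      (sLe (&(Fin.last (n + 2))) (&v.succ.succ.castSucc) ⊓ φ.toScat))

/-- The segment from `a = x₀` to `z = x₁` is a number that has a witness of `δ` below `z`. -/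
noncomputable def witnessBody (δ : PureDelta 1) : scatLang.BoundedFormula Empty 2 :=
  (BoundedFormula.relabel Sum.inr scatModelsTN : scatLang.BoundedFormula Empty 2) ⊓
    ∃' ((sLe (&0) (&2) ⊓ sLt (&2) (&1)) ⊓ δ.toScat)

/-- Some segment is a number that has a witness of `δ` below its largest element. -/
noncomputable def witnessSentence (δ : PureDelta 1) : scatLang.Sentence :=
  ∃' ∃' (witnessBody δ)

section
variable {M : Type} [scatLang.Structure M] {a z : M} {N : Type} [arith.Structure N] {e : N → M}

theorem IsSegment.exists_top (h : IsSegment a z N e) : ∃ t, e t = z := by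
  have : inSeg a z a := (h.range a).2 ⟨_, h.zero⟩
  exact (h.range z).1 ⟨this.2, .inr rfl⟩

theorem IsSegment.top_not_less (h : IsSegment a z N e) (hN : IsTN N) {t : N} (ht : e t = z) (x : N) :
    ¬ less t x := by
  intro hx
  rcases ((h.range (e x)).2 ⟨x, rfl⟩).2 with h1 | h1
  · rw [← ht, h.lt] at h1
    exact hN.asymm h1 hx
  · rw [← ht] at h1
    exact hN.irrefl t (by rwa [h.inj h1] at hx)

/-- Below the largest element, the cut-off graph of an operation is its graph. -/
theorem IsSegment.rel_iff (h : IsSegment a z N e) (hN : IsTN N) {t : N} (ht : e t = z) {n : ℕ}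
    (f : ArithFunc (n + 1)) (d : Fin (n + 1) → N) {w : N} (hw : less w t) :
    Structure.RelMap (L := scatLang) (relOfFunc f) (Fin.snoc (fun i => e (d i)) (e w)) ↔
      w = Structure.funMap (L := arith) (M := N) f d := by
  rw [← h.op, CutGraph]
  have h1 : e w ≠ z := fun h1 => hN.irrefl t (by rwa [h.inj (h1.trans ht.symm)] at hw)
  have h2 : inSeg a z (e w) := (h.range _).2 ⟨w, rfl⟩
  constructor
  · exact fun h3 => .inl ⟨⟨_, h2, h3⟩, h3⟩
  · rintro (h3 | h3)
    · exact h3.2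
    · exact (h1 h3.2).elim

theorem IsSegment.realize_toScat (h : IsSegment a z N e) (hN : IsTN N) {t : N} (ht : e t = z) :
    ∀ {n : ℕ} (δ : PureDelta n) (v : Fin n → N) (xs : Fin (n + 2) → M), xs 0 = a → xs 1 = z →
      (∀ i, xs i.succ.succ = e (v i)) → (∀ i, less (v i) t) →
      (δ.toScat.Realize default xs ↔ δ.Holds N v)
  | _, .bot, v, xs, ha, hz, hx, hv => Iff.rfl
  | _, .top, v, xs, ha, hz, hx, hv => by simp [PureDelta.toScat, PureDelta.Holds]
  | _, .lt a b, v, xs, ha, hz, hx, hv => by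
    simp [PureDelta.toScat, PureDelta.Holds, hx, h.lt]
  | _, .zero a, v, xs, ha, hz, hx, hv => by
    simp [PureDelta.toScat, PureDelta.Holds, hx, ha, ← h.zero, h.inj.eq_iff]
  | _, .succ a b, v, xs, ha, hz, hx, hv => by
    simp only [PureDelta.toScat, PureDelta.Holds, realize_sSucc, Term.realize_var,
      Function.comp_apply, Sum.elim_inr, hx]
    rw [eq_comm]
    refine Iff.trans ?_ (h.rel_iff hN ht .succ ![v a] (hv b))
    refine iff_of_eq (congrArg (Structure.RelMap (L := scatLang) (M := M) ScatRel.succ)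
      (funext fun i => ?_))
    fin_cases i <;> rfl
  | _, .add a b c, v, xs, ha, hz, hx, hv => by
    refine Iff.trans ?_ ((h.rel_iff hN ht .add ![v a, v b] (hv c)).trans eq_comm)
    refine iff_of_eq (congrArg (Structure.RelMap (L := scatLang) (M := M) ScatRel.add)
      (funext fun i => ?_))
    fin_cases i
    · exact hx a
    · exact hx b
    · exact hx c
  | _, .mul a b c, v, xs, ha, hz, hx, hv => by
    refine Iff.trans ?_ ((h.rel_iff hN ht .mul ![v a, v b] (hv c)).trans eq_comm)
    refine iff_of_eq (congrArg (Structure.RelMap (L := scatLang) (M := M) ScatRel.mul)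
      (funext fun i => ?_))
    fin_cases i
    · exact hx a
    · exact hx b
    · exact hx c
  | _, .neg φ, v, xs, ha, hz, hx, hv => by
    simp [PureDelta.toScat, PureDelta.Holds, h.realize_toScat hN ht φ v xs ha hz hx hv]
  | _, .and φ ψ, v, xs, ha, hz, hx, hv => by
    simp [PureDelta.toScat, PureDelta.Holds, h.realize_toScat hN ht φ v xs ha hz hx hv,
      h.realize_toScat hN ht ψ v xs ha hz hx hv]
  | _, .or φ ψ, v, xs, ha, hz, hx, hv => by
    simp [PureDelta.toScat, PureDelta.Holds, h.realize_toScat hN ht φ v xs ha hz hx hv,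
      h.realize_toScat hN ht ψ v xs ha hz hx hv]
  | _, .imp φ ψ, v, xs, ha, hz, hx, hv => by
    simp [PureDelta.toScat, PureDelta.Holds, h.realize_toScat hN ht φ v xs ha hz hx hv,
      h.realize_toScat hN ht ψ v xs ha hz hx hv]
  | n, .allLt b φ, v, xs, ha, hz, hx, hv => by
    have hs0 (m : M) : (Fin.snoc xs m : Fin (n + 3) → M) 0 = a := ha
    have hs1 (m : M) : (Fin.snoc xs m : Fin (n + 3) → M) 1 = z := hz
    have key (y : N) (hy : less y t) := h.realize_toScat hN ht φ (Fin.snoc v y)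
      (Fin.snoc xs (e y)) (hs0 _) (hs1 _)
      (Fin.lastCases (by rw [Fin.snoc_last]; exact Fin.snoc_last (α := fun _ => M) _ _) fun i => by
        rw [Fin.snoc_castSucc, ← hx]; exact Fin.snoc_castSucc (α := fun _ => M) _ _ i.succ.succ)
      (Fin.lastCases (by simpa using hy) (by simpa using hv))
    have hl : ∀ y, less y (v b) → less y t := fun y hy => hN.trans _ _ _ hy (hv b)
    simp only [PureDelta.toScat, PureDelta.Holds, BoundedFormula.realize_all,
      BoundedFormula.realize_imp, BoundedFormula.realize_inf, realize_sLe, realize_sLt,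
      Term.realize_var, Function.comp_apply, Sum.elim_inr, Fin.snoc_last, Fin.snoc_castSucc,
      hs0, hs1, hx]
    constructor
    · intro H y hy
      exact (key y (hl y hy)).1 (H (e y) ((h.range _).2 ⟨y, rfl⟩) ((h.lt _ _).2 hy))
    · intro H m hm h1
      obtain ⟨y, rfl⟩ := (h.range m).1 hm
      exact (key y (hl y ((h.lt _ _).1 h1))).2 (H y ((h.lt _ _).1 h1))
  | n, .exLt b φ, v, xs, ha, hz, hx, hv => by
    have hs0 (m : M) : (Fin.snoc xs m : Fin (n + 3) → M) 0 = a := ha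
    have hs1 (m : M) : (Fin.snoc xs m : Fin (n + 3) → M) 1 = z := hz
    have key (y : N) (hy : less y t) := h.realize_toScat hN ht φ (Fin.snoc v y)
      (Fin.snoc xs (e y)) (hs0 _) (hs1 _)
      (Fin.lastCases (by rw [Fin.snoc_last]; exact Fin.snoc_last (α := fun _ => M) _ _) fun i => by
        rw [Fin.snoc_castSucc, ← hx]; exact Fin.snoc_castSucc (α := fun _ => M) _ _ i.succ.succ)
      (Fin.lastCases (by simpa using hy) (by simpa using hv))
    have hl : ∀ y, less y (v b) → less y t := fun y hy => hN.trans _ _ _ hy (hv b)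
    simp only [PureDelta.toScat, PureDelta.Holds, BoundedFormula.realize_ex,
      BoundedFormula.realize_inf, realize_sLe, realize_sLt,
      Term.realize_var, Function.comp_apply, Sum.elim_inr, Fin.snoc_last, Fin.snoc_castSucc,
      hs0, hs1, hx]
    constructor
    · rintro ⟨m, hm, h1, H⟩
      obtain ⟨y, rfl⟩ := (h.range m).1 hm
      exact ⟨y, (h.lt _ _).1 h1, (key y (hl y ((h.lt _ _).1 h1))).1 H⟩
    · rintro ⟨y, hy, H⟩
      exact ⟨e y, (h.range _).2 ⟨y, rfl⟩, (h.lt _ _).2 hy, (key y (hl y hy)).2 H⟩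
  | n, .allLe b φ, v, xs, ha, hz, hx, hv => by
    have hs0 (m : M) : (Fin.snoc xs m : Fin (n + 3) → M) 0 = a := ha
    have hs1 (m : M) : (Fin.snoc xs m : Fin (n + 3) → M) 1 = z := hz
    have key (y : N) (hy : less y t) := h.realize_toScat hN ht φ (Fin.snoc v y)
      (Fin.snoc xs (e y)) (hs0 _) (hs1 _)
      (Fin.lastCases (by rw [Fin.snoc_last]; exact Fin.snoc_last (α := fun _ => M) _ _) fun i => by
        rw [Fin.snoc_castSucc, ← hx]; exact Fin.snoc_castSucc (α := fun _ => M) _ _ i.succ.succ)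
      (Fin.lastCases (by simpa using hy) (by simpa using hv))
    have hl : ∀ y, less y (v b) ∨ y = v b → less y t := by
      rintro y (hy | rfl)
      · exact hN.trans _ _ _ hy (hv b)
      · exact hv b
    simp only [PureDelta.toScat, PureDelta.Holds, BoundedFormula.realize_all,
      BoundedFormula.realize_imp, BoundedFormula.realize_inf, realize_sLe,
      Term.realize_var, Function.comp_apply, Sum.elim_inr, Fin.snoc_last, Fin.snoc_castSucc,
      hs0, hs1, hx]
    have hle : ∀ y, sle (e y) (e (v b)) ↔ less y (v b) ∨ y = v b := fun y => by
      rw [sle, h.lt, h.inj.eq_iff]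
    constructor
    · intro H y hy
      exact (key y (hl y hy)).1 (H (e y) ((h.range _).2 ⟨y, rfl⟩) ((hle _).2 hy))
    · intro H m hm h1
      obtain ⟨y, rfl⟩ := (h.range m).1 hm
      exact (key y (hl y ((hle _).1 h1))).2 (H y ((hle _).1 h1))
  | n, .exLe b φ, v, xs, ha, hz, hx, hv => by
    have hs0 (m : M) : (Fin.snoc xs m : Fin (n + 3) → M) 0 = a := ha
    have hs1 (m : M) : (Fin.snoc xs m : Fin (n + 3) → M) 1 = z := hz
    have key (y : N) (hy : less y t) := h.realize_toScat hN ht φ (Fin.snoc v y)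
      (Fin.snoc xs (e y)) (hs0 _) (hs1 _)
      (Fin.lastCases (by rw [Fin.snoc_last]; exact Fin.snoc_last (α := fun _ => M) _ _) fun i => by
        rw [Fin.snoc_castSucc, ← hx]; exact Fin.snoc_castSucc (α := fun _ => M) _ _ i.succ.succ)
      (Fin.lastCases (by simpa using hy) (by simpa using hv))
    have hl : ∀ y, less y (v b) ∨ y = v b → less y t := by
      rintro y (hy | rfl)
      · exact hN.trans _ _ _ hy (hv b)
      · exact hv b
    simp only [PureDelta.toScat, PureDelta.Holds, BoundedFormula.realize_ex,
      BoundedFormula.realize_inf, realize_sLe,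
      Term.realize_var, Function.comp_apply, Sum.elim_inr, Fin.snoc_last, Fin.snoc_castSucc,
      hs0, hs1, hx]
    have hle : ∀ y, sle (e y) (e (v b)) ↔ less y (v b) ∨ y = v b := fun y => by
      rw [sle, h.lt, h.inj.eq_iff]
    constructor
    · rintro ⟨m, hm, h1, H⟩
      obtain ⟨y, rfl⟩ := (h.range m).1 hm
      exact ⟨y, (hle _).1 h1, (key y (hl y ((hle _).1 h1))).1 H⟩
    · rintro ⟨y, hy, H⟩
      exact ⟨e y, (h.range _).2 ⟨y, rfl⟩, (hle _).2 hy, (key y (hl y hy)).2 H⟩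

theorem realize_witnessBody (δ : PureDelta 1) (xs : Fin 2 → M) :
    (witnessBody δ).Realize default xs ↔ ∃ (N : Type) (_ : arith.Structure N) (e : N → M),
      IsSegment (xs 0) (xs 1) N e ∧ IsTN N ∧
      ∃ t x, e t = xs 1 ∧ less x t ∧ δ.Holds N fun _ => x := by
  have hxs : xs = ![xs 0, xs 1] := funext fun i => by fin_cases i <;> rfl
  have h0 : ∀ x : M, (Fin.snoc xs x : Fin 3 → M) 0 = xs 0 := fun _ => rfl
  have h1 : ∀ x : M, (Fin.snoc xs x : Fin 3 → M) 1 = xs 1 := fun _ => rfl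
  have h2 : ∀ x : M, (Fin.snoc xs x : Fin 3 → M) 2 = x := fun _ => rfl
  simp only [witnessBody, BoundedFormula.realize_inf, BoundedFormula.realize_ex, realize_sLe,
    realize_sLt, Formula.realize_relabel_sumInr, Term.realize_var, Function.comp_apply,
    Sum.elim_inr, h0, h1, h2]
  have htop : ∀ (N : Type) [arith.Structure N] (e : N → M) (_ : IsSegment (xs 0) (xs 1) N e)
      (_ : IsTN N) (t x : N), e t = xs 1 → less x t →
      (δ.toScat.Realize default (Fin.snoc xs (e x)) ↔ δ.Holds N fun _ => x) := by
    intro N _ e h hN t x ht hx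
    refine h.realize_toScat hN ht δ (fun _ => x) _ (h0 _) (h1 _) (fun i => ?_) fun _ => hx
    fin_cases i
    rfl
  constructor
  · rintro ⟨hC, m, ⟨hm1, hm2⟩, hδ⟩
    rw [hxs] at hC
    obtain ⟨N, _, e, h, hN⟩ := realize_scatModelsTN_iff.1 hC
    obtain ⟨x, rfl⟩ := (h.range m).1 ⟨hm1, .inl hm2⟩
    obtain ⟨t, ht⟩ := h.exists_top
    have hx : less x t := by rwa [← ht, h.lt] at hm2
    exact ⟨N, _, e, h, hN, t, x, ht, hx, (htop N e h hN t x ht hx).1 hδ⟩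
  · rintro ⟨N, _, e, h, hN, t, x, ht, hx, hδ⟩
    refine ⟨?_, e x, ⟨((h.range (e x)).2 ⟨x, rfl⟩).1, ?_⟩, (htop N e h hN t x ht hx).2 hδ⟩
    · rw [hxs]
      exact realize_scatModelsTN_iff.2 ⟨N, _, e, h, hN⟩
    · rw [← ht, h.lt]
      exact hx

theorem models_witnessSentence (δ : PureDelta 1) : M ⊨ witnessSentence δ ↔
    ∃ xs : Fin 2 → M, (witnessBody δ).Realize default xs := by
  simp only [witnessSentence, Sentence.Realize, Formula.Realize, BoundedFormula.realize_ex]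
  constructor
  · rintro ⟨a, z, h⟩
    exact ⟨_, h⟩
  · rintro ⟨xs, h⟩
    refine ⟨xs 0, xs 1, ?_⟩
    convert h using 1
    funext i
    fin_cases i <;> rfl

/-- A true `Σ⁰₁`-sentence has its witness in some scattered number. -/
theorem PAscat_models_witness (hM : M ⊨ PAscat) {δ : PureDelta 1} {j : ℕ}
    (hj : δ.Holds ℕ fun _ => j) : M ⊨ witnessSentence δ := by
  obtain ⟨a, ha⟩ := BoundedFormula.realize_ex.1 (hM.realize_of_mem _ ⟨j + 1, rfl⟩)
  obtain ⟨⟨z, -, ⟨ys, hy0, hy, hsucc⟩, hC⟩, -⟩ := (realize_tildeNum _ _ _).1 ha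
  change ys 0 = a at hy0
  change ∀ i, sle a (ys i) ∧ slt (ys i) z at hy
  change scatModelsTN.Realize ![a, z] at hC
  obtain ⟨N, _, e, h, hN⟩ := realize_scatModelsTN_iff.1 hC
  obtain ⟨t, ht⟩ := h.exists_top
  have hnum : ∀ i : Fin (j + 2), ys i = e (num N i) := by
    intro i
    induction i using Fin.induction with
    | zero => rw [hy0, ← h.zero]; rfl
    | succ i ih =>
      obtain ⟨w, hw⟩ := (h.range (ys i.succ)).1 ⟨(hy _).1, .inl (hy _).2⟩
      have hwt : less w t := by
        have := (hy i.succ).2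
        rwa [← hw, ← ht, h.lt] at this
      rw [← hw, (h.rel_iff hN ht .succ ![num N i] hwt).1]
      · rfl
      · refine (congrArg (Structure.RelMap (L := scatLang) (M := M) ScatRel.succ)
          (funext fun k => ?_)).mp (hsucc i)
        fin_cases k
        · exact ih
        · exact hw.symm
  have hlt : ∀ i < j + 2, less (num N i) t := by
    intro i hi
    have := (hy ⟨i, hi⟩).2
    rwa [hnum, ← ht, h.lt] at this
  refine (models_witnessSentence δ).2 ⟨![a, z], (realize_witnessBody δ _).2
    ⟨N, _, e, h, hN, t, num N j, ht, hlt j (by omega), ?_⟩⟩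
  exact (hN.holds_iff (k := j + 1) (fun i hi => (hN.lt_suc _ _ (hlt i (by omega))).1) δ
    (fun _ => j) fun _ => by omega).2 hj

end

/-- The cut-off translation, with the pairs of end points of numbers with a witness of `δ` as its
parameter domain. -/
noncomputable def witnessTrans (δ : PureDelta 1) : Translation arith scatLang :=
  { scatTrans with
    paramDom := ((witnessBody δ).toFormula.relabel (Sum.elim Empty.elim id) :
      scatLang.Formula (Fin 2)) }

/-- If `V` proves that some number has a witness of `δ`, and all numbers with a witness of `δ` below
their largest element are models of `U`, then `V` interprets `U`. -/
theorem interprets_of_witness (pw : Prop) (δ : PureDelta 1) (V : scatLang.Theory) (U : arith.Theory)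
    (hV : witnessSentence δ ∈ V)
    (hU : ∀ (N : Type) [arith.Structure N], IsTN N → ∀ t x : N, (∀ y, ¬ less t y) → less x t →
      (δ.Holds N fun _ => x) → N ⊨ U) : Interprets pw V U := by
  have hdom : ∀ (M : Type) [scatLang.Structure M] (p : Fin 2 → M),
      (witnessTrans δ).paramDom.Realize p ↔ (witnessBody δ).Realize default p := by
    intro M _ p
    refine Formula.realize_relabel.trans ((BoundedFormula.realize_toFormula _ _).trans
      (iff_of_eq (congrArg₂ _ ?_ ?_)))
    · exact Subsingleton.elim _ _
    · rfl
  refine ⟨witnessTrans δ, .inr rfl, ?_, ?_⟩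
  · rw [Theory.models_sentence_iff]
    intro M
    refine Formula.realize_iExs.2 ?_
    obtain ⟨p, hp⟩ := (models_witnessSentence δ).1 (M.is_model.realize_of_mem _ hV)
    refine ⟨p, Formula.realize_relabel.2 ?_⟩
    exact (hdom M p).2 hp
  · intro φ hφ
    rw [Theory.models_formula_iff]
    intro M (p : Fin 2 → M)
    refine Formula.realize_imp.2 fun hp => ?_
    obtain ⟨N, _, e, h, hN, t, x, ht, hx, hδ⟩ := (realize_witnessBody δ p).1 ((hdom M p).1 hp)
    have : N ⊨ U := hU N hN t x (h.top_not_less hN ht) hx hδ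
    have : Nonempty N := ⟨t⟩
    have hNφ : N ⊨ φ := hφ.realize_sentence N
    have := (h.realize_sentence φ).2 hNφ
    have hpp : p = ![p (0 : Fin 2), p (1 : Fin 2)] :=
      funext fun (i : Fin 2) => by fin_cases i <;> rfl
    rw [hpp]
    refine ((witnessTrans δ).realize_sentence _ φ).2 ?_
    exact (scatTrans.realize_sentence _ φ).1 this

end LaxInt

namespace LaxInt

/-! ### Recursively enumerable predicates -/

section RecursivelyEnumerable
variable {α β γ : Type} [Primcodable α] [Primcodable β] [Primcodable γ]

theorem rePred_of_exists {q : α → ℕ → Prop} (hq : PrimrecRel q) : REPred fun a => ∃ n, q a n := by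
  classical
  have h : Partrec fun a => Nat.rfind fun n => Part.some (decide (q a n)) :=
    Partrec.rfind (p := fun a n => (Part.some (decide (q a n)) : Part Bool))
      (hq.decide.to_comp).partrec
  refine h.dom_re.of_eq fun a => ?_
  refine (Nat.rfind_dom' (p := fun n => Part.some (decide (q a n)))).trans ?_
  simp

/-- The projection theorem: a predicate is recursively enumerable when it says that a primitive
recursive relation has a witness. -/
theorem rePred_iff_exists {p : α → Prop} :
    REPred p ↔ ∃ q : α → ℕ → Prop, PrimrecRel q ∧ ∀ a, p a ↔ ∃ n, q a n := by
  constructor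
  · intro h
    obtain ⟨c, hc⟩ := Nat.Partrec.Code.exists_code.1 h
    refine ⟨fun a n => (Nat.Partrec.Code.evaln n c (Encodable.encode a)).isSome = true, ?_, ?_⟩
    · refine Primrec.eq.comp (Primrec.option_isSome.comp
        (Nat.Partrec.Code.primrec_evaln.comp (((Primrec.snd).pair (Primrec.const c)).pair
          (Primrec.encode.comp Primrec.fst)))) (Primrec.const true)
    · intro a
      have h1 : (c.eval (Encodable.encode a)).Dom ↔ p a := by
        rw [hc]
        simp [Part.assert]
      rw [← h1, Part.dom_iff_mem]
      constructor
      · rintro ⟨y, hy⟩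
        obtain ⟨k, hk⟩ := Nat.Partrec.Code.evaln_complete.1 hy
        exact ⟨k, Option.isSome_iff_exists.2 ⟨y, hk⟩⟩
      · rintro ⟨k, hk⟩
        obtain ⟨y, hy⟩ := Option.isSome_iff_exists.1 hk
        exact ⟨y, Nat.Partrec.Code.evaln_sound hy⟩
  · rintro ⟨q, hq, h⟩
    exact (rePred_of_exists hq).of_eq fun a => (h a).symm

theorem rePred_iff_enum {p : α → Prop} :
    REPred p ↔ ∃ e : ℕ → Option α, Primrec e ∧ ∀ a, p a ↔ ∃ n, e n = some a := by
  classical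
  constructor
  · intro h
    obtain ⟨q, hq, h⟩ := rePred_iff_exists.1 h
    refine ⟨fun n => (Encodable.decode (α := α) n.unpair.1).bind fun a =>
      if q a n.unpair.2 then some a else none, ?_, fun a => ?_⟩
    · refine Primrec.option_bind (Primrec.decode.comp (Primrec.fst.comp Primrec.unpair)) ?_
      refine Primrec.ite ?_ (Primrec.option_some.comp Primrec.snd) (Primrec.const none)
      exact hq.comp Primrec.snd (Primrec.snd.comp (Primrec.unpair.comp Primrec.fst))
    · rw [h]
      constructor
      · rintro ⟨n, hn⟩
        exact ⟨Nat.pair (Encodable.encode a) n, by simp [hn]⟩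
      · rintro ⟨n, hn⟩
        obtain ⟨b, -, hb⟩ := Option.bind_eq_some_iff.1 hn
        split_ifs at hb with hq
        cases hb
        exact ⟨_, hq⟩
  · rintro ⟨e, he, h⟩
    refine (rePred_of_exists (q := fun a n => e n = some a) ?_).of_eq fun a => (h a).symm
    exact Primrec.eq.comp (he.comp Primrec.snd) (Primrec.option_some.comp Primrec.fst)

theorem PrimrecPred.rePred {p : α → Prop} (h : PrimrecPred p) : REPred p :=
  (ComputablePred.to_re (by obtain ⟨_, h⟩ := h; exact ⟨_, h.to_comp⟩))

theorem rePred_comp {p : β → Prop} (hp : REPred p) {f : α → β} (hf : Computable f) :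
    REPred fun a => p (f a) :=
  Partrec.comp hp hf

theorem rePred_exists {p : α × β → Prop} (hp : REPred p) : REPred fun a => ∃ b, p (a, b) := by
  obtain ⟨q, hq, h⟩ := rePred_iff_exists.1 hp
  classical
  refine (rePred_of_exists (q := fun a n => ∃ b ∈ (Encodable.decode (α := β) n.unpair.1).toList,
    q (a, b) n.unpair.2) ?_).of_eq fun a => ?_
  · have : PrimrecRel fun (b : β) (x : α × ℕ) => q (x.1, b) x.2.unpair.2 :=
      hq.comp ((Primrec.fst.comp Primrec.snd).pair Primrec.fst)
        (Primrec.snd.comp (Primrec.unpair.comp (Primrec.snd.comp Primrec.snd)))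
    exact this.exists_mem_list.comp (Primrec.optionToList.comp
      (Primrec.decode.comp (Primrec.fst.comp (Primrec.unpair.comp Primrec.snd)))) Primrec.id
  · constructor
    · rintro ⟨n, b, -, hb⟩
      exact ⟨b, (h _).2 ⟨_, hb⟩⟩
    · rintro ⟨b, hb⟩
      obtain ⟨n, hn⟩ := (h _).1 hb
      exact ⟨Nat.pair (Encodable.encode b) n, b, by simp, by simpa using hn⟩

theorem rePred_and {p q : α → Prop} (hp : REPred p) (hq : REPred q) :
    REPred fun a => p a ∧ q a := by
  obtain ⟨p', hp', h1⟩ := rePred_iff_exists.1 hp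
  obtain ⟨q', hq', h2⟩ := rePred_iff_exists.1 hq
  refine (rePred_of_exists (q := fun a n => p' a n.unpair.1 ∧ q' a n.unpair.2) ?_).of_eq fun a => ?_
  · exact PrimrecPred.and
      (hp'.comp Primrec.fst (Primrec.fst.comp (Primrec.unpair.comp Primrec.snd)))
      (hq'.comp Primrec.fst (Primrec.snd.comp (Primrec.unpair.comp Primrec.snd)))
  · rw [h1, h2]
    constructor
    · rintro ⟨n, h1, h2⟩
      exact ⟨⟨_, h1⟩, ⟨_, h2⟩⟩
    · rintro ⟨⟨n, h1⟩, ⟨m, h2⟩⟩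
      exact ⟨Nat.pair n m, by simpa using h1, by simpa using h2⟩

theorem rePred_or {p q : α → Prop} (hp : REPred p) (hq : REPred q) :
    REPred fun a => p a ∨ q a := by
  obtain ⟨p', hp', h1⟩ := rePred_iff_exists.1 hp
  obtain ⟨q', hq', h2⟩ := rePred_iff_exists.1 hq
  refine (rePred_of_exists (q := fun a n => p' a n ∨ q' a n) (PrimrecPred.or hp' hq')).of_eq
    fun a => ?_
  rw [h1, h2, exists_or]

theorem rePred_false : REPred fun _ : α => False :=
  (rePred_of_exists (q := fun (_ : α) (_ : ℕ) => False)
    ⟨fun _ => .isFalse id, (Primrec.const false).of_eq fun _ => rfl⟩).of_eq fun _ => by simp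

/-- The image of a recursively enumerable set under a computable function is recursively
enumerable. -/
theorem rePred_image {p : α → Prop} (hp : REPred p) {f : α → β} (hf : Computable f) :
    REPred fun b => ∃ a, p a ∧ f a = b := by
  have h : REPred fun x : β × β => x.1 = x.2 := PrimrecPred.rePred Primrec.eq
  refine rePred_exists (p := fun x : β × α => p x.2 ∧ f x.2 = x.1) (rePred_and ?_ ?_)
  · exact rePred_comp hp Computable.snd
  · exact rePred_comp h ((hf.comp Computable.snd).pair Computable.fst)

theorem rePred_range {f : α → β} (hf : Computable f) : REPred fun b => ∃ a, f a = b := by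
  have h : REPred fun x : β × β => x.1 = x.2 := PrimrecPred.rePred Primrec.eq
  exact rePred_exists (p := fun x : β × α => f x.2 = x.1)
    (rePred_comp h ((hf.comp Computable.snd).pair Computable.fst))

theorem rePred_mem_finite {s : Set α} (hs : s.Finite) : REPred fun a => a ∈ s := by
  classical
  obtain ⟨s, rfl⟩ := hs.exists_finset_coe
  induction s using Finset.induction_on with
  | empty => exact rePred_false.of_eq fun a => by simp
  | insert b s _ ih =>
    refine (rePred_or (PrimrecPred.rePred (p := fun a : α => a = b)
      (Primrec.eq.comp Primrec.id (Primrec.const b))) (ih s.finite_toSet)).of_eq fun a => by simp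

/-- A finite union of recursively enumerable predicates is recursively enumerable, even if the index
is not treated as data. -/
theorem rePred_exists_finite {ι : Type*} [Finite ι] {p : ι → α → Prop} (hp : ∀ i, REPred (p i)) :
    REPred fun a => ∃ i, p i a := by
  classical
  have := Fintype.ofFinite ι
  suffices h : ∀ s : Finset ι, REPred fun a => ∃ i ∈ s, p i a from
    (h Finset.univ).of_eq fun a => by simp
  intro s
  induction s using Finset.induction_on with
  | empty => exact rePred_false.of_eq fun a => by simp
  | insert b s _ ih => exact (rePred_or (hp b) ih).of_eq fun a => by simp

/-- The set of conclusions derivable from a set of rules; a rule is a list of premises with a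
conclusion. -/
inductive Der (S : List α × α → Prop) : α → Prop
  | mk (l : List α) (a : α) : S (l, a) → (∀ b ∈ l, Der S b) → Der S a

/-- The conclusions derivable from a recursively enumerable set of rules form a recursively
enumerable set. -/
theorem rePred_der {S : List α × α → Prop} (hS : REPred S) : REPred (Der S) := by
  classical
  obtain ⟨e, he, h⟩ := rePred_iff_enum.1 hS
  -- The stages of the closure; at stage `s` the rule with number `s.unpair.1` is tried, so that
  -- every rule is tried infinitely often.
  let step : ℕ → List α → List α := fun s D =>
    ((e s.unpair.1).map fun r : List α × α => if ∀ b ∈ r.1, b ∈ D then r.2 :: D else D).getD D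
  let D : ℕ → List α := fun s => Nat.rec [] step s
  have hD : Primrec D := by
    refine Primrec.nat_rec₁ [] ?_
    refine Primrec.option_getD.comp (Primrec.option_map
      (he.comp (Primrec.fst.comp (Primrec.unpair.comp Primrec.fst))) ?_) Primrec.snd
    refine Primrec.ite ?_ (Primrec.list_cons.comp (Primrec.snd.comp Primrec.snd)
      (Primrec.snd.comp Primrec.fst)) (Primrec.snd.comp Primrec.fst)
    have h1 : PrimrecRel fun (b : α) (D : List α) => b ∈ D :=
      (PrimrecRel.exists_mem_list (R := fun x b : α => x = b) Primrec.eq).swap.of_eq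
        fun b D => by simp [Function.swap]
    exact h1.forall_mem_list.comp (Primrec.fst.comp Primrec.snd) (Primrec.snd.comp Primrec.fst)
  have hsucc : ∀ s, D (s + 1) = step s (D s) := fun s => rfl
  have hmono1 : ∀ s a, a ∈ D s → a ∈ D (s + 1) := by
    intro s a ha
    rw [hsucc]
    simp only [step]
    rcases e s.unpair.1 with _ | r
    · exact ha
    · simp only [Option.map_some, Option.getD_some]
      rcases Classical.em (∀ b : α, b ∈ r.1 → b ∈ D s) with hc | hc
      · rw [if_pos hc]
        exact List.mem_cons_of_mem _ ha
      · rwa [if_neg hc]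
  have hmono : ∀ s t a, s ≤ t → a ∈ D s → a ∈ D t := by
    intro s t a hst ha
    induction hst with
    | refl => exact ha
    | step _ ih => exact hmono1 _ _ ih
  have hmem : REPred fun a => ∃ s, a ∈ D s := by
    refine rePred_of_exists (q := fun a s => a ∈ D s) ?_
    exact (PrimrecRel.exists_mem_list (R := fun x b : α => x = b) Primrec.eq).comp
      (hD.comp Primrec.snd) Primrec.fst |>.of_eq fun x => by simp
  refine hmem.of_eq fun a => ⟨?_, ?_⟩
  · rintro ⟨s, hs⟩
    induction s generalizing a with
    | zero => simp [D] at hs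
    | succ s ih =>
      rw [hsucc] at hs
      simp only [step] at hs
      rcases hr : e s.unpair.1 with _ | r
      · rw [hr] at hs
        exact ih a hs
      · rw [hr] at hs
        simp only [Option.map_some, Option.getD_some] at hs
        rcases Classical.em (∀ b : α, b ∈ r.1 → b ∈ D s) with hc | hc
        · rw [if_pos hc] at hs
          rcases List.mem_cons.1 hs with rfl | hs
          · exact Der.mk r.1 r.2 ((h _).2 ⟨_, hr⟩) fun b hb => ih b (hc b hb)
          · exact ih a hs
        · rw [if_neg hc] at hs
          exact ih a hs
  · intro ha
    induction ha with
    | mk l a hl _ ih =>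
      obtain ⟨k, hk⟩ := (h _).1 hl
      have : ∃ m, ∀ b ∈ l, b ∈ D m := by
        clear hl hk
        induction l with
        | nil => exact ⟨0, by simp⟩
        | cons c l ihl =>
          obtain ⟨m, hm⟩ := ihl (fun b hb => by solve_by_elim [List.mem_cons_of_mem])
            (fun b hb => ih b (List.mem_cons_of_mem _ hb))
          obtain ⟨s, hs⟩ := ih c List.mem_cons_self
          refine ⟨max m s, fun b hb => ?_⟩
          rcases List.mem_cons.1 hb with rfl | hb
          · exact hmono _ _ _ (le_max_right _ _) hs
          · exact hmono _ _ _ (le_max_left _ _) (hm b hb)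
      obtain ⟨m, hm⟩ := this
      refine ⟨Nat.pair k m + 1, ?_⟩
      rw [hsucc]
      simp only [step, Nat.unpair_pair, hk, Option.map_some, Option.getD_some]
      rw [if_pos fun b hb => hmono _ _ _ (Nat.right_le_pair k m) (hm b hb)]
      exact List.mem_cons_self

end RecursivelyEnumerable

end LaxInt

namespace LaxInt

/-! ### Semantic trees -/

/-- A finite initial segment `p` of a valuation makes all literals of the clause `c` false. A literal
is an atom with the truth value that it asks for. -/
def Falsifies (p : List Bool) (c : List (ℕ × Bool)) : Prop :=
  ∀ x ∈ c, p[x.1]? = some (!x.2)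

theorem primrecRel_falsifies : PrimrecRel Falsifies := by
  have h : PrimrecRel fun (x : ℕ × Bool) (p : List Bool) => p[x.1]? = some (!x.2) :=
    Primrec.eq.comp (Primrec.list_getElem?.comp Primrec.snd (Primrec.fst.comp Primrec.fst))
      (Primrec.option_some.comp (Primrec.not.comp (Primrec.snd.comp Primrec.fst)))
  exact h.forall_mem_list.swap

/-- The rules that close nodes of the semantic tree of a set of clauses: a node is closed when it
falsifies a clause, or when both its children are closed. -/
def treeRules (C : ℕ × List (ℕ × Bool) → Prop) (r : List (ℕ × List Bool) × (ℕ × List Bool)) : Prop :=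
  (r.1 = [] ∧ ∃ c, C (r.2.1, c) ∧ Falsifies r.2.2 c) ∨
    r.1 = [(r.2.1, r.2.2 ++ [true]), (r.2.1, r.2.2 ++ [false])]

theorem rePred_treeRules {C : ℕ × List (ℕ × Bool) → Prop} (hC : REPred C) :
    REPred (treeRules C) := by
  refine rePred_or (rePred_and ?_ (rePred_exists (p := fun x :
    (List (ℕ × List Bool) × (ℕ × List Bool)) × List (ℕ × Bool) =>
      C (x.1.2.1, x.2) ∧ Falsifies x.1.2.2 x.2) (rePred_and ?_ ?_))) ?_
  · exact PrimrecPred.rePred (Primrec.eq.comp Primrec.fst (Primrec.const []))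
  · exact rePred_comp hC ((Computable.fst.comp (Computable.snd.comp Computable.fst)).pair
      Computable.snd)
  · exact PrimrecPred.rePred (primrecRel_falsifies.comp
      (Primrec.snd.comp (Primrec.snd.comp Primrec.fst)) Primrec.snd)
  · have h : ∀ b, Primrec fun x : List (ℕ × List Bool) × (ℕ × List Bool) =>
        (x.2.1, x.2.2 ++ [b]) := fun b =>
      (Primrec.fst.comp Primrec.snd).pair (Primrec.list_append.comp (Primrec.snd.comp Primrec.snd)
        (Primrec.const [b]))
    exact PrimrecPred.rePred (Primrec.eq.comp Primrec.fst (Primrec.list_cons.comp (h true)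
      (Primrec.list_cons.comp (h false) (Primrec.const []))))

theorem not_exists_valuation_iff_der {C : ℕ × List (ℕ × Bool) → Prop} (k : ℕ) :
    (¬∃ v : ℕ → Bool, ∀ c, C (k, c) → ∃ x ∈ c, v x.1 = x.2) ↔ Der (treeRules C) (k, []) := by
  constructor
  · intro h
    by_contra hD
    apply h
    have step : ∀ p : List Bool, ¬Der (treeRules C) (k, p) →
        ∃ b, ¬Der (treeRules C) (k, p ++ [b]) := by
      intro p hp
      by_contra hb
      push Not at hb
      refine hp (Der.mk [(k, p ++ [true]), (k, p ++ [false])] _ (Or.inr rfl) fun q hq => ?_)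
      simp only [List.mem_cons, List.not_mem_nil, or_false] at hq
      rcases hq with rfl | rfl
      · exact hb true
      · exact hb false
    choose! next hnext using step
    let q : ℕ → List Bool := fun n => Nat.rec [] (fun _ p => p ++ [next p]) n
    have hqs : ∀ n, q (n + 1) = q n ++ [next (q n)] := fun n => rfl
    have hq : ∀ n, ¬Der (treeRules C) (k, q n) := by
      intro n
      induction n with
      | zero => exact hD
      | succ n ih => exact hnext _ ih
    have hv : ∀ n, q n = (List.range n).map fun i => next (q i) := by
      intro n
      induction n with
      | zero => rfl
      | succ n ih => rw [hqs, List.range_succ, List.map_append, ← ih]; rfl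
    refine ⟨fun i => next (q i), fun c hc => ?_⟩
    by_contra hx
    push Not at hx
    obtain ⟨N, hN⟩ : ∃ N, ∀ x ∈ c, x.1 < N :=
      ⟨(c.map Prod.fst).sum + 1, fun x hx => Nat.lt_succ_of_le
        (List.single_le_sum (by simp) _ (List.mem_map_of_mem hx))⟩
    refine hq N (Der.mk [] _ (Or.inl ⟨rfl, c, hc, fun x hxc => ?_⟩) (by simp))
    have h1 := hx x hxc
    have h2 := hN x hxc
    simp only [hv N, List.getElem?_map, List.getElem?_range h2, Option.map_some]
    congr 1
    revert h1
    cases next (q x.1) <;> cases x.2 <;> simp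
  · rintro hD ⟨v, hv⟩
    suffices h : ∀ y, Der (treeRules C) y → y.1 = k →
        (∀ (i : ℕ) (b : Bool), y.2[i]? = some b → b = v i) → False from
      h _ hD rfl (by simp)
    intro y hy
    induction hy with
    | mk l y hl _ ih =>
      rintro rfl hp
      rcases hl with ⟨-, c, hc, hf⟩ | hl
      · obtain ⟨x, hx, hvx⟩ := hv c hc
        have := hp _ _ (hf x hx)
        rw [hvx] at this
        cases h : x.2 <;> simp [h] at this
      · simp only at hl
        refine ih (y.1, y.2 ++ [v y.2.length]) ?_ rfl ?_
        · rw [hl]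
          cases v y.2.length <;> simp
        · intro i b hb
          rw [List.getElem?_append] at hb
          split_ifs at hb with hi
          · exact hp i b hb
          · rw [List.getElem?_singleton] at hb
            split_ifs at hb with h0
            cases hb
            congr 1
            omega

/-- Propositional compactness, effectively: unsatisfiability of a recursively enumerable set of
clauses is recursively enumerable, uniformly in a parameter. -/
theorem rePred_unsatisfiable {C : ℕ × List (ℕ × Bool) → Prop} (hC : REPred C) :
    REPred fun k => ¬∃ v : ℕ → Bool, ∀ c, C (k, c) → ∃ x ∈ c, v x.1 = x.2 :=
  (rePred_comp (rePred_der (rePred_treeRules hC)) (f := fun k : ℕ => (k, ([] : List Bool)))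
    (Computable.id.pair (Computable.const []))).of_eq fun k => (not_exists_valuation_iff_der k).symm

end LaxInt

namespace LaxInt

/-! ### Henkin valuations -/

section Henkin
variable {L : FirstOrder.Language.{0, 0}}

/-- The variable that a term of a relational language is. -/
theorem exists_eq_var [L.IsRelational] {n : ℕ} (t : L.Term (Empty ⊕ Fin n)) :
    ∃ i : Fin n, t = Term.var (Sum.inr i) := by
  cases t with
  | var x =>
    rcases x with x | i
    · exact x.elim
    · exact ⟨i, rfl⟩
  | func f ts => exact isEmptyElim f

variable [Encodable (Σ n, L.Relations n)] {M : Type} [L.Structure M]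

/-- Satisfaction in a structure, as a relation between Gödel numbers of formulas of a relational
language and lists of elements. The element `d` is the value of variables beyond the list. -/
def CodeSat (L : FirstOrder.Language.{0, 0}) [Encodable (Σ n, L.Relations n)]
    {M : Type} [L.Structure M] (d : M) (k : ℕ) (a : List M) : Prop :=
  if k.unpair.1 = 1 then
    a.getD k.unpair.2.unpair.1.unpair.2 d = a.getD k.unpair.2.unpair.2.unpair.2 d
  else if k.unpair.1 = 2 then
    ∃ (s : Σ n, L.Relations n) (l : Fin s.1 → ℕ), Encodable.encode s = k.unpair.2.unpair.1 ∧
      Encodable.encode (List.ofFn l) = k.unpair.2.unpair.2 ∧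
      Structure.RelMap s.2 fun i => a.getD (l i).unpair.2 d
  else if h : k.unpair.1 = 3 then
    have : k.unpair.2 < k := by
      have := Nat.add_le_pair k.unpair.1 k.unpair.2
      rw [Nat.pair_unpair] at this
      omega
    have := Nat.unpair_left_le k.unpair.2
    have := Nat.unpair_right_le k.unpair.2
    CodeSat L d k.unpair.2.unpair.1 a → CodeSat L d k.unpair.2.unpair.2 a
  else if h : k.unpair.1 = 4 then
    have : k.unpair.2 < k := by
      have := Nat.add_le_pair k.unpair.1 k.unpair.2
      rw [Nat.pair_unpair] at this
      omega
    ∀ x : M, CodeSat L d k.unpair.2 (a ++ [x])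
  else False
termination_by k
decreasing_by all_goals omega

theorem codeSat_bot (d : M) (a : List M) : ¬CodeSat L d (Nat.pair 0 0) a := by
  rw [CodeSat]; simp

theorem codeSat_equal (d : M) (i j : ℕ) (a : List M) :
    CodeSat L d (Nat.pair 1 (Nat.pair (Nat.pair 0 i) (Nat.pair 0 j))) a ↔
      a.getD i d = a.getD j d := by
  rw [CodeSat]; simp

theorem codeSat_rel (d : M) {n : ℕ} (r : L.Relations n) (l : Fin n → ℕ) (a : List M) :
    CodeSat L d (Nat.pair 2 (Nat.pair (Encodable.encode (⟨n, r⟩ : Σ n, L.Relations n))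
      (Encodable.encode (List.ofFn l)))) a ↔
      Structure.RelMap r fun i => a.getD (l i).unpair.2 d := by
  rw [CodeSat]
  simp only [Nat.unpair_pair, if_true, Encodable.encode_inj]
  rw [if_neg (by decide)]
  constructor
  · rintro ⟨s, l', rfl, h2, h3⟩
    rw [List.ofFn_injective h2] at h3
    exact h3
  · intro h
    exact ⟨⟨n, r⟩, l, rfl, rfl, h⟩

theorem codeSat_imp (d : M) (k l : ℕ) (a : List M) :
    CodeSat L d (Nat.pair 3 (Nat.pair k l)) a ↔ (CodeSat L d k a → CodeSat L d l a) := by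
  rw [CodeSat]; simp

theorem codeSat_all (d : M) (k : ℕ) (a : List M) :
    CodeSat L d (Nat.pair 4 k) a ↔ ∀ x : M, CodeSat L d k (a ++ [x]) := by
  rw [CodeSat]; simp

theorem ofFn_snoc {α : Type} {n : ℕ} (e : Fin n → α) (x : α) :
    List.ofFn (Fin.snoc e x : Fin (n + 1) → α) = List.ofFn e ++ [x] := by
  rw [List.ofFn_succ']
  simp [List.concat_eq_append]

theorem getD_ofFn {α : Type} {n : ℕ} (e : Fin n → α) (i : Fin n) (d : α) :
    (List.ofFn e).getD i d = e i := by
  simp [List.getD]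

theorem realize_iff_codeSat [Encodable (Σ n, L.Functions n)] [L.IsRelational] (d : M) {n : ℕ} (φ : L.BoundedFormula Empty n)
    (v : Empty → M) (e : Fin n → M) :
    φ.Realize v e ↔ CodeSat L d (formulaCode φ) (List.ofFn e) := by
  induction φ with
  | falsum => simp only [formulaCode, codeSat_bot]; rfl
  | equal t u =>
    obtain ⟨i, rfl⟩ := exists_eq_var t
    obtain ⟨j, rfl⟩ := exists_eq_var u
    simp only [formulaCode, termCode, codeSat_equal, getD_ofFn]
    rfl
  | rel r ts =>
    choose τ hτ using fun i => exists_eq_var (ts i)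
    obtain rfl : ts = fun i => Term.var (Sum.inr (τ i)) := funext hτ
    simp only [formulaCode, termCode, codeSat_rel, Nat.unpair_pair, getD_ofFn]
    rfl
  | imp φ ψ ih1 ih2 => simp only [formulaCode, codeSat_imp, BoundedFormula.realize_imp, ih1, ih2]
  | all φ ih => simp only [formulaCode, codeSat_all, BoundedFormula.realize_all, ih, ofFn_snoc]

/-- The atom `(k, a)` of a Henkin valuation says that the formula with Gödel number `k` holds for the
elements listed in `a`; the elements are named by numbers. -/
def hAtom (k : ℕ) (a : List ℕ) : ℕ := Encodable.encode (k, a)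

/-- The Gödel number of `xᵢ = xⱼ`. -/
def eqCode (i j : ℕ) : ℕ := Nat.pair 1 (Nat.pair (Nat.pair 0 i) (Nat.pair 0 j))

/-- The Gödel number of the application of a relation symbol with number `r` to the variables with
indices `l`. -/
def relCode (r : ℕ) (l : List ℕ) : ℕ :=
  Nat.pair 2 (Nat.pair r (Encodable.encode (l.map (Nat.pair 0))))

/-- The atom that says that the names `x` and `y` denote the same element. -/
def hEq (x y : ℕ) : ℕ := hAtom (eqCode 0 1) [x, y]

/-- The clauses that make a valuation the truth valuation of a Henkin structure: the conditions on
the connectives, on the quantifier with the name of a possible counterexample, and on identity. -/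
inductive HenkinClause : List (ℕ × Bool) → Prop
  | bot (a : List ℕ) : HenkinClause [(hAtom (Nat.pair 0 0) a, false)]
  | imp (k l : ℕ) (a : List ℕ) : HenkinClause
      [(hAtom (Nat.pair 3 (Nat.pair k l)) a, false), (hAtom k a, false), (hAtom l a, true)]
  | impLeft (k l : ℕ) (a : List ℕ) : HenkinClause
      [(hAtom (Nat.pair 3 (Nat.pair k l)) a, true), (hAtom k a, true)]
  | impRight (k l : ℕ) (a : List ℕ) : HenkinClause
      [(hAtom (Nat.pair 3 (Nat.pair k l)) a, true), (hAtom l a, false)]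
  | all (k c : ℕ) (a : List ℕ) : HenkinClause
      [(hAtom (Nat.pair 4 k) a, false), (hAtom k (a ++ [c]), true)]
  | witness (k : ℕ) (a : List ℕ) : HenkinClause
      [(hAtom (Nat.pair 4 k) a, true), (hAtom k (a ++ [hAtom k a + 1]), false)]
  | eq (i j : ℕ) (a : List ℕ) : HenkinClause
      [(hAtom (eqCode i j) a, false), (hEq (a.getD i 0) (a.getD j 0), true)]
  | eq' (i j : ℕ) (a : List ℕ) : HenkinClause
      [(hAtom (eqCode i j) a, true), (hEq (a.getD i 0) (a.getD j 0), false)]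
  | refl (x : ℕ) : HenkinClause [(hEq x x, true)]
  | eucl (x y z : ℕ) : HenkinClause [(hEq x y, false), (hEq x z, false), (hEq y z, true)]
  | rel (r : ℕ) (l : List (ℕ × ℕ)) (a b : List ℕ) : HenkinClause
      ((hAtom (relCode r (l.map Prod.fst)) a, false) ::
        (hAtom (relCode r (l.map Prod.snd)) b, true) ::
        l.map fun x => (hEq (a.getD x.1 0) (b.getD x.2 0), false))

theorem primrec_hAtom : Primrec₂ hAtom := Primrec.encode.comp₂ Primrec₂.pair

theorem primrec_relCode : Primrec₂ relCode := by
  refine Primrec₂.natPair.comp (Primrec.const 2) (Primrec₂.natPair.comp Primrec.fst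
    (Primrec.encode.comp (Primrec.list_map Primrec.snd ?_)))
  exact Primrec₂.natPair.comp (Primrec.const 0) Primrec.snd

theorem primrec_eqCode : Primrec₂ eqCode :=
  Primrec₂.natPair.comp (Primrec.const 1) (Primrec₂.natPair.comp
    (Primrec₂.natPair.comp (Primrec.const 0) Primrec.fst)
    (Primrec₂.natPair.comp (Primrec.const 0) Primrec.snd))

theorem primrec_hEq : Primrec₂ hEq :=
  primrec_hAtom.comp (Primrec.const _) (Primrec.list_cons.comp Primrec.fst
    (Primrec.list_cons.comp Primrec.snd (Primrec.const [])))

theorem primrec_clause_nil {α : Type} [Primcodable α] :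
    Primrec fun _ : α => ([] : List (ℕ × Bool)) := Primrec.const []

theorem primrec_clause_cons {α : Type} [Primcodable α] {f : α → ℕ} {g : α → List (ℕ × Bool)}
    (b : Bool) (hf : Primrec f) (hg : Primrec g) : Primrec fun x => (f x, b) :: g x :=
  Primrec.list_cons.comp (hf.pair (Primrec.const b)) hg

theorem rePred_henkinClause : REPred HenkinClause := by
  have hi : ∀ {α : Type} [Primcodable α] {f g : α → ℕ} (_ : Primrec f) (_ : Primrec g)
      {h : α → List ℕ} (_ : Primrec h) (t : ℕ),
      Primrec fun x => hAtom (Nat.pair t (Nat.pair (f x) (g x))) (h x) := fun hf hg _ hh t =>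
    primrec_hAtom.comp (Primrec₂.natPair.comp (Primrec.const t) (Primrec₂.natPair.comp hf hg)) hh
  have ha : ∀ {α : Type} [Primcodable α] {f : α → ℕ} (_ : Primrec f)
      {h : α → List ℕ} (_ : Primrec h), Primrec fun x => hAtom (Nat.pair 4 (f x)) (h x) :=
    fun hf _ hh => primrec_hAtom.comp (Primrec₂.natPair.comp (Primrec.const 4) hf) hh
  have hg : ∀ {α : Type} [Primcodable α] {f g : α → ℕ} (_ : Primrec f) (_ : Primrec g)
      {a b : α → List ℕ} (_ : Primrec a) (_ : Primrec b),
      Primrec fun x => hEq ((a x).getD (f x) 0) ((b x).getD (g x) 0) := fun hf hg _ _ ha hb =>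
    primrec_hEq.comp ((Primrec.list_getD 0).comp ha hf) ((Primrec.list_getD 0).comp hb hg)
  have f1 : ∀ {α β γ : Type} [Primcodable α] [Primcodable β] [Primcodable γ],
      Primrec fun x : α × β × γ => x.2.1 := Primrec.fst.comp Primrec.snd
  have f2 : ∀ {α β γ : Type} [Primcodable α] [Primcodable β] [Primcodable γ],
      Primrec fun x : α × β × γ => x.2.2 := Primrec.snd.comp Primrec.snd
  have c1 := rePred_range (Primrec.to_comp (primrec_clause_cons false
    (primrec_hAtom.comp (Primrec.const (Nat.pair 0 0)) (Primrec.id (α := List ℕ)))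
      primrec_clause_nil))
  have c2 := rePred_range (Primrec.to_comp (primrec_clause_cons false
    (hi (α := ℕ × ℕ × List ℕ) Primrec.fst f1 f2 3)
      (primrec_clause_cons false (primrec_hAtom.comp Primrec.fst f2)
        (primrec_clause_cons true (primrec_hAtom.comp f1 f2) primrec_clause_nil))))
  have c3 := rePred_range (Primrec.to_comp (primrec_clause_cons true
    (hi (α := ℕ × ℕ × List ℕ) Primrec.fst f1 f2 3)
      (primrec_clause_cons true (primrec_hAtom.comp Primrec.fst f2) primrec_clause_nil)))
  have c4 := rePred_range (Primrec.to_comp (primrec_clause_cons true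
    (hi (α := ℕ × ℕ × List ℕ) Primrec.fst f1 f2 3)
      (primrec_clause_cons false (primrec_hAtom.comp f1 f2) primrec_clause_nil)))
  have c5 := rePred_range (Primrec.to_comp (primrec_clause_cons false
    (ha (α := ℕ × ℕ × List ℕ) Primrec.fst f2)
      (primrec_clause_cons true (primrec_hAtom.comp Primrec.fst (Primrec.list_concat.comp f2 f1))
        primrec_clause_nil)))
  have c6 := rePred_range (Primrec.to_comp (primrec_clause_cons true
    (ha (α := ℕ × List ℕ) Primrec.fst Primrec.snd)
      (primrec_clause_cons false (primrec_hAtom.comp Primrec.fst (Primrec.list_concat.comp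
        Primrec.snd (Primrec.succ.comp (primrec_hAtom.comp Primrec.fst Primrec.snd))))
        primrec_clause_nil)))
  have c7 := fun b b' => rePred_range (Primrec.to_comp (primrec_clause_cons b
    (primrec_hAtom.comp (primrec_eqCode.comp Primrec.fst f1) f2)
      (primrec_clause_cons b' (hg (α := ℕ × ℕ × List ℕ) Primrec.fst f1 f2 f2)
        primrec_clause_nil)))
  have c8 := rePred_range (Primrec.to_comp (primrec_clause_cons true
    (primrec_hEq.comp Primrec.id Primrec.id) primrec_clause_nil))
  have c9 := rePred_range (Primrec.to_comp (primrec_clause_cons false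
    (primrec_hEq.comp Primrec.fst (f1 (α := ℕ) (γ := ℕ)))
      (primrec_clause_cons false (primrec_hEq.comp Primrec.fst f2)
        (primrec_clause_cons true (primrec_hEq.comp f1 f2) primrec_clause_nil))))
  have c10 : REPred fun c => ∃ x : ℕ × List (ℕ × ℕ) × List ℕ × List ℕ,
      ((hAtom (relCode x.1 (x.2.1.map Prod.fst)) x.2.2.1, false) ::
        (hAtom (relCode x.1 (x.2.1.map Prod.snd)) x.2.2.2, true) ::
        x.2.1.map fun y => (hEq (x.2.2.1.getD y.1 0) (x.2.2.2.getD y.2 0), false)) = c := by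
    refine rePred_range (Primrec.to_comp (primrec_clause_cons false ?_
      (primrec_clause_cons true ?_ ?_)))
    · exact primrec_hAtom.comp (primrec_relCode.comp Primrec.fst
        (Primrec.list_map f1 (Primrec.fst.comp Primrec.snd))) (Primrec.fst.comp f2)
    · exact primrec_hAtom.comp (primrec_relCode.comp Primrec.fst
        (Primrec.list_map f1 (Primrec.snd.comp Primrec.snd))) (Primrec.snd.comp f2)
    · refine Primrec.list_map f1 (Primrec.pair (hg (Primrec.fst.comp Primrec.snd)
        (Primrec.snd.comp Primrec.snd) (Primrec.fst.comp (f2.comp Primrec.fst))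
        (Primrec.snd.comp (f2.comp Primrec.fst))) (Primrec.const false))
  refine (rePred_or c1 (rePred_or c2 (rePred_or c3 (rePred_or c4 (rePred_or c5 (rePred_or c6
    (rePred_or (c7 false true) (rePred_or (c7 true false) (rePred_or c8
      (rePred_or c9 c10)))))))))).of_eq fun c => ⟨?_, ?_⟩
  · rintro (⟨a, rfl⟩ | ⟨x, rfl⟩ | ⟨x, rfl⟩ | ⟨x, rfl⟩ | ⟨x, rfl⟩ | ⟨x, rfl⟩ | ⟨x, rfl⟩ | ⟨x, rfl⟩ |
      ⟨x, rfl⟩ | ⟨x, rfl⟩ | ⟨x, rfl⟩)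
    · exact .bot _
    · exact .imp _ _ _
    · exact .impLeft _ _ _
    · exact .impRight _ _ _
    · exact .all _ _ _
    · exact .witness _ _
    · exact .eq _ _ _
    · exact .eq' _ _ _
    · exact .refl _
    · exact .eucl _ _ _
    · exact .rel _ _ _ _
  · intro h
    cases h with
    | bot a => exact .inl ⟨a, rfl⟩
    | imp k l a => exact .inr (.inl ⟨(k, l, a), rfl⟩)
    | impLeft k l a => exact .inr (.inr (.inl ⟨(k, l, a), rfl⟩))
    | impRight k l a => exact .inr (.inr (.inr (.inl ⟨(k, l, a), rfl⟩)))
    | all k c a => exact .inr (.inr (.inr (.inr (.inl ⟨(k, c, a), rfl⟩))))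
    | witness k a => exact .inr (.inr (.inr (.inr (.inr (.inl ⟨(k, a), rfl⟩)))))
    | eq i j a => exact .inr (.inr (.inr (.inr (.inr (.inr (.inl ⟨(i, j, a), rfl⟩))))))
    | eq' i j a => exact .inr (.inr (.inr (.inr (.inr (.inr (.inr (.inl ⟨(i, j, a), rfl⟩)))))))
    | refl x => exact .inr (.inr (.inr (.inr (.inr (.inr (.inr (.inr (.inl ⟨x, rfl⟩))))))))
    | eucl x y z =>
      exact .inr (.inr (.inr (.inr (.inr (.inr (.inr (.inr (.inr (.inl ⟨(x, y, z), rfl⟩)))))))))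
    | rel r l a b =>
      exact .inr (.inr (.inr (.inr (.inr (.inr (.inr (.inr (.inr (.inr ⟨(r, l, a, b), rfl⟩)))))))))

end Henkin

end LaxInt

namespace LaxInt

section Completeness
variable {L : FirstOrder.Language.{0, 0}} [Encodable (Σ n, L.Relations n)]

/-- Course-of-values recursion: the value at `n` is computed from the values below `n`. -/
def courseOfValues {M : Type} (d : M) (F : ℕ → (ℕ → M) → M) (n : ℕ) : M :=
  F n fun m => if _h : m < n then courseOfValues d F m else d

theorem mem_lt_encode {a : List ℕ} {x : ℕ} (h : x ∈ a) : x < Encodable.encode a := by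
  induction a with
  | nil => simp at h
  | cons y a ih =>
    rw [Encodable.encode_list_cons, Nat.lt_succ_iff]
    rcases List.mem_cons.1 h with rfl | h
    · exact Nat.left_le_pair _ _
    · exact (ih h).le.trans (Nat.right_le_pair _ _)

theorem mem_lt_hAtom {k : ℕ} {a : List ℕ} {x : ℕ} (h : x ∈ a) : x < hAtom k a :=
  (mem_lt_encode h).trans_le (Nat.right_le_pair _ _)

/-- The elements of a structure can be named by numbers in such a way that every false universal
formula has the counterexample that the Henkin clauses ask for. -/
theorem exists_henkin_naming {M : Type} [L.Structure M] (d : M) :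
    ∃ g : ℕ → M, g 0 = d ∧ ∀ k a, CodeSat L d k (a.map g ++ [g (hAtom k a + 1)]) →
      ∀ x, CodeSat L d k (a.map g ++ [x]) := by
  classical
  let F : ℕ → (ℕ → M) → M := fun n h =>
    if H : ∃ (k : ℕ) (a : List ℕ) (x : M), n = hAtom k a + 1 ∧ ¬CodeSat L d k (a.map h ++ [x])
    then H.choose_spec.choose_spec.choose else d
  refine ⟨courseOfValues d F, ?_, ?_⟩
  · rw [courseOfValues]
    simp only [F]
    rw [dif_neg]
    rintro ⟨k, a, x, h, -⟩
    exact absurd h (Nat.succ_ne_zero _).symm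
  · intro k a
    contrapose!
    rintro ⟨x, hx⟩
    have hmap : ∀ a : List ℕ, ∀ n, (∀ y ∈ a, y < n) →
        a.map (fun m => if _h : m < n then courseOfValues d F m else d) =
          a.map (courseOfValues d F) := by
      intro a n hn
      refine List.map_congr_left fun y hy => ?_
      simp [hn y hy]
    have hlt : ∀ y ∈ a, y < hAtom k a + 1 := fun y hy => (mem_lt_hAtom hy).trans (Nat.lt_succ_self _)
    have H : ∃ (k' : ℕ) (a' : List ℕ) (x : M), hAtom k a + 1 = hAtom k' a' + 1 ∧
        ¬CodeSat L d k' (a'.map (fun m => if _h : m < hAtom k a + 1 then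
          courseOfValues d F m else d) ++ [x]) :=
      ⟨k, a, x, rfl, by rwa [hmap a _ hlt]⟩
    obtain ⟨k', a', h1, h2⟩ : ∃ (k' : ℕ) (a' : List ℕ), hAtom k a + 1 = hAtom k' a' + 1 ∧
        ¬CodeSat L d k' (a'.map (fun m => if _h : m < hAtom k a + 1 then
          courseOfValues d F m else d) ++ [courseOfValues d F (hAtom k a + 1)]) := by
      refine ⟨_, _, H.choose_spec.choose_spec.choose_spec.1, ?_⟩
      have hval : courseOfValues d F (hAtom k a + 1) = H.choose_spec.choose_spec.choose := by
        rw [courseOfValues]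
        simp only [F]
        rw [dif_pos H]
      rw [hval]
      exact H.choose_spec.choose_spec.choose_spec.2
    obtain ⟨rfl, rfl⟩ := Prod.mk.inj (Encodable.encode_injective (Nat.succ_injective h1))
    rwa [hmap a _ hlt] at h2

/-- The truth valuation of a structure whose elements are named by numbers satisfies the Henkin
clauses. -/
theorem exists_valuation_of_structure {M : Type} [L.Structure M] (d : M) :
    ∃ v : ℕ → Bool, (∀ c, HenkinClause c → ∃ x ∈ c, v x.1 = x.2) ∧
      ∀ k, v (hAtom k []) = true ↔ CodeSat L d k [] := by
  classical
  obtain ⟨g, g0, hg⟩ := exists_henkin_naming (L := L) d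
  let v : ℕ → Bool := fun n => decide (∃ k a, hAtom k a = n ∧ CodeSat L d k (a.map g))
  have hv : ∀ k a, v (hAtom k a) = true ↔ CodeSat L d k (a.map g) := by
    intro k a
    simp only [v, decide_eq_true_eq]
    constructor
    · rintro ⟨k', a', h, h'⟩
      obtain ⟨rfl, rfl⟩ := Prod.mk.inj (Encodable.encode_injective h)
      exact h'
    · intro h
      exact ⟨k, a, rfl, h⟩
  have hv' : ∀ k a, v (hAtom k a) = false ↔ ¬CodeSat L d k (a.map g) := by
    intro k a
    rw [← hv, Bool.not_eq_true]
  have hget : ∀ (a : List ℕ) i, (a.map g).getD i d = g (a.getD i 0) := by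
    intro a i
    rw [← g0, List.getD_map]
  have hE : ∀ x y, CodeSat L d (eqCode 0 1) ([x, y].map g) ↔ g x = g y := by
    intro x y
    rw [eqCode, codeSat_equal]
    rfl
  refine ⟨v, fun c hc => ?_, fun k => by rw [hv]; rfl⟩
  cases hc with
  | bot a => simp [hv', codeSat_bot]
  | imp k l a =>
    simp only [List.mem_cons, List.not_mem_nil, or_false, exists_eq_or_imp, exists_eq_left, hv, hv',
      codeSat_imp]
    tauto
  | impLeft k l a =>
    simp only [List.mem_cons, List.not_mem_nil, or_false, exists_eq_or_imp, exists_eq_left, hv,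
      codeSat_imp]
    tauto
  | impRight k l a =>
    simp only [List.mem_cons, List.not_mem_nil, or_false, exists_eq_or_imp, exists_eq_left, hv, hv',
      codeSat_imp]
    tauto
  | all k c a =>
    simp only [List.mem_cons, List.not_mem_nil, or_false, exists_eq_or_imp, exists_eq_left, hv, hv',
      codeSat_all, List.map_append, List.map_cons, List.map_nil]
    exact or_iff_not_imp_left.2 fun h => not_not.1 h (g c)
  | witness k a =>
    simp only [List.mem_cons, List.not_mem_nil, or_false, exists_eq_or_imp, exists_eq_left, hv, hv',
      codeSat_all, List.map_append, List.map_cons, List.map_nil]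
    exact or_iff_not_imp_right.2 fun h => hg k a (not_not.1 h)
  | eq i j a =>
    simp only [List.mem_cons, List.not_mem_nil, or_false, exists_eq_or_imp, exists_eq_left, hEq, hv,
      hv', hE]
    rw [eqCode, codeSat_equal, hget, hget]
    tauto
  | eq' i j a =>
    simp only [List.mem_cons, List.not_mem_nil, or_false, exists_eq_or_imp, exists_eq_left, hEq, hv,
      hv', hE]
    rw [eqCode, codeSat_equal, hget, hget]
    tauto
  | refl x => simp [hEq, hv, -List.map_cons, hE]
  | eucl x y z =>
    simp only [List.mem_cons, List.not_mem_nil, or_false, exists_eq_or_imp, exists_eq_left, hEq, hv,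
      hv', hE]
    by_cases h1 : g x = g y
    · rw [h1]; tauto
    · exact .inl h1
  | rel r l a b =>
    by_cases h : ∀ x ∈ l, g (a.getD x.1 0) = g (b.getD x.2 0)
    · have key : CodeSat L d (relCode r (l.map Prod.fst)) (a.map g) ↔
          CodeSat L d (relCode r (l.map Prod.snd)) (b.map g) := by
        have hcode : ∀ (f : ℕ × ℕ → ℕ) (a : List ℕ),
            CodeSat L d (relCode r (l.map f)) (a.map g) ↔ ∃ s : Σ n, L.Relations n,
              Encodable.encode s = r ∧ ∃ h : s.1 = l.length, Structure.RelMap s.2 fun i =>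
                g (a.getD (f (l.get (i.cast h))) 0) := by
          intro f a
          rw [relCode, CodeSat]
          simp only [Nat.unpair_pair]
          rw [if_neg (by decide), if_pos trivial]
          constructor
          · rintro ⟨s, t, h1, h2, h3⟩
            have h2 := Encodable.encode_injective h2
            have hlen : s.1 = l.length := by simpa using congrArg List.length h2
            refine ⟨s, h1, hlen, ?_⟩
            convert h3 using 2 with i
            rw [hget]
            have : t i = Nat.pair 0 (f (l.get (i.cast hlen))) := by
              have h4 := congrArg (fun l : List ℕ => l.getD i.1 0) h2
              simp only [getD_ofFn] at h4
              rw [h4]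
              have hi : i.1 < l.length := i.isLt.trans_eq hlen
              simp [List.getD, hi]
            rw [this, Nat.unpair_pair]
          · rintro ⟨s, h1, hlen, h3⟩
            refine ⟨s, fun i => Nat.pair 0 (f (l.get (i.cast hlen))), h1, ?_, ?_⟩
            · congr 1
              refine List.ext_getElem (by simp [hlen]) fun i h1 h2 => ?_
              simp
            · simp only [hget, Nat.unpair_pair]
              exact h3
        rw [hcode, hcode]
        simp only [h _ (List.get_mem _ _)]
      by_cases h1 : CodeSat L d (relCode r (l.map Prod.fst)) (a.map g)
      · exact ⟨_, List.mem_cons_of_mem _ List.mem_cons_self, (hv _ _).2 (key.1 h1)⟩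
      · exact ⟨_, List.mem_cons_self, (hv' _ _).2 h1⟩
    · push Not at h
      obtain ⟨x, hx, hne⟩ := h
      exact ⟨_, List.mem_cons_of_mem _ (List.mem_cons_of_mem _ (List.mem_map_of_mem hx)),
        (hv' _ _).2 (mt (hE _ _).1 hne)⟩

/-- The Henkin construction: a valuation that satisfies the Henkin clauses is the truth valuation of
a structure. -/
theorem exists_structure_of_valuation [Encodable (Σ n, L.Functions n)] [L.IsRelational]
    {v : ℕ → Bool} (hv : ∀ c, HenkinClause c → ∃ x ∈ c, v x.1 = x.2) :
    ∃ (M : Type) (_ : L.Structure M) (_ : Nonempty M), ∀ φ : L.Sentence,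
      M ⊨ φ ↔ v (hAtom (formulaCode φ) []) = true := by
  let V : ℕ → List ℕ → Prop := fun k a => v (hAtom k a) = true
  have hbot : ∀ a, ¬V (Nat.pair 0 0) a := fun a h => by
    simpa [show v (hAtom (Nat.pair 0 0) a) = true from h] using hv _ (.bot a)
  have himp : ∀ k l a, V (Nat.pair 3 (Nat.pair k l)) a ↔ (V k a → V l a) := by
    intro k l a
    have h1 := hv _ (.imp k l a)
    have h2 := hv _ (.impLeft k l a)
    have h3 := hv _ (.impRight k l a)
    simp only [List.mem_cons, List.not_mem_nil, or_false, exists_eq_or_imp, exists_eq_left,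
      ← Bool.not_eq_true] at h1 h2 h3
    simp only [V]
    tauto
  have hall : ∀ k a, V (Nat.pair 4 k) a ↔ ∀ c, V k (a ++ [c]) := by
    intro k a
    constructor
    · intro h c
      have h1 := hv _ (.all k c a)
      simp only [List.mem_cons, List.not_mem_nil, or_false, exists_eq_or_imp, exists_eq_left,
        ← Bool.not_eq_true] at h1
      exact h1.resolve_left (not_not.2 h)
    · intro h
      have h1 := hv _ (.witness k a)
      simp only [List.mem_cons, List.not_mem_nil, or_false, exists_eq_or_imp, exists_eq_left,
        ← Bool.not_eq_true] at h1
      exact h1.resolve_right (not_not.2 (h _))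
  let E : ℕ → ℕ → Prop := fun x y => v (hEq x y) = true
  have heq : ∀ i j a, V (eqCode i j) a ↔ E (a.getD i 0) (a.getD j 0) := by
    intro i j a
    have h1 := hv _ (.eq i j a)
    have h2 := hv _ (.eq' i j a)
    simp only [List.mem_cons, List.not_mem_nil, or_false, exists_eq_or_imp, exists_eq_left,
      ← Bool.not_eq_true] at h1 h2
    simp only [V, E]
    tauto
  have hrefl : ∀ x, E x x := fun x => by simpa using hv _ (.refl x)
  have heucl : ∀ x y z, E x y → E x z → E y z := by
    intro x y z
    have h1 := hv _ (.eucl x y z)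
    simp only [List.mem_cons, List.not_mem_nil, or_false, exists_eq_or_imp, exists_eq_left,
      ← Bool.not_eq_true] at h1
    simp only [E]
    tauto
  have hrel : ∀ r (l : List (ℕ × ℕ)) a b, (∀ x ∈ l, E (a.getD x.1 0) (b.getD x.2 0)) →
      V (relCode r (l.map Prod.fst)) a → V (relCode r (l.map Prod.snd)) b := by
    intro r l a b h h1
    obtain ⟨x, hx, hvx⟩ := hv _ (.rel r l a b)
    rcases List.mem_cons.1 hx with rfl | hx
    · exact absurd (h1.symm.trans hvx) (by simp)
    rcases List.mem_cons.1 hx with rfl | hx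
    · exact hvx
    · obtain ⟨y, hy, rfl⟩ := List.mem_map.1 hx
      exact absurd ((h y hy).symm.trans hvx) (by simp)
  have hrelFn : ∀ {m n p : ℕ} (r : ℕ) (i : Fin m → Fin n) (j : Fin m → Fin p) (a : Fin n → ℕ)
      (b : Fin p → ℕ), (∀ s, E (a (i s)) (b (j s))) →
      V (relCode r (List.ofFn fun s => (i s : ℕ))) (List.ofFn a) →
        V (relCode r (List.ofFn fun s => (j s : ℕ))) (List.ofFn b) := by
    intro m n p r i j a b h h1
    have h2 := hrel r (List.ofFn fun s => ((i s : ℕ), (j s : ℕ))) (List.ofFn a) (List.ofFn b) ?_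
    · rw [List.map_ofFn, List.map_ofFn] at h2
      exact h2 h1
    · intro x hx
      obtain ⟨s, rfl⟩ := List.mem_ofFn.1 hx
      simp only [getD_ofFn]
      exact h s
  let st : Setoid ℕ := ⟨E, hrefl, fun {x y} h => heucl x y x h (hrefl x),
    fun {x y z} h h' => heucl y x z (heucl x y x h (hrefl x)) h'⟩
  let cls : ℕ → Quotient st := Quotient.mk st
  have hcls : ∀ x y, cls x = cls y ↔ E x y := fun x y => Quotient.eq
  let inst : L.Structure (Quotient st) :=
    { funMap := fun f _ => isEmptyElim f
      RelMap := fun {n} r xs => ∃ ys : Fin n → ℕ, (∀ i, cls (ys i) = xs i) ∧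
        V (relCode (Encodable.encode (⟨n, r⟩ : Σ n, L.Relations n))
          (List.ofFn fun s : Fin n => (s : ℕ))) (List.ofFn ys) }
  have key : ∀ {n : ℕ} (φ : L.BoundedFormula Empty n) (w : Empty → Quotient st) (e : Fin n → ℕ),
      φ.Realize w (cls ∘ e) ↔ V (formulaCode φ) (List.ofFn e) := by
    intro n φ w
    induction φ with
    | falsum => exact fun e => (iff_false_intro (hbot _)).symm
    | equal t u =>
      intro e
      obtain ⟨i, rfl⟩ := exists_eq_var t
      obtain ⟨j, rfl⟩ := exists_eq_var u
      refine (hcls (e i) (e j)).trans ?_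
      have := heq i j (List.ofFn e)
      rw [getD_ofFn, getD_ofFn] at this
      exact this.symm
    | @rel n m r ts =>
      intro e
      choose τ hτ using fun i => exists_eq_var (ts i)
      obtain rfl : ts = fun i => Term.var (Sum.inr (τ i)) := funext hτ
      have hcode : formulaCode (BoundedFormula.rel r fun i => Term.var (Sum.inr (τ i))) =
          relCode (Encodable.encode (⟨m, r⟩ : Σ n, L.Relations n))
            (List.ofFn fun s => (τ s : ℕ)) := by
        simp only [formulaCode, termCode, relCode, List.map_ofFn]
        rfl
      rw [hcode]
      constructor
      · rintro ⟨ys, h1, h2⟩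
        exact hrelFn _ _ _ ys e (fun s => (hcls _ _).1 (h1 s)) h2
      · intro h
        exact ⟨fun s => e (τ s), fun s => rfl,
          hrelFn _ _ (fun s => s) e (fun s => e (τ s)) (fun s => hrefl _) h⟩
    | imp φ ψ ih1 ih2 =>
      intro e
      exact (imp_congr (ih1 e) (ih2 e)).trans (himp _ _ _).symm
    | all φ ih =>
      intro e
      refine Iff.trans ?_ (hall _ _).symm
      constructor
      · intro h c
        have := (ih (Fin.snoc e c)).1 (by rw [Fin.comp_snoc]; exact h (cls c))
        rwa [ofFn_snoc] at this
      · intro h x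
        obtain ⟨c, rfl⟩ := Quotient.exists_rep x
        have := (ih (Fin.snoc e c)).2 (by rw [ofFn_snoc]; exact h c)
        rwa [Fin.comp_snoc] at this
  refine ⟨Quotient st, inst, ⟨cls 0⟩, fun φ => ?_⟩
  have := key φ default Fin.elim0
  rw [List.ofFn_zero] at this
  exact Iff.trans (iff_of_eq (congrArg₂ (BoundedFormula.Realize φ) (Subsingleton.elim _ _)
    (Subsingleton.elim _ _))) this

/-- An effective form of the completeness theorem: for a recursively enumerable theory `V` in a
relational language, it is recursively enumerable whether a sentence is inconsistent with `V`. -/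
theorem rePred_not_isSatisfiable [Encodable (Σ n, L.Functions n)] [L.IsRelational] {V : L.Theory}
    (hV : IsRE V) : ∃ P : ℕ → Prop, REPred P ∧
      ∀ φ : L.Sentence, P (formulaCode φ) ↔ ¬(V ∪ {φ}).IsSatisfiable := by
  let C : ℕ × List (ℕ × Bool) → Prop := fun x => HenkinClause x.2 ∨
    ((∃ j, (∃ φ : L.Sentence, φ ∈ V ∧ formulaCode φ = j) ∧ [(hAtom j [], true)] = x.2) ∨
      x.2 = [(hAtom x.1 [], true)])
  have hunit : ∀ {α : Type} [Primcodable α] {f : α → ℕ} (_ : Primrec f),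
      Primrec fun x => [(hAtom (f x) [], true)] := fun hf =>
    primrec_clause_cons true (primrec_hAtom.comp hf (Primrec.const [])) primrec_clause_nil
  have hC : REPred C := by
    refine rePred_or (rePred_comp rePred_henkinClause Computable.snd) (rePred_or ?_ ?_)
    · exact rePred_comp (rePred_image hV (hunit Primrec.id).to_comp) Computable.snd
    · exact PrimrecPred.rePred (Primrec.eq.comp Primrec.snd (hunit Primrec.fst))
  refine ⟨_, rePred_unsatisfiable hC, fun φ => not_congr ⟨?_, ?_⟩⟩
  · rintro ⟨v, hv⟩
    obtain ⟨M, _, _, hM⟩ := exists_structure_of_valuation (L := L) fun c hc => hv c (.inl hc)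
    have : M ⊨ (V ∪ {φ} : L.Theory) := by
      refine (Theory.model_iff _).2 fun ψ hψ => (hM ψ).2 ?_
      rcases hψ with hψ | rfl
      · simpa using hv _ (.inr (.inl ⟨_, ⟨ψ, hψ, rfl⟩, rfl⟩))
      · simpa using hv [(hAtom (formulaCode ψ) [], true)] (.inr (.inr rfl))
    exact Theory.Model.isSatisfiable M
  · rintro ⟨M⟩
    obtain ⟨d⟩ : Nonempty M := inferInstance
    obtain ⟨v, h1, h2⟩ := exists_valuation_of_structure (L := L) d
    have hMv : ∀ ψ ∈ V ∪ {φ}, v (hAtom (formulaCode ψ) []) = true := by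
      intro ψ hψ
      have := (realize_iff_codeSat d ψ default default).1 (M.is_model.realize_of_mem _ hψ)
      rw [List.ofFn_zero] at this
      exact (h2 _).2 this
    refine ⟨v, fun c hc => ?_⟩
    rcases hc with hc | ⟨_, ⟨ψ, hψ, rfl⟩, rfl⟩ | hc
    · exact h1 c hc
    · exact ⟨_, List.mem_cons_self, hMv _ (.inl hψ)⟩
    · obtain rfl : c = [(hAtom (formulaCode φ) [], true)] := hc
      exact ⟨_, List.mem_cons_self, hMv _ (.inr rfl)⟩

end Completeness

end LaxInt

namespace LaxInt

/-! ### Representability of recursively enumerable predicates by `Σ₁`-formulas -/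

section Representability

/-- Renaming of the free variables of a pure `Δ₀`-formula. -/
def PureDelta.rename : {n m : ℕ} → (Fin n → Fin m) → PureDelta n → PureDelta m
  | _, _, _, .bot => .bot
  | _, _, _, .top => .top
  | _, _, ρ, .lt u v => .lt (ρ u) (ρ v)
  | _, _, ρ, .zero u => .zero (ρ u)
  | _, _, ρ, .succ u v => .succ (ρ u) (ρ v)
  | _, _, ρ, .add u v w => .add (ρ u) (ρ v) (ρ w)
  | _, _, ρ, .mul u v w => .mul (ρ u) (ρ v) (ρ w)
  | _, _, ρ, .neg φ => .neg (φ.rename ρ)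
  | _, _, ρ, .and φ ψ => .and (φ.rename ρ) (ψ.rename ρ)
  | _, _, ρ, .or φ ψ => .or (φ.rename ρ) (ψ.rename ρ)
  | _, _, ρ, .imp φ ψ => .imp (φ.rename ρ) (ψ.rename ρ)
  | _, m, ρ, .allLt v φ => .allLt (ρ v) (φ.rename (Fin.snoc (fun i => (ρ i).castSucc) (Fin.last m)))
  | _, m, ρ, .exLt v φ => .exLt (ρ v) (φ.rename (Fin.snoc (fun i => (ρ i).castSucc) (Fin.last m)))
  | _, m, ρ, .allLe v φ => .allLe (ρ v) (φ.rename (Fin.snoc (fun i => (ρ i).castSucc) (Fin.last m)))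
  | _, m, ρ, .exLe v φ => .exLe (ρ v) (φ.rename (Fin.snoc (fun i => (ρ i).castSucc) (Fin.last m)))

theorem PureDelta.holds_rename {N : Type} [arith.Structure N] :
    ∀ {n m : ℕ} (ρ : Fin n → Fin m) (δ : PureDelta n) (v : Fin m → N),
      (δ.rename ρ).Holds N v ↔ δ.Holds N (v ∘ ρ) := by
  have h : ∀ {n m : ℕ} (ρ : Fin n → Fin m) (v : Fin m → N) (x : N),
      Fin.snoc v x ∘ (Fin.snoc (fun i => (ρ i).castSucc) (Fin.last m) :
        Fin (n + 1) → Fin (m + 1)) = (Fin.snoc (v ∘ ρ) x : Fin (n + 1) → N) := by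
    intro n m ρ v x
    rw [Fin.comp_snoc]; congr 1 <;> simp [Function.comp_def]
  intro n m ρ δ
  induction δ generalizing m with
  | neg φ ih => exact fun v => not_congr (ih ρ v)
  | and φ ψ ih1 ih2 => exact fun v => and_congr (ih1 ρ v) (ih2 ρ v)
  | or φ ψ ih1 ih2 => exact fun v => or_congr (ih1 ρ v) (ih2 ρ v)
  | imp φ ψ ih1 ih2 => exact fun v => imp_congr (ih1 ρ v) (ih2 ρ v)
  | allLt a φ ih => intro v; simp only [rename, Holds, ih, h]; rfl
  | exLt a φ ih => intro v; simp only [rename, Holds, ih, h]; rfl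
  | allLe a φ ih => intro v; simp only [rename, Holds, ih, h]; rfl
  | exLe a φ ih => intro v; simp only [rename, Holds, ih, h]; rfl
  | _ => exact fun v => Iff.rfl

theorem snoc_vecCons {α : Type} {n : ℕ} (a : α) (v : Fin n → α) (x : α) :
    (Fin.snoc (Matrix.vecCons a v) x : Fin (n + 2) → α) =
      Matrix.vecCons a (Fin.snoc v x : Fin (n + 1) → α) :=
  (Fin.cons_snoc_eq_snoc_cons a v x).symm

theorem snoc_vecEmpty {α : Type} (v : Fin 0 → α) (x : α) :
    (Fin.snoc v x : Fin 1 → α) = ![x] :=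
  funext fun i => by fin_cases i; rfl

theorem comp_vecCons {α : Type} {n m : ℕ} (v : Fin m → α) (i : Fin m) (ρ : Fin n → Fin m) :
    v ∘ Matrix.vecCons i ρ = Matrix.vecCons (v i) (v ∘ ρ) :=
  funext fun j => by cases j using Fin.cases <;> rfl

theorem comp_vecEmpty {α : Type} {m : ℕ} (v : Fin m → α) (ρ : Fin 0 → Fin m) :
    v ∘ ρ = (![] ) := Subsingleton.elim _ _

section Nat
variable {n : ℕ} (v : Fin n → ℕ)

theorem holds_nat_lt (a b : Fin n) : (PureDelta.lt a b).Holds ℕ v ↔ v a < v b := Iff.rfl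
theorem holds_nat_zero (a : Fin n) : (PureDelta.zero a).Holds ℕ v ↔ v a = 0 := eq_comm
theorem holds_nat_succ (a b : Fin n) : (PureDelta.succ a b).Holds ℕ v ↔ v b = v a + 1 := eq_comm
theorem holds_nat_add (a b c : Fin n) : (PureDelta.add a b c).Holds ℕ v ↔ v c = v a + v b := eq_comm
theorem holds_nat_mul (a b c : Fin n) : (PureDelta.mul a b c).Holds ℕ v ↔ v c = v a * v b := eq_comm
theorem holds_nat_neg (φ : PureDelta n) : φ.neg.Holds ℕ v ↔ ¬φ.Holds ℕ v := Iff.rfl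
theorem holds_nat_and (φ ψ : PureDelta n) :
    (φ.and ψ).Holds ℕ v ↔ φ.Holds ℕ v ∧ ψ.Holds ℕ v := Iff.rfl
theorem holds_nat_or (φ ψ : PureDelta n) :
    (φ.or ψ).Holds ℕ v ↔ φ.Holds ℕ v ∨ ψ.Holds ℕ v := Iff.rfl
theorem holds_nat_exLe (a : Fin n) (φ : PureDelta (n + 1)) :
    (φ.exLe a).Holds ℕ v ↔ ∃ x, x ≤ v a ∧ φ.Holds ℕ (Fin.snoc v x) :=
  exists_congr fun _ => and_congr_left fun _ => Nat.le_iff_lt_or_eq.symm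
theorem holds_nat_exLt (a : Fin n) (φ : PureDelta (n + 1)) :
    (φ.exLt a).Holds ℕ v ↔ ∃ x, x < v a ∧ φ.Holds ℕ (Fin.snoc v x) := Iff.rfl
theorem holds_nat_allLt (a : Fin n) (φ : PureDelta (n + 1)) :
    (φ.allLt a).Holds ℕ v ↔ ∀ x, x < v a → φ.Holds ℕ (Fin.snoc v x) := Iff.rfl

/-- The pure `Δ₀`-formula for `w = u + v * v`. -/
def PureDelta.addSq (u v w : Fin n) : PureDelta n :=
  .exLe w (.and (.mul v.castSucc v.castSucc (Fin.last n))
    (.add u.castSucc (Fin.last n) w.castSucc))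

theorem holds_addSq (a b c : Fin n) :
    (PureDelta.addSq a b c).Holds ℕ v ↔ v c = v a + v b * v b := by
  simp only [PureDelta.addSq, holds_nat_exLe, holds_nat_and, holds_nat_mul, holds_nat_add,
    Fin.snoc_last, Fin.snoc_castSucc]
  constructor
  · rintro ⟨x, -, rfl, h⟩; exact h
  · intro h; exact ⟨_, by omega, rfl, h⟩

/-- The pure `Δ₀`-formula for `w = Nat.pair u v`. -/
def PureDelta.pair (u v w : Fin n) : PureDelta n :=
  .or (.and (.lt u v) (.addSq u v w)) (.and (.neg (.lt u v)) (.exLe w (.and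
    (.addSq u.castSucc u.castSucc (Fin.last n)) (.add (Fin.last n) v.castSucc w.castSucc))))

theorem holds_pair (a b c : Fin n) :
    (PureDelta.pair a b c).Holds ℕ v ↔ v c = Nat.pair (v a) (v b) := by
  simp only [PureDelta.pair, holds_nat_or, holds_nat_exLe, holds_nat_and, holds_nat_neg,
    holds_nat_lt, holds_nat_add, holds_addSq, Fin.snoc_last, Fin.snoc_castSucc, Nat.pair]
  split_ifs with h
  · simp [h, add_comm]
  · simp only [h, false_and, not_false_eq_true, true_and, false_or]
    constructor
    · rintro ⟨x, -, rfl, h⟩; rw [h]; ring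
    · intro h; exact ⟨v a + v a * v a, by omega, rfl, by rw [h]; ring⟩

end Nat

variable {α β γ : Type} [Encodable α] [Encodable β] [Encodable γ]

/-- A predicate is `Σ₁` when its set of codes is defined in the standard model by a pure
`Δ₀`-formula preceded by one existential quantifier. -/
def Sig (P : α → Prop) : Prop :=
  ∃ δ : PureDelta 2, ∀ a, P a ↔ ∃ b, δ.Holds ℕ ![Encodable.encode a, b]

/-- A function is `Σ₁` when its graph is. -/
def SigF (f : α → β) : Prop := Sig fun x : α × ℕ => x.2 = Encodable.encode (f x.1)

theorem Sig.of_eq {P Q : α → Prop} (h : Sig P) (hPQ : ∀ a, P a ↔ Q a) : Sig Q :=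
  (funext fun a => propext (hPQ a) : P = Q) ▸ h

theorem Sig.and {P Q : α → Prop} (hP : Sig P) (hQ : Sig Q) : Sig fun a => P a ∧ Q a := by
  obtain ⟨δ, hδ⟩ := hP
  obtain ⟨ε, hε⟩ := hQ
  refine ⟨.and (.exLe 1 (δ.rename ![0, 2])) (.exLe 1 (ε.rename ![0, 2])), fun a => ?_⟩
  simp only [holds_nat_and, holds_nat_exLe, PureDelta.holds_rename, snoc_vecCons, snoc_vecEmpty,
    comp_vecCons, comp_vecEmpty, Matrix.cons_val, hδ, hε]
  constructor
  · rintro ⟨⟨b, hb⟩, c, hc⟩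
    exact ⟨max b c, ⟨b, le_max_left _ _, hb⟩, c, le_max_right _ _, hc⟩
  · rintro ⟨B, ⟨b, -, hb⟩, c, -, hc⟩
    exact ⟨⟨b, hb⟩, c, hc⟩

theorem Sig.exists {P : α × ℕ → Prop} (hP : Sig P) : Sig fun a => ∃ y, P (a, y) := by
  obtain ⟨δ, hδ⟩ := hP
  refine ⟨.exLe 1 (.exLe 1 (.exLe 1 (.and (.pair 0 2 3) (δ.rename ![3, 4])))), fun a => ?_⟩
  simp only [holds_nat_and, holds_nat_exLe, PureDelta.holds_rename, snoc_vecCons, snoc_vecEmpty,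
    comp_vecCons, comp_vecEmpty, Matrix.cons_val, hδ, holds_pair]
  constructor
  · rintro ⟨y, b, hb⟩
    exact ⟨max y (max (Nat.pair (Encodable.encode a) y) b), y, by simp, _, by simp, b, by simp,
      rfl, hb⟩
  · rintro ⟨B, y, -, z, -, b, -, rfl, hb⟩
    exact ⟨y, b, hb⟩

/-- Bounded universal quantification; the bound on the finitely many witnesses is the existential
witness. -/
theorem Sig.forall_lt {P : α × ℕ → Prop} (hP : Sig P) :
    Sig fun x : α × ℕ => ∀ i < x.2, P (x.1, i) := by
  obtain ⟨δ, hδ⟩ := hP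
  refine ⟨.exLe 1 (.exLe 1 (.and (.pair 2 3 0) (.allLt 3 (.exLe 1 (.exLe 1 (.and (.pair 2 4 5)
    (δ.rename ![5, 6]))))))), fun ⟨a, n⟩ => ?_⟩
  simp only [holds_nat_and, holds_nat_exLe, holds_nat_allLt, PureDelta.holds_rename, snoc_vecCons,
    snoc_vecEmpty, comp_vecCons, comp_vecEmpty, Matrix.cons_val, hδ, holds_pair,
    Encodable.encode_prod_val, Encodable.encode_nat]
  constructor
  · intro h
    choose! b hb using h
    refine ⟨Encodable.encode a + n + ∑ i ∈ Finset.range n, (Nat.pair (Encodable.encode a) i + b i),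
      _, ?_, _, ?_, rfl, fun i hi => ?_⟩
    · omega
    · omega
    · have := Finset.single_le_sum (f := fun i => Nat.pair (Encodable.encode a) i + b i)
        (fun _ _ => Nat.zero_le _) (Finset.mem_range.2 hi)
      exact ⟨_, by omega, b i, by omega, rfl, hb i hi⟩
  · rintro ⟨B, x, -, y, -, h, h'⟩ i hi
    obtain ⟨rfl, rfl⟩ := Nat.pair_eq_pair.1 h
    obtain ⟨_, -, b, -, rfl, hb⟩ := h' i hi
    exact ⟨b, hb⟩

theorem SigF.fst : SigF (Prod.fst : α × β → α) := by
  refine ⟨.exLe 0 (.exLe 0 (.exLe 0 (.and (.pair 2 3 4) (.pair 4 2 0)))), fun ⟨⟨a, b⟩, y⟩ => ?_⟩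
  simp only [holds_nat_and, holds_nat_exLe, snoc_vecCons, snoc_vecEmpty, Matrix.cons_val,
    holds_pair, Encodable.encode_prod_val, Encodable.encode_nat]
  constructor
  · rintro rfl
    exact ⟨0, _, (Nat.left_le_pair _ _).trans (Nat.left_le_pair _ _), _,
      (Nat.right_le_pair _ _).trans (Nat.left_le_pair _ _), _, Nat.left_le_pair _ _, rfl, rfl⟩
  · rintro ⟨_, x, -, x', -, z, -, rfl, h⟩
    obtain ⟨h1, rfl⟩ := Nat.pair_eq_pair.1 h
    exact (Nat.pair_eq_pair.1 h1).1.symm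

theorem SigF.snd : SigF (Prod.snd : α × β → β) := by
  refine ⟨.exLe 0 (.exLe 0 (.exLe 0 (.and (.pair 2 3 4) (.pair 4 3 0)))), fun ⟨⟨a, b⟩, y⟩ => ?_⟩
  simp only [holds_nat_and, holds_nat_exLe, snoc_vecCons, snoc_vecEmpty, Matrix.cons_val,
    holds_pair, Encodable.encode_prod_val, Encodable.encode_nat]
  constructor
  · rintro rfl
    exact ⟨0, _, (Nat.left_le_pair _ _).trans (Nat.left_le_pair _ _), _,
      (Nat.right_le_pair _ _).trans (Nat.left_le_pair _ _), _, Nat.left_le_pair _ _, rfl, rfl⟩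
  · rintro ⟨_, x, -, x', -, z, -, rfl, h⟩
    obtain ⟨h1, rfl⟩ := Nat.pair_eq_pair.1 h
    exact (Nat.pair_eq_pair.1 h1).2.symm

theorem SigF.id : SigF (id : α → α) := by
  refine ⟨.exLe 0 (.pair 2 2 0), fun ⟨a, y⟩ => ?_⟩
  simp only [holds_nat_exLe, snoc_vecCons, snoc_vecEmpty, Matrix.cons_val,
    holds_pair, Encodable.encode_prod_val, Encodable.encode_nat]
  constructor
  · rintro rfl
    exact ⟨0, _, Nat.left_le_pair _ _, rfl⟩
  · rintro ⟨_, x, -, h⟩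
    obtain ⟨h1, rfl⟩ := Nat.pair_eq_pair.1 h
    exact h1.symm

theorem SigF.pair {f : α → β} {g : α → γ} (hf : SigF f) (hg : SigF g) :
    SigF fun a => (f a, g a) := by
  obtain ⟨δ, hδ⟩ := hf
  obtain ⟨ε, hε⟩ := hg
  -- The variables are the argument `z`, the bound, and `a, y, u, v, p, q` with `z = ⟨a, y⟩`,
  -- `y = ⟨u, v⟩`, `p = ⟨a, u⟩`, `q = ⟨a, v⟩`.
  refine ⟨.exLe 1 (.exLe 1 (.exLe 1 (.exLe 1 (.exLe 1 (.exLe 1 (.and (.and (.pair 2 3 0)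
    (.and (.pair 4 5 3) (.and (.pair 2 4 6) (.pair 2 5 7))))
    (.and (.exLe 1 (δ.rename ![6, 8])) (.exLe 1 (ε.rename ![7, 8]))))))))), fun ⟨a, y⟩ => ?_⟩
  simp only [holds_nat_and, holds_nat_exLe, PureDelta.holds_rename, snoc_vecCons, snoc_vecEmpty,
    comp_vecCons, comp_vecEmpty, Matrix.cons_val, holds_pair,
    Encodable.encode_prod_val, Encodable.encode_nat]
  have h1 := hδ (a, Encodable.encode (f a))
  have h2 := hε (a, Encodable.encode (g a))
  simp only [Encodable.encode_prod_val, Encodable.encode_nat, true_iff] at h1 h2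
  obtain ⟨b, hb⟩ := h1
  obtain ⟨c, hc⟩ := h2
  constructor
  · rintro rfl
    refine ⟨Encodable.encode a + Nat.pair (Encodable.encode (f a)) (Encodable.encode (g a)) +
      Encodable.encode (f a) + Encodable.encode (g a) +
      Nat.pair (Encodable.encode a) (Encodable.encode (f a)) +
      Nat.pair (Encodable.encode a) (Encodable.encode (g a)) + b + c,
      _, ?_, _, ?_, _, ?_, _, ?_, _, ?_, _, ?_, ⟨rfl, rfl, rfl, rfl⟩, ⟨b, ?_, hb⟩, c, ?_, hc⟩ <;> omega
  · rintro ⟨_, x, -, y', -, u, -, v, -, p, -, q, -, ⟨h, rfl, rfl, rfl⟩, ⟨b, -, hb⟩, c, -, hc⟩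
    obtain ⟨rfl, rfl⟩ := Nat.pair_eq_pair.1 h
    have h1 := (hδ (a, u)).2 ⟨b, hb⟩
    have h2 := (hε (a, v)).2 ⟨c, hc⟩
    simp only at h1 h2
    rw [h1, h2]

theorem Sig.comp_snd {P : β → Prop} (hP : Sig P) : Sig fun x : α × β => P x.2 := by
  obtain ⟨δ, hδ⟩ := hP
  refine ⟨.exLe 0 (.exLe 0 (.and (.pair 2 3 0) (δ.rename ![3, 1]))), fun ⟨a, y⟩ => ?_⟩
  simp only [holds_nat_and, holds_nat_exLe, PureDelta.holds_rename, snoc_vecCons, snoc_vecEmpty,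
    comp_vecCons, comp_vecEmpty, Matrix.cons_val, hδ, holds_pair, Encodable.encode_prod_val]
  refine exists_congr fun b => ⟨fun h => ?_, ?_⟩
  · exact ⟨_, Nat.left_le_pair _ _, _, Nat.right_le_pair _ _, rfl, h⟩
  · rintro ⟨x, -, y, -, h, hb⟩
    obtain ⟨rfl, rfl⟩ := Nat.pair_eq_pair.1 h
    exact hb

theorem Sig.comp {P : β → Prop} (hP : Sig P) {f : α → β} (hf : SigF f) : Sig fun a => P (f a) := by
  obtain ⟨δ, hδ⟩ := hP
  -- The predicate on numbers that holds of the codes of the elements with the property `P`.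
  have hP' : Sig fun y : ℕ => ∃ b, δ.Holds ℕ ![y, b] := ⟨δ, fun y => Iff.rfl⟩
  refine (Sig.exists (P := fun x : α × ℕ => x.2 = Encodable.encode (f x.1) ∧
    ∃ b, δ.Holds ℕ ![x.2, b]) (Sig.and hf hP'.comp_snd)).of_eq fun a => ?_
  simp only [exists_eq_left]
  exact (hδ _).symm

theorem SigF.comp {g : β → γ} (hg : SigF g) {f : α → β} (hf : SigF f) :
    SigF fun a => g (f a) := by
  obtain ⟨δ, hδ⟩ := hf
  obtain ⟨ε, hε⟩ := hg
  -- The variables are the argument `z`, the bound, and `a, y, u, p, q` with `z = ⟨a, y⟩`,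
  -- `p = ⟨a, u⟩`, `q = ⟨u, y⟩`.
  refine ⟨.exLe 1 (.exLe 1 (.exLe 1 (.exLe 1 (.exLe 1 (.and (.and (.pair 2 3 0)
    (.and (.pair 2 4 5) (.pair 4 3 6)))
    (.and (.exLe 1 (δ.rename ![5, 7])) (.exLe 1 (ε.rename ![6, 7])))))))), fun ⟨a, y⟩ => ?_⟩
  simp only [holds_nat_and, holds_nat_exLe, PureDelta.holds_rename, snoc_vecCons, snoc_vecEmpty,
    comp_vecCons, comp_vecEmpty, Matrix.cons_val, holds_pair,
    Encodable.encode_prod_val, Encodable.encode_nat]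
  have h1 := hδ (a, Encodable.encode (f a))
  have h2 := hε (f a, y)
  simp only [Encodable.encode_prod_val, Encodable.encode_nat, true_iff] at h1 h2
  obtain ⟨b, hb⟩ := h1
  constructor
  · intro h
    obtain ⟨c, hc⟩ := h2.1 h
    refine ⟨Encodable.encode a + y + Encodable.encode (f a) +
      Nat.pair (Encodable.encode a) (Encodable.encode (f a)) +
      Nat.pair (Encodable.encode (f a)) y + b + c,
      _, ?_, _, ?_, _, ?_, _, ?_, _, ?_, ⟨rfl, rfl, rfl⟩, ⟨b, ?_, hb⟩, c, ?_, hc⟩ <;> omega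
  · rintro ⟨_, x, -, y', -, u, -, p, -, q, -, ⟨h, rfl, rfl⟩, ⟨b, -, hb⟩, c, -, hc⟩
    obtain ⟨rfl, rfl⟩ := Nat.pair_eq_pair.1 h
    have h3 := (hδ (a, u)).2 ⟨b, hb⟩
    simp only at h3
    subst h3
    exact h2.2 ⟨c, hc⟩

theorem Sig.eq {f g : α → ℕ} (hf : SigF f) (hg : SigF g) : Sig fun a => f a = g a :=
  Sig.comp (P := fun x : ℕ × ℕ => x.2 = x.1)
    (SigF.id (α := ℕ)) (f := fun a => (g a, f a)) (hg.pair hf)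

theorem Sig.lt {f g : α → ℕ} (hf : SigF f) (hg : SigF g) : Sig fun a => f a < g a := by
  refine Sig.comp (P := fun x : ℕ × ℕ => x.1 < x.2) ?_ (f := fun a => (f a, g a)) (hf.pair hg)
  refine ⟨.exLe 0 (.exLe 0 (.and (.pair 2 3 0) (.lt 2 3))), fun ⟨x, y⟩ => ?_⟩
  simp only [holds_nat_and, holds_nat_exLe, holds_nat_lt, snoc_vecCons, snoc_vecEmpty,
    Matrix.cons_val, holds_pair, Encodable.encode_prod_val, Encodable.encode_nat]
  constructor
  · intro h
    exact ⟨0, _, Nat.left_le_pair _ _, _, Nat.right_le_pair _ _, rfl, h⟩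
  · rintro ⟨_, x, -, y, -, h, hb⟩
    obtain ⟨rfl, rfl⟩ := Nat.pair_eq_pair.1 h
    exact hb

theorem SigF.zero : SigF fun _ : α => 0 := by
  refine ⟨.exLe 0 (.exLe 0 (.and (.pair 2 3 0) (.zero 3))), fun ⟨x, y⟩ => ?_⟩
  simp only [holds_nat_and, holds_nat_exLe, holds_nat_zero, snoc_vecCons, snoc_vecEmpty,
    Matrix.cons_val, holds_pair, Encodable.encode_prod_val, Encodable.encode_nat]
  constructor
  · intro h
    exact ⟨0, _, Nat.left_le_pair _ _, _, Nat.right_le_pair _ _, rfl, h⟩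
  · rintro ⟨_, x, -, y, -, h, hb⟩
    obtain ⟨rfl, rfl⟩ := Nat.pair_eq_pair.1 h
    exact hb

theorem SigF.succ {f : α → ℕ} (hf : SigF f) : SigF fun a => f a + 1 := by
  refine SigF.comp (g := fun n : ℕ => n + 1) ?_ hf
  refine ⟨.exLe 0 (.exLe 0 (.and (.pair 2 3 0) (.succ 2 3))), fun ⟨x, y⟩ => ?_⟩
  simp only [holds_nat_and, holds_nat_exLe, holds_nat_succ, snoc_vecCons, snoc_vecEmpty,
    Matrix.cons_val, holds_pair, Encodable.encode_prod_val, Encodable.encode_nat]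
  constructor
  · intro h
    exact ⟨0, _, Nat.left_le_pair _ _, _, Nat.right_le_pair _ _, rfl, h⟩
  · rintro ⟨_, x, -, y, -, h, hb⟩
    obtain ⟨rfl, rfl⟩ := Nat.pair_eq_pair.1 h
    exact hb

theorem SigF.add {f g : α → ℕ} (hf : SigF f) (hg : SigF g) : SigF fun a => f a + g a := by
  refine SigF.comp (g := fun x : ℕ × ℕ => x.1 + x.2) ?_ (hf.pair hg)
  refine ⟨.exLe 0 (.exLe 0 (.exLe 0 (.exLe 0 (.and (.and (.pair 2 3 0) (.pair 4 5 2))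
    (.add 4 5 3))))), fun ⟨⟨x, x'⟩, y⟩ => ?_⟩
  simp only [holds_nat_and, holds_nat_exLe, holds_nat_add, snoc_vecCons, snoc_vecEmpty,
    Matrix.cons_val, holds_pair, Encodable.encode_prod_val, Encodable.encode_nat]
  constructor
  · intro h
    exact ⟨0, _, Nat.left_le_pair _ _, _, Nat.right_le_pair _ _, _,
      (Nat.left_le_pair _ _).trans (Nat.left_le_pair _ _), _,
      (Nat.right_le_pair _ _).trans (Nat.left_le_pair _ _), ⟨rfl, rfl⟩, h⟩
  · rintro ⟨_, x, -, y, -, x1, -, x2, -, ⟨h, rfl⟩, hb⟩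
    obtain ⟨h', rfl⟩ := Nat.pair_eq_pair.1 h
    obtain ⟨rfl, rfl⟩ := Nat.pair_eq_pair.1 h'
    exact hb

theorem SigF.mul {f g : α → ℕ} (hf : SigF f) (hg : SigF g) : SigF fun a => f a * g a := by
  refine SigF.comp (g := fun x : ℕ × ℕ => x.1 * x.2) ?_ (hf.pair hg)
  refine ⟨.exLe 0 (.exLe 0 (.exLe 0 (.exLe 0 (.and (.and (.pair 2 3 0) (.pair 4 5 2))
    (.mul 4 5 3))))), fun ⟨⟨x, x'⟩, y⟩ => ?_⟩
  simp only [holds_nat_and, holds_nat_exLe, holds_nat_mul, snoc_vecCons, snoc_vecEmpty,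
    Matrix.cons_val, holds_pair, Encodable.encode_prod_val, Encodable.encode_nat]
  constructor
  · intro h
    exact ⟨0, _, Nat.left_le_pair _ _, _, Nat.right_le_pair _ _, _,
      (Nat.left_le_pair _ _).trans (Nat.left_le_pair _ _), _,
      (Nat.right_le_pair _ _).trans (Nat.left_le_pair _ _), ⟨rfl, rfl⟩, h⟩
  · rintro ⟨_, x, -, y, -, x1, -, x2, -, ⟨h, rfl⟩, hb⟩
    obtain ⟨h', rfl⟩ := Nat.pair_eq_pair.1 h
    obtain ⟨rfl, rfl⟩ := Nat.pair_eq_pair.1 h'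
    exact hb

theorem SigF.natPair {f g : α → ℕ} (hf : SigF f) (hg : SigF g) :
    SigF fun a => Nat.pair (f a) (g a) := hf.pair hg

theorem SigF.unpair {f : α → ℕ} (hf : SigF f) : SigF fun a => (f a).unpair := by
  refine SigF.comp (g := Nat.unpair) ((SigF.id (α := ℕ)).of_eq fun x => ?_) hf
  rw [show Encodable.encode x.1.unpair = x.1 from Nat.pair_unpair _]
  rfl

theorem SigF.beta {f g : α → ℕ} (hf : SigF f) (hg : SigF g) :
    SigF fun a => Nat.beta (f a) (g a) := by
  refine SigF.comp (g := fun x : ℕ × ℕ => Nat.beta x.1 x.2) ?_ (hf.pair hg)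
  -- The remainder is specified by a quotient, the existential witness.
  have hm : SigF fun x : ((ℕ × ℕ) × ℕ) × ℕ => (x.1.1.2 + 1) * x.1.1.1.unpair.2 + 1 := by
    have h1 : SigF fun x : ((ℕ × ℕ) × ℕ) × ℕ => x.1.1 := SigF.fst.comp SigF.fst
    exact ((SigF.snd.comp h1).succ.mul (SigF.snd.comp (SigF.fst.comp h1).unpair)).succ
  have hy : SigF fun x : ((ℕ × ℕ) × ℕ) × ℕ => x.1.2 := SigF.snd.comp SigF.fst
  have hn : SigF fun x : ((ℕ × ℕ) × ℕ) × ℕ => x.1.1.1.unpair.1 :=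
    SigF.fst.comp (SigF.fst.comp (SigF.fst.comp (SigF.fst (α := (ℕ × ℕ) × ℕ) (β := ℕ)))).unpair
  refine (Sig.exists ((Sig.lt hy hm).and (Sig.eq hn ((hm.mul SigF.snd).add hy)))).of_eq
    fun ⟨⟨n, i⟩, y⟩ => ?_
  simp only [Nat.beta, Encodable.encode_nat]
  constructor
  · rintro ⟨q, h1, h2⟩
    rw [h2, Nat.mul_add_mod, Nat.mod_eq_of_lt h1]
  · rintro rfl
    exact ⟨_, Nat.mod_lt _ (Nat.succ_pos _), (Nat.div_add_mod _ _).symm⟩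

/-- The graph of a partial recursive function is `Σ₁`. -/
theorem Sig.of_partrec {f : ℕ →. ℕ} (hf : Nat.Partrec f) : Sig fun x : ℕ × ℕ => x.2 ∈ f x.1 := by
  have hfst : ∀ {α β : Type} [Encodable α] [Encodable β], SigF fun x : α × β => x.1 := SigF.fst
  have hsnd : ∀ {α β : Type} [Encodable α] [Encodable β], SigF fun x : α × β => x.2 := SigF.snd
  induction hf with
  | zero => exact (Sig.eq hsnd SigF.zero).of_eq fun x => by simp [pure, PFun.pure]
  | succ => exact (Sig.eq hsnd hfst.succ).of_eq fun x => by simp [PFun.coe_val]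
  | left => exact (Sig.eq hsnd (hfst.comp hfst.unpair)).of_eq fun x => by simp [PFun.coe_val]
  | right => exact (Sig.eq hsnd (hsnd.comp hfst.unpair)).of_eq fun x => by simp [PFun.coe_val]
  | @pair f g _ _ ihf ihg =>
    have h1 := ihf.comp (f := fun x : ((ℕ × ℕ) × ℕ) × ℕ => (x.1.1.1, x.1.2))
      ((hfst.comp (hfst.comp hfst)).pair (hsnd.comp hfst))
    have h2 := ihg.comp (f := fun x : ((ℕ × ℕ) × ℕ) × ℕ => (x.1.1.1, x.2))
      ((hfst.comp (hfst.comp hfst)).pair hsnd)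
    have h3 := Sig.eq (hsnd.comp (hfst.comp hfst))
      (SigF.natPair (f := fun x : ((ℕ × ℕ) × ℕ) × ℕ => x.1.2) (g := fun x => x.2)
        (hsnd.comp hfst) hsnd)
    refine ((h1.and (h2.and h3)).exists.exists).of_eq fun x => ?_
    simp only [Seq.seq, Part.mem_bind_iff, Part.map_eq_map, Part.mem_map_iff]
    constructor
    · rintro ⟨u, v, hu, hv, h⟩
      exact ⟨_, ⟨u, hu, rfl⟩, v, hv, h.symm⟩
    · rintro ⟨_, ⟨u, hu, rfl⟩, v, hv, h⟩
      exact ⟨u, v, hu, hv, h.symm⟩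
  | @comp f g _ _ ihf ihg =>
    have h1 := ihg.comp (f := fun x : (ℕ × ℕ) × ℕ => (x.1.1, x.2)) ((hfst.comp hfst).pair hsnd)
    have h2 := ihf.comp (f := fun x : (ℕ × ℕ) × ℕ => (x.2, x.1.2)) (hsnd.pair (hsnd.comp hfst))
    refine (h1.and h2).exists.of_eq fun x => ?_
    change _ ↔ x.2 ∈ Part.bind (g x.1) f
    constructor
    · rintro ⟨y, hy, hz⟩
      exact Part.mem_bind hy hz
    · intro h
      obtain ⟨y, hy, hz⟩ := Part.mem_bind_iff.1 h
      exact ⟨y, hy, hz⟩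
  | @prec f g _ _ ihf ihg =>
    -- The sequence of intermediate values is coded by the existential witness `t`.
    have ha : SigF fun x : (ℕ × ℕ) × ℕ => x.1.1.unpair.1 := hfst.comp (hfst.comp hfst).unpair
    have hn : SigF fun x : (ℕ × ℕ) × ℕ => x.1.1.unpair.2 := hsnd.comp (hfst.comp hfst).unpair
    have h1 := ihf.comp (f := fun x : (ℕ × ℕ) × ℕ => (x.1.1.unpair.1, Nat.beta x.2 0))
      (ha.pair (hsnd.beta SigF.zero))
    have h2 := ihg.comp (f := fun x : ((ℕ × ℕ) × ℕ) × ℕ =>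
        (Nat.pair x.1.1.1.unpair.1 (Nat.pair x.2 (Nat.beta x.1.2 x.2)), Nat.beta x.1.2 (x.2 + 1)))
      (SigF.pair ((ha.comp hfst).natPair (hsnd.natPair ((hsnd.comp hfst).beta hsnd)))
        ((hsnd.comp hfst).beta hsnd.succ))
    have h2' := h2.forall_lt.comp (f := fun x : (ℕ × ℕ) × ℕ => (x, x.1.1.unpair.2))
      (SigF.id.pair hn)
    have h3 := Sig.eq (hsnd.comp hfst) (hsnd.beta hn)
    refine (h1.and (h2'.and h3)).exists.of_eq fun ⟨x, y⟩ => ?_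
    simp only [Nat.unpaired]
    generalize x.unpair.1 = a
    generalize x.unpair.2 = n
    constructor
    · rintro ⟨t, h0, hs, rfl⟩
      induction n with
      | zero => exact h0
      | succ n ih =>
        exact Part.mem_bind_iff.2 ⟨Nat.beta t n, ih fun i hi => hs i (hi.trans (Nat.lt_succ_self _)),
          hs n (Nat.lt_succ_self _)⟩
    · intro h
      suffices h' : ∃ l : List ℕ, l.length = n + 1 ∧ l.getD 0 0 ∈ f a ∧
          (∀ i < n, l.getD (i + 1) 0 ∈ g (Nat.pair a (Nat.pair i (l.getD i 0)))) ∧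
          y = l.getD n 0 by
        obtain ⟨l, hl, h0, hs, hy⟩ := h'
        have hb : ∀ i, i ≤ n → Nat.beta (Nat.unbeta l) i = l.getD i 0 := by
          intro i hi
          have hi' : i < l.length := by omega
          have := Nat.beta_unbeta_coe l ⟨i, hi'⟩
          simp only at this
          rw [this]
          simp [List.getD, hi']
        have tr : ∀ {i u u' w w' : ℕ}, u = u' → w = w' → w ∈ g (Nat.pair a (Nat.pair i u)) →
            w' ∈ g (Nat.pair a (Nat.pair i u')) := by rintro _ _ _ _ _ rfl rfl h; exact h
        refine ⟨Nat.unbeta l, ?_, fun i (hi : i < n) => ?_, hy.trans (hb n le_rfl).symm⟩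
        · exact (hb 0 (Nat.zero_le _)).symm ▸ h0
        · exact tr (hb i hi.le).symm (hb (i + 1) hi).symm (hs i hi)
      clear h1 h2 h2' h3
      induction n generalizing y with
      | zero => exact ⟨[y], rfl, h, by simp, rfl⟩
      | succ n ih =>
        obtain ⟨z, hz, hy⟩ := Part.mem_bind_iff.1 h
        obtain ⟨l, hl, h0, hs, rfl⟩ := ih z hz
        have hget : ∀ i, i ≤ n → (l ++ [y]).getD i 0 = l.getD i 0 := by
          intro i hi
          rw [List.getD_append]
          omega
        refine ⟨l ++ [y], by simp [hl], ?_, fun i hi => ?_, ?_⟩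
        · rw [hget 0 (Nat.zero_le _)]; exact h0
        · rcases Nat.lt_succ_iff_lt_or_eq.1 hi with hi | rfl
          · rw [hget i hi.le, hget (i + 1) hi]; exact hs i hi
          · rw [hget i le_rfl, List.getD_append_right _ _ _ _ (by omega)]
            simpa [hl] using hy
        · rw [List.getD_append_right _ _ _ _ (by omega)]
          simp [hl]
  | @rfind f _ ih =>
    have h1 := ih.comp (f := fun x : ℕ × ℕ => (Nat.pair x.1 x.2, 0))
      ((hfst.natPair hsnd).pair SigF.zero)
    have h2 := ih.comp (f := fun x : ((ℕ × ℕ) × ℕ) × ℕ => (Nat.pair x.1.1.1 x.1.2, x.2 + 1))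
      (((hfst.comp (hfst.comp hfst)).natPair (hsnd.comp hfst)).pair hsnd.succ)
    have h3 := h2.exists.forall_lt.comp (f := fun x : ℕ × ℕ => (x, x.2)) (SigF.id.pair hsnd)
    refine (h1.and h3).of_eq fun x => ?_
    refine Iff.trans (and_congr ⟨fun h => ?_, fun h => ?_⟩ ?_) Nat.mem_rfind.symm
    · exact (Part.mem_map_iff _).2 ⟨0, h, rfl⟩
    · obtain ⟨m, hm, h0⟩ := (Part.mem_map_iff _).1 h
      obtain rfl : m = 0 := of_decide_eq_true h0
      exact hm
    · refine forall_congr' fun i => forall_congr' fun _ => ⟨fun ⟨y, hy⟩ => ?_, fun h => ?_⟩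
      · exact (Part.mem_map_iff _).2 ⟨_, hy, decide_eq_false (Nat.succ_ne_zero _)⟩
      · obtain ⟨m, hm, h0⟩ := (Part.mem_map_iff _).1 h
        have h0 : m ≠ 0 := of_decide_eq_false h0
        obtain ⟨m, rfl⟩ := Nat.exists_eq_succ_of_ne_zero h0
        exact ⟨m, hm⟩

end Representability

end LaxInt

namespace LaxInt

/-! ### Computations with Gödel numbers -/

section Codes

/-- The Gödel number of an implication. -/
def cImp (a b : ℕ) : ℕ := Nat.pair 3 (Nat.pair a b)
/-- The Gödel number of a negation. -/
def cNot (a : ℕ) : ℕ := cImp a (Nat.pair 0 0)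
/-- The Gödel number of a conjunction. -/
def cAnd (a b : ℕ) : ℕ := cNot (cImp a (cNot b))
/-- The Gödel number of a disjunction. -/
def cOr (a b : ℕ) : ℕ := cImp (cNot a) b
/-- The Gödel number of a universal quantification. -/
def cAll (a : ℕ) : ℕ := Nat.pair 4 a
/-- The Gödel number of an existential quantification. -/
def cEx (a : ℕ) : ℕ := cNot (cAll (cNot a))
/-- The Gödel number of a conjunction over a list. -/
def cBigAnd (l : List ℕ) : ℕ := l.foldr cAnd (cNot (Nat.pair 0 0))
/-- The Gödel number of a disjunction over a list. -/
def cBigOr (l : List ℕ) : ℕ := l.foldr cOr (Nat.pair 0 0)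

section
variable {L : FirstOrder.Language.{0, 0}} [Encodable (Σ n, L.Functions n)]
  [Encodable (Σ n, L.Relations n)] {n : ℕ}

theorem code_bot : formulaCode (⊥ : L.BoundedFormula Empty n) = Nat.pair 0 0 := rfl
theorem code_top : formulaCode (⊤ : L.BoundedFormula Empty n) = cNot (Nat.pair 0 0) := rfl
theorem code_imp (φ ψ : L.BoundedFormula Empty n) :
    formulaCode (φ.imp ψ) = cImp (formulaCode φ) (formulaCode ψ) := rfl
theorem code_not (φ : L.BoundedFormula Empty n) : formulaCode (∼φ) = cNot (formulaCode φ) := rfl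
theorem code_inf (φ ψ : L.BoundedFormula Empty n) :
    formulaCode (φ ⊓ ψ) = cAnd (formulaCode φ) (formulaCode ψ) := rfl
theorem code_sup (φ ψ : L.BoundedFormula Empty n) :
    formulaCode (φ ⊔ ψ) = cOr (formulaCode φ) (formulaCode ψ) := rfl
theorem code_all (φ : L.BoundedFormula Empty (n + 1)) :
    formulaCode φ.all = cAll (formulaCode φ) := rfl
theorem code_ex (φ : L.BoundedFormula Empty (n + 1)) :
    formulaCode φ.ex = cEx (formulaCode φ) := rfl

theorem code_bigAnd (l : List (L.BoundedFormula Empty n)) :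
    formulaCode (bigAnd l) = cBigAnd (l.map formulaCode) := by
  induction l with
  | nil => rfl
  | cons φ l ih =>
    change cAnd (formulaCode φ) (formulaCode (bigAnd l)) = _
    rw [ih]; rfl

theorem code_bigOr (l : List (L.BoundedFormula Empty n)) :
    formulaCode (bigOr l) = cBigOr (l.map formulaCode) := by
  induction l with
  | nil => rfl
  | cons φ l ih =>
    change cOr (formulaCode φ) (formulaCode (bigOr l)) = _
    rw [ih]; rfl

theorem code_exBlock : ∀ (k : ℕ) (φ : L.BoundedFormula Empty (n + k)),
    formulaCode (exBlock k φ) = cEx^[k] (formulaCode φ)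
  | 0, φ => rfl
  | k + 1, φ => by
    rw [exBlock, code_exBlock k φ.ex, Function.iterate_succ_apply, code_ex]

theorem code_eq (i j : Fin n) :
    formulaCode ((&i) =' (&j) : L.BoundedFormula Empty n) = eqCode i j := rfl

end

theorem primrec_cImp : Primrec₂ cImp :=
  Primrec₂.natPair.comp (Primrec.const 3) (Primrec₂.natPair.comp Primrec.fst Primrec.snd)
theorem primrec_cNot : Primrec cNot := primrec_cImp.comp Primrec.id (Primrec.const _)
theorem primrec_cAnd : Primrec₂ cAnd :=
  primrec_cNot.comp (primrec_cImp.comp Primrec.fst (primrec_cNot.comp Primrec.snd))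
theorem primrec_cOr : Primrec₂ cOr :=
  primrec_cImp.comp (primrec_cNot.comp Primrec.fst) Primrec.snd
theorem primrec_cAll : Primrec cAll := Primrec₂.natPair.comp (Primrec.const 4) Primrec.id
theorem primrec_cEx : Primrec cEx := primrec_cNot.comp (primrec_cAll.comp primrec_cNot)
theorem primrec_cBigAnd : Primrec cBigAnd :=
  Primrec.list_foldr Primrec.id (Primrec.const _)
    (primrec_cAnd.comp (Primrec.fst.comp Primrec.snd) (Primrec.snd.comp Primrec.snd)).to₂
theorem primrec_cBigOr : Primrec cBigOr :=
  Primrec.list_foldr Primrec.id (Primrec.const _)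
    (primrec_cOr.comp (Primrec.fst.comp Primrec.snd) (Primrec.snd.comp Primrec.snd)).to₂

/-- Recursion with at most two recursive calls, at arguments that are computed from the current
argument; a call at an argument that is not smaller has value `0`. -/
def twoCalls (step : ℕ → ℕ → ℕ → ℕ) (j₁ j₂ : ℕ → ℕ) (k : ℕ) : ℕ :=
  step k (if _h : j₁ k < k then twoCalls step j₁ j₂ (j₁ k) else 0)
    (if _h : j₂ k < k then twoCalls step j₁ j₂ (j₂ k) else 0)

theorem primrec_twoCalls {step : ℕ → ℕ → ℕ → ℕ} {j₁ j₂ : ℕ → ℕ}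
    (hs : Primrec fun x : ℕ × ℕ × ℕ => step x.1 x.2.1 x.2.2) (h1 : Primrec j₁) (h2 : Primrec j₂) :
    Primrec (twoCalls step j₁ j₂) := by
  have hg : Primrec₂ fun (_ : Unit) (l : List ℕ) => some (step l.length
      (l.getD (j₁ l.length) 0) (l.getD (j₂ l.length) 0)) := by
    have hl : Primrec fun x : Unit × List ℕ => x.2.length := Primrec.list_length.comp Primrec.snd
    exact Primrec.option_some.comp (hs.comp (hl.pair
      (((Primrec.list_getD 0).comp Primrec.snd (h1.comp hl)).pair
        ((Primrec.list_getD 0).comp Primrec.snd (h2.comp hl)))))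
  have := Primrec.nat_strong_rec (fun _ k => twoCalls step j₁ j₂ k) hg fun _ k => ?_
  · exact this.comp (Primrec.const ()) Primrec.id
  · have hget : ∀ j, ((List.range k).map (twoCalls step j₁ j₂)).getD j 0 =
        if _h : j < k then twoCalls step j₁ j₂ j else 0 := by
      intro j
      split_ifs with h <;> simp [List.getD, h]
    simp only [List.length_map, List.length_range, hget]
    conv_rhs => rw [twoCalls]

/-- The Gödel number of `xᵢ < xⱼ` in the language of scattered numbers. -/
noncomputable def cLt (i j : ℕ) : ℕ :=
  relCode (Encodable.encode (⟨2, ScatRel.lt⟩ : Σ n, scatLang.Relations n)) [i, j]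
/-- The Gödel number of `xᵢ ≤ xⱼ` in the language of scattered numbers. -/
noncomputable def cLe (i j : ℕ) : ℕ := cOr (cLt i j) (eqCode i j)
/-- The Gödel number of `S(xᵢ, xⱼ)` in the language of scattered numbers. -/
noncomputable def cSucc (i j : ℕ) : ℕ :=
  relCode (Encodable.encode (⟨2, ScatRel.succ⟩ : Σ n, scatLang.Relations n)) [i, j]

theorem code_sLt {n : ℕ} (i j : Fin n) :
    formulaCode (sLt (&i) (&j) : scatLang.BoundedFormula Empty n) = cLt i j := rfl
theorem code_sLe {n : ℕ} (i j : Fin n) :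
    formulaCode (sLe (&i) (&j) : scatLang.BoundedFormula Empty n) = cLe i j := rfl
theorem code_sSucc {n : ℕ} (i j : Fin n) :
    formulaCode (sSucc (&i) (&j) : scatLang.BoundedFormula Empty n) = cSucc i j := rfl

theorem primrec_list_two : Primrec₂ fun i j : ℕ => [i, j] :=
  Primrec.list_cons.comp Primrec.fst (Primrec.list_cons.comp Primrec.snd (Primrec.const []))
theorem primrec_cLt : Primrec₂ cLt :=
  primrec_relCode.comp (Primrec.const _) primrec_list_two
theorem primrec_cSucc : Primrec₂ cSucc :=
  primrec_relCode.comp (Primrec.const _) primrec_list_two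
theorem primrec_cLe : Primrec₂ cLe := primrec_cOr.comp₂ primrec_cLt primrec_eqCode

/-- The first recursive argument in the computation of the code of `PureDelta.toScat`. The argument
`k` stands for a formula with code `k.unpair.2` whose number of free variables is
`k.unpair.1 - k.unpair.2`. -/
def scatArg₁ (k : ℕ) : ℕ :=
  let n := k.unpair.1 - k.unpair.2
  let t := k.unpair.2.unpair.1
  let r := k.unpair.2.unpair.2
  if t = 7 then Nat.pair (n + r) r
  else if t ≤ 10 then Nat.pair (n + r.unpair.1) r.unpair.1
  else Nat.pair (n + 1 + r.unpair.2) r.unpair.2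

/-- The second recursive argument in the computation of the code of `PureDelta.toScat`. -/
def scatArg₂ (k : ℕ) : ℕ :=
  let n := k.unpair.1 - k.unpair.2
  let r := k.unpair.2.unpair.2
  Nat.pair (n + r.unpair.2) r.unpair.2

/-- The computation step for the code of `PureDelta.toScat`. -/
noncomputable def scatStep (k a b : ℕ) : ℕ :=
  let n := k.unpair.1 - k.unpair.2
  let t := k.unpair.2.unpair.1
  let r := k.unpair.2.unpair.2
  let v := r.unpair.1 + 2
  let w := r.unpair.2 + 2
  let g := cAnd (cLe 0 (n + 2)) (cLe (n + 2) 1)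
  let l := [v, r.unpair.2.unpair.1 + 2, r.unpair.2.unpair.2 + 2]
  if t = 0 then Nat.pair 0 0
  else if t = 1 then cNot (Nat.pair 0 0)
  else if t = 2 then cLt v w
  else if t = 3 then eqCode 0 (r + 2)
  else if t = 4 then cSucc v w
  else if t = 5 then
    relCode (Encodable.encode (⟨3, ScatRel.add⟩ : Σ n, scatLang.Relations n)) l
  else if t = 6 then
    relCode (Encodable.encode (⟨3, ScatRel.mul⟩ : Σ n, scatLang.Relations n)) l
  else if t = 7 then cNot a
  else if t = 8 then cAnd a b
  else if t = 9 then cOr a b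
  else if t = 10 then cImp a b
  else if t = 11 then cAll (cImp g (cImp (cLt (n + 2) v) a))
  else if t = 12 then cEx (cAnd g (cAnd (cLt (n + 2) v) a))
  else if t = 13 then cAll (cImp g (cImp (cLe (n + 2) v) a))
  else cEx (cAnd g (cAnd (cLe (n + 2) v) a))

theorem primrec_scatArg₁ : Primrec scatArg₁ := by
  have hu := Primrec.unpair
  have hc : Primrec fun k : ℕ => k.unpair.2 := Primrec.snd.comp hu
  have hn : Primrec fun k : ℕ => k.unpair.1 - k.unpair.2 :=
    Primrec.nat_sub.comp (Primrec.fst.comp hu) hc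
  have ht : Primrec fun k : ℕ => k.unpair.2.unpair.1 := Primrec.fst.comp (hu.comp hc)
  have hr : Primrec fun k : ℕ => k.unpair.2.unpair.2 := Primrec.snd.comp (hu.comp hc)
  have hr1 := Primrec.fst.comp (hu.comp hr)
  have hr2 := Primrec.snd.comp (hu.comp hr)
  exact Primrec.ite (Primrec.eq.comp ht (Primrec.const 7))
    (Primrec₂.natPair.comp (Primrec.nat_add.comp hn hr) hr)
    (Primrec.ite (Primrec.nat_le.comp ht (Primrec.const 10))
      (Primrec₂.natPair.comp (Primrec.nat_add.comp hn hr1) hr1)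
      (Primrec₂.natPair.comp (Primrec.nat_add.comp (Primrec.succ.comp hn) hr2) hr2))

theorem primrec_scatArg₂ : Primrec scatArg₂ := by
  have hu := Primrec.unpair
  have hc : Primrec fun k : ℕ => k.unpair.2 := Primrec.snd.comp hu
  have hn : Primrec fun k : ℕ => k.unpair.1 - k.unpair.2 :=
    Primrec.nat_sub.comp (Primrec.fst.comp hu) hc
  have hr : Primrec fun k : ℕ => k.unpair.2.unpair.2 := Primrec.snd.comp (hu.comp hc)
  have hr2 := Primrec.snd.comp (hu.comp hr)
  exact Primrec₂.natPair.comp (Primrec.nat_add.comp hn hr2) hr2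

theorem primrec_scatStep : Primrec fun x : ℕ × ℕ × ℕ => scatStep x.1 x.2.1 x.2.2 := by
  have hu := Primrec.unpair
  have hc : Primrec fun x : ℕ × ℕ × ℕ => x.1.unpair.2 := Primrec.snd.comp (hu.comp Primrec.fst)
  have hn : Primrec fun x : ℕ × ℕ × ℕ => x.1.unpair.1 - x.1.unpair.2 + 2 :=
    Primrec.succ.comp (Primrec.succ.comp
      (Primrec.nat_sub.comp (Primrec.fst.comp (hu.comp Primrec.fst)) hc))
  have ht : Primrec fun x : ℕ × ℕ × ℕ => x.1.unpair.2.unpair.1 := Primrec.fst.comp (hu.comp hc)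
  have hr : Primrec fun x : ℕ × ℕ × ℕ => x.1.unpair.2.unpair.2 := Primrec.snd.comp (hu.comp hc)
  have s2 : Primrec fun n : ℕ => n + 2 := Primrec.succ.comp Primrec.succ
  have hr' := Primrec.snd.comp (hu.comp hr)
  have hv := s2.comp (Primrec.fst.comp (hu.comp hr))
  have hw := s2.comp hr'
  have hg := primrec_cAnd.comp (primrec_cLe.comp (Primrec.const 0) hn)
    (primrec_cLe.comp hn (Primrec.const 1))
  have hl := Primrec.list_cons.comp hv (Primrec.list_cons.comp
    (s2.comp (Primrec.fst.comp (hu.comp hr'))) (Primrec.list_cons.comp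
      (s2.comp (Primrec.snd.comp (hu.comp hr'))) (Primrec.const [])))
  have ha : Primrec fun x : ℕ × ℕ × ℕ => x.2.1 := Primrec.fst.comp Primrec.snd
  have hb : Primrec fun x : ℕ × ℕ × ℕ => x.2.2 := Primrec.snd.comp Primrec.snd
  have hif : ∀ (i : ℕ) {f g : ℕ × ℕ × ℕ → ℕ}, Primrec f → Primrec g →
      Primrec fun x => if x.1.unpair.2.unpair.1 = i then f x else g x := fun i _ _ hf hg =>
    Primrec.ite (Primrec.eq.comp ht (Primrec.const i)) hf hg
  refine hif 0 (Primrec.const _) (hif 1 (Primrec.const _) (hif 2 (primrec_cLt.comp hv hw)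
    (hif 3 (primrec_eqCode.comp (Primrec.const 0) (s2.comp hr)) (hif 4 (primrec_cSucc.comp hv hw)
    (hif 5 (primrec_relCode.comp (Primrec.const _) hl)
    (hif 6 (primrec_relCode.comp (Primrec.const _) hl)
    (hif 7 (primrec_cNot.comp ha) (hif 8 (primrec_cAnd.comp ha hb) (hif 9 (primrec_cOr.comp ha hb)
    (hif 10 (primrec_cImp.comp ha hb)
    (hif 11 ?_ (hif 12 ?_ (hif 13 ?_ ?_)))))))))))))
  · exact primrec_cAll.comp (primrec_cImp.comp hg (primrec_cImp.comp (primrec_cLt.comp hn hv) ha))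
  · exact primrec_cEx.comp (primrec_cAnd.comp hg (primrec_cAnd.comp (primrec_cLt.comp hn hv) ha))
  · exact primrec_cAll.comp (primrec_cImp.comp hg (primrec_cImp.comp (primrec_cLe.comp hn hv) ha))
  · exact primrec_cEx.comp (primrec_cAnd.comp hg (primrec_cAnd.comp (primrec_cLe.comp hn hv) ha))

theorem lt_pair_of_pos {t : ℕ} (ht : 0 < t) (r : ℕ) : r < Nat.pair t r := by
  have := Nat.add_le_pair t r
  omega

theorem pair_add_lt {n m c d : ℕ} (h : n + c ≤ m + d) (h' : c < d) :
    Nat.pair (n + c) c < Nat.pair (m + d) d :=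
  (Nat.pair_lt_pair_right _ h').trans_le (by
    rcases h.lt_or_eq with h | h
    · exact (Nat.pair_lt_pair_left _ h).le
    · rw [h])

theorem twoCalls_toScat : ∀ {n : ℕ} (δ : PureDelta n),
    twoCalls scatStep scatArg₁ scatArg₂ (Nat.pair (n + δ.code) δ.code) = formulaCode δ.toScat := by
  intro n δ
  induction δ with
  | bot => rw [twoCalls]; simp [scatStep, PureDelta.code, PureDelta.toScat, code_bot]
  | top => rw [twoCalls]; simp [scatStep, PureDelta.code, PureDelta.toScat, code_top]
  | lt u v =>
    rw [twoCalls]; simp [scatStep, PureDelta.code, PureDelta.toScat]; rfl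
  | zero u => rw [twoCalls]; simp [scatStep, PureDelta.code, PureDelta.toScat]; rfl
  | succ u v => rw [twoCalls]; simp [scatStep, PureDelta.code, PureDelta.toScat]; rfl
  | add u v w => rw [twoCalls]; simp [scatStep, PureDelta.code, PureDelta.toScat]; rfl
  | mul u v w => rw [twoCalls]; simp [scatStep, PureDelta.code, PureDelta.toScat]; rfl
  | @neg n φ ih =>
    have hlt : φ.code < φ.neg.code := lt_pair_of_pos (by decide) _
    have h1 : scatArg₁ (Nat.pair (n + φ.neg.code) φ.neg.code) =
        Nat.pair (n + φ.code) φ.code := by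
      simp [scatArg₁, PureDelta.code]
    rw [twoCalls, h1, dif_pos (pair_add_lt (by omega) hlt), ih]
    simp [scatStep, PureDelta.code, PureDelta.toScat, code_not]
  | @and n φ ψ ih1 ih2 =>
    have hlt : Nat.pair φ.code ψ.code < (φ.and ψ).code := lt_pair_of_pos (by decide) _
    have h1 : scatArg₁ (Nat.pair (n + (φ.and ψ).code) (φ.and ψ).code) =
        Nat.pair (n + φ.code) φ.code := by
      simp [scatArg₁, PureDelta.code]
    have h2 : scatArg₂ (Nat.pair (n + (φ.and ψ).code) (φ.and ψ).code) =
        Nat.pair (n + ψ.code) ψ.code := by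
      simp [scatArg₂, PureDelta.code]
    have hl1 := (Nat.left_le_pair φ.code ψ.code).trans_lt hlt
    have hl2 := (Nat.right_le_pair φ.code ψ.code).trans_lt hlt
    rw [twoCalls, h1, h2, dif_pos (pair_add_lt (by omega) hl1), ih1,
      dif_pos (pair_add_lt (by omega) hl2), ih2]
    simp [scatStep, PureDelta.code, PureDelta.toScat, code_inf]
  | @or n φ ψ ih1 ih2 =>
    have hlt : Nat.pair φ.code ψ.code < (φ.or ψ).code := lt_pair_of_pos (by decide) _
    have h1 : scatArg₁ (Nat.pair (n + (φ.or ψ).code) (φ.or ψ).code) =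
        Nat.pair (n + φ.code) φ.code := by
      simp [scatArg₁, PureDelta.code]
    have h2 : scatArg₂ (Nat.pair (n + (φ.or ψ).code) (φ.or ψ).code) =
        Nat.pair (n + ψ.code) ψ.code := by
      simp [scatArg₂, PureDelta.code]
    have hl1 := (Nat.left_le_pair φ.code ψ.code).trans_lt hlt
    have hl2 := (Nat.right_le_pair φ.code ψ.code).trans_lt hlt
    rw [twoCalls, h1, h2, dif_pos (pair_add_lt (by omega) hl1), ih1,
      dif_pos (pair_add_lt (by omega) hl2), ih2]
    simp [scatStep, PureDelta.code, PureDelta.toScat, code_sup]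
  | @imp n φ ψ ih1 ih2 =>
    have hlt : Nat.pair φ.code ψ.code < (φ.imp ψ).code := lt_pair_of_pos (by decide) _
    have h1 : scatArg₁ (Nat.pair (n + (φ.imp ψ).code) (φ.imp ψ).code) =
        Nat.pair (n + φ.code) φ.code := by
      simp [scatArg₁, PureDelta.code]
    have h2 : scatArg₂ (Nat.pair (n + (φ.imp ψ).code) (φ.imp ψ).code) =
        Nat.pair (n + ψ.code) ψ.code := by
      simp [scatArg₂, PureDelta.code]
    have hl1 := (Nat.left_le_pair φ.code ψ.code).trans_lt hlt
    have hl2 := (Nat.right_le_pair φ.code ψ.code).trans_lt hlt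
    rw [twoCalls, h1, h2, dif_pos (pair_add_lt (by omega) hl1), ih1,
      dif_pos (pair_add_lt (by omega) hl2), ih2]
    simp [scatStep, PureDelta.code, PureDelta.toScat, code_imp]
  | @allLt n v φ ih =>
    have hlt : φ.code < (φ.allLt v).code :=
      (Nat.right_le_pair _ _).trans_lt (lt_pair_of_pos (by decide) _)
    have h1 : scatArg₁ (Nat.pair (n + (φ.allLt v).code) (φ.allLt v).code) =
        Nat.pair (n + 1 + φ.code) φ.code := by
      simp [scatArg₁, PureDelta.code]
    rw [twoCalls, h1, dif_pos (pair_add_lt (by omega) hlt), ih]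
    simp [scatStep, PureDelta.code, PureDelta.toScat]
    rfl
  | @exLt n v φ ih =>
    have hlt : φ.code < (φ.exLt v).code :=
      (Nat.right_le_pair _ _).trans_lt (lt_pair_of_pos (by decide) _)
    have h1 : scatArg₁ (Nat.pair (n + (φ.exLt v).code) (φ.exLt v).code) =
        Nat.pair (n + 1 + φ.code) φ.code := by
      simp [scatArg₁, PureDelta.code]
    rw [twoCalls, h1, dif_pos (pair_add_lt (by omega) hlt), ih]
    simp [scatStep, PureDelta.code, PureDelta.toScat]
    rfl
  | @allLe n v φ ih =>
    have hlt : φ.code < (φ.allLe v).code :=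
      (Nat.right_le_pair _ _).trans_lt (lt_pair_of_pos (by decide) _)
    have h1 : scatArg₁ (Nat.pair (n + (φ.allLe v).code) (φ.allLe v).code) =
        Nat.pair (n + 1 + φ.code) φ.code := by
      simp [scatArg₁, PureDelta.code]
    rw [twoCalls, h1, dif_pos (pair_add_lt (by omega) hlt), ih]
    simp [scatStep, PureDelta.code, PureDelta.toScat]
    rfl
  | @exLe n v φ ih =>
    have hlt : φ.code < (φ.exLe v).code :=
      (Nat.right_le_pair _ _).trans_lt (lt_pair_of_pos (by decide) _)
    have h1 : scatArg₁ (Nat.pair (n + (φ.exLe v).code) (φ.exLe v).code) =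
        Nat.pair (n + 1 + φ.code) φ.code := by
      simp [scatArg₁, PureDelta.code]
    rw [twoCalls, h1, dif_pos (pair_add_lt (by omega) hlt), ih]
    simp [scatStep, PureDelta.code, PureDelta.toScat]
    rfl

/-- The assignment `δ ↦ witnessSentence δ` is recursive. -/
theorem exists_computable_witnessSentence : ∃ f : ℕ → ℕ, Computable f ∧
    ∀ δ : PureDelta 1, f δ.code = formulaCode (witnessSentence δ) := by
  let c := formulaCode (BoundedFormula.relabel Sum.inr scatModelsTN : scatLang.BoundedFormula Empty 2)
  refine ⟨fun k => cEx (cEx (cAnd c (cEx (cAnd (cAnd (cLe 0 2) (cLt 2 1))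
    (twoCalls scatStep scatArg₁ scatArg₂ (Nat.pair (1 + k) k)))))), Primrec.to_comp ?_, fun δ => ?_⟩
  · have h := (primrec_twoCalls primrec_scatStep primrec_scatArg₁ primrec_scatArg₂).comp
      (Primrec₂.natPair.comp (Primrec.nat_add.comp (Primrec.const 1) Primrec.id) Primrec.id)
    exact primrec_cEx.comp (primrec_cEx.comp (primrec_cAnd.comp (Primrec.const _) (primrec_cEx.comp
      (primrec_cAnd.comp (Primrec.const _) h))))
  · simp only [twoCalls_toScat]
    rfl

end Codes

end LaxInt

namespace LaxInt

/-! ### An undecidable family of `Σ₁`-sentences -/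

/-- For a pure `Δ₀`-formula with variables `x₀, …, xₙ`: the variable `xₙ` has value `k`. -/
def PureDelta.lastEq : (k n : ℕ) → PureDelta (n + 1)
  | 0, n => .zero (Fin.last n)
  | k + 1, n => .exLt (Fin.last n)
      (.and (.succ (Fin.last (n + 1)) (Fin.last n).castSucc) (lastEq k (n + 1)))

theorem holds_lastEq : ∀ (k : ℕ) {n : ℕ} (v : Fin (n + 1) → ℕ),
    (PureDelta.lastEq k n).Holds ℕ v ↔ v (Fin.last n) = k
  | 0, n, v => holds_nat_zero v _
  | k + 1, n, v => by
    simp only [PureDelta.lastEq, holds_nat_exLt, holds_nat_and, holds_nat_succ, holds_lastEq k,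
      Fin.snoc_last, Fin.snoc_castSucc]
    constructor
    · rintro ⟨x, -, h, rfl⟩; exact h
    · intro h; exact ⟨k, by omega, h, rfl⟩

/-- The code of `PureDelta.lastEq i (k - i + 1)`, computed by recursion on `i`. -/
def lastEqCode (k i : ℕ) : ℕ :=
  Nat.rec (Nat.pair 3 (k + 1)) (fun i d => Nat.pair 12 (Nat.pair (k - i) (Nat.pair 8
    (Nat.pair (Nat.pair 4 (Nat.pair (k - i + 1) (k - i))) d)))) i

theorem lastEqCode_eq (k : ℕ) : ∀ i, i ≤ k →
    lastEqCode k i = (PureDelta.lastEq i (k - i + 1)).code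
  | 0, _ => rfl
  | i + 1, h => by
    have ih := lastEqCode_eq k i (by omega)
    have h1 : k - (i + 1) + 1 = k - i := by omega
    rw [h1]
    change Nat.pair 12 (Nat.pair (k - i) (Nat.pair 8
      (Nat.pair (Nat.pair 4 (Nat.pair (k - i + 1) (k - i))) (lastEqCode k i)))) = _
    rw [ih]
    rfl

theorem primrec_lastEqCode : Primrec₂ lastEqCode := by
  refine Primrec.nat_rec (f := fun k => Nat.pair 3 (k + 1))
    (g := fun k x => Nat.pair 12 (Nat.pair (k - x.1) (Nat.pair 8
    (Nat.pair (Nat.pair 4 (Nat.pair (k - x.1 + 1) (k - x.1))) x.2))))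
    (Primrec₂.natPair.comp (Primrec.const 3) Primrec.succ) ?_
  have hs : Primrec fun x : ℕ × ℕ × ℕ => x.1 - x.2.1 :=
    Primrec.nat_sub.comp Primrec.fst (Primrec.fst.comp Primrec.snd)
  exact Primrec₂.natPair.comp (Primrec.const 12) (Primrec₂.natPair.comp hs
    (Primrec₂.natPair.comp (Primrec.const 8) (Primrec₂.natPair.comp
      (Primrec₂.natPair.comp (Primrec.const 4) (Primrec₂.natPair.comp (Primrec.succ.comp hs) hs))
      (Primrec.snd.comp Primrec.snd))))

/-- A computable sequence of pure 1-`Σ₁`-sentences, given by their matrices, such that it is not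
recursively enumerable which of them are false. -/
theorem exists_undecidable_family : ∃ δ : ℕ → PureDelta 1, Computable (fun k => (δ k).code) ∧
    ¬REPred fun k => ¬∃ x, (δ k).Holds ℕ fun _ => x := by
  let u : ℕ →. ℕ := fun k => (Denumerable.ofNat Nat.Partrec.Code k).eval 0
  have hu : Nat.Partrec u := by
    refine Partrec.nat_iff.1 ?_
    exact Nat.Partrec.Code.eval_part.comp (Computable.ofNat _) (Computable.const 0)
  obtain ⟨ε, hε⟩ := (Sig.of_partrec hu).exists
  let δ : ℕ → PureDelta 1 := fun k =>
    .exLe 0 (.and (.lastEq k 1) (.exLe 0 (ε.rename ![1, 2])))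
  have hδ : ∀ k, (∃ x, (δ k).Holds ℕ fun _ => x) ↔ (u k).Dom := by
    intro k
    have hv : ∀ x : ℕ, (fun _ : Fin 1 => x) = ![x] := fun x => funext fun i => by fin_cases i; rfl
    refine Iff.trans (Iff.trans ?_ (hε k).symm) (Part.dom_iff_mem (o := u k)).symm
    simp only [δ, hv, holds_nat_and, holds_nat_exLe, holds_lastEq, PureDelta.holds_rename,
      snoc_vecCons, snoc_vecEmpty, comp_vecCons, comp_vecEmpty, Matrix.cons_val,
      Encodable.encode_nat]
    constructor
    · rintro ⟨x, y, -, hy, b, -, hb⟩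
      obtain rfl : y = k := hy
      exact ⟨b, hb⟩
    · rintro ⟨b, hb⟩
      exact ⟨max k b, k, by simp, rfl, b, by simp, hb⟩
  refine ⟨δ, ?_, fun h => ?_⟩
  · have hc : ∀ k, (δ k).code = Nat.pair 14 (Nat.pair 0 (Nat.pair 8 (Nat.pair (lastEqCode k k)
        (PureDelta.exLe (0 : Fin 2) (ε.rename ![1, 2])).code))) := by
      intro k
      rw [lastEqCode_eq k k le_rfl, Nat.sub_self]
      rfl
    simp only [hc]
    exact Primrec.to_comp (Primrec₂.natPair.comp (Primrec.const _) (Primrec₂.natPair.comp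
      (Primrec.const _) (Primrec₂.natPair.comp (Primrec.const _) (Primrec₂.natPair.comp
        (primrec_lastEqCode.comp Primrec.id Primrec.id) (Primrec.const _)))))
  · refine ComputablePred.halting_problem_not_re 0 ?_
    refine (rePred_comp h (Computable.encode (α := Nat.Partrec.Code))).of_eq fun c => ?_
    rw [hδ]
    simp [u]

/-! ### Recursive enumerability of the theories -/

section
variable {L : FirstOrder.Language.{0, 0}} [Encodable (Σ n, L.Functions n)]
  [Encodable (Σ n, L.Relations n)]

theorem isRE_union {V W : L.Theory} (hV : IsRE V) (hW : IsRE W) : IsRE (V ∪ W) :=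
  (rePred_or hV hW).of_eq fun k => by
    simp only [Set.mem_union, or_and_right, exists_or]

theorem isRE_of_finite {V : L.Theory} (hV : V.Finite) : IsRE V :=
  (rePred_mem_finite (hV.image formulaCode)).of_eq fun k => by simp

end

theorem code_bigAnd_finRange {L : FirstOrder.Language.{0, 0}} [Encodable (Σ n, L.Functions n)]
    [Encodable (Σ n, L.Relations n)] {n k : ℕ} {φ : Fin k → L.BoundedFormula Empty n} {c : ℕ → ℕ}
    (h : ∀ i, formulaCode (φ i) = c i) :
    formulaCode (bigAnd ((List.finRange k).map φ)) = cBigAnd ((List.range k).map c) := by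
  rw [code_bigAnd, List.map_map]
  congr 1
  refine List.ext_getElem (by simp) fun i h1 h2 => ?_
  simp [h]

theorem primrec_iterate {α : Type} [Primcodable α] {f : ℕ → ℕ} (hf : Primrec f) {g h : α → ℕ}
    (hg : Primrec g) (hh : Primrec h) : Primrec fun a => f^[g a] (h a) :=
  Primrec.nat_iterate hg hh (hf.comp Primrec.snd).to₂

/-- The Gödel number of `numeralBelow n`. -/
noncomputable def numeralBelowCode (n : ℕ) : ℕ :=
  cEx^[n + 1] (cAnd (cAnd (eqCode 2 0)
    (cBigAnd ((List.range (n + 1)).map fun i => cAnd (cLe 0 (2 + i)) (cLt (2 + i) 1))))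
    (cBigAnd ((List.range n).map fun i => cSucc (2 + i) (2 + (i + 1)))))

theorem code_numeralBelow (n : ℕ) : formulaCode (numeralBelow n) = numeralBelowCode n := by
  have h1 : ∀ i : Fin (n + 1), formulaCode
      (sLe (&(Fin.castAdd (n + 1) (0 : Fin 2))) (&(Fin.natAdd 2 i)) ⊓
        sLt (&(Fin.natAdd 2 i)) (&(Fin.castAdd (n + 1) (1 : Fin 2))) :
          scatLang.BoundedFormula Empty (2 + (n + 1))) = cAnd (cLe 0 (2 + i)) (cLt (2 + i) 1) := by
    intro i
    rw [code_inf, code_sLe, code_sLt]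
    rfl
  have h2 : ∀ i : Fin n, formulaCode
      (sSucc (&(Fin.natAdd 2 i.castSucc)) (&(Fin.natAdd 2 i.succ)) :
          scatLang.BoundedFormula Empty (2 + (n + 1))) = cSucc (2 + i) (2 + (i + 1)) := by
    intro i
    rw [code_sSucc]
    rfl
  rw [numeralBelow, code_exBlock, code_inf, code_inf, code_eq,
    code_bigAnd_finRange (c := fun i => cAnd (cLe 0 (2 + i)) (cLt (2 + i) 1)) h1,
    code_bigAnd_finRange (c := fun i => cSucc (2 + i) (2 + (i + 1))) h2]
  rfl

theorem primrec_numeralBelowCode : Primrec numeralBelowCode := by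
  have h2 : Primrec fun i : ℕ => 2 + i := Primrec.nat_add.comp (Primrec.const 2) Primrec.id
  refine primrec_iterate primrec_cEx Primrec.succ (primrec_cAnd.comp (primrec_cAnd.comp
    (Primrec.const _) (primrec_cBigAnd.comp (Primrec.list_map
      (Primrec.list_range.comp Primrec.succ) ?_)))
    (primrec_cBigAnd.comp (Primrec.list_map Primrec.list_range ?_)))
  · exact (primrec_cAnd.comp (primrec_cLe.comp (Primrec.const 0) (h2.comp Primrec.snd))
      (primrec_cLt.comp (h2.comp Primrec.snd) (Primrec.const 1))).to₂
  · exact (primrec_cSucc.comp (h2.comp Primrec.snd)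
      (h2.comp (Primrec.succ.comp Primrec.snd))).to₂

/-- The Gödel number of `atLeast n`. -/
noncomputable def atLeastCode (n : ℕ) : ℕ :=
  cEx^[n] (cAnd (cBigAnd ((List.range n).map fun i => cLe 0 (1 + i)))
    (cBigAnd ((List.range n).map fun j => cBigAnd ((List.range j).map fun i =>
      cNot (eqCode (1 + i) (1 + j))))))

theorem map_val_filter_finRange {n : ℕ} (j : Fin n) :
    ((List.finRange n).filter (· < j)).map Fin.val = List.range j := by
  have h2 : (List.finRange n).map Fin.val = List.range n := by simp
  have h3 : (List.range n).filter (· < j.1) = List.range j := by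
    obtain ⟨d, hd⟩ := Nat.exists_eq_add_of_le j.2.le
    generalize j.1 = i at hd
    rw [hd, List.range_add, List.filter_append,
      List.filter_eq_self.2 (by simp), List.filter_eq_nil_iff.2 (by simp), List.append_nil]
  rw [← h3, ← h2, List.filter_map]
  rfl

theorem code_atLeast (n : ℕ) : formulaCode (atLeast n) = atLeastCode n := by
  have h1 : ∀ i : Fin n, formulaCode
      (sLe (&(Fin.castAdd n (0 : Fin 1))) (&(Fin.natAdd 1 i)) :
          scatLang.BoundedFormula Empty (1 + n)) = cLe 0 (1 + i) := by
    intro i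
    rw [code_sLe]
    rfl
  have h2 : ∀ j : Fin n, formulaCode
      (bigAnd (((List.finRange n).filter (· < j)).map fun i =>
          ∼((&(Fin.natAdd 1 i)) =' (&(Fin.natAdd 1 j)))) :
          scatLang.BoundedFormula Empty (1 + n)) =
        cBigAnd ((List.range j).map fun i => cNot (eqCode (1 + i) (1 + j))) := by
    intro j
    rw [code_bigAnd, List.map_map, ← map_val_filter_finRange, List.map_map]
    congr 1
  rw [atLeast, code_exBlock, code_inf,
    code_bigAnd_finRange (c := fun i => cLe 0 (1 + i)) h1,
    code_bigAnd_finRange (c := fun j => cBigAnd ((List.range j).map fun i =>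
      cNot (eqCode (1 + i) (1 + j)))) h2]
  rfl

theorem primrec_atLeastCode : Primrec atLeastCode := by
  have h2 : Primrec fun i : ℕ => 1 + i := Primrec.nat_add.comp (Primrec.const 1) Primrec.id
  refine primrec_iterate primrec_cEx Primrec.id (primrec_cAnd.comp
    (primrec_cBigAnd.comp (Primrec.list_map Primrec.list_range ?_))
    (primrec_cBigAnd.comp (Primrec.list_map Primrec.list_range ?_)))
  · exact (primrec_cLe.comp (Primrec.const 0) (h2.comp Primrec.snd)).to₂
  · have h3 : Primrec₂ fun (x : ℕ × ℕ) (i : ℕ) => cNot (eqCode (1 + i) (1 + x.2)) :=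
      primrec_cNot.comp (primrec_eqCode.comp (h2.comp Primrec.snd)
        (h2.comp (Primrec.snd.comp Primrec.fst)))
    exact (primrec_cBigAnd.comp (Primrec.list_map (Primrec.list_range.comp Primrec.snd) h3)).to₂

theorem isRE_PAscat : IsRE PAscat := by
  let c := formulaCode (BoundedFormula.relabel Sum.inr scatModelsTN : scatLang.BoundedFormula Empty 2)
  have hcode : ∀ n, formulaCode (∃' (tildeNum n) : scatLang.Sentence) =
      cEx (cAnd (cEx (cAnd (cAnd (cLe 0 1) (numeralBelowCode n)) c)) (atLeastCode n)) := by
    intro n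
    rw [← code_numeralBelow, ← code_atLeast]
    rfl
  refine (rePred_range (Primrec.to_comp (primrec_cEx.comp (primrec_cAnd.comp (primrec_cEx.comp
    (primrec_cAnd.comp (primrec_cAnd.comp (Primrec.const (cLe 0 1)) primrec_numeralBelowCode)
      (Primrec.const c))) primrec_atLeastCode)))).of_eq fun k => ?_
  simp only [PAscat, Set.mem_range, exists_exists_eq_and, hcode]

/-- The Gödel number of an arithmetical term with function symbol `f` and arguments `l`. -/
noncomputable def aFunc (f : Σ n, arith.Functions n) (l : List ℕ) : ℕ :=
  Nat.pair 1 (Nat.pair (Encodable.encode f) (Encodable.encode l))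


/-- The Gödel number of the numeral of `n`. -/
noncomputable def aNumCode (n : ℕ) : ℕ :=
  Nat.rec (aFunc ⟨0, ArithFunc.zero⟩ []) (fun _ c => aFunc ⟨1, ArithFunc.succ⟩ [c]) n

theorem termCode_aNum {n : ℕ} : ∀ k : ℕ,
    termCode (aNum k : arith.Term (Empty ⊕ Fin n)) = aNumCode k
  | 0 => rfl
  | k + 1 => by
    change aFunc ⟨1, ArithFunc.succ⟩ [termCode (aNum k)] = _
    rw [termCode_aNum k]
    rfl

theorem primrec_aFunc (f : Σ n, arith.Functions n) : Primrec (aFunc f) :=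
  Primrec₂.natPair.comp (Primrec.const 1)
    (Primrec₂.natPair.comp (Primrec.const _) Primrec.encode)

theorem primrec_aNumCode : Primrec aNumCode :=
  Primrec.nat_rec₁ _ ((primrec_aFunc _).comp (Primrec.list_cons.comp (Primrec.snd)
    (Primrec.const []))).to₂

theorem isRE_R : IsRE R := by
  have hn := primrec_aNumCode
  -- the Gödel numbers of `t = u` and of `t < u`, in terms of those of `t` and `u`
  let e : ℕ → ℕ → ℕ := fun a b => Nat.pair 1 (Nat.pair a b)
  let lt : ℕ → ℕ → ℕ := fun a b => Nat.pair 2 (Nat.pair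
    (Encodable.encode (⟨2, ArithRel.lt⟩ : Σ n, arith.Relations n)) (Encodable.encode [a, b]))
  have he : Primrec₂ e := Primrec₂.natPair.comp (Primrec.const 1) Primrec₂.natPair
  have hlt : Primrec₂ lt := Primrec₂.natPair.comp (Primrec.const 2)
    (Primrec₂.natPair.comp (Primrec.const _) (Primrec.encode.comp primrec_list_two))
  have hop : ∀ (f : Σ n, arith.Functions n) {g : ℕ → ℕ → ℕ} (_ : Primrec₂ g),
      REPred fun k => ∃ x : ℕ × ℕ, e (aFunc f [aNumCode x.1, aNumCode x.2]) (aNumCode (g x.1 x.2)) = k :=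
    fun f g hg => rePred_range (Primrec.to_comp (he.comp ((primrec_aFunc f).comp
      (primrec_list_two.comp (hn.comp Primrec.fst) (hn.comp Primrec.snd))) (hn.comp hg)))
  have hne : REPred fun k => ∃ x : ℕ × ℕ, x.1 ≠ x.2 ∧ cNot (e (aNumCode x.1) (aNumCode x.2)) = k :=
    rePred_image (PrimrecPred.rePred (Primrec.eq (α := ℕ)).not)
      (Primrec.to_comp (primrec_cNot.comp (he.comp (hn.comp Primrec.fst) (hn.comp Primrec.snd))))
  have hlt' : REPred fun k => ∃ n : ℕ, cAll (cImp (lt (Nat.pair 0 0) (aNumCode n))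
      (cBigOr ((List.range n).map fun i => e (Nat.pair 0 0) (aNumCode i)))) = k :=
    rePred_range (Primrec.to_comp (primrec_cAll.comp (primrec_cImp.comp
      (hlt.comp (Primrec.const _) hn) (primrec_cBigOr.comp (Primrec.list_map Primrec.list_range
        (he.comp (Primrec.const _) (hn.comp Primrec.snd)).to₂)))))
  have htri : REPred fun k => ∃ n : ℕ, cAll (cOr (cOr (lt (Nat.pair 0 0) (aNumCode n))
      (e (Nat.pair 0 0) (aNumCode n))) (lt (aNumCode n) (Nat.pair 0 0))) = k :=
    rePred_range (Primrec.to_comp (primrec_cAll.comp (primrec_cOr.comp (primrec_cOr.comp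
      (hlt.comp (Primrec.const _) hn) (he.comp (Primrec.const _) hn))
        (hlt.comp hn (Primrec.const _)))))
  have cadd : ∀ m n : ℕ, formulaCode (aAdd (aNum m) (aNum n) =' aNum (m + n) : arith.Sentence) =
      e (aFunc ⟨2, ArithFunc.add⟩ [aNumCode m, aNumCode n]) (aNumCode (m + n)) := by
    intro m n; simp only [← termCode_aNum (n := 0)]; rfl
  have cmul : ∀ m n : ℕ, formulaCode (aMul (aNum m) (aNum n) =' aNum (m * n) : arith.Sentence) =
      e (aFunc ⟨2, ArithFunc.mul⟩ [aNumCode m, aNumCode n]) (aNumCode (m * n)) := by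
    intro m n; simp only [← termCode_aNum (n := 0)]; rfl
  have cne : ∀ m n : ℕ, formulaCode (∼(aNum m =' aNum n) : arith.Sentence) =
      cNot (e (aNumCode m) (aNumCode n)) := by
    intro m n; simp only [← termCode_aNum (n := 0)]; rfl
  have clt : ∀ n : ℕ, formulaCode (∀' (aLt (&0) (aNum n) ⟹
      bigOr ((List.range n).map fun i => (&0) =' aNum i)) : arith.Sentence) =
      cAll (cImp (lt (Nat.pair 0 0) (aNumCode n))
        (cBigOr ((List.range n).map fun i => e (Nat.pair 0 0) (aNumCode i)))) := by
    intro n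
    rw [code_all, code_imp, code_bigOr, List.map_map]
    simp only [← termCode_aNum (n := 1)]
    rfl
  have ctri : ∀ n : ℕ, formulaCode (∀' ((aLt (&0) (aNum n) ⊔ ((&0) =' aNum n)) ⊔
      aLt (aNum n) (&0)) : arith.Sentence) = cAll (cOr (cOr (lt (Nat.pair 0 0) (aNumCode n))
        (e (Nat.pair 0 0) (aNumCode n))) (lt (aNumCode n) (Nat.pair 0 0))) := by
    intro n; simp only [← termCode_aNum (n := 1)]; rfl
  refine (rePred_or (hop ⟨2, ArithFunc.add⟩ Primrec.nat_add) (rePred_or (hop ⟨2, ArithFunc.mul⟩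
    Primrec.nat_mul) (rePred_or hne (rePred_or hlt' htri)))).of_eq fun k => ⟨?_, ?_⟩
  · rintro (⟨x, rfl⟩ | ⟨x, rfl⟩ | ⟨x, hx, rfl⟩ | ⟨n, rfl⟩ | ⟨n, rfl⟩)
    · exact ⟨_, .add x.1 x.2, cadd _ _⟩
    · exact ⟨_, .mul x.1 x.2, cmul _ _⟩
    · exact ⟨_, .ne x.1 x.2 hx, cne _ _⟩
    · exact ⟨_, .lt n, clt _⟩
    · exact ⟨_, .tri n, ctri _⟩
  · rintro ⟨_, h, rfl⟩
    cases h with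
    | add m n => exact .inl ⟨(m, n), (cadd m n).symm⟩
    | mul m n => exact .inr (.inl ⟨(m, n), (cmul m n).symm⟩)
    | ne m n h => exact .inr (.inr (.inl ⟨(m, n), h, (cne m n).symm⟩))
    | lt n => exact .inr (.inr (.inr (.inl ⟨n, (clt n).symm⟩)))
    | tri n => exact .inr (.inr (.inr (.inr ⟨n, (ctri n).symm⟩)))

/-! ### Scattered numbers and `R` -/

theorem isSatisfiable_PAscat : PAscat.IsSatisfiable :=
  have := Nscat_models_PAscat
  Theory.Model.isSatisfiable Nscat

theorem sigmaFriendly_PAscat (pw : Prop) : SigmaFriendly pw PAscat where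
  re := isRE_PAscat
  consistent := isSatisfiable_PAscat
  friendly := by
    refine ⟨witnessSentence, exists_computable_witnessSentence, fun δ hδ => ?_, fun δ => ?_⟩
    · obtain ⟨j, hj⟩ := (models_sigmaSentence ℕ δ).1 hδ
      rw [Theory.models_sentence_iff]
      exact fun M => PAscat_models_witness M.is_model hj
    · refine interprets_of_witness pw δ _ _ (Or.inr rfl) fun N _ hN t x ht hx hδ => ?_
      rw [Theory.model_singleton_iff]
      exact models_sigmaQ hN ht δ hx hδ

/-- The theory of scattered numbers tolerates `R`. If a false `Σ₁`-sentence has a witness below the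
largest element of a number, then that number is nonstandard and satisfies `R`. Such a number is
consistent with any given consistent RE extension for some false `Σ₁`-sentence, since otherwise the
false `Σ₁`-sentences would be recursively enumerable. -/
theorem laxInterprets_R (pw : Prop) : LaxInterprets pw PAscat R := by
  intro V hV hsat hsub
  obtain ⟨δ, hδ, hundec⟩ := exists_undecidable_family
  have : scatLang.IsRelational := fun n => inferInstanceAs (IsEmpty Empty)
  obtain ⟨P, hP, hPV⟩ := rePred_not_isSatisfiable hV
  obtain ⟨f, hf, hfδ⟩ := exists_computable_witnessSentence
  obtain ⟨k, hk1, hk2⟩ : ∃ k, (¬∃ x, (δ k).Holds ℕ fun _ => x) ∧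
      (V ∪ {witnessSentence (δ k)}).IsSatisfiable := by
    by_contra hcon
    push Not at hcon
    refine hundec ((rePred_comp hP (hf.comp hδ)).of_eq fun k => ?_)
    rw [hfδ, hPV]
    constructor
    · rintro hns ⟨x, hx⟩
      apply hns
      obtain ⟨M⟩ := hsat
      have hM : M ⊨ PAscat := (Theory.model_iff _).2 fun φ hφ =>
        Theory.models_sentence_iff.1 (hsub φ (Theory.models_sentence_of_mem hφ)) M
      have : M ⊨ (V ∪ {witnessSentence (δ k)} : scatLang.Theory) := by
        refine (Theory.model_iff _).2 fun φ hφ => ?_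
        rcases hφ with hφ | rfl
        · exact M.is_model.realize_of_mem _ hφ
        · exact PAscat_models_witness hM hx
      exact Theory.Model.isSatisfiable M
    · exact fun h => hcon k fun x hx => h ⟨x, hx⟩
  refine ⟨V ∪ {witnessSentence (δ k)}, isRE_union hV (isRE_of_finite (Set.finite_singleton _)), hk2,
    fun φ hφ => ?_, ?_⟩
  · rw [Theory.models_sentence_iff] at hφ ⊢
    intro M
    have : M ⊨ V := M.is_model.mono Set.subset_union_left
    exact hφ (Theory.ModelType.of V M)
  · exact interprets_of_witness pw (δ k) _ _ (Or.inr rfl) fun N _ hN t x ht hx hw =>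
      hN.models_R (hN.num_increasing ht (δ k) hx hw hk1)

end LaxInt

namespace LaxInt

/-! ### Types of tuples of scattered numbers -/

namespace Scat

/-- Atomic types of `m`-tuples relative to a component: the atomic formulas that hold inside that
component. -/
abbrev AtType (m : ℕ) : Type :=
  Set (Σ r : (Σ l, ScatRel l), Fin r.1 → Fin m) × Set (Fin m × Fin m)

/-- Types of `m`-tuples for formulas of quantifier depth `q`. -/
def Ty : ℕ → ℕ → Type
  | 0, m => AtType m
  | q + 1, m => Set (Ty q (m + 1))

/-- The type for quantifier depth `q` of the part of the tuple `e` in the component `n` of the model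
of scattered numbers. The elements of `e` outside this component do not matter; conversely all
elements outside the component realise the same one-element extension of the type. -/
def ty (n : ℕ) : (q : ℕ) → {m : ℕ} → (Fin m → Nscat) → Ty q m
  | 0, _, e => ({x | (∀ i, (e (x.2 i)).1 = n) ∧
      Structure.RelMap (L := scatLang) x.1.2 fun i => e (x.2 i)},
      {x | (e x.1).1 = n ∧ e x.1 = e x.2})
  | q + 1, _, e => Set.range fun x : Nscat => ty n q (Fin.snoc e x : Fin (_ + 1) → Nscat)

instance : Finite (Σ l, ScatRel l) :=
  Finite.of_surjective
    (![⟨_, .lt⟩, ⟨_, .succ⟩, ⟨_, .add⟩, ⟨_, .mul⟩] : Fin 4 → Σ l, ScatRel l) (by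
      rintro ⟨_, _ | _⟩
      exacts [⟨0, rfl⟩, ⟨1, rfl⟩, ⟨2, rfl⟩, ⟨3, rfl⟩])

theorem finite_ty : ∀ q m, Finite (Ty q m)
  | 0, m => inferInstanceAs (Finite (AtType m))
  | q + 1, m => by
    have := finite_ty q (m + 1)
    exact inferInstanceAs (Finite (Set (Ty q (m + 1))))

/-- The type in the component `n` depends only on the elements in this component. -/
theorem ty_congr {n : ℕ} : ∀ (q : ℕ) {m : ℕ} (e e' : Fin m → Nscat),
    (∀ i, e i = e' i ∨ ((e i).1 ≠ n ∧ (e' i).1 ≠ n)) → ty n q e = ty n q e'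
  | 0, m, e, e', h => by
    have key : ∀ i, (e i).1 = n → e i = e' i := fun i hi =>
      (h i).resolve_right fun h => h.1 hi
    have key' : ∀ i, (e' i).1 = n → e i = e' i := fun i hi =>
      (h i).resolve_right fun h => h.2 hi
    refine Prod.ext (Set.ext fun x => ?_) (Set.ext fun x => ?_)
    · constructor
      · rintro ⟨h1, h2⟩
        have he : (fun i => e (x.2 i)) = fun i => e' (x.2 i) := funext fun i => key _ (h1 i)
        exact ⟨fun i => key _ (h1 i) ▸ h1 i, he ▸ h2⟩
      · rintro ⟨h1, h2⟩
        have he : (fun i => e (x.2 i)) = fun i => e' (x.2 i) := funext fun i => key' _ (h1 i)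
        exact ⟨fun i => (key' _ (h1 i)).symm ▸ h1 i, he.symm ▸ h2⟩
    · constructor
      · rintro ⟨h1, h2⟩
        have h3 := key x.2 (h2 ▸ h1)
        exact ⟨key x.1 h1 ▸ h1, (key x.1 h1).symm.trans (h2.trans h3)⟩
      · rintro ⟨h1, h2⟩
        have h3 := key' x.2 (h2 ▸ h1)
        exact ⟨(key' x.1 h1).symm ▸ h1, (key' x.1 h1).trans (h2.trans h3.symm)⟩
  | q + 1, m, e, e', h => by
    refine congrArg Set.range (funext fun x => ty_congr q _ _ fun i => ?_)
    refine Fin.lastCases ?_ (fun i => ?_) i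
    · left; simp
    · simpa using h i

theorem exists_ty_snoc {n n' q m : ℕ} {e e' : Fin m → Nscat} (h : ty n (q + 1) e = ty n' (q + 1) e')
    (x : Nscat) : ∃ x' : Nscat, ty n q (Fin.snoc e x : Fin (m + 1) → Nscat) =
      ty n' q (Fin.snoc e' x' : Fin (m + 1) → Nscat) := by
  have h' : (Set.range fun x : Nscat => ty n q (Fin.snoc e x : Fin (m + 1) → Nscat)) =
    Set.range fun x : Nscat => ty n' q (Fin.snoc e' x : Fin (m + 1) → Nscat) := h
  obtain ⟨x', hx'⟩ := h'.le ⟨x, rfl⟩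
  exact ⟨x', hx'.symm⟩

/-- Types for a larger quantifier depth determine the atomic types. -/
theorem at_eq_of_ty_eq {n n' : ℕ} : ∀ (q : ℕ) {m : ℕ} (e e' : Fin m → Nscat),
    ty n q e = ty n' q e' → ty n 0 e = ty n' 0 e'
  | 0, _, _, _, h => h
  | q + 1, m, e, e', h => by
    obtain ⟨x₀⟩ : Nonempty Nscat := inferInstance
    obtain ⟨x', hx'⟩ := exists_ty_snoc h x₀
    have := at_eq_of_ty_eq q _ _ hx'
    refine Prod.ext (Set.ext fun x => ?_) (Set.ext fun x => ?_)
    · have h1 := Set.ext_iff.1 (congrArg Prod.fst this) ⟨x.1, fun i => (x.2 i).castSucc⟩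
      simpa [ty] using h1
    · have h1 := Set.ext_iff.1 (congrArg Prod.snd this) (x.1.castSucc, x.2.castSucc)
      simpa [ty] using h1

theorem mem_iff_of_ty_eq {n n' q m : ℕ} {e e' : Fin m → Nscat} (h : ty n q e = ty n' q e')
    (i : Fin m) : (e i).1 = n ↔ (e' i).1 = n' := by
  have := Set.ext_iff.1 (congrArg Prod.snd (at_eq_of_ty_eq q e e' h)) (i, i)
  simpa [ty] using this

/-- The relations hold only inside a component. -/
theorem relMap_fst {l : ℕ} (r : ScatRel l) (x : Fin l → Nscat)
    (h : Structure.RelMap (L := scatLang) r x) : ∃ n, ∀ i, (x i).1 = n := by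
  cases r with
  | lt => exact ⟨_, Fin.forall_fin_two.2 ⟨rfl, h.1.symm⟩⟩
  | succ => exact ⟨_, Fin.forall_fin_two.2 ⟨rfl, h.1.symm⟩⟩
  | add => exact ⟨(x 0).1, by rintro i; fin_cases i; exacts [rfl, h.1.symm, (h.1.trans h.2.1).symm]⟩
  | mul => exact ⟨(x 0).1, by rintro i; fin_cases i; exacts [rfl, h.1.symm, (h.1.trans h.2.1).symm]⟩

/-- The tuples `e` and `e'` have the same types in corresponding components. -/
def Equi (q : ℕ) (π : Equiv.Perm ℕ) {m : ℕ} (e e' : Fin m → Nscat) : Prop :=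
  ∀ n, ty n q e = ty (π n) q e'

theorem Equi.symm {q : ℕ} {π : Equiv.Perm ℕ} {m : ℕ} {e e' : Fin m → Nscat} (h : Equi q π e e') :
    Equi q π.symm e' e := fun n => by rw [h, Equiv.apply_symm_apply]

/-- The extension step of the back-and-forth argument. An element in the component `x.1` is answered
there; in every other component it is an element from outside. -/
theorem Equi.snoc {q : ℕ} {π : Equiv.Perm ℕ} {m : ℕ} {e e' : Fin m → Nscat}
    (h : Equi (q + 1) π e e') (x : Nscat) : ∃ x' : Nscat,
      Equi q π (Fin.snoc e x : Fin (m + 1) → Nscat) (Fin.snoc e' x' : Fin (m + 1) → Nscat) := by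
  have hex : ∀ n, ∃ x' : Nscat, ty n q (Fin.snoc e x : Fin (m + 1) → Nscat) =
      ty (π n) q (Fin.snoc e' x' : Fin (m + 1) → Nscat) := fun n =>
    exists_ty_snoc (h n) x
  obtain ⟨x', hx'⟩ := hex x.1
  refine ⟨x', fun n => ?_⟩
  obtain ⟨y, hy⟩ := hex n
  have h1 := mem_iff_of_ty_eq hx' (Fin.last m)
  have h2 := mem_iff_of_ty_eq hy (Fin.last m)
  simp only [Fin.snoc_last, true_iff] at h1 h2
  rcases eq_or_ne x.1 n with rfl | hn
  · exact hx'
  · rw [hy]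
    refine ty_congr q _ _ fun i => ?_
    refine Fin.lastCases ?_ (fun i => ?_) i
    · right
      simp only [Fin.snoc_last, h1]
      exact ⟨fun h => hn (h2.2 h), fun h => hn (π.injective h)⟩
    · left; simp

/-- The quantifier depth of a formula. -/
def depth : {m : ℕ} → scatLang.BoundedFormula Empty m → ℕ
  | _, .falsum => 0
  | _, .equal _ _ => 0
  | _, .rel _ _ => 0
  | _, .imp φ ψ => max (depth φ) (depth ψ)
  | _, .all φ => depth φ + 1

theorem Equi.mono {q : ℕ} {π : Equiv.Perm ℕ} {m : ℕ} {e e' : Fin m → Nscat}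
    (h : Equi q π e e') : Equi 0 π e e' := fun n => at_eq_of_ty_eq q e e' (h n)

/-- Tuples with the same types for quantifier depth `q` satisfy the same formulas of quantifier depth
at most `q`. -/
theorem Equi.realize_iff : ∀ {m : ℕ} (φ : scatLang.BoundedFormula Empty m) (q : ℕ)
    (π : Equiv.Perm ℕ) (e e' : Fin m → Nscat), depth φ ≤ q → Equi q π e e' →
    (φ.Realize default e ↔ φ.Realize default e')
  | _, .falsum, _, _, _, _, _, _ => Iff.rfl
  | m, .equal t u, q, π, e, e', _, h => by
    have : scatLang.IsRelational := fun n => inferInstanceAs (IsEmpty Empty)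
    obtain ⟨i, rfl⟩ := exists_eq_var t
    obtain ⟨j, rfl⟩ := exists_eq_var u
    have key : ∀ (π : Equiv.Perm ℕ) (e e' : Fin m → Nscat), Equi 0 π e e' → e i = e j →
        e' i = e' j := fun π e e' h hij => by
      have := Set.ext_iff.1 (congrArg Prod.snd (h (e i).1)) (i, j)
      exact (this.1 ⟨rfl, hij⟩).2
    exact ⟨key π e e' h.mono, key π.symm e' e h.mono.symm⟩
  | m, .rel (l := l) r ts, q, π, e, e', _, h => by
    have : scatLang.IsRelational := fun n => inferInstanceAs (IsEmpty Empty)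
    choose ρ hρ using fun i => exists_eq_var (ts i)
    obtain rfl : ts = fun i => .var (.inr (ρ i)) := funext hρ
    have key : ∀ (π : Equiv.Perm ℕ) (e e' : Fin m → Nscat), Equi 0 π e e' →
        Structure.RelMap (L := scatLang) r (fun i => e (ρ i)) →
        Structure.RelMap (L := scatLang) r (fun i => e' (ρ i)) := fun π e e' h hr => by
      obtain ⟨n, hn⟩ := relMap_fst r _ hr
      have := Set.ext_iff.1 (congrArg Prod.fst (h n)) ⟨⟨l, r⟩, ρ⟩
      exact (this.1 ⟨hn, hr⟩).2
    exact ⟨key π e e' h.mono, key π.symm e' e h.mono.symm⟩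
  | _, .imp φ ψ, q, π, e, e', hq, h => by
    have hq' : max (depth φ) (depth ψ) ≤ q := hq
    exact imp_congr (realize_iff φ q π e e' (by omega) h) (realize_iff ψ q π e e' (by omega) h)
  | _, .all φ, q, π, e, e', hq, h => by
    have hq' : depth φ + 1 ≤ q := hq
    obtain ⟨q, rfl⟩ : ∃ q', q = q' + 1 := ⟨q - 1, by omega⟩
    constructor
    · intro H x
      obtain ⟨x', hx'⟩ := h.symm.snoc x
      exact (realize_iff φ q _ _ _ (by omega) hx').2 (H x')
    · intro H x
      obtain ⟨x', hx'⟩ := h.snoc x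
      exact (realize_iff φ q _ _ _ (by omega) hx').2 (H x')

/-- Components with the same type of the empty tuple realise the same types of `m`-tuples, at the cost
of `m` quantifiers. -/
theorem exists_ty_eq {c c' q : ℕ} : ∀ {m : ℕ},
    ty c (q + m) (Fin.elim0 : Fin 0 → Nscat) = ty c' (q + m) (Fin.elim0 : Fin 0 → Nscat) →
    ∀ e : Fin m → Nscat, ∃ e' : Fin m → Nscat, ty c q e = ty c' q e' := by
  intro m
  induction m generalizing q with
  | zero => exact fun h e => ⟨Fin.elim0, by rw [Subsingleton.elim e Fin.elim0]; exact h⟩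
  | succ m ih =>
    intro h e
    rw [show q + (m + 1) = q + 1 + m by omega] at h
    obtain ⟨e', he'⟩ := ih h (Fin.init e)
    obtain ⟨x, hx⟩ := exists_ty_snoc he' (e (Fin.last m))
    rw [Fin.snoc_init_self] at hx
    exact ⟨_, hx⟩

/-- If the components `c` and `c'` are equivalent for a sufficient quantifier depth, then the elements
of a tuple in the component `c` can be moved to an unused component `c'`. -/
theorem exists_move {m : ℕ} (φ : scatLang.BoundedFormula Empty m) {c c' : ℕ} (hc : c ≠ c')
    (h : ty c (depth φ + m) (Fin.elim0 : Fin 0 → Nscat) =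
      ty c' (depth φ + m) (Fin.elim0 : Fin 0 → Nscat))
    (e : Fin m → Nscat) (hu : ∀ i, (e i).1 ≠ c') (hφ : φ.Realize default e) :
    ∃ e' : Fin m → Nscat, φ.Realize default e' ∧
      ∀ i, if (e i).1 = c then (e' i).1 = c' else e' i = e i := by
  obtain ⟨f, hf⟩ := exists_ty_eq h e
  obtain ⟨g, hg⟩ := exists_ty_eq h.symm e
  have hf' := mem_iff_of_ty_eq hf
  have hg' := mem_iff_of_ty_eq hg
  let e' : Fin m → Nscat := fun i => if (e i).1 = c then f i else e i
  have he' : ∀ i, if (e i).1 = c then (e' i).1 = c' else e' i = e i := fun i => by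
    by_cases hi : (e i).1 = c
    · simp only [e', if_pos hi]; exact (hf' i).1 hi
    · simp only [e', if_neg hi]
  refine ⟨e', (Equi.realize_iff φ _ (Equiv.swap c c') e e' le_rfl fun n => ?_).1 hφ, he'⟩
  rcases eq_or_ne n c with rfl | hn
  · rw [Equiv.swap_apply_left, hf]
    refine ty_congr _ _ _ fun i => ?_
    by_cases hi : (e i).1 = n
    · left; simp only [e', if_pos hi]
    · right; simp only [e', if_neg hi]
      exact ⟨fun h => hi ((hf' i).2 h), hu i⟩
  rcases eq_or_ne n c' with rfl | hn'
  · rw [Equiv.swap_apply_right, hg]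
    refine ty_congr _ _ _ fun i => .inr ⟨fun h => hu i ((hg' i).2 h), fun h => ?_⟩
    have := he' i
    split_ifs at this with hi
    · exact hc (h.symm.trans this)
    · exact hi (this ▸ h)
  · rw [Equiv.swap_apply_of_ne_of_ne hn hn']
    refine ty_congr _ _ _ fun i => ?_
    have := he' i
    split_ifs at this with hi
    · right; exact ⟨fun h => hn (h.symm.trans hi), fun h => hn' (h.symm.trans this)⟩
    · left; exact this.symm

/-- A map to a finite type: from some number on, every value that is still taken was taken more than
`m` times before. -/
theorem eventually_many {F : Type} [Finite F] (t : ℕ → F) (m : ℕ) :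
    ∀ᶠ N in Filter.atTop, ∀ c, N ≤ c →
      ∃ S : Finset ℕ, m < S.card ∧ ∀ c' ∈ S, c' < N ∧ t c' = t c := by
  have : ∀ f : F, ∀ᶠ N in Filter.atTop, ∀ c, N ≤ c → t c = f →
      ∃ S : Finset ℕ, m < S.card ∧ ∀ c' ∈ S, c' < N ∧ t c' = f := by
    intro f
    rcases Set.finite_or_infinite {c | t c = f} with hfin | hinf
    · obtain ⟨B, hB⟩ := hfin.bddAbove
      filter_upwards [Filter.eventually_gt_atTop B] with N hN c hc hf
      exact absurd (hB hf) (by omega)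
    · obtain ⟨S, hS, hcard⟩ := hinf.exists_subset_card_eq (m + 1)
      filter_upwards [Filter.eventually_gt_atTop (S.sup id)] with N hN c hc hf
      refine ⟨S, by omega, fun c' hc' => ⟨?_, hS hc'⟩⟩
      exact (Finset.le_sup (f := id) hc').trans_lt hN
  filter_upwards [Filter.eventually_all.2 this] with N hN c hc
  exact hN (t c) c hc rfl

/-- Every formula that holds of a tuple also holds of a tuple from the first components, where the
elements that already come from these components are unchanged. -/
theorem eventually_small_bounded {m : ℕ} (φ : scatLang.BoundedFormula Empty m) :
    ∀ᶠ N in Filter.atTop, ∀ e : Fin m → Nscat, φ.Realize default e →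
      ∃ e' : Fin m → Nscat, φ.Realize default e' ∧ (∀ i, (e i).1 < N → e' i = e i) ∧
        ∀ i, (e' i).1 < N := by
  have := finite_ty (depth φ + m) 0
  filter_upwards [eventually_many
    (fun c => ty c (depth φ + m) (Fin.elim0 : Fin 0 → Nscat)) m] with N hN
  -- The elements of a large component are moved to a smaller one, one component at a time.
  have key : ∀ (k : ℕ) (e : Fin m → Nscat), (Finset.univ.filter fun i => N ≤ (e i).1).card = k →
      φ.Realize default e → ∃ e' : Fin m → Nscat, φ.Realize default e' ∧
        (∀ i, (e i).1 < N → e' i = e i) ∧ ∀ i, (e' i).1 < N := by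
    intro k
    induction k using Nat.strong_induction_on with
    | _ k ih =>
      intro e hk he
      by_cases hs : ∀ i, (e i).1 < N
      · exact ⟨e, he, fun _ _ => rfl, hs⟩
      push Not at hs
      obtain ⟨i₀, hi₀⟩ := hs
      obtain ⟨S, hS, hSt⟩ := hN (e i₀).1 hi₀
      -- At most `m` components occur in `e`, so one of the more than `m` candidates is unused.
      have : ∃ c' ∈ S, c' ∉ Finset.univ.image fun i => (e i).1 := by
        by_contra hcon
        push Not at hcon
        have := (Finset.card_le_card fun c' hc' => hcon c' hc').trans Finset.card_image_le
        simp at this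
        omega
      obtain ⟨c', hc', hu⟩ := this
      have hlt := (hSt c' hc').1
      obtain ⟨e', he', hmove⟩ := exists_move φ (by omega : (e i₀).1 ≠ c') (hSt c' hc').2.symm e
        (fun i h => hu (Finset.mem_image.2 ⟨i, Finset.mem_univ _, h⟩)) he
      have hsub : (Finset.univ.filter fun i => N ≤ (e' i).1) ⊂
          Finset.univ.filter fun i => N ≤ (e i).1 := by
        refine Finset.ssubset_iff_subset_ne.2 ⟨fun i hi => ?_, fun h => ?_⟩
        · have h1 := hmove i
          simp only [Finset.mem_filter, Finset.mem_univ, true_and] at hi ⊢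
          split_ifs at h1 with h2
          · omega
          · rwa [h1] at hi
        · have h1 := hmove i₀
          rw [if_pos rfl] at h1
          have : i₀ ∈ Finset.univ.filter fun i => N ≤ (e' i).1 := h ▸ by simpa using hi₀
          simp at this
          omega
      obtain ⟨e'', h1, h2, h3⟩ := ih _ (hk ▸ Finset.card_lt_card hsub) e' rfl he'
      refine ⟨e'', h1, fun i hi => ?_, h3⟩
      have h4 := hmove i
      rw [if_neg (by omega)] at h4
      rw [h2 i (by rwa [h4]), h4]
  exact fun e => key _ e rfl

theorem eventually_small {α : Type} [Finite α] (φ : scatLang.Formula α) :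
    ∀ᶠ N in Filter.atTop, ∀ v : α → Nscat, φ.Realize v →
      ∃ v' : α → Nscat, φ.Realize v' ∧ (∀ i, (v i).1 < N → v' i = v i) ∧ ∀ i, (v' i).1 < N := by
  obtain ⟨m, ⟨f⟩⟩ := Finite.exists_equiv_fin α
  have hr : ∀ e : Fin m → Nscat, (BoundedFormula.relabel Sum.inr (φ.relabel f) :
      scatLang.BoundedFormula Empty m).Realize default e ↔ φ.Realize fun a => e (f a) := fun e =>
    Formula.realize_relabel_sumInr (φ.relabel f) |>.trans Formula.realize_relabel
  filter_upwards [eventually_small_bounded (BoundedFormula.relabel Sum.inr (φ.relabel f) :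
      scatLang.BoundedFormula Empty m)] with N hN v hv
  obtain ⟨e', h1, h2, h3⟩ := hN (fun i => v (f.symm i)) ((hr _).2 (by simpa using hv))
  refine ⟨fun a => e' (f a), (hr _).1 h1, fun a ha => ?_, fun a => h3 _⟩
  exact (h2 (f a) (by simpa using ha)).trans (by rw [Equiv.symm_apply_apply])

/-! ### No internal model of successor arithmetic -/

/-- In an internal structure of the model of scattered numbers, the iterates of a unary function at
a constant are not pairwise different: they are all represented by tuples from the first
components. -/
theorem not_injective_iterate {L : FirstOrder.Language.{0, 0}} (τ : Translation L scatLang)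
    (p : Fin τ.params → Nscat) {N : Type} [L.Structure N] {cls : {x // (τ.raw p).dom x} → N}
    (h : (τ.raw p).Presents N cls) (z : L.Functions 0) (s : L.Functions 1) :
    ¬ Function.Injective fun n => (fun x : N => Structure.funMap s fun _ => x)^[n]
      (Structure.funMap z default) := by
  have hz : ∀ x : (Fin 0 → Fin τ.pieces) × Fin τ.pieces, ∀ᶠ B in Filter.atTop, _ := fun x =>
    eventually_small ((τ.dom x.2).relabel (Sum.map id Sum.inr) ⊓ τ.func z x.1 x.2)
  have hs : ∀ x : Fin τ.pieces × Fin τ.pieces, ∀ᶠ B in Filter.atTop, _ := fun x => eventually_small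
    ((τ.dom x.2).relabel (Sum.map id Sum.inr) ⊓ τ.func s (fun _ => x.1) x.2)
  have hp : ∀ i, ∀ᶠ B in Filter.atTop, (p i).1 < B := fun i => Filter.eventually_gt_atTop _
  obtain ⟨B, hz, hs, hp⟩ := ((Filter.eventually_all.2 hz).and
    ((Filter.eventually_all.2 hs).and (Filter.eventually_all.2 hp))).exists
  -- The values of `z` and `s` have representatives in the components below a fixed bound `B`, if the
  -- parameters and the representatives of the arguments are there.
  have small : ∀ n, ∃ x : {x // (τ.raw p).dom x}, (∀ j, (x.1.2 j).1 < B) ∧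
      cls x = (fun x : N => Structure.funMap s fun _ => x)^[n] (Structure.funMap z default) := by
    intro n
    induction n with
    | zero =>
      obtain ⟨⟨⟨l, y⟩, hy⟩, hf⟩ := h.func_total z Fin.elim0
      obtain ⟨v, hv, hv1, hv2⟩ := hz (_, l) (Sum.elim p (Sum.elim (fun i => i.1.elim0) y)) (by
        refine Formula.realize_inf.2 ⟨Formula.realize_relabel.2 (realize_of_eq hy ?_),
          realize_of_eq hf ?_⟩
        · funext i; rcases i with i | i <;> rfl
        · funext i; rcases i with i | i | i
          exacts [rfl, i.1.elim0, rfl])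
      have hv3 : v = Sum.elim p (Sum.elim (fun i => i.1.elim0) fun j => v (.inr (.inr j))) := by
        funext i
        rcases i with i | i | i
        · exact hv1 _ (hp i)
        · exact i.1.elim0
        · rfl
      obtain ⟨hd, hf'⟩ := Formula.realize_inf.1 hv
      refine ⟨⟨⟨l, fun j => v (.inr (.inr j))⟩, ?_⟩, fun j => hv2 _, ?_⟩
      · refine realize_of_eq (Formula.realize_relabel.1 hd) ?_
        rw [hv3]; funext i; rcases i with i | i <;> rfl
      · refine (h.func_val z Fin.elim0 _ ?_).trans
          (congrArg (Structure.funMap z) (Subsingleton.elim _ _))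
        refine realize_of_eq hf' (hv3.trans ?_)
        funext i; rcases i with i | i | i
        exacts [rfl, i.1.elim0, rfl]
    | succ n ih =>
      obtain ⟨⟨⟨k, x⟩, hx⟩, hxB, hxn⟩ := ih
      obtain ⟨⟨⟨l, y⟩, hy⟩, hf⟩ := h.func_total s fun _ => ⟨⟨k, x⟩, hx⟩
      obtain ⟨v, hv, hv1, hv2⟩ := hs (k, l) (Sum.elim p (Sum.elim (fun i => x i.2) y)) (by
        refine Formula.realize_inf.2 ⟨Formula.realize_relabel.2 (realize_of_eq hy ?_), hf⟩
        funext i; rcases i with i | i <;> rfl)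
      have hv3 : v = Sum.elim p (Sum.elim (fun i => x i.2) fun j => v (.inr (.inr j))) := by
        funext i
        rcases i with i | i | i
        · exact hv1 _ (hp i)
        · exact hv1 _ (hxB _)
        · rfl
      obtain ⟨hd, hf'⟩ := Formula.realize_inf.1 hv
      refine ⟨⟨⟨l, fun j => v (.inr (.inr j))⟩, ?_⟩, fun j => hv2 _, ?_⟩
      · refine realize_of_eq (Formula.realize_relabel.1 hd) ?_
        rw [hv3]; funext i; rcases i with i | i <;> rfl
      · rw [Function.iterate_succ_apply', ← hxn]
        refine h.func_val s (fun _ => ⟨⟨k, x⟩, hx⟩) _ ?_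
        exact realize_of_eq hf' hv3
  choose x hxB hx using small
  intro hinj
  -- The first components contain only finitely many elements.
  let g : ℕ → Σ k, Fin (τ.dim k) → (Σ n : Fin B, Fin n) := fun n =>
    ⟨(x n).1.1, fun j => ⟨⟨((x n).1.2 j).1, hxB n j⟩, ((x n).1.2 j).2⟩⟩
  obtain ⟨m, n, hne, hmn⟩ := Finite.exists_ne_map_eq_of_infinite g
  refine hne (hinj ((hx m).symm.trans (Eq.trans (congrArg cls (Subtype.ext ?_)) (hx n))))
  exact congrArg (fun y : Σ k, Fin (τ.dim k) → (Σ n : Fin B, Fin n) =>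
    (⟨y.1, fun j => ⟨(y.2 j).1, (y.2 j).2⟩⟩ : Σ k, Fin (τ.dim k) → Nscat)) hmn

end Scat

theorem realize_iterate {L : FirstOrder.Language.{0, 0}} {N : Type} [L.Structure N]
    (z : L.Functions 0) (s : L.Functions 1) (num : ℕ → L.Term (Empty ⊕ Fin 0))
    (h0 : num 0 = Term.func z ![]) (hs : ∀ n, num (n + 1) = Term.func s ![num n])
    (v : Empty ⊕ Fin 0 → N) (n : ℕ) : (num n).realize v =
      (fun x : N => Structure.funMap s fun _ => x)^[n] (Structure.funMap z default) := by
  induction n with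
  | zero => rw [h0]; exact congrArg (Structure.funMap z) (Subsingleton.elim _ _)
  | succ n ih =>
    rw [hs, Function.iterate_succ_apply', ← ih]
    exact congrArg (Structure.funMap s) (funext fun i => by fin_cases i; rfl)

/-- A theory that proves that the values of different numerals are different has no internal model in
the model of scattered numbers. -/
theorem not_definesModel {L : FirstOrder.Language.{0, 0}} {U : L.Theory} (z : L.Functions 0)
    (s : L.Functions 1) (num : ℕ → L.Term (Empty ⊕ Fin 0)) (h0 : num 0 = Term.func z ![])
    (hs : ∀ n, num (n + 1) = Term.func s ![num n])
    (hU : ∀ m n, m ≠ n → (∼(num m =' num n) : L.Sentence) ∈ U) (τ : Translation L scatLang)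
    (p : Fin τ.params → Nscat) : ¬ τ.DefinesModel U Nscat p := by
  intro h
  have hsat : ∀ φ : L.Sentence, U ⊨ᵇ φ → (τ.raw p).Sat φ Fin.elim0 := fun φ hφ =>
    (τ.realize_sentence p φ).1 (h φ hφ)
  obtain ⟨N, _, _, cls, hN⟩ := (τ.raw p).exists_presents fun φ hφ => hsat φ
    (Theory.models_sentence_iff.2 fun M => (models_idTheory M).realize_of_mem φ hφ)
  refine Scat.not_injective_iterate τ p hN z s fun m n hmn => ?_
  by_contra hne
  have := (hN.sat_sentence _).1 (hsat _ (Theory.models_sentence_of_mem (hU m n hne)))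
  refine this ?_
  exact (realize_iterate z s num h0 hs _ m).trans (hmn.trans (realize_iterate z s num h0 hs _ n).symm)

theorem not_definesModel_Rsucc (τ : Translation succLang scatLang) (p : Fin τ.params → Nscat) :
    ¬ τ.DefinesModel Rsucc Nscat p :=
  not_definesModel (L := succLang) SuccFunc.zero SuccFunc.succ succNum rfl (fun _ => rfl)
    (fun m n h => by exact ⟨n, m, h, rfl⟩) τ p

theorem not_definesModel_R (τ : Translation arith scatLang) (p : Fin τ.params → Nscat) :
    ¬ τ.DefinesModel R Nscat p :=
  not_definesModel (L := arith) ArithFunc.zero ArithFunc.succ aNum rfl (fun _ => rfl)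
    (fun m n h => R.ne m n h) τ p

theorem not_modelInterprets_of_Nscat (pw : Prop) {L : FirstOrder.Language.{0, 0}} {U : L.Theory}
    (h : ∀ (τ : Translation L scatLang) (p : Fin τ.params → Nscat), ¬ τ.DefinesModel U Nscat p) :
    ¬ ModelInterprets pw PAscat U := fun H => by
  obtain ⟨τ, -, ⟨p, hp⟩, hτ⟩ := H Nscat Nscat_models_PAscat
  exact h τ p (hτ p hp)

end LaxInt

namespace LaxInt

/-! ### Codes of formulas with a prescribed meaning -/

/-- The Gödel number of an instance of a fixed term is a primitive recursive function of the names of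
the variables that are substituted. The bound variables are shifted by `N`. -/
theorem exists_primrec_termCode {L : FirstOrder.Language.{0, 0}}
    [Encodable (Σ n, L.Functions n)] {α σ : Type} [Primcodable σ] {n : ℕ} (t : L.Term (α ⊕ Fin n))
    {ρ : α → σ → ℕ} {N : σ → ℕ} (hρ : ∀ a, Primrec (ρ a)) (hN : Primrec N) :
    ∃ g : σ → ℕ, Primrec g ∧ ∀ s, (∀ a, ρ a s < N s) →
      ∃ t' : L.Term (Empty ⊕ Fin (N s + n)), termCode t' = g s ∧
        ∀ (M : Type) [L.Structure M] (e : ℕ → M), t'.realize (Sum.elim default fun i : Fin (N s + n) => e i) =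
          t.realize (Sum.elim (fun a => e (ρ a s)) fun i : Fin n => e (N s + i)) := by
  induction t with
  | var x =>
    rcases x with a | i
    · exact ⟨fun s => Nat.pair 0 (ρ a s), Primrec₂.natPair.comp (Primrec.const 0) (hρ a),
        fun s hs => ⟨.var (.inr ⟨ρ a s, by have := hs a; omega⟩), rfl, fun M _ e => rfl⟩⟩
    · exact ⟨fun s => Nat.pair 0 (N s + i), Primrec₂.natPair.comp (Primrec.const 0)
        (Primrec.nat_add.comp hN (Primrec.const _)),
        fun s hs => ⟨.var (.inr ⟨N s + i, by omega⟩), rfl, fun M _ e => rfl⟩⟩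
  | @func m f ts ih =>
    choose g hg h using ih
    refine ⟨fun s => Nat.pair 1 (Nat.pair (Encodable.encode (⟨m, f⟩ : Σ n, L.Functions n))
        (Encodable.encode (List.ofFn fun i => g i s))),
      Primrec₂.natPair.comp (Primrec.const 1) (Primrec₂.natPair.comp (Primrec.const _)
        (Primrec.encode.comp (Primrec.list_ofFn hg))), fun s hs => ?_⟩
    choose t' ht' H using fun i => h i s hs
    refine ⟨.func f t', ?_, fun M _ e => congrArg (Structure.funMap f) (funext fun i => H i M e)⟩
    simp only [termCode, ht']

section Represents
variable {L : FirstOrder.Language.{0, 0}} [Encodable (Σ n, L.Functions n)]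
  [Encodable (Σ n, L.Relations n)]

/-- The number `k` is the Gödel number of a formula with the variables `x₀, …, x_{N-1}` that means
`Q`, uniformly in all structures. A valuation assigns values to all variables. -/
def Represents (L : FirstOrder.Language.{0, 0}) [Encodable (Σ n, L.Functions n)]
    [Encodable (Σ n, L.Relations n)] (N k : ℕ) (Q : ∀ (M : Type) [L.Structure M], (ℕ → M) → Prop) : Prop :=
  ∃ ψ : L.BoundedFormula Empty N, formulaCode ψ = k ∧
    ∀ (M : Type) [L.Structure M] (e : ℕ → M), ψ.Realize default (fun i => e i) ↔ Q M e

variable {N k l : ℕ} {Q Q' : ∀ (M : Type) [L.Structure M], (ℕ → M) → Prop}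

theorem Represents.of_iff (h : Represents L N k Q)
    (hQ : ∀ (M : Type) [L.Structure M] (e : ℕ → M), Q M e ↔ Q' M e) : Represents L N k Q' := by
  obtain ⟨ψ, hψ, H⟩ := h
  exact ⟨ψ, hψ, fun M _ e => (H M e).trans (hQ M e)⟩

theorem represents_bot (N : ℕ) : Represents L N (Nat.pair 0 0) fun _ _ _ => False :=
  ⟨⊥, code_bot, fun _ _ _ => Iff.rfl⟩

theorem represents_eq {i j : ℕ} (hi : i < N) (hj : j < N) :
    Represents L N (eqCode i j) fun _ _ e => e i = e j :=
  ⟨(&(⟨i, hi⟩ : Fin N)) =' (&(⟨j, hj⟩ : Fin N)), code_eq _ _, fun _ _ _ => by simp⟩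

theorem Represents.imp (h : Represents L N k Q) (h' : Represents L N l Q') :
    Represents L N (cImp k l) fun M _ e => Q M e → Q' M e := by
  obtain ⟨ψ, rfl, H⟩ := h
  obtain ⟨ψ', rfl, H'⟩ := h'
  exact ⟨ψ.imp ψ', code_imp _ _, fun M _ e => imp_congr (H M e) (H' M e)⟩

theorem Represents.not (h : Represents L N k Q) : Represents L N (cNot k) fun M _ e => ¬ Q M e :=
  h.imp (represents_bot N)

theorem Represents.and (h : Represents L N k Q) (h' : Represents L N l Q') :
    Represents L N (cAnd k l) fun M _ e => Q M e ∧ Q' M e :=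
  (h.imp h'.not).not.of_iff fun M _ e => by tauto

theorem Represents.or (h : Represents L N k Q) (h' : Represents L N l Q') :
    Represents L N (cOr k l) fun M _ e => Q M e ∨ Q' M e :=
  (h.not.imp h').of_iff fun M _ e => by tauto

theorem represents_bigAnd {ι : Type} {Q : ι → ∀ (M : Type) [L.Structure M], (ℕ → M) → Prop}
    {c : ι → ℕ} (l : List ι) (h : ∀ i ∈ l, Represents L N (c i) (Q i)) :
    Represents L N (cBigAnd (l.map c)) fun M _ e => ∀ i ∈ l, Q i M e := by
  induction l with
  | nil => exact (represents_bot N).not.of_iff fun M _ e => by simp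
  | cons i l ih =>
    exact ((h i (by simp)).and (ih fun j hj => h j (by simp [hj]))).of_iff fun M _ e => by simp

theorem represents_bigOr {ι : Type} {Q : ι → ∀ (M : Type) [L.Structure M], (ℕ → M) → Prop}
    {c : ι → ℕ} (l : List ι) (h : ∀ i ∈ l, Represents L N (c i) (Q i)) :
    Represents L N (cBigOr (l.map c)) fun M _ e => ∃ i ∈ l, Q i M e := by
  induction l with
  | nil => exact (represents_bot N).of_iff fun M _ e => by simp
  | cons i l ih =>
    exact ((h i (by simp)).or (ih fun j hj => h j (by simp [hj]))).of_iff fun M _ e => by simp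

/-- The universal quantifier over the variable `x_N` ranges over the valuations that agree with the
given one below `N`. -/
theorem Represents.all (h : Represents L (N + 1) k Q) : Represents L N (cAll k) fun M _ e =>
    ∀ e' : ℕ → M, (∀ i < N, e' i = e i) → Q M e' := by
  obtain ⟨ψ, rfl, H⟩ := h
  refine ⟨ψ.all, code_all _, fun M _ e => ?_⟩
  have key : ∀ e' : ℕ → M, (∀ i < N, e' i = e i) →
      (fun i : Fin (N + 1) => e' i) = Fin.snoc (fun i : Fin N => e i) (e' N) := fun e' he' => by
    funext i
    refine Fin.lastCases ?_ (fun i => ?_) i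
    · simp
    · simpa using he' i i.2
  constructor
  · intro h e' he'
    rw [← H, key e' he']
    exact h (e' N)
  · intro h x
    have := (H M _).2 (h (Function.update e N x) fun i hi => Function.update_of_ne hi.ne _ _)
    rw [key _ fun i hi => Function.update_of_ne hi.ne _ _, Function.update_self] at this
    exact this

theorem Represents.allBlock (D : ℕ) (h : Represents L (N + D) k Q) :
    Represents L N (cAll^[D] k) fun M _ e => ∀ e' : ℕ → M, (∀ i < N, e' i = e i) → Q M e' := by
  induction D generalizing k Q with
  | zero =>
    obtain ⟨ψ, rfl, H⟩ := h
    refine ⟨ψ, rfl, fun M _ e => ⟨fun h e' he' => ?_, fun h => (H M e).2 (h e fun _ _ => rfl)⟩⟩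
    have : (fun i : Fin (N + 0) => e' i) = fun i : Fin (N + 0) => e i := funext fun i => he' i i.2
    rw [← H, this]
    exact h
  | succ D ih =>
    rw [Function.iterate_succ_apply]
    refine (ih (Represents.all (N := N + D) h)).of_iff fun M _ e => ?_
    constructor
    · intro h e' he'
      exact h e' he' e' fun _ _ => rfl
    · intro h e' he' e'' he''
      exact h e'' fun i hi => (he'' i (by omega)).trans (he' i hi)

theorem Represents.exBlock (D : ℕ) (h : Represents L (N + D) k Q) :
    Represents L N (cEx^[D] k) fun M _ e => ∃ e' : ℕ → M, (∀ i < N, e' i = e i) ∧ Q M e' := by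
  induction D generalizing k Q with
  | zero =>
    obtain ⟨ψ, rfl, H⟩ := h
    refine ⟨ψ, rfl, fun M _ e => ⟨fun h => ⟨e, fun _ _ => rfl, (H M e).1 h⟩, ?_⟩⟩
    rintro ⟨e', he', h⟩
    have : (fun i : Fin (N + 0) => e' i) = fun i : Fin (N + 0) => e i := funext fun i => he' i i.2
    rw [← H, this] at h
    exact h
  | succ D ih =>
    rw [Function.iterate_succ_apply]
    refine (ih (Represents.all (N := N + D) h.not).not).of_iff fun M _ e => ?_
    constructor
    · rintro ⟨e', he', h⟩
      push Not at h
      obtain ⟨e'', he'', h⟩ := h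
      exact ⟨e'', fun i hi => (he'' i (by omega)).trans (he' i hi), h⟩
    · rintro ⟨e', he', h⟩
      exact ⟨e', he', fun h' => h' e' (fun _ _ => rfl) h⟩

/-- The Gödel number of an instance of a fixed formula is a primitive recursive function of the names
of the variables that are substituted. -/
theorem exists_primrec_represents {α σ : Type} [Primcodable σ] {n : ℕ} (θ : L.BoundedFormula α n)
    {ρ : α → σ → ℕ} {N : σ → ℕ} (hρ : ∀ a, Primrec (ρ a)) (hN : Primrec N) :
    ∃ g : σ → ℕ, Primrec g ∧ ∀ s, (∀ a, ρ a s < N s) →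
      Represents L (N s + n) (g s) fun _ _ e =>
        θ.Realize (fun a => e (ρ a s)) fun i => e (N s + i) := by
  induction θ with
  | falsum => exact ⟨fun _ => Nat.pair 0 0, Primrec.const _, fun s _ => represents_bot _⟩
  | equal t u =>
    obtain ⟨g, hg, H⟩ := exists_primrec_termCode t hρ hN
    obtain ⟨g', hg', H'⟩ := exists_primrec_termCode u hρ hN
    refine ⟨fun s => Nat.pair 1 (Nat.pair (g s) (g' s)),
      Primrec₂.natPair.comp (Primrec.const 1) (Primrec₂.natPair.comp hg hg'), fun s hs => ?_⟩
    obtain ⟨t', ht, h⟩ := H s hs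
    obtain ⟨u', hu, h'⟩ := H' s hs
    refine ⟨.equal t' u', by simp only [formulaCode, ht, hu], fun M _ e => ?_⟩
    exact iff_of_eq (congrArg₂ _ (h M e) (h' M e))
  | @rel n m R ts =>
    choose g hg H using fun i => exists_primrec_termCode (ts i) hρ hN
    refine ⟨fun s => Nat.pair 2 (Nat.pair (Encodable.encode (⟨m, R⟩ : Σ n, L.Relations n))
        (Encodable.encode (List.ofFn fun i => g i s))),
      Primrec₂.natPair.comp (Primrec.const 2) (Primrec₂.natPair.comp (Primrec.const _)
        (Primrec.encode.comp (Primrec.list_ofFn hg))), fun s hs => ?_⟩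
    choose t' ht' h using fun i => H i s hs
    refine ⟨.rel R t', by simp only [formulaCode, ht'], fun M _ e => ?_⟩
    exact iff_of_eq (congrArg (Structure.RelMap R) (funext fun i => h i M e))
  | imp φ ψ ih1 ih2 =>
    obtain ⟨g, hg, H⟩ := ih1
    obtain ⟨g', hg', H'⟩ := ih2
    exact ⟨fun s => cImp (g s) (g' s), primrec_cImp.comp hg hg', fun s hs => (H s hs).imp (H' s hs)⟩
  | @all n φ ih =>
    obtain ⟨g, hg, H⟩ := ih
    refine ⟨fun s => cAll (g s), primrec_cAll.comp hg, fun s hs => ?_⟩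
    obtain ⟨ψ, hψ, h⟩ := H s hs
    refine ⟨ψ.all, by rw [code_all, hψ], fun M _ e => forall_congr' fun x => ?_⟩
    have := h M (Function.update e (N s + n) x)
    have h1 : (fun i : Fin (N s + (n + 1)) => Function.update e (N s + n) x i) =
        Fin.snoc (α := fun _ => M) (fun i : Fin (N s + n) => e i) x := by
      funext i
      refine Fin.lastCases (n := N s + n) ?_ (fun i => ?_) i
      · simp
      · simp [Function.update_of_ne i.2.ne]
    have h2 : (fun i : Fin (n + 1) => Function.update e (N s + n) x (N s + i)) =
        Fin.snoc (α := fun _ => M) (fun i : Fin n => e (N s + i)) x := by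
      funext i
      refine Fin.lastCases ?_ (fun i => ?_) i
      · simp
      · simp
        rw [Function.update_of_ne (by omega)]
    have h3 : (fun a => Function.update e (N s + n) x (ρ a s)) = fun a => e (ρ a s) :=
      funext fun a => Function.update_of_ne (by have := hs a; omega) _ _
    beta_reduce at this
    rw [h1, h2, h3] at this
    exact this

end Represents
end LaxInt

namespace LaxInt

/-! ### The translation of Gödel numbers -/

/-- A symbol that an unnested atomic formula applies to its arguments: the symbol for identity, a
function symbol, or a relation symbol. -/
abbrev Head (L : FirstOrder.Language.{0, 0}) : Type :=
  Unit ⊕ (Σ n, L.Functions n) ⊕ (Σ n, L.Relations n)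

/-- The number of arguments; for a function symbol the value counts as the first argument. -/
def Head.arity {L : FirstOrder.Language.{0, 0}} : Head L → ℕ
  | .inl _ => 2
  | .inr (.inl f) => f.1 + 1
  | .inr (.inr r) => r.1

/-- The unnested atomic formula holds in a raw structure. -/
def Head.Holds {L : FirstOrder.Language.{0, 0}} {X : Type} (S : RawStr L X) :
    (H : Head L) → (Fin H.arity → X) → Prop
  | .inl _, x => S.eqv (x (0 : Fin 2)) (x (1 : Fin 2))
  | .inr (.inl f), x => S.func f.2 (Fin.tail x) (x (0 : Fin (f.1 + 1)))
  | .inr (.inr r), x => S.rel r.2 x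

namespace Translation
variable {L L' : FirstOrder.Language.{0, 0}} (τ : Translation L L') (D : ℕ) {M : Type}

/-- The first variables of the target language stand for the parameters. -/
def pars (e : ℕ → M) : Fin τ.params → M := fun i => e i

/-- After the parameters come blocks of `D` variables. The element of piece `k` that is given by the
block with number `i`. -/
def blk (e : ℕ → M) (k : Fin τ.pieces) (i : ℕ) : Σ k, Fin (τ.dim k) → M :=
  ⟨k, fun j => e (τ.params + D * i + j)⟩

variable {D}

theorem pos_lt (hD : ∀ k, τ.dim k ≤ D) {k : Fin τ.pieces} (j : Fin (τ.dim k)) {i κ : ℕ}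
    (hi : i < κ) : τ.params + D * i + j < τ.params + D * κ := by
  have h1 : D * (i + 1) ≤ D * κ := Nat.mul_le_mul le_rfl hi
  have h2 := hD k
  have h3 := j.2
  rw [Nat.mul_succ] at h1
  omega

theorem pars_congr {κ : ℕ} {e e' : ℕ → M} (h : ∀ i < τ.params + D * κ, e' i = e i) :
    τ.pars e' = τ.pars e :=
  funext fun i => h i (by omega)

theorem blk_congr (hD : ∀ k, τ.dim k ≤ D) {κ : ℕ} {e e' : ℕ → M}
    (h : ∀ i < τ.params + D * κ, e' i = e i) (k : Fin τ.pieces) {i : ℕ} (hi : i < κ) :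
    τ.blk D e' k i = τ.blk D e k i := by
  unfold blk
  congr 1
  funext j
  exact h _ (τ.pos_lt hD j hi)

theorem exists_blk_eq (D κ : ℕ) (e : ℕ → M) (k : Fin τ.pieces) (y : Fin (τ.dim k) → M) :
    ∃ e' : ℕ → M, (∀ i < τ.params + D * κ, e' i = e i) ∧ τ.blk D e' k κ = ⟨k, y⟩ := by
  refine ⟨fun i => if h : τ.params + D * κ ≤ i ∧ i - (τ.params + D * κ) < τ.dim k then
    y ⟨_, h.2⟩ else e i, fun i hi => dif_neg fun h => by omega, ?_⟩
  unfold blk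
  congr 1
  funext j
  refine (dif_pos ⟨by omega, by omega⟩).trans (congrArg y (Fin.ext (by simp)))

section
variable [Encodable (Σ n, L'.Functions n)] [Encodable (Σ n, L'.Relations n)]

/-- A block of `D` universal quantifiers is a quantifier over the tuples of piece `k`. The variables
of the block beyond the dimension of the piece are idle. -/
theorem represents_allBlk {k : Fin τ.pieces} {κ r : ℕ}
    {Q : ∀ (M : Type) [L'.Structure M], (ℕ → M) → Prop}
    {Q' : ∀ (M : Type) [L'.Structure M], (ℕ → M) → (Σ k, Fin (τ.dim k) → M) → Prop}
    (h : Represents L' (τ.params + D * (κ + 1)) r Q)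
    (hQ : ∀ (M : Type) [L'.Structure M] (e e' : ℕ → M),
      (∀ i < τ.params + D * κ, e' i = e i) → (Q M e' ↔ Q' M e (τ.blk D e' k κ))) :
    Represents L' (τ.params + D * κ) (cAll^[D] r) fun M _ e =>
      ∀ y : Fin (τ.dim k) → M, Q' M e ⟨k, y⟩ := by
  rw [Nat.mul_succ, ← Nat.add_assoc] at h
  refine h.allBlock.of_iff fun M _ e => ⟨fun h y => ?_, fun h e' he' => (hQ M e e' he').2 (h _)⟩
  obtain ⟨e', he', hy⟩ := τ.exists_blk_eq D κ e k y
  rw [← hy]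
  exact (hQ M e e' he').1 (h e' he')

theorem represents_exBlk {k : Fin τ.pieces} {κ r : ℕ}
    {Q : ∀ (M : Type) [L'.Structure M], (ℕ → M) → Prop}
    {Q' : ∀ (M : Type) [L'.Structure M], (ℕ → M) → (Σ k, Fin (τ.dim k) → M) → Prop}
    (h : Represents L' (τ.params + D * (κ + 1)) r Q)
    (hQ : ∀ (M : Type) [L'.Structure M] (e e' : ℕ → M),
      (∀ i < τ.params + D * κ, e' i = e i) → (Q M e' ↔ Q' M e (τ.blk D e' k κ))) :
    Represents L' (τ.params + D * κ) (cEx^[D] r) fun M _ e =>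
      ∃ y : Fin (τ.dim k) → M, Q' M e ⟨k, y⟩ := by
  rw [Nat.mul_succ, ← Nat.add_assoc] at h
  refine (h.exBlock D).of_iff fun M _ e => ⟨?_, ?_⟩
  · rintro ⟨e', he', h⟩
    exact ⟨_, (hQ M e e' he').1 h⟩
  · rintro ⟨y, h⟩
    obtain ⟨e', he', hy⟩ := τ.exists_blk_eq D κ e k y
    rw [← hy] at h
    exact ⟨e', he', (hQ M e e' he').2 h⟩

theorem primrec_pos (P D j : ℕ) {g : ℕ → ℕ} (hg : Primrec g) :
    Primrec fun κ : ℕ => P + D * g κ + j :=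
  Primrec.nat_add.comp (Primrec.nat_add.comp (Primrec.const _)
    (Primrec.nat_mul.comp (Primrec.const _) hg)) (Primrec.const _)

/-- The domain formula, for the block with number `κ`. -/
theorem exists_domCode (hD : ∀ k, τ.dim k ≤ D) (k : Fin τ.pieces) :
    ∃ g : ℕ → ℕ, Primrec g ∧ ∀ κ, Represents L' (τ.params + D * (κ + 1)) (g κ)
      fun _ _ e => (τ.raw (τ.pars e)).dom (τ.blk D e k κ) := by
  obtain ⟨g, hg, h⟩ := exists_primrec_represents (τ.dom k)
    (ρ := Sum.elim (fun i _ => (i : ℕ)) fun j κ => τ.params + D * κ + j)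
    (N := fun κ => τ.params + D * (κ + 1) + 0)
    (by rintro (i | j); exacts [Primrec.const _, primrec_pos _ _ _ Primrec.id])
    (primrec_pos _ _ _ Primrec.succ)
  refine ⟨g, hg, fun κ => (h κ ?_).of_iff fun M _ e => ?_⟩
  · rintro (i | j)
    · exact i.2.trans_le ((Nat.le_add_right _ _).trans (Nat.le_add_right _ _))
    · exact τ.pos_lt hD j κ.lt_succ_self
  · refine iff_of_eq (congrArg₂ (BoundedFormula.Realize _) (funext ?_) (Subsingleton.elim _ _))
    rintro (i | j) <;> rfl

/-- The translation of an unnested atomic formula, for consecutive blocks that start with the number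
`s`. -/
theorem exists_headCode (hD : ∀ k, τ.dim k ≤ D) (H : Head L) (w : Fin H.arity → Fin τ.pieces) :
    ∃ g : ℕ → ℕ, Primrec g ∧ ∀ s, Represents L' (τ.params + D * (s + H.arity)) (g s)
      fun _ _ e => H.Holds (τ.raw (τ.pars e)) fun i => τ.blk D e (w i) (s + i) := by
  -- All three kinds of symbols are translated to a fixed formula whose variables are named by the
  -- parameters and by a coordinate of an argument.
  have key : ∀ (α : Type) (θ : L'.Formula (Fin τ.params ⊕ α)) (i : α → Fin H.arity)
      (j : ∀ a, Fin (τ.dim (w (i a)))),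
      ∃ g : ℕ → ℕ, Primrec g ∧ ∀ s, Represents L' (τ.params + D * (s + H.arity)) (g s)
        fun _ _ e => θ.Realize (Sum.elim (τ.pars e) fun a => (τ.blk D e (w (i a)) (s + i a)).2 (j a)) := by
    intro α θ i j
    obtain ⟨g, hg, h⟩ := exists_primrec_represents θ
      (ρ := Sum.elim (fun i _ => (i : ℕ)) fun a s => τ.params + D * (s + i a) + j a)
      (N := fun s => τ.params + D * (s + H.arity) + 0)
      (by
        rintro (i | j)
        exacts [Primrec.const _, primrec_pos _ _ _ (Primrec.nat_add.comp Primrec.id (Primrec.const _))])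
      (primrec_pos _ _ _ (Primrec.nat_add.comp Primrec.id (Primrec.const _)))
    refine ⟨g, hg, fun s => (h s ?_).of_iff fun M _ e => ?_⟩
    · rintro (i' | a)
      · exact i'.2.trans_le ((Nat.le_add_right _ _).trans (Nat.le_add_right _ _))
      · exact τ.pos_lt hD (j a) (Nat.add_lt_add_left (i a).2 s)
    · refine iff_of_eq (congrArg₂ (BoundedFormula.Realize _) (funext ?_) (Subsingleton.elim _ _))
      rintro (i | j) <;> rfl
  rcases H with _ | ⟨l, f⟩ | ⟨l, r⟩
  · obtain ⟨g, hg, h⟩ := key _ (τ.eqv (w (0 : Fin 2)) (w (1 : Fin 2)))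
      (Sum.elim (fun _ => (0 : Fin 2)) fun _ => (1 : Fin 2)) (by rintro (j | j); exacts [j, j])
    refine ⟨g, hg, fun s => (h s).of_iff fun M _ e => ?_⟩
    refine iff_of_eq (congrArg _ (funext ?_))
    rintro (i | j | j) <;> rfl
  · obtain ⟨g, hg, h⟩ := key _ (τ.func f (Fin.tail w) (w (0 : Fin (l + 1))))
      (Sum.elim (fun x => x.1.succ) fun _ => (0 : Fin (l + 1)))
      (by rintro (j | j); exacts [j.2, j])
    refine ⟨g, hg, fun s => (h s).of_iff fun M _ e => ?_⟩
    refine iff_of_eq (congrArg _ (funext ?_))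
    rintro (i | j | j) <;> rfl
  · obtain ⟨g, hg, h⟩ := key _ (τ.rel r w) (fun x => x.1) (fun x => x.2)
    exact ⟨g, hg, h⟩

end
end Translation

/-! ### Rules for the translation -/

/-- Judgements about Gödel numbers. The list of numbers `c` contains the pieces over which the
variables range. -/
abbrev Judgement : Type :=
  (List ℕ × ℕ × ℕ) ⊕ (List ℕ × ℕ × ℕ) ⊕ (List ℕ × (ℕ × ℕ) × List ℕ × ℕ)

/-- The formula with number `a` is translated to the formula with number `k`. -/
def jSat (c : List ℕ) (a k : ℕ) : Judgement := .inl (c, a, k)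
/-- The formula with number `k` says that the last variable is the value of the term with
number `a`. -/
def jVal (c : List ℕ) (a k : ℕ) : Judgement := .inr (.inl (c, a, k))
/-- The formula with number `k` says that the symbol with number `h` holds of the variables from
number `s` on, followed by values of the terms with numbers in the list `l`. -/
def jArgs (c : List ℕ) (s h : ℕ) (l : List ℕ) (k : ℕ) : Judgement := .inr (.inr (c, (s, h), l, k))

/-- The number of the formula that says that the last variable equals the variable with
number `i`; the list `dims` contains the dimensions of the pieces. -/
def varCode (P D : ℕ) (dims c : List ℕ) (i : ℕ) : ℕ :=
  if c.getD i 0 = c.getD (c.length - 1) 0 then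
    cBigAnd ((List.range (dims.getD (c.getD i 0) 0)).map fun j =>
      eqCode (P + D * i + j) (P + D * (c.length - 1) + j))
  else Nat.pair 0 0

section Rules
variable {L : FirstOrder.Language.{0, 0}} [Encodable (Σ n, L.Functions n)]
  [Encodable (Σ n, L.Relations n)] (q P D : ℕ) (dims : List ℕ) (gd : Fin q → ℕ → ℕ)
  (gh : ∀ H : Head L, (Fin H.arity → Fin q) → ℕ → ℕ)

/-- The rules for the translation of Gödel numbers, where `q` is the number of pieces, `P` the number
of parameters, and `D` the size of a block of variables. The functions `gd` and `gh` give the numbers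
of the translations of the domain and of unnested atomic formulas. -/
inductive TransRule : List Judgement × Judgement → Prop
  | bot (c : List ℕ) : TransRule ([], jSat c (Nat.pair 0 0) (Nat.pair 0 0))
  | imp (c : List ℕ) (a b r s : ℕ) :
      TransRule ([jSat c a r, jSat c b s], jSat c (cImp a b) (cImp r s))
  | all (c : List ℕ) (a : ℕ) (rs : List ℕ) :
      TransRule (List.ofFn fun k : Fin q => jSat (c ++ [(k : ℕ)]) a (rs.getD k 0),
        jSat c (cAll a) (cBigAnd (List.ofFn fun k : Fin q =>
          cAll^[D] (cImp (gd k c.length) (rs.getD k 0)))))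
  | eq (c : List ℕ) (a b r : ℕ) :
      TransRule ([jArgs c c.length (Encodable.encode (.inl () : Head L)) [a, b] r],
        jSat c (Nat.pair 1 (Nat.pair a b)) r)
  | rel (R : Σ n, L.Relations n) (c l : List ℕ) (r : ℕ) :
      TransRule ([jArgs c c.length (Encodable.encode (.inr (.inr R) : Head L)) l r],
        jSat c (Nat.pair 2 (Nat.pair (Encodable.encode R) (Encodable.encode l))) r)
  | var (c : List ℕ) (i : ℕ) : TransRule ([], jVal c (Nat.pair 0 i) (varCode P D dims c i))
  | func (f : Σ n, L.Functions n) (c l : List ℕ) (r : ℕ) :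
      TransRule ([jArgs c (c.length - 1) (Encodable.encode (.inr (.inl f) : Head L)) l r],
        jVal c (Nat.pair 1 (Nat.pair (Encodable.encode f) (Encodable.encode l))) r)
  | nil (H : Head L) (w : Fin H.arity → Fin q) (c : List ℕ) :
      TransRule ([], jArgs (c ++ List.ofFn fun i => (w i : ℕ)) c.length (Encodable.encode H) []
        (gh H w c.length))
  | cons (c : List ℕ) (s h t : ℕ) (ts rs us : List ℕ) :
      TransRule ((List.ofFn fun k : Fin q => jVal (c ++ [(k : ℕ)]) t (rs.getD k 0)) ++
          List.ofFn fun k : Fin q => jArgs (c ++ [(k : ℕ)]) s h ts (us.getD k 0),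
        jArgs c s h (t :: ts) (cBigOr (List.ofFn fun k : Fin q =>
          cEx^[D] (cAnd (gd k c.length) (cAnd (rs.getD k 0) (us.getD k 0))))))

theorem primrec_varCode : Primrec₂ (varCode P D dims) := by
  have hc : Primrec fun x : List ℕ × ℕ => x.1 := Primrec.fst
  have hi : Primrec fun x : List ℕ × ℕ => x.2 := Primrec.snd
  have hm : Primrec fun x : List ℕ × ℕ => x.1.length - 1 :=
    Primrec.pred.comp (Primrec.list_length.comp hc)
  have h1 := (Primrec.list_getD 0).comp hc hi
  have h2 := (Primrec.list_getD 0).comp hc hm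
  refine Primrec.ite (Primrec.eq.comp h1 h2) (primrec_cBigAnd.comp (Primrec.list_map
    (Primrec.list_range.comp ((Primrec.list_getD 0).comp (Primrec.const dims) h1)) ?_))
    (Primrec.const _)
  have hp : ∀ {g : List ℕ × ℕ → ℕ}, Primrec g →
      Primrec fun x : (List ℕ × ℕ) × ℕ => P + D * g x.1 + x.2 := fun hg =>
    Primrec.nat_add.comp (Primrec.nat_add.comp (Primrec.const _)
      (Primrec.nat_mul.comp (Primrec.const _) (hg.comp Primrec.fst))) Primrec.snd
  exact (primrec_eqCode.comp (hp hi) (hp hm)).to₂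

variable {gd gh}

theorem rePred_transRule [Finite (Σ n, L.Functions n)] [Finite (Σ n, L.Relations n)]
    (hd : ∀ k, Primrec (gd k)) (hh : ∀ H w, Primrec (gh H w)) :
    REPred (TransRule q P D dims gd gh) := by
  have hS : ∀ {α : Type} [Primcodable α] {f : α → List ℕ} {g h : α → ℕ}, Primrec f → Primrec g →
      Primrec h → Primrec fun a => jSat (f a) (g a) (h a) := fun hf hg hh =>
    Primrec.sumInl.comp (hf.pair (hg.pair hh))
  have hV : ∀ {α : Type} [Primcodable α] {f : α → List ℕ} {g h : α → ℕ}, Primrec f → Primrec g →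
      Primrec h → Primrec fun a => jVal (f a) (g a) (h a) := fun hf hg hh =>
    Primrec.sumInr.comp (Primrec.sumInl.comp (hf.pair (hg.pair hh)))
  have hA : ∀ {α : Type} [Primcodable α] {f l : α → List ℕ} {s g h : α → ℕ}, Primrec f → Primrec s →
      Primrec g → Primrec l → Primrec h → Primrec fun a => jArgs (f a) (s a) (g a) (l a) (h a) :=
    fun hf hs hg hl hh =>
      Primrec.sumInr.comp (Primrec.sumInr.comp (hf.pair ((hs.pair hg).pair (hl.pair hh))))
  have hone : ∀ {α : Type} [Primcodable α] {f : α → Judgement}, Primrec f →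
      Primrec fun a => [f a] := fun hf => Primrec.list_cons.comp hf (Primrec.const [])
  have hlen : ∀ {α : Type} [Primcodable α] {f : α → List ℕ}, Primrec f →
      Primrec fun a => (f a).length := fun hf => Primrec.list_length.comp hf
  have hget : ∀ {α : Type} [Primcodable α] {f : α → List ℕ} (k : ℕ), Primrec f →
      Primrec fun a => (f a).getD k 0 := fun k hf =>
    (Primrec.list_getD 0).comp hf (Primrec.const k)
  have happ : ∀ {α : Type} [Primcodable α] {f : α → List ℕ} (k : ℕ), Primrec f →
      Primrec fun a => f a ++ [k] := fun k hf => Primrec.list_append.comp hf (Primrec.const [k])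
  have hnp : ∀ {α : Type} [Primcodable α] (k : ℕ) {f g : α → ℕ}, Primrec f → Primrec g →
      Primrec fun a => Nat.pair k (Nat.pair (f a) (g a)) := fun k _ _ hf hg =>
    Primrec₂.natPair.comp (Primrec.const k) (Primrec₂.natPair.comp hf hg)
  have hcAll : ∀ {α : Type} [Primcodable α] {f : α → ℕ}, Primrec f →
      Primrec fun a => cAll^[D] (f a) := fun hf =>
    Primrec.nat_iterate (Primrec.const D) hf (primrec_cAll.comp Primrec.snd).to₂
  have hcEx : ∀ {α : Type} [Primcodable α] {f : α → ℕ}, Primrec f →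
      Primrec fun a => cEx^[D] (f a) := fun hf =>
    Primrec.nat_iterate (Primrec.const D) hf (primrec_cEx.comp Primrec.snd).to₂
  have henc : ∀ {α : Type} [Primcodable α] {f : α → List ℕ}, Primrec f →
      Primrec fun a => Encodable.encode (f a) := fun hf => Primrec.encode.comp hf
  have hr : ∀ {α : Type} [Primcodable α] {f : α → List Judgement} {g : α → Judgement}, Primrec f →
      Primrec g → REPred fun x => ∃ a, (f a, g a) = x := fun hf hg => rePred_range (hf.pair hg).to_comp
  have e : ∀ {α β : Type} [Primcodable α] [Primcodable β], Primrec fun x : α × β => x.1 := Primrec.fst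
  have e' : ∀ {α β : Type} [Primcodable α] [Primcodable β], Primrec fun x : α × β => x.2 :=
    Primrec.snd
  have r1 : REPred fun x => ∃ c : List ℕ, ([], jSat c (Nat.pair 0 0) (Nat.pair 0 0)) = x :=
    hr (Primrec.const []) (hS .id (.const _) (.const _))
  have r2 : REPred fun x => ∃ y : List ℕ × (ℕ × ℕ) × ℕ × ℕ,
      ([jSat y.1 y.2.1.1 y.2.2.1, jSat y.1 y.2.1.2 y.2.2.2],
        jSat y.1 (cImp y.2.1.1 y.2.1.2) (cImp y.2.2.1 y.2.2.2)) = x := by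
    have a := e.comp (e.comp (e' (α := List ℕ) (β := (ℕ × ℕ) × ℕ × ℕ)))
    have b := e'.comp (e.comp (e' (α := List ℕ) (β := (ℕ × ℕ) × ℕ × ℕ)))
    have r := e.comp (e'.comp (e' (α := List ℕ) (β := (ℕ × ℕ) × ℕ × ℕ)))
    have s := e'.comp (e'.comp (e' (α := List ℕ) (β := (ℕ × ℕ) × ℕ × ℕ)))
    exact hr (Primrec.list_cons.comp (hS e a r) (hone (hS e b s)))
      (hS e (primrec_cImp.comp a b) (primrec_cImp.comp r s))
  have r3 : REPred fun x => ∃ y : List ℕ × ℕ × List ℕ,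
      ((List.ofFn fun k : Fin q => jSat (y.1 ++ [(k : ℕ)]) y.2.1 (y.2.2.getD k 0)),
        jSat y.1 (cAll y.2.1) (cBigAnd (List.ofFn fun k : Fin q =>
          cAll^[D] (cImp (gd k y.1.length) (y.2.2.getD k 0))))) = x :=
    hr (Primrec.list_ofFn fun k => hS (happ k e) (e.comp e') (hget k (e'.comp e')))
      (hS e (primrec_cAll.comp (e.comp e')) (primrec_cBigAnd.comp (Primrec.list_ofFn fun k =>
        hcAll (primrec_cImp.comp ((hd k).comp (hlen e)) (hget k (e'.comp e'))))))
  have r4 : REPred fun x => ∃ y : List ℕ × ℕ × ℕ × ℕ,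
      ([jArgs y.1 y.1.length (Encodable.encode (.inl () : Head L)) [y.2.1, y.2.2.1] y.2.2.2],
        jSat y.1 (Nat.pair 1 (Nat.pair y.2.1 y.2.2.1)) y.2.2.2) = x :=
    hr (hone (hA e (hlen e) (.const _) (primrec_list_two.comp (e.comp e') (e.comp (e'.comp e')))
      (e'.comp (e'.comp e'))))
      (hS e (hnp 1 (e.comp e') (e.comp (e'.comp e'))) (e'.comp (e'.comp e')))
  have r5 : REPred fun x => ∃ (R : Σ n, L.Relations n) (y : List ℕ × List ℕ × ℕ),
      ([jArgs y.1 y.1.length (Encodable.encode (.inr (.inr R) : Head L)) y.2.1 y.2.2],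
        jSat y.1 (Nat.pair 2 (Nat.pair (Encodable.encode R) (Encodable.encode y.2.1))) y.2.2) = x :=
    rePred_exists_finite fun R =>
      hr (hone (hA e (hlen e) (.const _) (e.comp e') (e'.comp e')))
        (hS e (hnp 2 (.const _) (henc (e.comp e'))) (e'.comp e'))
  have r6 : REPred fun x => ∃ y : List ℕ × ℕ,
      ([], jVal y.1 (Nat.pair 0 y.2) (varCode P D dims y.1 y.2)) = x :=
    hr (Primrec.const []) (hV e (Primrec₂.natPair.comp (.const 0) e')
      ((primrec_varCode P D dims).comp e e'))
  have r7 : REPred fun x => ∃ (f : Σ n, L.Functions n) (y : List ℕ × List ℕ × ℕ),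
      ([jArgs y.1 (y.1.length - 1) (Encodable.encode (.inr (.inl f) : Head L)) y.2.1 y.2.2],
        jVal y.1 (Nat.pair 1 (Nat.pair (Encodable.encode f) (Encodable.encode y.2.1))) y.2.2) = x :=
    rePred_exists_finite fun R =>
      hr (hone (hA e (Primrec.pred.comp (hlen e)) (.const _) (e.comp e') (e'.comp e')))
        (hV e (hnp 1 (.const _) (henc (e.comp e'))) (e'.comp e'))
  have r8 : REPred fun x => ∃ (i : Σ H : Head L, Fin H.arity → Fin q) (c : List ℕ),
      ([], jArgs (c ++ List.ofFn fun j => (i.2 j : ℕ)) c.length (Encodable.encode i.1) []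
        (gh i.1 i.2 c.length)) = x :=
    rePred_exists_finite fun i => hr (Primrec.const [])
      (hA (Primrec.list_append.comp .id (.const _)) (hlen .id) (.const _) (.const [])
        ((hh i.1 i.2).comp (hlen .id)))
  have r9 : REPred fun x => ∃ y : List ℕ × (ℕ × ℕ × ℕ) × List ℕ × List ℕ × List ℕ,
      ((List.ofFn fun k : Fin q => jVal (y.1 ++ [(k : ℕ)]) y.2.1.2.2 (y.2.2.2.1.getD k 0)) ++
          List.ofFn fun k : Fin q =>
            jArgs (y.1 ++ [(k : ℕ)]) y.2.1.1 y.2.1.2.1 y.2.2.1 (y.2.2.2.2.getD k 0),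
        jArgs y.1 y.2.1.1 y.2.1.2.1 (y.2.1.2.2 :: y.2.2.1) (cBigOr (List.ofFn fun k : Fin q =>
          cEx^[D] (cAnd (gd k y.1.length)
            (cAnd (y.2.2.2.1.getD k 0) (y.2.2.2.2.getD k 0)))))) = x := by
    have m1 := (e (α := ℕ × ℕ × ℕ) (β := List ℕ × List ℕ × List ℕ)).comp (e' (α := List ℕ))
    have m2 := (e' (α := ℕ × ℕ × ℕ) (β := List ℕ × List ℕ × List ℕ)).comp (e' (α := List ℕ))
    have ht := e'.comp (e'.comp m1)
    have hrs := e.comp (e'.comp m2)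
    have hus := e'.comp (e'.comp m2)
    exact hr (Primrec.list_append.comp
        (Primrec.list_ofFn fun k => hV (happ k e) ht (hget k hrs))
        (Primrec.list_ofFn fun k => hA (happ k e) (e.comp m1) (e.comp (e'.comp m1)) (e.comp m2)
          (hget k hus)))
      (hA e (e.comp m1) (e.comp (e'.comp m1)) (Primrec.list_cons.comp ht (e.comp m2))
        (primrec_cBigOr.comp (Primrec.list_ofFn fun k => hcEx (primrec_cAnd.comp
          ((hd k).comp (hlen e)) (primrec_cAnd.comp (hget k hrs) (hget k hus))))))
  refine (rePred_or r1 (rePred_or r2 (rePred_or r3 (rePred_or r4 (rePred_or r5 (rePred_or r6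
    (rePred_or r7 (rePred_or r8 r9)))))))).of_eq fun x => ⟨?_, fun h => ?_⟩
  · rintro (⟨y, rfl⟩ | ⟨y, rfl⟩ | ⟨y, rfl⟩ | ⟨y, rfl⟩ | ⟨R, y, rfl⟩ | ⟨y, rfl⟩ | ⟨f, y, rfl⟩ |
      ⟨i, y, rfl⟩ | ⟨y, rfl⟩)
    exacts [.bot _, .imp .., .all .., .eq .., .rel .., .var .., .func .., .nil .., .cons ..]
  · cases h with
    | bot c => exact .inl ⟨c, rfl⟩
    | imp c a b r s => exact .inr (.inl ⟨(c, (a, b), r, s), rfl⟩)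
    | all c a rs => exact .inr (.inr (.inl ⟨(c, a, rs), rfl⟩))
    | eq c a b r => exact .inr (.inr (.inr (.inl ⟨(c, a, b, r), rfl⟩)))
    | rel R c l r => exact .inr (.inr (.inr (.inr (.inl ⟨R, (c, l, r), rfl⟩))))
    | var c i => exact .inr (.inr (.inr (.inr (.inr (.inl ⟨(c, i), rfl⟩)))))
    | func f c l r => exact .inr (.inr (.inr (.inr (.inr (.inr (.inl ⟨f, (c, l, r), rfl⟩))))))
    | nil H w c => exact .inr (.inr (.inr (.inr (.inr (.inr (.inr (.inl ⟨⟨H, w⟩, c, rfl⟩)))))))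
    | cons c s h t ts rs us =>
      exact .inr (.inr (.inr (.inr (.inr (.inr (.inr (.inr ⟨(c, (s, h, t), ts, rs, us), rfl⟩)))))))

end Rules
end LaxInt

namespace LaxInt

/-! ### Soundness of the translation rules -/

section Inversion
variable {L : FirstOrder.Language.{0, 0}} [Encodable (Σ n, L.Functions n)] {n : ℕ}

theorem exists_of_termCode_var {t : L.Term (Empty ⊕ Fin n)} {i : ℕ}
    (h : termCode t = Nat.pair 0 i) : ∃ j : Fin n, (j : ℕ) = i ∧ t = .var (.inr j) := by
  cases t with
  | var x =>
    rcases x with x | j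
    · exact x.elim
    · exact ⟨j, (Nat.pair_eq_pair.1 h).2, rfl⟩
  | func f ts => exact absurd (Nat.pair_eq_pair.1 h).1 one_ne_zero

theorem exists_of_termCode_func {t : L.Term (Empty ⊕ Fin n)} {f : Σ n, L.Functions n} {l : List ℕ}
    (h : termCode t = Nat.pair 1 (Nat.pair (Encodable.encode f) (Encodable.encode l))) :
    ∃ ts : Fin f.1 → L.Term (Empty ⊕ Fin n), t = .func f.2 ts ∧
      l = (List.ofFn ts).map termCode := by
  cases t with
  | var x =>
    rcases x with x | j
    · exact x.elim
    · exact absurd (Nat.pair_eq_pair.1 h).1 zero_ne_one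
  | func g ts =>
    obtain ⟨h1, h2⟩ := Nat.pair_eq_pair.1 (Nat.pair_eq_pair.1 h).2
    obtain rfl := Encodable.encode_injective h1
    refine ⟨ts, rfl, ?_⟩
    rw [List.map_ofFn]
    exact (Encodable.encode_injective h2).symm

variable [Encodable (Σ n, L.Relations n)] {φ : L.BoundedFormula Empty n}

theorem eq_bot_of_formulaCode (h : formulaCode φ = Nat.pair 0 0) : φ = ⊥ := by
  cases φ with
  | falsum => rfl
  | equal | rel | imp | all => exact absurd (Nat.pair_eq_pair.1 h).1 (by decide)

theorem exists_of_formulaCode_imp {a b : ℕ} (h : formulaCode φ = cImp a b) :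
    ∃ φ₁ φ₂, φ = .imp φ₁ φ₂ ∧ formulaCode φ₁ = a ∧ formulaCode φ₂ = b := by
  cases φ with
  | imp φ₁ φ₂ => exact ⟨φ₁, φ₂, rfl, Nat.pair_eq_pair.1 (Nat.pair_eq_pair.1 h).2⟩
  | falsum | equal | rel | all => exact absurd (Nat.pair_eq_pair.1 h).1 (by decide)

theorem exists_of_formulaCode_all {a : ℕ} (h : formulaCode φ = cAll a) :
    ∃ ψ, φ = .all ψ ∧ formulaCode ψ = a := by
  cases φ with
  | all ψ => exact ⟨ψ, rfl, (Nat.pair_eq_pair.1 h).2⟩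
  | falsum | equal | rel | imp => exact absurd (Nat.pair_eq_pair.1 h).1 (by decide)

theorem exists_of_formulaCode_eq {a b : ℕ} (h : formulaCode φ = Nat.pair 1 (Nat.pair a b)) :
    ∃ t u, φ = .equal t u ∧ termCode t = a ∧ termCode u = b := by
  cases φ with
  | equal t u => exact ⟨t, u, rfl, Nat.pair_eq_pair.1 (Nat.pair_eq_pair.1 h).2⟩
  | falsum | all | rel | imp => exact absurd (Nat.pair_eq_pair.1 h).1 (by decide)

theorem exists_of_formulaCode_rel {R : Σ n, L.Relations n} {l : List ℕ}
    (h : formulaCode φ = Nat.pair 2 (Nat.pair (Encodable.encode R) (Encodable.encode l))) :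
    ∃ ts : Fin R.1 → L.Term (Empty ⊕ Fin n), φ = .rel R.2 ts ∧
      l = (List.ofFn ts).map termCode := by
  cases φ with
  | rel R' ts =>
    obtain ⟨h1, h2⟩ := Nat.pair_eq_pair.1 (Nat.pair_eq_pair.1 h).2
    obtain rfl := Encodable.encode_injective h1
    refine ⟨ts, rfl, ?_⟩
    rw [List.map_ofFn]
    exact (Encodable.encode_injective h2).symm
  | falsum | all | equal | imp => exact absurd (Nat.pair_eq_pair.1 h).1 (by decide)

end Inversion

theorem forall₂_ofFn {α β : Type} {r : α → β → Prop} : ∀ {n : ℕ} {f : Fin n → α} {d : List β},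
    List.Forall₂ r (List.ofFn f) d ↔ ∃ g : Fin n → β, d = List.ofFn g ∧ ∀ i, r (f i) (g i)
  | 0, f, d => by
    simp only [List.ofFn_zero, List.forall₂_nil_left_iff]
    exact ⟨fun h => ⟨Fin.elim0, h, fun i => i.elim0⟩, fun ⟨_, h, _⟩ => h⟩
  | n + 1, f, d => by
    rw [List.ofFn_succ, List.forall₂_cons_left_iff]
    constructor
    · rintro ⟨b, u, hb, hu, rfl⟩
      obtain ⟨g, rfl, hg⟩ := forall₂_ofFn.1 hu
      exact ⟨Fin.cons b g, by simp [List.ofFn_succ], Fin.cases hb hg⟩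
    · rintro ⟨g, rfl, hg⟩
      exact ⟨g 0, List.ofFn fun i => g i.succ, hg 0, forall₂_ofFn.2 ⟨_, rfl, fun i => hg i.succ⟩,
        by rw [List.ofFn_succ]⟩

namespace RawStr
variable {L : FirstOrder.Language.{0, 0}} {X : Type} (S : RawStr L X) {n : ℕ}

/-- The symbol `H` holds of the elements in the list `pre`, followed by values of the terms in the
list `ts`. -/
def SatArgs (H : Head L) (e : Fin n → X) (pre : List X) (ts : List (L.Term (Empty ⊕ Fin n))) : Prop :=
  ∃ d : List X, List.Forall₂ (fun t y => S.dom y ∧ S.Val e t y) ts d ∧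
    ∃ x : Fin H.arity → X, List.ofFn x = pre ++ d ∧ H.Holds S x

variable {S}

theorem satArgs_nil {H : Head L} {e : Fin n → X} {pre : List X} :
    S.SatArgs H e pre [] ↔ ∃ x : Fin H.arity → X, List.ofFn x = pre ∧ H.Holds S x := by
  simp [SatArgs]

theorem satArgs_cons {H : Head L} {e : Fin n → X} {pre : List X} {t : L.Term (Empty ⊕ Fin n)}
    {ts : List (L.Term (Empty ⊕ Fin n))} :
    S.SatArgs H e pre (t :: ts) ↔ ∃ y, S.dom y ∧ S.Val e t y ∧ S.SatArgs H e (pre ++ [y]) ts := by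
  simp only [SatArgs, List.forall₂_cons_left_iff]
  constructor
  · rintro ⟨_, ⟨y, d, ⟨h1, h2⟩, h3, rfl⟩, x, hx, h⟩
    exact ⟨y, h1, h2, d, h3, x, by simpa using hx, h⟩
  · rintro ⟨y, h1, h2, d, h3, x, hx, h⟩
    exact ⟨_, ⟨y, d, ⟨h1, h2⟩, h3, rfl⟩, x, by simpa using hx, h⟩

theorem sat_equal_iff_satArgs {e : Fin n → X} {t u : L.Term (Empty ⊕ Fin n)} :
    S.Sat (.equal t u) e ↔ S.SatArgs (.inl ()) e [] [t, u] := by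
  rw [satArgs_cons]
  simp only [satArgs_cons, satArgs_nil]
  change (∃ y z, _) ↔ _
  constructor
  · rintro ⟨y, z, h1, h2, h3, h4, h5⟩
    exact ⟨y, h1, h3, z, h2, h4, ![y, z], rfl, h5⟩
  · rintro ⟨y, h1, h3, z, h2, h4, x, hx, h5⟩
    obtain rfl : x = ![y, z] := List.ofFn_injective (n := 2) (hx.trans (by simp [List.ofFn_succ]))
    exact ⟨y, z, h1, h2, h3, h4, h5⟩

theorem sat_rel_iff_satArgs {e : Fin n → X} (R : Σ n, L.Relations n)
    {ts : Fin R.1 → L.Term (Empty ⊕ Fin n)} :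
    S.Sat (.rel R.2 ts) e ↔ S.SatArgs (.inr (.inr R)) e [] (List.ofFn ts) := by
  change (∃ d, _) ↔ _
  constructor
  · rintro ⟨d, hd, h⟩
    exact ⟨List.ofFn d, forall₂_ofFn.2 ⟨d, rfl, hd⟩, d, rfl, h⟩
  · rintro ⟨d, hd, x, hx, h⟩
    obtain ⟨g, rfl, hg⟩ := forall₂_ofFn.1 hd
    obtain rfl : x = g := List.ofFn_injective hx
    exact ⟨x, hg, h⟩

theorem val_func_iff_satArgs {e : Fin n → X} (f : Σ n, L.Functions n)
    {ts : Fin f.1 → L.Term (Empty ⊕ Fin n)} {y : X} :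
    S.Val e (.func f.2 ts) y ↔ S.SatArgs (.inr (.inl f)) e [y] (List.ofFn ts) := by
  change (∃ d, _) ↔ _
  constructor
  · rintro ⟨d, hd, h⟩
    exact ⟨List.ofFn d, forall₂_ofFn.2 ⟨d, rfl, hd⟩, Fin.cons y d,
      List.ofFn_cons y d, h⟩
  · rintro ⟨d, hd, x, hx, h⟩
    obtain ⟨g, rfl, hg⟩ := forall₂_ofFn.1 hd
    obtain rfl : x = Fin.cons y g := List.ofFn_injective (n := f.1 + 1)
      (hx.trans (by simp [List.ofFn_succ]))
    exact ⟨g, hg, h⟩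

end RawStr

section Tuples
variable {L L' : FirstOrder.Language.{0, 0}} (τ : Translation L L') (D : ℕ)

/-- The elements that are given by the blocks of variables, for the pieces `c`. -/
def Translation.tuple {M : Type} (e : ℕ → M) {κ : ℕ} (c : Fin κ → Fin τ.pieces) :
    Fin κ → Σ k, Fin (τ.dim k) → M := fun i => τ.blk D e (c i) i

/-- The list of the numbers of the pieces. -/
def pieceList {q κ : ℕ} (c : Fin κ → Fin q) : List ℕ := List.ofFn fun i => (c i : ℕ)

variable {τ D}

theorem pieceList_snoc {q κ : ℕ} (c : Fin κ → Fin q) (k : Fin q) :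
    pieceList c ++ [(k : ℕ)] = pieceList (Fin.snoc c k : Fin (κ + 1) → Fin q) := by
  rw [pieceList, pieceList, ← ofFn_snoc]
  exact congrArg _ (Fin.comp_snoc (fun k : Fin q => (k : ℕ)) c k).symm

@[simp] theorem length_pieceList {q κ : ℕ} (c : Fin κ → Fin q) : (pieceList c).length = κ := by
  simp [pieceList]

theorem Translation.tuple_snoc (hD : ∀ k, τ.dim k ≤ D) {M : Type} {e e' : ℕ → M} {κ : ℕ}
    (c : Fin κ → Fin τ.pieces) (k : Fin τ.pieces) (h : ∀ i < τ.params + D * κ, e' i = e i) :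
    τ.tuple D e' (Fin.snoc c k : Fin (κ + 1) → Fin τ.pieces) =
      Fin.snoc (α := fun _ => Σ k, Fin (τ.dim k) → M) (τ.tuple D e c) (τ.blk D e' k κ) := by
  funext i
  refine Fin.lastCases ?_ (fun i => ?_) i
  · simp [tuple]
  · simpa [tuple] using τ.blk_congr hD h (c i) i.2

end Tuples

section Soundness
variable {L L' : FirstOrder.Language.{0, 0}} [Encodable (Σ n, L.Functions n)]
  [Encodable (Σ n, L.Relations n)] [Encodable (Σ n, L'.Functions n)]
  [Encodable (Σ n, L'.Relations n)] (τ : Translation L L') (D : ℕ)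

/-- The meaning of the judgements. -/
def Judgement.Sound : Judgement → Prop
  | .inl (c, a, k) => ∀ (n : ℕ) (cf : Fin n → Fin τ.pieces) (φ : L.BoundedFormula Empty n),
      c = pieceList cf → formulaCode φ = a → Represents L' (τ.params + D * n) k
        fun _ _ e => (τ.raw (τ.pars e)).Sat φ (τ.tuple D e cf)
  | .inr (.inl (c, a, k)) => ∀ (n κ : ℕ) (hn : n ≤ κ) (cf : Fin (κ + 1) → Fin τ.pieces)
      (t : L.Term (Empty ⊕ Fin n)), c = pieceList cf → termCode t = a →
      Represents L' (τ.params + D * (κ + 1)) k fun _ _ e => (τ.raw (τ.pars e)).Val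
        (fun i => τ.tuple D e cf (i.castLE (hn.trans κ.le_succ))) t (τ.tuple D e cf (Fin.last κ))
  | .inr (.inr (c, (s, h), l, k)) => ∀ (n κ : ℕ) (hn : n ≤ κ) (cf : Fin κ → Fin τ.pieces)
      (H : Head L) (ts : List (L.Term (Empty ⊕ Fin n))), c = pieceList cf → Encodable.encode H = h →
      ts.map termCode = l → s ≤ κ → Represents L' (τ.params + D * κ) k fun _ _ e =>
        (τ.raw (τ.pars e)).SatArgs H (fun i => τ.tuple D e cf (i.castLE hn))
          ((List.ofFn (τ.tuple D e cf)).drop s) ts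

variable {τ D}

theorem sound_var (hD : ∀ k, τ.dim k ≤ D) (c : List ℕ) (i : ℕ) :
    (jVal c (Nat.pair 0 i) (varCode τ.params D (List.ofFn τ.dim) c i)).Sound (L := L) (L' := L') τ D := by
  intro n κ hn cf t hc ht
  obtain ⟨j, rfl, rfl⟩ := exists_of_termCode_var ht
  subst hc
  have h1 : (pieceList cf).getD j 0 = cf (j.castLE (hn.trans κ.le_succ)) :=
    getD_ofFn (fun i => (cf i : ℕ)) (j.castLE (hn.trans κ.le_succ)) 0
  have h2 : (pieceList cf).getD κ 0 = cf (Fin.last κ) :=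
    getD_ofFn (fun i => (cf i : ℕ)) (Fin.last κ) 0
  have h3 : (List.ofFn τ.dim).getD (cf (j.castLE (hn.trans κ.le_succ))) 0 =
    τ.dim (cf (j.castLE (hn.trans κ.le_succ))) := getD_ofFn _ _ _
  rw [varCode, length_pieceList, Nat.add_sub_cancel, h1, h2, h3]
  split_ifs with h
  · refine (represents_bigAnd (Q := fun i M _ e => e (τ.params + D * j + i) = e (τ.params + D * κ + i))
      _ fun i hi => represents_eq ?_ ?_).of_iff fun M _ e => ?_
    · exact τ.pos_lt hD ⟨i, List.mem_range.1 hi⟩ (by omega)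
    · exact τ.pos_lt hD ⟨i, List.mem_range.1 hi⟩ (by omega)
    · change _ ↔ τ.tuple D e cf _ = τ.tuple D e cf _
      have h' : cf (j.castLE (hn.trans κ.le_succ)) = cf (Fin.last κ) := Fin.ext h
      unfold Translation.tuple
      rw [← h']
      simp only [Translation.blk, List.mem_range, Sigma.mk.injEq, heq_eq_eq, true_and, funext_iff]
      exact ⟨fun h i => h i i.2, fun h i hi => h ⟨i, hi⟩⟩
  · refine (represents_bot _).of_iff fun M _ e => ⟨False.elim, fun he => h ?_⟩
    exact congrArg Fin.val (congrArg Sigma.fst he)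

/-- The conclusion of a translation rule has its intended meaning if its premises have. -/
theorem sound_of_transRule (hD : ∀ k, τ.dim k ≤ D) {gd : Fin τ.pieces → ℕ → ℕ}
    {gh : ∀ H : Head L, (Fin H.arity → Fin τ.pieces) → ℕ → ℕ}
    (hd : ∀ k κ, Represents L' (τ.params + D * (κ + 1)) (gd k κ)
      fun _ _ e => (τ.raw (τ.pars e)).dom (τ.blk D e k κ))
    (hh : ∀ (H : Head L) w s, Represents L' (τ.params + D * (s + H.arity)) (gh H w s)
      fun _ _ e => H.Holds (τ.raw (τ.pars e)) fun i => τ.blk D e (w i) (s + i))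
    {l : List Judgement} {j : Judgement}
    (hr : TransRule τ.pieces τ.params D (List.ofFn τ.dim) gd gh (l, j))
    (hl : ∀ b ∈ l, b.Sound (L := L) (L' := L') τ D) : j.Sound (L := L) (L' := L') τ D := by
  cases hr with
  | bot c =>
    intro n cf φ hc hφ
    obtain rfl := eq_bot_of_formulaCode hφ
    exact represents_bot _
  | imp c a b r s =>
    intro n cf φ hc hφ
    obtain ⟨φ₁, φ₂, rfl, h1, h2⟩ := exists_of_formulaCode_imp hφ
    exact (hl (jSat c a r) (by simp) n cf φ₁ hc h1).imp (hl (jSat c b s) (by simp) n cf φ₂ hc h2)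
  | all c a rs =>
    intro n cf φ hc hφ
    obtain ⟨ψ, rfl, ha⟩ := exists_of_formulaCode_all hφ
    subst hc
    rw [length_pieceList]
    have key : ∀ k : Fin τ.pieces, Represents L' (τ.params + D * n)
        (cAll^[D] (cImp (gd k n) (rs.getD k 0))) fun M _ e => ∀ y : Fin (τ.dim k) → M,
          (τ.raw (τ.pars e)).dom ⟨k, y⟩ → (τ.raw (τ.pars e)).Sat ψ
            (Fin.snoc (α := fun _ => Σ k, Fin (τ.dim k) → M) (τ.tuple D e cf) ⟨k, y⟩) := fun k => by
      refine τ.represents_allBlk (Q' := fun M _ e y => (τ.raw (τ.pars e)).dom y →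
        (τ.raw (τ.pars e)).Sat ψ (Fin.snoc (α := fun _ => Σ k, Fin (τ.dim k) → M)
          (τ.tuple D e cf) y)) ((hd k n).imp (hl (jSat _ a (rs.getD k 0)) (List.mem_ofFn.2 ⟨k, rfl⟩)
        (n + 1) (Fin.snoc cf k) ψ (pieceList_snoc cf k) ha)) fun M _ e e' he => ?_
      rw [τ.pars_congr he, Translation.tuple_snoc hD cf k he]
    rw [List.ofFn_eq_map]
    refine (represents_bigAnd _ fun k _ => key k).of_iff fun M _ e => ?_
    exact ⟨fun h y => h y.1 (List.mem_finRange _) y.2, fun h k _ y => h ⟨k, y⟩⟩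
  | eq c a b r =>
    intro n cf φ hc hφ
    obtain ⟨t, u, rfl, ht, hu⟩ := exists_of_formulaCode_eq hφ
    refine (hl (jArgs _ _ _ _ _) (List.mem_singleton_self _) n n le_rfl cf (.inl ()) [t, u] hc rfl
      (by simp [ht, hu]) (by simp [hc])).of_iff fun M _ e => ?_
    rw [RawStr.sat_equal_iff_satArgs, List.drop_eq_nil_of_le (by simp [hc])]
    rfl
  | rel R c l r =>
    intro n cf φ hc hφ
    obtain ⟨ts, rfl, rfl⟩ := exists_of_formulaCode_rel hφ
    refine (hl (jArgs _ _ _ _ _) (List.mem_singleton_self _) n n le_rfl cf (.inr (.inr R)) _ hc rfl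
      rfl (by simp [hc])).of_iff fun M _ e => ?_
    rw [RawStr.sat_rel_iff_satArgs, List.drop_eq_nil_of_le (by simp [hc])]
    rfl
  | var c i => exact sound_var hD c i
  | func f c l r =>
    intro n κ hn cf t hc ht
    obtain ⟨ts, rfl, rfl⟩ := exists_of_termCode_func ht
    refine (hl (jArgs _ _ _ _ _) (List.mem_singleton_self _) n (κ + 1) (hn.trans κ.le_succ) cf
      (.inr (.inl f)) _ hc rfl rfl (by simp [hc])).of_iff fun M _ e => ?_
    have hdrop : (List.ofFn (τ.tuple D e cf)).drop (c.length - 1) = [τ.tuple D e cf (Fin.last κ)] := by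
      rw [hc, length_pieceList, Nat.add_sub_cancel, List.ofFn_succ', List.concat_eq_append,
        List.drop_left' (by simp)]
    rw [RawStr.val_func_iff_satArgs, hdrop]
  | nil H w c =>
    intro n κ hn cf H' ts hc hH hts hs
    obtain rfl := Encodable.encode_injective hH
    obtain rfl := List.map_eq_nil_iff.1 hts
    obtain rfl : κ = c.length + H'.arity := by
      have := congrArg List.length hc
      simpa using this.symm
    refine (hh H' w c.length).of_iff fun M _ e => ?_
    have hw : ∀ i, cf (Fin.natAdd c.length i) = w i := fun i => by
      have h1 : (pieceList cf)[c.length + (i : ℕ)]? = some (w i : ℕ) := by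
        rw [← hc, List.getElem?_append_right (by omega)]
        simp
      simp [pieceList] at h1
      exact Fin.ext h1
    have hdrop : (List.ofFn (τ.tuple D e cf)).drop c.length =
        List.ofFn fun i => τ.blk D e (w i) (c.length + i) := by
      rw [List.ofFn_add, List.drop_left' (by simp)]
      refine congrArg _ (funext fun i => ?_)
      simp [Translation.tuple, hw]
    rw [RawStr.satArgs_nil, hdrop]
    exact ⟨fun h => ⟨_, rfl, h⟩, fun ⟨x, hx, h⟩ => List.ofFn_injective hx ▸ h⟩
  | cons c s h t ts rs us =>
    intro n κ hn cf H ts' hc hH hts hs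
    obtain ⟨t', ts', rfl, ht, hts⟩ := List.map_eq_cons_iff.1 hts
    subst hc
    rw [length_pieceList]
    have key : ∀ k : Fin τ.pieces, Represents L' (τ.params + D * κ)
        (cEx^[D] (cAnd (gd k κ) (cAnd (rs.getD k 0) (us.getD k 0)))) fun M _ e =>
          ∃ y : Fin (τ.dim k) → M, (τ.raw (τ.pars e)).dom ⟨k, y⟩ ∧
            (τ.raw (τ.pars e)).Val (fun i => τ.tuple D e cf (i.castLE hn)) t' ⟨k, y⟩ ∧
            (τ.raw (τ.pars e)).SatArgs H (fun i => τ.tuple D e cf (i.castLE hn))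
              ((List.ofFn (τ.tuple D e cf)).drop s ++ [⟨k, y⟩]) ts' := fun k => by
      refine τ.represents_exBlk (Q' := fun M _ e y => (τ.raw (τ.pars e)).dom y ∧
            (τ.raw (τ.pars e)).Val (fun i => τ.tuple D e cf (i.castLE hn)) t' y ∧
            (τ.raw (τ.pars e)).SatArgs H (fun i => τ.tuple D e cf (i.castLE hn))
              ((List.ofFn (τ.tuple D e cf)).drop s ++ [y]) ts')
        ((hd k κ).and ((hl (jVal _ t (rs.getD k 0))
          (List.mem_append_left _ (List.mem_ofFn.2 ⟨k, rfl⟩)) n κ hn (Fin.snoc cf k) t'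
          (pieceList_snoc cf k) ht).and (hl (jArgs _ s h ts (us.getD k 0))
          (List.mem_append_right _ (List.mem_ofFn.2 ⟨k, rfl⟩)) n (κ + 1) (hn.trans κ.le_succ)
          (Fin.snoc cf k) H ts' (pieceList_snoc cf k) hH hts (hs.trans κ.le_succ))))
        fun M _ e e' he => ?_
      have h1 : ∀ i : Fin n, Fin.snoc (α := fun _ => Σ k, Fin (τ.dim k) → M) (τ.tuple D e cf)
          (τ.blk D e' k κ) (i.castLE (hn.trans κ.le_succ)) = τ.tuple D e cf (i.castLE hn) :=
        fun i => Fin.snoc_castSucc (α := fun _ => Σ k, Fin (τ.dim k) → M) _ _ (i.castLE hn)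
      simp only [τ.pars_congr he, Translation.tuple_snoc hD cf k he, h1, Fin.snoc_last, ofFn_snoc]
      rw [List.drop_append_of_le_length (by simpa using hs)]
    rw [List.ofFn_eq_map]
    refine (represents_bigOr _ fun k _ => key k).of_iff fun M _ e => ?_
    rw [RawStr.satArgs_cons]
    constructor
    · rintro ⟨k, -, y, h⟩
      exact ⟨_, h⟩
    · rintro ⟨⟨k, y⟩, h⟩
      exact ⟨k, List.mem_finRange _, y, h⟩

end Soundness
end LaxInt

namespace LaxInt

/-! ### Totality of the translation rules -/

section Total
variable {L : FirstOrder.Language.{0, 0}} [Encodable (Σ n, L.Functions n)]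
  [Encodable (Σ n, L.Relations n)] {q P D : ℕ} {dims : List ℕ} {gd : Fin q → ℕ → ℕ}
  {gh : ∀ H : Head L, (Fin H.arity → Fin q) → ℕ → ℕ}

/-- Every list of terms of the right length has a translation as a list of arguments, provided that
every term in it has one. -/
theorem exists_der_args (H : Head L) : ∀ (l : List ℕ), (∀ t ∈ l, ∀ {κ : ℕ} (c : Fin (κ + 1) → Fin q),
      ∃ k, Der (TransRule q P D dims gd gh) (jVal (pieceList c) t k)) →
    ∀ {κ s : ℕ} (c : Fin κ → Fin q), κ + l.length = s + H.arity →
      ∃ k, Der (TransRule q P D dims gd gh) (jArgs (pieceList c) s (Encodable.encode H) l k)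
  | [], _, κ, s, c, hs => by
    obtain rfl : κ = s + H.arity := hs
    have := TransRule.nil (P := P) (D := D) (dims := dims) (gd := gd) (gh := gh) H
      (fun i => c (Fin.natAdd s i)) (pieceList fun i : Fin s => c (Fin.castAdd _ i))
    rw [length_pieceList] at this
    refine ⟨gh H (fun i => c (Fin.natAdd s i)) s,
      .mk [] _ ?_ (fun b hb => absurd hb List.not_mem_nil)⟩
    rwa [pieceList, List.ofFn_add]
  | t :: l, hl, κ, s, c, hs => by
    choose r hr using fun k : Fin q => hl t (by simp) (Fin.snoc c k : Fin (κ + 1) → Fin q)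
    choose u hu using fun k : Fin q => exists_der_args H l (fun t ht => hl t (by simp [ht]))
      (s := s) (Fin.snoc c k : Fin (κ + 1) → Fin q) (by rw [List.length_cons] at hs; omega)
    refine ⟨_, .mk _ _ (.cons _ s _ t l (List.ofFn r) (List.ofFn u)) fun b hb => ?_⟩
    simp only [getD_ofFn, pieceList_snoc] at hb
    rcases List.mem_append.1 hb with hb | hb
    · obtain ⟨k, rfl⟩ := List.mem_ofFn.1 hb
      exact hr k
    · obtain ⟨k, rfl⟩ := List.mem_ofFn.1 hb
      exact hu k

theorem exists_der_val {n : ℕ} (t : L.Term (Empty ⊕ Fin n)) {κ : ℕ} (c : Fin (κ + 1) → Fin q) :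
    ∃ k, Der (TransRule q P D dims gd gh) (jVal (pieceList c) (termCode t) k) := by
  induction t generalizing κ with
  | var x =>
    rcases x with x | i
    · exact x.elim
    · exact ⟨_, .mk _ _ (.var _ i) (fun b hb => absurd hb List.not_mem_nil)⟩
  | @func m f ts ih =>
    obtain ⟨k, hk⟩ := exists_der_args (P := P) (D := D) (dims := dims) (gd := gd) (gh := gh)
      (.inr (.inl ⟨m, f⟩)) (List.ofFn fun i => termCode (ts i))
      (fun t ht κ c => by obtain ⟨i, rfl⟩ := List.mem_ofFn.1 ht; exact ih i c) (s := κ) c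
      (by simp [Head.arity]; omega)
    refine ⟨k, .mk _ _ (.func ⟨m, f⟩ _ (List.ofFn fun i => termCode (ts i)) k) fun b hb => ?_⟩
    rw [List.mem_singleton.1 hb, length_pieceList, Nat.add_sub_cancel]
    exact hk

theorem exists_der_sat : ∀ {n : ℕ} (φ : L.BoundedFormula Empty n) (c : Fin n → Fin q),
    ∃ k, Der (TransRule q P D dims gd gh) (jSat (pieceList c) (formulaCode φ) k)
  | _, .falsum, c => ⟨_, .mk _ _ (.bot _) (fun b hb => absurd hb List.not_mem_nil)⟩
  | n, .equal t u, c => by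
    obtain ⟨k, hk⟩ := exists_der_args (P := P) (D := D) (dims := dims) (gd := gd) (gh := gh)
      (.inl () : Head L) [termCode t, termCode u]
      (fun a ha κ c => by
        rcases List.mem_pair.1 ha with rfl | rfl
        exacts [exists_der_val t c, exists_der_val u c]) (s := n) c rfl
    refine ⟨k, .mk _ _ (.eq _ _ _ k) fun b hb => ?_⟩
    rw [List.mem_singleton.1 hb, length_pieceList]
    exact hk
  | n, .rel (l := m) R ts, c => by
    obtain ⟨k, hk⟩ := exists_der_args (P := P) (D := D) (dims := dims) (gd := gd) (gh := gh)
      (.inr (.inr ⟨m, R⟩) : Head L) (List.ofFn fun i => termCode (ts i))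
      (fun t ht κ c => by obtain ⟨i, rfl⟩ := List.mem_ofFn.1 ht; exact exists_der_val (ts i) c)
      (s := n) c (by simp [Head.arity])
    refine ⟨k, .mk _ _ (.rel ⟨m, R⟩ _ (List.ofFn fun i => termCode (ts i)) k) fun b hb => ?_⟩
    rw [List.mem_singleton.1 hb, length_pieceList]
    exact hk
  | n, .imp φ ψ, c => by
    obtain ⟨r, hr⟩ := exists_der_sat φ c
    obtain ⟨s, hs⟩ := exists_der_sat ψ c
    refine ⟨_, .mk _ _ (.imp _ _ _ r s) fun b hb => ?_⟩
    rcases List.mem_pair.1 hb with rfl | rfl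
    exacts [hr, hs]
  | n, .all φ, c => by
    choose r hr using fun k : Fin q => exists_der_sat φ (Fin.snoc c k : Fin (n + 1) → Fin q)
    refine ⟨_, .mk _ _ (.all _ (formulaCode φ) (List.ofFn r)) fun b hb => ?_⟩
    simp only [getD_ofFn, pieceList_snoc] at hb
    obtain ⟨k, rfl⟩ := List.mem_ofFn.1 hb
    exact hr k

end Total

/-! ### Model interpretability implies lax interpretability -/

section ModelToLax
variable {L L' : FirstOrder.Language.{0, 0}} [Encodable (Σ n, L.Functions n)]
  [Encodable (Σ n, L.Relations n)] [Encodable (Σ n, L'.Functions n)]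
  [Encodable (Σ n, L'.Relations n)]

/-- The translations of the axioms of a recursively enumerable theory can be axiomatised by a
recursively enumerable theory. The sentences of the latter are found by derivations with the
translation rules; they are equivalent to, but need not be equal to, the translations of the
axioms. -/
theorem exists_isRE_translation [Finite (Σ n, L.Functions n)] [Finite (Σ n, L.Relations n)]
    (τ : Translation L L') {W : L.Theory} (hW : IsRE W) : ∃ A : L'.Theory, IsRE A ∧
      ∀ (M : Type) [L'.Structure M] [Nonempty M], M ⊨ A ↔
        ∀ φ ∈ W, ∀ p : Fin τ.params → M, τ.paramDom.Realize p → (τ.raw p).Sat φ Fin.elim0 := by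
  let D := ∑ k, τ.dim k
  have hD : ∀ k, τ.dim k ≤ D := fun k =>
    Finset.single_le_sum (f := τ.dim) (fun _ _ => Nat.zero_le _) (Finset.mem_univ k)
  choose gd hgd hd using τ.exists_domCode (D := D) hD
  choose gh hgh hh using τ.exists_headCode (D := D) hD
  obtain ⟨a, -, ha⟩ := exists_primrec_represents τ.paramDom (σ := Unit) (ρ := fun i _ => i)
    (N := fun _ => τ.params) (fun _ => Primrec.const _) (Primrec.const _)
  let F : ℕ → ℕ := fun k => cAll^[τ.params] (cImp (a ()) k)
  have hF : Primrec F := Primrec.nat_iterate (Primrec.const _)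
    (primrec_cImp.comp (Primrec.const _) Primrec.id) (primrec_cAll.comp Primrec.snd).to₂
  let Δ := Der (TransRule τ.pieces τ.params D (List.ofFn τ.dim) gd gh)
  have hΔ : ∀ j, Δ j → j.Sound (L := L) (L' := L') τ D := fun j hj => by
    induction hj with
    | mk l j hr _ ih => exact sound_of_transRule hD hd hh hr ih
  have key : ∀ (φ : L.Sentence) (k : ℕ), Δ (jSat [] (formulaCode φ) k) →
      ∃ ψ : L'.Sentence, formulaCode ψ = F k ∧ ∀ (M : Type) [L'.Structure M] [Nonempty M], M ⊨ ψ ↔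
        ∀ p : Fin τ.params → M, τ.paramDom.Realize p → (τ.raw p).Sat φ Fin.elim0 := by
    intro φ k hk
    have h1 : Represents L' (0 + τ.params) (cImp (a ()) k) fun _ _ e =>
        τ.paramDom.Realize (τ.pars e) → (τ.raw (τ.pars e)).Sat φ Fin.elim0 := by
      rw [Nat.zero_add]
      refine ((ha () fun i => i.2).imp (hΔ _ hk 0 Fin.elim0 φ rfl rfl)).of_iff fun M _ e => ?_
      exact imp_congr
        (iff_of_eq (congrArg (BoundedFormula.Realize τ.paramDom _) (Subsingleton.elim _ _)))
        (iff_of_eq (congrArg _ (Subsingleton.elim _ _)))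
    have h2 : Represents L' 0 (F k) _ := h1.allBlock
    obtain ⟨ψ, hψ, H⟩ := h2
    refine ⟨ψ, hψ, fun M _ _ => ?_⟩
    obtain ⟨x⟩ : Nonempty M := inferInstance
    have h3 := H M fun _ => x
    rw [Subsingleton.elim (fun i : Fin 0 => x) default] at h3
    refine h3.trans ⟨fun h p hp => ?_, fun h e _ he => ?_⟩
    · have h4 := h (fun i => if hi : i < τ.params then p ⟨i, hi⟩ else x) (fun i hi => by omega)
      have h5 : τ.pars (fun i => if hi : i < τ.params then p ⟨i, hi⟩ else x) = p :=
        funext fun i => dif_pos i.2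
      rw [h5] at h4
      exact h4 hp
    · exact h _ he
  refine ⟨{ψ | ∃ φ ∈ W, ∃ k, Δ (jSat [] (formulaCode φ) k) ∧ formulaCode ψ = F k ∧
    ∀ (M : Type) [L'.Structure M] [Nonempty M], M ⊨ ψ ↔
      ∀ p : Fin τ.params → M, τ.paramDom.Realize p → (τ.raw p).Sat φ Fin.elim0}, ?_, ?_⟩
  · have hjS : Computable fun x : ℕ × ℕ => jSat [] x.1 x.2 :=
      (Primrec.sumInl.comp ((Primrec.const []).pair Primrec.id)).to_comp
    refine (rePred_image (rePred_and (rePred_comp hW Computable.fst) (rePred_comp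
      (rePred_der (rePred_transRule τ.pieces τ.params D (List.ofFn τ.dim) hgd hgh)) hjS))
      (hF.comp Primrec.snd).to_comp).of_eq fun x => ?_
    constructor
    · rintro ⟨⟨b, k⟩, ⟨⟨φ, hφ, rfl⟩, hk⟩, rfl⟩
      obtain ⟨ψ, hψ, H⟩ := key φ k hk
      exact ⟨ψ, ⟨φ, hφ, k, hk, hψ, H⟩, hψ⟩
    · rintro ⟨ψ, ⟨φ, hφ, k, hk, hψ, H⟩, rfl⟩
      exact ⟨(formulaCode φ, k), ⟨⟨φ, hφ, rfl⟩, hk⟩, hψ.symm⟩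
  · intro M _ _
    constructor
    · intro hM φ hφ
      obtain ⟨k, hk⟩ := exists_der_sat (P := τ.params) (D := D) (dims := List.ofFn τ.dim) (gd := gd)
        (gh := gh) φ (Fin.elim0 : Fin 0 → Fin τ.pieces)
      obtain ⟨ψ, hψ, H⟩ := key φ k hk
      exact (H M).1 (hM.realize_of_mem ψ ⟨φ, hφ, k, hk, hψ, H⟩)
    · intro h
      refine ⟨?_⟩
      rintro ψ ⟨φ, hφ, k, -, -, H⟩
      exact (H M).2 (h φ hφ)

/-- If `V` model-interprets `U`, then one model of a consistent extension `V'` of `V` provides a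
translation, and `V'` can be extended by the axioms that this translation is an interpretation: the
parameter domain is not empty, and the axioms of `U` and the axioms of identity hold under the
translation. The extension is consistent since it holds in that model. -/
theorem laxInterprets_of_modelInterprets (pw : Prop) [Finite (Σ n, L.Functions n)]
    [Finite (Σ n, L.Relations n)] {V : L'.Theory} {U : L.Theory} (hU : IsRE U)
    (h : ModelInterprets pw V U) : LaxInterprets pw V U := by
  intro V' hV' ⟨M₀⟩ hVV'
  have hM₀ : M₀ ⊨ V := ⟨fun φ hφ =>
    Theory.models_sentence_iff.1 (hVV' φ (Theory.models_sentence_of_mem hφ)) M₀⟩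
  obtain ⟨τ, hpw, ⟨p₀, hp₀⟩, hτ⟩ := h M₀ hM₀
  obtain ⟨A, hA, hAM⟩ := exists_isRE_translation τ (isRE_union hU (isRE_of_finite idTheory_finite))
  have hne : ∀ (M : Type) [L'.Structure M] [Nonempty M],
      M ⊨ τ.paramDomNonempty ↔ ∃ p : Fin τ.params → M, τ.paramDom.Realize p := fun M _ _ => by
    refine Formula.realize_iExs.trans (exists_congr fun p => ?_)
    exact Formula.realize_relabel
  refine ⟨V' ∪ A ∪ {τ.paramDomNonempty}, isRE_union (isRE_union hV' hA)
    (isRE_of_finite (Set.finite_singleton _)), ?_, fun φ hφ => ?_, τ, hpw, ?_, fun φ hφ => ?_⟩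
  · have h1 : M₀ ⊨ A := (hAM M₀).2 fun φ hφ p hp => by
      refine (τ.realize_sentence p φ).1 (hτ p hp φ ?_)
      rcases hφ with hφ | hφ
      · exact Theory.models_sentence_of_mem hφ
      · exact Theory.models_sentence_iff.2 fun M => (models_idTheory M).realize_of_mem φ hφ
    have h2 : M₀ ⊨ V' ∪ A ∪ {τ.paramDomNonempty} :=
      (M₀.is_model.union h1).union ((Theory.model_singleton_iff).2 ((hne M₀).2 ⟨p₀, hp₀⟩))
    exact ⟨Theory.ModelType.of _ M₀⟩
  · exact Theory.models_sentence_iff.2 fun M => by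
      have : M ⊨ V' := M.is_model.mono fun _ h => .inl (.inl h)
      exact Theory.models_sentence_iff.1 hφ (Theory.ModelType.of V' M)
  · exact Theory.models_sentence_of_mem (.inr rfl)
  · refine Theory.models_formula_iff.2 fun M p hp => ?_
    have hMA := (hAM M).1 (M.is_model.mono fun _ h => .inl (.inr h))
    obtain ⟨N, _, _, cls, hN⟩ := (τ.raw p).exists_presents fun φ hφ => hMA φ (.inr hφ) p hp
    have hNU : N ⊨ U := ⟨fun φ hφ => (hN.sat_sentence φ).1 (hMA φ (.inl hφ) p hp)⟩
    refine (τ.realize_sentence p φ).2 ((hN.sat_sentence φ).2 ?_)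
    exact Theory.models_sentence_iff.1 hφ (Theory.ModelType.of U N)

end ModelToLax
end LaxInt

theorem mainTheorem6 (pw : Prop) :
    (∀ φ : LaxInt.scatLang.Sentence,
      LaxInt.PAscat ⊨ᵇ φ → LaxInt.R ⊨ᵇ (LaxInt.toArith φ : LaxInt.arith.Sentence)) ∧
    LaxInt.SigmaFriendly pw LaxInt.PAscat ∧
    LaxInt.LaxInterprets pw LaxInt.PAscat LaxInt.R ∧
    LaxInt.Nscat ⊨ LaxInt.PAscat ∧
    (∀ (τ : LaxInt.Translation LaxInt.succLang LaxInt.scatLang) (p : Fin τ.params → LaxInt.Nscat),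
      ¬ τ.DefinesModel LaxInt.Rsucc LaxInt.Nscat p) ∧
    ¬ LaxInt.ModelInterprets pw LaxInt.PAscat LaxInt.Rsucc ∧
    ¬ LaxInt.ModelInterprets pw LaxInt.PAscat LaxInt.R ∧
    LaxInt.IsRE LaxInt.R ∧
    (∀ (L L' : FirstOrder.Language.{0, 0})
      [Finite (Σ n, L.Functions n)] [Finite (Σ n, L.Relations n)]
      [Finite (Σ n, L'.Functions n)] [Finite (Σ n, L'.Relations n)]
      [Encodable (Σ n, L.Functions n)] [Encodable (Σ n, L.Relations n)]
      [Encodable (Σ n, L'.Functions n)] [Encodable (Σ n, L'.Relations n)]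
      (V : L'.Theory) (U : L.Theory), LaxInt.IsRE V → LaxInt.IsRE U →
        LaxInt.ModelInterprets pw V U → LaxInt.LaxInterprets pw V U) := by
  refine ⟨LaxInt.R_proves_PAscat, LaxInt.sigmaFriendly_PAscat pw, LaxInt.laxInterprets_R pw,
    LaxInt.Nscat_models_PAscat, LaxInt.not_definesModel_Rsucc,
    LaxInt.not_modelInterprets_of_Nscat pw LaxInt.not_definesModel_Rsucc,
    LaxInt.not_modelInterprets_of_Nscat pw LaxInt.not_definesModel_R, LaxInt.isRE_R, ?_⟩
  intro L L' _ _ _ _ _ _ _ _ V U _ hU h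
  exact LaxInt.laxInterprets_of_modelInterprets pw hU h
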